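/- **Theorem (superconvergence of the post-processed solution).** Let $d\ge 2$, $k\ge 1$. Let $\Omega\subset\mathbb R^d$ be a bounded polygonal domain that equals the interior of its closure, let $\Omega_+,\Omega_-\subset\Omega$ be disjoint open sets with $\overline\Omega=\overline{\Omega}_+\cup\overline{\Omega}_-$, put $\Gamma_I=\overline\Omega_+\cap\overline\Omega_-$, let $\emptyset\neq\Gamma_D\subset\partial\Omega$ and $\Gamma_N=\partial\Omega\setminus\overline{\Gamma_D}$. Let $\sigma=\sigma_+>0$ on $\Omega_+$ and $\sigma=\sigma_-<0$ on $\Omega_-$, with $\sigma_\pm$ constant. *Regularity assumption.* There is $C_{\rm reg}$ such that for every $\theta\in L^2(\Omega)$ the dual problem $\sigma^{-1}\Phi+\nabla\phi=0$, $\nabla\cdot\Phi=\theta$ in $\Omega$, $\phi=0$ on $\Gamma_D$, $\Phi\cdot n=0$ on $\Gamma_N$, has a weak solution with $\|\Phi\|_{1,\Omega_+}+\|\Phi\|_{1,\Omega_-}+\|\phi\|_{2,\Omega_+}+\|\phi\|_{2,\Omega_-}\le C_{\rm reg}\|\theta\|_\Omega$. *Meshes.* Let $\mathcal T_h$ be a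 conforming simplicial triangulation of $\Omega$ such that the interior of each element lies in $\Omega_+$ or in $\Omega_-$, each of $\Gamma_I$ and $\overline{\Gamma_D}$ is a union of facets, no element $K$ has $\partial K\subset\Gamma_I$, and (shape regularity) each $K$ contains a ball of radius $\rho h_K$, where $h_K=\operatorname{diam}K$ and $\rho>0$ is fixed. Put $h=\max_K h_K$. Let $\tau$ be constant on each facet $F$, with $\tau|_F=0$ if $F\subset\Gamma_I$, and, for $F\subset\partial K$, $F\not\subset\Gamma_I$, $\tau|_F>0$ if $K\subset\overline\Omega_+$ and $\tau|_F<0$ if $K\subset\overline\Omega_-$; let $|\tau|\le\gamma_1$. *Solutions.* Let $f\in L^2(\Omega)$ and let $(q,u)$ be a weak solution of $\sigma^{-1}q+\nabla u=0$, $\nabla\cdot q=-f$ in $\Omega$, $u=0$ on $\Gamma_D$, $q\cdot n=0$ on $\Gamma_N$, with $u\in H^1(\Omega)$ and $u|_{\Omega_\pm}\in H^{k+2}(\Omega_\pm)$. Let $V_h$, $W_h$ be the spaces of vector and scalar functions that are polynomials of degree at most $k$ on each element, and $M_h$ the space of functions on the facets that are polynomials of degree at most $k$ on each facet and vanish on the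 facets in $\overline{\Gamma_D}$. Let $(q_h,u_h,\bar u_h)\in V_h\times W_h\times M_h$ be a solution of the HDG method: for all $(r,v,\bar v)\in V_h\times W_h\times M_h$, $$(\sigma^{-1}q_h,r)_\Omega+\sum_K(\nabla u_h,r)_K-\sum_K\langle u_h-\bar u_h,r\cdot n_K\rangle_{\partial K}=0,$$ $$\sum_K(q_h,\nabla v)_K-\sum_K\langle q_h\cdot n_K+\tau(u_h-\bar u_h),v\rangle_{\partial K}=(f,v)_\Omega,$$ $$\sum_K\langle q_h\cdot n_K+\tau(u_h-\bar u_h),\bar v\rangle_{\partial K}=0.$$ Let $u_h^*$ be the Stenberg post-processed solution: on each $K$ it is a polynomial of degree at most $k+1$ with $(\nabla u_h^*,\nabla v)_K=-(\sigma^{-1}q_h,\nabla v)_K$ for all $v\in\mathcal P_{k+1}(K)$ and $(u_h^*,1)_K=(u_h,1)_K$. Let $(\Pi_Vq,\Pi_Wu)\in V_h\times W_h$ be the HDG projection of $(q,u)$: on each $K$, $(\Pi_Vq,r)_K=(q,r)_K$ for $r\in\mathcal P_{k-1}(K;\mathbb R^d)$, $(\Pi_Wu,v)_K=(u,v)_K$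 for $v\in\mathcal P_{k-1}(K)$, and $\langle\Pi_Vq\cdot n_K+\tau\Pi_Wu,\lambda\rangle_F=\langle q\cdot n_K+\tau u,\lambda\rangle_F$ for $\lambda\in\mathcal P_k(F)$ and each facet $F\subset\partial K$. Let $\|r\|_{V_h}^2=(|\sigma|^{-1}r,r)_\Omega$. *Conclusion.* Then $$\|u-u_h^*\|_\Omega\le C\,h\big(\|q-q_h\|_{V_h}+\|q-\Pi_Vq\|_\Omega\big)+C\,h^{k+2}\big(\|u\|_{k+2,\Omega_+}+\|u\|_{k+2,\Omega_-}\big),$$ where $C>0$ depends only on $d,k,\Omega,\Omega_\pm,\Gamma_D,\sigma_\pm,C_{\rm reg},\rho$ and $\gamma_1$; it does not depend on the mesh, $\tau$, $f$ or the solutions. -/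

import Mathlib

open MeasureTheory Filter Topology
open scoped ContDiff

noncomputable section

namespace HDG

/-- The Euclidean space `ℝ^d`. -/
abbrev Space (d : ℕ) : Type := EuclideanSpace ℝ (Fin d)

variable {d : ℕ}

/-! ### Sobolev spaces -/

/-- The classical partial derivative in the `i`-th coordinate direction. -/
def partialDeriv (i : Fin d) (φ : Space d → ℝ) : Space d → ℝ :=
  fun x => fderiv ℝ φ x (EuclideanSpace.single i 1)

/-- The classical derivative `∂^α φ` for a multi-index `α`. -/
def multiDeriv (α : Fin d → ℕ) (φ : Space d → ℝ) : Space d → ℝ :=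
  (List.finRange d).foldr (fun i ψ => (partialDeriv i)^[α i] ψ) φ

/-- Test functions: smooth with compact support inside `D`. -/
structure IsTestFunction (D : Set (Space d)) (φ : Space d → ℝ) : Prop where
  smooth : ContDiff ℝ ∞ φ
  compact : HasCompactSupport φ
  support_subset : tsupport φ ⊆ D

/-- `w ∈ L²(D)` is the weak derivative `D^α u` of `u ∈ L²(D)`. -/
def IsWeakDeriv (D : Set (Space d)) (α : Fin d → ℕ) (u w : Space d → ℝ) : Prop :=
  MemLp u 2 (volume.restrict D) ∧ MemLp w 2 (volume.restrict D) ∧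
    ∀ φ : Space d → ℝ, IsTestFunction D φ →
      ∫ x in D, u x * multiDeriv α φ x = (-1) ^ (∑ i, α i) * ∫ x in D, w x * φ x

open Classical in
/-- The weak derivative `D^α u` in `L²(D)` (unique almost everywhere; `0` if there is none). -/
def weakDeriv (D : Set (Space d)) (α : Fin d → ℕ) (u : Space d → ℝ) : Space d → ℝ :=
  if h : ∃ w, IsWeakDeriv D α u w then h.choose else 0

/-- `u ∈ H^m(D)`. -/
def MemSobolev (D : Set (Space d)) (m : ℕ) (u : Space d → ℝ) : Prop :=
  ∀ α : Fin d → ℕ, ∑ i, α i ≤ m → ∃ w, IsWeakDeriv D α u w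

/-- The norm `‖u‖_{m,D} = (∑_{|α| ≤ m} ‖D^α u‖²_{L²(D)})^{1/2}` of `H^m(D)`. -/
def sobolevNorm (D : Set (Space d)) (m : ℕ) (u : Space d → ℝ) : ℝ :=
  Real.sqrt (∑ j ∈ Finset.range (m + 1), ∑ α ∈ Finset.piAntidiag (Finset.univ : Finset (Fin d)) j,
    ∫ x in D, (weakDeriv D α u x) ^ 2)

/-- `q ∈ H^m(D; ℝ^d)`. -/
def MemSobolevVec (D : Set (Space d)) (m : ℕ) (q : Space d → Space d) : Prop :=
  ∀ i, MemSobolev D m (fun x => q x i)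

/-- The norm of `H^m(D; ℝ^d)`. -/
def sobolevNormVec (D : Set (Space d)) (m : ℕ) (q : Space d → Space d) : ℝ :=
  Real.sqrt (∑ i, (sobolevNorm D m (fun x => q x i)) ^ 2)

/-- `u ∈ H^1(D)` with weak gradient `G`. -/
def HasWeakGradient (D : Set (Space d)) (u : Space d → ℝ) (G : Space d → Space d) : Prop :=
  MemLp u 2 (volume.restrict D) ∧ MemLp G 2 (volume.restrict D) ∧
    ∀ φ : Space d → ℝ, IsTestFunction D φ → ∀ i : Fin d,
      ∫ x in D, u x * partialDeriv i φ x = -∫ x in D, G x i * φ x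

/-- The surface measure on hypersurfaces of `ℝ^d`: the `(d-1)`-dimensional Hausdorff measure,
normalised to agree with Lebesgue measure on hyperplanes. -/
def surface (d : ℕ) : Measure (Space d) := Measure.euclideanHausdorffMeasure (d - 1)

/-- `g ∈ L²(S)` is the trace on `S ⊆ ∂D` of `u ∈ H^1(D)`: some functions smooth on all of `ℝ^d`
converge to `u` in `H^1(D)`, and their restrictions to `S` converge to `g` in `L²(S)`. -/
def HasTrace (D S : Set (Space d)) (u g : Space d → ℝ) : Prop :=
  MemLp g 2 ((surface d).restrict S) ∧
  ∃ G : Space d → Space d, HasWeakGradient D u G ∧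
    ∃ φ : ℕ → Space d → ℝ, (∀ n, ContDiff ℝ ∞ (φ n)) ∧
      Tendsto (fun n => eLpNorm (fun x => φ n x - u x) 2 (volume.restrict D)) atTop (𝓝 0) ∧
      Tendsto (fun n => eLpNorm (fun x => gradient (φ n) x - G x) 2 (volume.restrict D))
        atTop (𝓝 0) ∧
      Tendsto (fun n => eLpNorm (fun x => φ n x - g x) 2 ((surface d).restrict S)) atTop (𝓝 0)

/-! ### The continuous problem -/

/-- The data of the problem: a bounded domain `Ω` divided into `Ω₊` and `Ω₋`, the Dirichlet part
`Γ_D` of the boundary, and the two values of the coefficient. That the domains are polygonal is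
implied by the existence of a triangulation. The Neumann part of the boundary is the
rest, `Γ_N = ∂Ω \ closure Γ_D`. -/
structure Problem (d : ℕ) where
  Ω : Set (Space d)
  Ωp : Set (Space d)
  Ωm : Set (Space d)
  ΓD : Set (Space d)
  σp : ℝ
  σm : ℝ
  isOpen_Ω : IsOpen Ω
  isConnected_Ω : IsConnected Ω
  isBounded_Ω : Bornology.IsBounded Ω
  /-- `Ω` lies on one side of its boundary (no slits). -/
  interior_closure_Ω : interior (closure Ω) = Ω
  isOpen_Ωp : IsOpen Ωp
  isOpen_Ωm : IsOpen Ωm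
  Ωp_subset : Ωp ⊆ Ω
  Ωm_subset : Ωm ⊆ Ω
  disjoint : Disjoint Ωp Ωm
  closure_eq : closure Ω = closure Ωp ∪ closure Ωm
  ΓD_subset : ΓD ⊆ frontier Ω
  ΓD_nonempty : ΓD.Nonempty
  σp_pos : 0 < σp
  σm_neg : σm < 0

namespace Problem

variable (P : Problem d)

open Classical in
/-- The sign-changing coefficient. -/
def σ (x : Space d) : ℝ := if x ∈ P.Ωp then P.σp else P.σm

/-- The interface `Γ_I`. -/
def ΓI : Set (Space d) := closure P.Ωp ∩ closure P.Ωm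

/-- `v ∈ H^1(Ω)` with weak gradient `G` and `v = 0` on `Γ_D`. -/
def MemH1D (v : Space d → ℝ) (G : Space d → Space d) : Prop :=
  HasWeakGradient P.Ω v G ∧ HasTrace P.Ω (closure P.ΓD) v 0

/-- `(q, u)` is the (weak) solution of the mixed problem
`σ⁻¹ q + ∇u = 0` and `∇ ⬝ q = g` in `Ω`, `u = 0` on `Γ_D`, `q ⬝ n = 0` on `Γ_N`. -/
def IsMixedSolution (g : Space d → ℝ) (q : Space d → Space d) (u : Space d → ℝ) : Prop :=
  (∃ G : Space d → Space d, P.MemH1D u G ∧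
    ∀ᵐ x ∂(volume.restrict P.Ω), (P.σ x)⁻¹ • q x + G x = 0) ∧
  ∀ (v : Space d → ℝ) (Gv : Space d → Space d), P.MemH1D v Gv →
    ∫ x in P.Ω, inner ℝ (q x) (Gv x) = -∫ x in P.Ω, g x * v x

/-- The regularity assumption with constant `Creg`: for every `θ ∈ L²(Ω)` the dual problem
`σ⁻¹ Φ + ∇φ = 0`, `∇ ⬝ Φ = θ`, `φ = 0` on `Γ_D`, `Φ ⬝ n = 0` on `Γ_N` has a solution with
`‖Φ‖_{1,Ω₊} + ‖Φ‖_{1,Ω₋} + ‖φ‖_{2,Ω₊} + ‖φ‖_{2,Ω₋} ≤ Creg ‖θ‖_Ω`. -/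
def DualRegularity (Creg : ℝ) : Prop :=
  ∀ θ : Space d → ℝ, MemLp θ 2 (volume.restrict P.Ω) →
    ∃ (Φ : Space d → Space d) (φ : Space d → ℝ), P.IsMixedSolution θ Φ φ ∧
      MemSobolevVec P.Ωp 1 Φ ∧ MemSobolevVec P.Ωm 1 Φ ∧
      MemSobolev P.Ωp 2 φ ∧ MemSobolev P.Ωm 2 φ ∧
      sobolevNormVec P.Ωp 1 Φ + sobolevNormVec P.Ωm 1 Φ +
        sobolevNorm P.Ωp 2 φ + sobolevNorm P.Ωm 2 φ ≤ Creg * Real.sqrt (∫ x in P.Ω, θ x ^ 2)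

end Problem

/-! ### Triangulations -/

/-- The closed simplex (of any dimension) spanned by a finite set of vertices. -/
def hull (s : Finset (Space d)) : Set (Space d) := convexHull ℝ (s : Set (Space d))

/-- A triangulation of `Ω` that is conforming with respect to `Γ_I` and resolves `Γ_D`: a finite
simplicial complex all of whose faces belong to `d`-simplices, the elements. Elements have
`d + 1` vertices, facets have `d`. -/
structure Triangulation (P : Problem d) where
  complex : Geometry.SimplicialComplex ℝ (Space d)
  finite : complex.faces.Finite
  pure : ∀ s ∈ complex.faces, ∃ K ∈ complex.faces, s ⊆ K ∧ K.card = d + 1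
  space_eq : complex.space = closure P.Ω
  element_subset : ∀ K ∈ complex.faces, K.card = d + 1 →
    interior (hull K) ⊆ P.Ωp ∨ interior (hull K) ⊆ P.Ωm
  interface_eq : P.ΓI = ⋃ F ∈ {F ∈ complex.faces | F.card = d ∧ hull F ⊆ P.ΓI}, hull F
  dirichlet_eq : closure P.ΓD =
    ⋃ F ∈ {F ∈ complex.faces | F.card = d ∧ hull F ⊆ closure P.ΓD}, hull F
  /-- No element has its whole boundary on the interface. -/
  boundary_not_subset : ∀ K ∈ complex.faces, K.card = d + 1 →
    ∃ F ⊆ K, F.card = d ∧ ¬ hull F ⊆ P.ΓI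

open Classical in
/-- The facet of the simplex `K` opposite to its vertex `a`. -/
def facet (K : Finset (Space d)) (a : Space d) : Finset (Space d) := K.erase a

/-- The unit outward normal of the simplex `K` on `facet K a`: the normalised component,
orthogonal to the facet, of the vector from `a` to the centroid of the facet. -/
def normal (K : Finset (Space d)) (a : Space d) : Space d :=
  let w : Space d := (vectorSpan ℝ (facet K a : Set (Space d)))ᗮ.starProjection
    ((facet K a).centroid ℝ id - a)
  ‖w‖⁻¹ • w

namespace Triangulation

variable {P : Problem d} (T : Triangulation P)

open Classical in
/-- The set `𝒯_h` of elements. -/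
def elements : Finset (Finset (Space d)) := {K ∈ T.finite.toFinset | K.card = d + 1}

open Classical in
/-- The set `ℱ_h` of facets. -/
def facets : Finset (Finset (Space d)) := {F ∈ T.finite.toFinset | F.card = d}

/-- The mesh size, the largest diameter of an element. -/
def h : ℝ := sSup ((fun K => Metric.diam (hull K)) '' (T.elements : Set (Finset (Space d))))

/-- Shape regularity with constant `ρ`: each element `K` contains a ball of radius `ρ h_K`. -/
def ShapeRegular (ρ : ℝ) : Prop :=
  ∀ K ∈ T.elements, ∃ c, Metric.closedBall c (ρ * Metric.diam (hull K)) ⊆ hull K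

/-- `∑_K ∫_K g_K dx`. -/
def integral (g : Finset (Space d) → Space d → ℝ) : ℝ :=
  ∑ K ∈ T.elements, ∫ x in hull K, g K x

/-- `∑_K ∫_{∂K} g ds`, where `g K a` is the integrand on the facet of `K` opposite to `a`. -/
def bdryIntegral (g : Finset (Space d) → Space d → Space d → ℝ) : ℝ :=
  ∑ K ∈ T.elements, ∑ a ∈ K, ∫ x in hull (facet K a), g K a x ∂(surface d)

end Triangulation

/-! ### The HDG method -/

/-- `f` is a polynomial function of degree at most `m`. -/
def IsPoly (m : ℕ) (f : Space d → ℝ) : Prop :=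
  ∃ p : MvPolynomial (Fin d) ℝ, p.totalDegree ≤ m ∧ ∀ x, f x = MvPolynomial.eval (fun i => x i) p

/-- `f` is a vector-valued polynomial function of degree at most `m`. -/
def IsPolyVec (m : ℕ) (f : Space d → Space d) : Prop :=
  ∀ i, IsPoly m (fun x => f x i)

section Method

variable {P : Problem d} (T : Triangulation P)

/-- Membership in `V_h`; `r K` is the polynomial that represents the function on `K`. -/
def MemV (k : ℕ) (r : Finset (Space d) → Space d → Space d) : Prop :=
  ∀ K ∈ T.elements, IsPolyVec k (r K)

/-- Membership in `W_h`; `v K` is the polynomial that represents the function on `K`. -/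
def MemW (k : ℕ) (v : Finset (Space d) → Space d → ℝ) : Prop :=
  ∀ K ∈ T.elements, IsPoly k (v K)

/-- Membership in `M_h`; `μ F`, a polynomial, is only ever evaluated on the facet `F`. -/
def MemM (k : ℕ) (μ : Finset (Space d) → Space d → ℝ) : Prop :=
  ∀ F ∈ T.facets, IsPoly k (μ F) ∧ (hull F ⊆ closure P.ΓD → ∀ x ∈ hull F, μ F x = 0)

/-- The sign condition on the stabilisation parameter `τ`, constant on each facet. -/
def TauCondition (τ : Finset (Space d) → ℝ) : Prop :=
  (∀ F ∈ T.facets, hull F ⊆ P.ΓI → τ F = 0) ∧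
  ∀ K ∈ T.elements, ∀ F ∈ T.facets, F ⊆ K → ¬ hull F ⊆ P.ΓI →
    (interior (hull K) ⊆ P.Ωp → 0 < τ F) ∧ (interior (hull K) ⊆ P.Ωm → τ F < 0)

/-- `(q_h, u_h, ū_h) ∈ V_h × W_h × M_h` solves the HDG method with source `f`, for homogeneous
boundary data. -/
structure IsHDGSolution (k : ℕ) (τ : Finset (Space d) → ℝ) (f : Space d → ℝ)
    (qh : Finset (Space d) → Space d → Space d) (uh ubar : Finset (Space d) → Space d → ℝ) :
    Prop where
  memV : MemV T k qh
  memW : MemW T k uh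
  memM : MemM T k ubar
  eq1 : ∀ r, MemV T k r →
    T.integral (fun K x => (P.σ x)⁻¹ * inner ℝ (qh K x) (r K x))
      + T.integral (fun K x => inner ℝ (gradient (uh K) x) (r K x))
      - T.bdryIntegral (fun K a x =>
          (uh K x - ubar (facet K a) x) * inner ℝ (r K x) (normal K a)) = 0
  eq2 : ∀ v, MemW T k v →
    T.integral (fun K x => inner ℝ (qh K x) (gradient (v K) x))
      - T.bdryIntegral (fun K a x =>
          (inner ℝ (qh K x) (normal K a)
            + τ (facet K a) * (uh K x - ubar (facet K a) x)) * v K x)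
      = T.integral (fun K x => f x * v K x)
  eq3 : ∀ vbar, MemM T k vbar →
    T.bdryIntegral (fun K a x =>
      (inner ℝ (qh K x) (normal K a)
        + τ (facet K a) * (uh K x - ubar (facet K a) x)) * vbar (facet K a) x) = 0

/-- The Stenberg post-processing `u_h^*` of `(q_h, u_h)`: on each element a polynomial of degree
at most `k + 1`. -/
def IsPostProcessed (k : ℕ) (qh : Finset (Space d) → Space d → Space d)
    (uh us : Finset (Space d) → Space d → ℝ) : Prop :=
  ∀ K ∈ T.elements, IsPoly (k + 1) (us K) ∧
    (∀ v : Space d → ℝ, IsPoly (k + 1) v →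
      ∫ x in hull K, inner ℝ (gradient (us K) x) (gradient v x)
        = -∫ x in hull K, (P.σ x)⁻¹ * inner ℝ (qh K x) (gradient v x)) ∧
    ∫ x in hull K, us K x = ∫ x in hull K, uh K x

/-- `(pq, pu) = (Π_V q, Π_W u)` is, element by element, the HDG projection of `(q, u)`, which is
of class `H^1` on each element: moments of degree less than `k` in the element agree, and so do
moments of degree at most `k` of `q ⬝ n + τ u` on each of its facets. -/
structure IsHDGProjection (k : ℕ) (τ : Finset (Space d) → ℝ)
    (q : Space d → Space d) (u : Space d → ℝ)
    (pq : Finset (Space d) → Space d → Space d) (pu : Finset (Space d) → Space d → ℝ) :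
    Prop where
  memV : MemV T k pq
  memW : MemW T k pu
  moment_q : ∀ K ∈ T.elements, ∀ j < k, ∀ r : Space d → Space d, IsPolyVec j r →
    ∫ x in hull K, inner ℝ (pq K x) (r x) = ∫ x in hull K, inner ℝ (q x) (r x)
  moment_u : ∀ K ∈ T.elements, ∀ j < k, ∀ v : Space d → ℝ, IsPoly j v →
    ∫ x in hull K, pu K x * v x = ∫ x in hull K, u x * v x
  facet_moment : ∀ K ∈ T.elements, ∀ a ∈ K,
    ∃ (tq : Space d → Space d) (tu : Space d → ℝ),
      (∀ i, HasTrace (interior (hull K)) (hull (facet K a)) (fun x => q x i) (fun x => tq x i)) ∧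
      HasTrace (interior (hull K)) (hull (facet K a)) u tu ∧
      ∀ l : Space d → ℝ, IsPoly k l →
        ∫ x in hull (facet K a),
            (inner ℝ (pq K x) (normal K a) + τ (facet K a) * pu K x) * l x ∂(surface d)
          = ∫ x in hull (facet K a),
            (inner ℝ (tq x) (normal K a) + τ (facet K a) * tu x) * l x ∂(surface d)

/-- `‖u - v‖_Ω` for `v` given element by element. -/
def scalarError (u : Space d → ℝ) (v : Finset (Space d) → Space d → ℝ) : ℝ :=
  Real.sqrt (T.integral fun K x => (u x - v K x) ^ 2)

/-- `‖q - r‖_Ω` for `r` given element by element. -/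
def vectorError (q : Space d → Space d) (r : Finset (Space d) → Space d → Space d) : ℝ :=
  Real.sqrt (T.integral fun K x => ‖q x - r K x‖ ^ 2)

/-- `‖q - r‖_{V_h}`, the norm weighted with `|σ|⁻¹`, for `r` given element by element. -/
def weightedError (q : Space d → Space d) (r : Finset (Space d) → Space d → Space d) : ℝ :=
  Real.sqrt (T.integral fun K x => |P.σ x|⁻¹ * ‖q x - r K x‖ ^ 2)

end Method

end HDG

end

open MeasureTheory Filter Topology
open scoped ContDiff

noncomputable section

namespace HDG

variable {d : ℕ}

/-! ### Square-integrable functions -/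

section L2

variable {X : Type*} [MeasurableSpace X] {ν : Measure X} {f g : X → ℝ}

/-! The Poincaré inequality on an element bounds `u - u_h^*` by its mean and by the diameter times
its gradient. Post-processing keeps element means, so the mean is that of `u - u_h`. The gradient of
`u_h^*` is the `L²` projection of `-σ⁻¹ q_h` onto gradients of polynomials of degree `k + 1`, while
the gradient of `u` is `-σ⁻¹ q`. The gradient error is thus bounded by a best approximation of `∇u`,
of order `h^(k+1)` by iterated Poincaré inequalities (`exists_poly_approx`), and by a multiple of `q
- q_h` (`postProcessed_gradient_error`). What remains is to show that the piecewise constant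
function `θ` of the element means of `u - u_h` gains a factor `h` (`exists_mean_error_le`).

This is a duality argument. Let `(Φ, φ)` solve the dual problem with source `θ`. The lowest order
Raviart-Thomas interpolant `RΦ` has divergence exactly `θ`, and its constant normal fluxes are
single valued on facets and vanish on the Neumann part. Testing the flux error equation with `RΦ`
removes all facet terms and gives `‖θ‖² = (σ⁻¹(q - q_h), RΦ)` (`sum_mean_error_sq`). Here `RΦ - Φ`
is of order `h`. In the remaining product with `Φ`, the part `q - Π_V q` is orthogonal to constants,
so the element means of `Φ` can be subtracted, which again gains `h`. The last part is `-(Π_V q -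
q_h, ∇φ)`, and `duality_identity` turns `(Π_V q - q_h, ∇φ)` into `(σ⁻¹(q - q_h), r)`, where `r` is
the vector part of a local HDG projection of `(0, φ)` for the adjoint method. As `r` is of order `h
‖∇φ‖` (`exists_local_dual`), all three terms are at most `C h ‖θ‖` times the flux errors. No
coercivity enters, so the sign change of `σ` is harmless; what matters is that `τ` has one sign on
each element.

The local projection lives on polynomials of degree `k` orthogonal to those of degree `k - 1`. By
Euler's identity their norms on an element and on any of its facets are proportional
(`integral_sq_polyPerp`), and every polynomial on a facet extends to one of them
(`exists_polyPerp_eq`). This gives explicit constants and replaces scaling to a reference element.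

All integration by parts comes from one identity: a simplex is a cone over each of its facets, and
the radial field `g(x)(x - a)` centred at the apex has flux through the base only
(`integral_radial_coneOver`). It yields the divergence theorem, the trace inequality and the inverse
trace inequality. Traces are `L²` limits of smooth functions, and single-valuedness of the exact
flux follows from cutoffs around one facet (`bdryIntegral_single_facet`). -/

theorem integrable_mul_of_memLp (hf : MemLp f 2 ν) (hg : MemLp g 2 ν) :
    Integrable (fun x => f x * g x) ν := hf.integrable_mul hg

theorem sq_eLpNorm_eq_integral (hf : MemLp f 2 ν) :
    eLpNorm f 2 ν = ENNReal.ofReal (Real.sqrt (∫ x, f x ^ 2 ∂ν)) := by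
  rw [hf.eLpNorm_eq_integral_rpow_norm (by norm_num) (by norm_num), Real.sqrt_eq_rpow]
  congr 2
  · refine integral_congr_ae (ae_of_all _ fun x => ?_)
    simp
  · norm_num

/-- Cauchy-Schwarz: the quadratic `t ↦ ∫ (f + t g)²` is nonnegative, so its discriminant is not
positive. -/
theorem abs_integral_mul_le_sqrt (hf : MemLp f 2 ν) (hg : MemLp g 2 ν) :
    |∫ x, f x * g x ∂ν| ≤ Real.sqrt (∫ x, f x ^ 2 ∂ν) * Real.sqrt (∫ x, g x ^ 2 ∂ν) := by
  have hf2 := hf.integrable_sq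
  have hg2 := hg.integrable_sq
  have hfg := integrable_mul_of_memLp hf hg
  rw [← Real.sqrt_mul (integral_nonneg fun x => sq_nonneg _)]
  refine Real.abs_le_sqrt ?_
  have key : ∀ t : ℝ, 0 ≤ (∫ x, g x ^ 2 ∂ν) * (t * t) + (2 * ∫ x, f x * g x ∂ν) * t
      + ∫ x, f x ^ 2 ∂ν := by
    intro t
    have h : 0 ≤ ∫ x, (f x + t * g x) ^ 2 ∂ν := integral_nonneg fun x => sq_nonneg _
    have e : ∫ x, (f x + t * g x) ^ 2 ∂ν
        = (∫ x, f x ^ 2 ∂ν) + ((2 * t) * ∫ x, f x * g x ∂ν) + (t * t) * ∫ x, g x ^ 2 ∂ν := by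
      have i1 : Integrable (fun x => f x ^ 2 + (2 * t) * (f x * g x)) ν := hf2.add (hfg.const_mul _)
      rw [← integral_const_mul, ← integral_const_mul, ← integral_add hf2 (hfg.const_mul _),
        ← integral_add i1 (hg2.const_mul _)]
      congr 1; ext x; ring
    linarith [h, e]
  have := discrim_le_zero key
  rw [discrim] at this
  nlinarith

theorem integral_sq_add_le (hf : MemLp f 2 ν) (hg : MemLp g 2 ν) :
    ∫ x, (f x + g x) ^ 2 ∂ν ≤ 2 * (∫ x, f x ^ 2 ∂ν) + 2 * ∫ x, g x ^ 2 ∂ν := by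
  rw [← integral_const_mul, ← integral_const_mul,
    ← integral_add (hf.integrable_sq.const_mul _) (hg.integrable_sq.const_mul _)]
  refine integral_mono (hf.add hg).integrable_sq
    ((hf.integrable_sq.const_mul _).add (hg.integrable_sq.const_mul _)) fun x => ?_
  simp only
  nlinarith [sq_nonneg (f x - g x)]

theorem integral_sq_sub_le (hf : MemLp f 2 ν) (hg : MemLp g 2 ν) :
    ∫ x, (f x - g x) ^ 2 ∂ν ≤ 2 * (∫ x, f x ^ 2 ∂ν) + 2 * ∫ x, g x ^ 2 ∂ν := by
  have := integral_sq_add_le hf hg.neg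
  simpa [sub_eq_add_neg] using this

/-- Traces are defined through `eLpNorm`, whereas all estimates are made with real integrals of
squares; this is the passage between the two. -/
theorem tendsto_eLpNorm_zero_iff {F : ℕ → X → ℝ} (hF : ∀ n, MemLp (F n) 2 ν) :
    Tendsto (fun n => eLpNorm (F n) 2 ν) atTop (𝓝 0) ↔
      Tendsto (fun n => ∫ x, F n x ^ 2 ∂ν) atTop (𝓝 0) := by
  simp_rw [fun n => sq_eLpNorm_eq_integral (hF n)]
  constructor
  · intro h
    have h2 := (ENNReal.tendsto_toReal ENNReal.zero_ne_top).comp h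
    simp only [Function.comp_def, ENNReal.toReal_zero,
      ENNReal.toReal_ofReal (Real.sqrt_nonneg _)] at h2
    have h3 := h2.pow 2
    simpa [Real.sq_sqrt (integral_nonneg fun x => sq_nonneg (F _ x))] using h3
  · intro h
    have h2 := (Real.continuous_sqrt.tendsto 0).comp h
    simp only [Function.comp_def, Real.sqrt_zero] at h2
    simpa using ENNReal.tendsto_ofReal h2

/-- `f n → f` in `L²(ν)`. -/
structure L2Tendsto (ν : Measure X) (F : ℕ → X → ℝ) (f : X → ℝ) : Prop where
  memF : ∀ n, MemLp (F n) 2 ν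
  memf : MemLp f 2 ν
  lim : Tendsto (fun n => ∫ x, (F n x - f x) ^ 2 ∂ν) atTop (𝓝 0)

theorem L2Tendsto.of_eLpNorm {F : ℕ → X → ℝ} (hF : ∀ n, MemLp (F n) 2 ν) (hf : MemLp f 2 ν)
    (h : Tendsto (fun n => eLpNorm (fun x => F n x - f x) 2 ν) atTop (𝓝 0)) :
    L2Tendsto ν F f :=
  ⟨hF, hf, (tendsto_eLpNorm_zero_iff fun n => (hF n).sub hf).1 h⟩

theorem L2Tendsto.eLpNorm {F : ℕ → X → ℝ} (h : L2Tendsto ν F f) :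
    Tendsto (fun n => eLpNorm (fun x => F n x - f x) 2 ν) atTop (𝓝 0) :=
  (tendsto_eLpNorm_zero_iff fun n => (h.memF n).sub h.memf).2 h.lim

theorem L2Tendsto.const (hf : MemLp f 2 ν) : L2Tendsto ν (fun _ => f) f :=
  ⟨fun _ => hf, hf, by simp⟩

theorem L2Tendsto.sub {F G : ℕ → X → ℝ} (hF : L2Tendsto ν F f) (hG : L2Tendsto ν G g) :
    L2Tendsto ν (fun n x => F n x - G n x) (fun x => f x - g x) := by
  refine ⟨fun n => (hF.memF n).sub (hG.memF n), hF.memf.sub hG.memf, ?_⟩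
  have h := (hF.lim.const_mul 2).add (hG.lim.const_mul 2)
  simp only [mul_zero, add_zero] at h
  refine squeeze_zero (fun n => integral_nonneg fun x => sq_nonneg _) (fun n => ?_) h
  have := integral_sq_sub_le ((hF.memF n).sub hF.memf) ((hG.memF n).sub hG.memf)
  refine le_trans (le_of_eq ?_) this
  refine integral_congr_ae (ae_of_all _ fun x => ?_)
  simp only [Pi.sub_apply]; ring

theorem L2Tendsto.congr {F : ℕ → X → ℝ} (hF : L2Tendsto ν F f) (h : f =ᵐ[ν] g) :
    L2Tendsto ν F g := by
  refine ⟨hF.memF, hF.memf.ae_eq h, hF.lim.congr fun n => integral_congr_ae ?_⟩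
  filter_upwards [h] with x hx
  rw [hx]

theorem L2Tendsto.integral_mul_of_memLp {F : ℕ → X → ℝ} (hF : L2Tendsto ν F f)
    (hg : MemLp g 2 ν) :
    Tendsto (fun n => ∫ x, F n x * g x ∂ν) atTop (𝓝 (∫ x, f x * g x ∂ν)) := by
  rw [tendsto_iff_norm_sub_tendsto_zero]
  have h := ((Real.continuous_sqrt.tendsto 0).comp hF.lim).mul_const
    (Real.sqrt (∫ x, g x ^ 2 ∂ν))
  simp only [Function.comp_def, Real.sqrt_zero, zero_mul] at h
  refine squeeze_zero (fun n => norm_nonneg _) (fun n => ?_) h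
  have := abs_integral_mul_le_sqrt ((hF.memF n).sub hF.memf) hg
  rw [Real.norm_eq_abs, ← integral_sub (integrable_mul_of_memLp (hF.memF n) hg)
    (integrable_mul_of_memLp hF.memf hg)]
  simpa [sub_mul] using this

theorem L2Tendsto.integral_sq {F : ℕ → X → ℝ} (hF : L2Tendsto ν F f) :
    Tendsto (fun n => ∫ x, F n x ^ 2 ∂ν) atTop (𝓝 (∫ x, f x ^ 2 ∂ν)) := by
  have h := (hF.lim.add ((hF.integral_mul_of_memLp hF.memf).const_mul 2)).sub_const
    (∫ x, f x ^ 2 ∂ν)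
  have e : 0 + 2 * (∫ x, f x * f x ∂ν) - ∫ x, f x ^ 2 ∂ν = ∫ x, f x ^ 2 ∂ν := by
    simp_rw [pow_two]; ring
  rw [e] at h
  refine h.congr fun n => ?_
  have i1 : Integrable (fun x => (F n x - f x) ^ 2) ν := ((hF.memF n).sub hF.memf).integrable_sq
  have i2 := (integrable_mul_of_memLp (hF.memF n) hF.memf).const_mul 2
  have i3 : Integrable (fun x => (F n x - f x) ^ 2 + 2 * (F n x * f x)) ν := i1.add i2
  rw [← integral_const_mul, ← integral_add i1 i2, ← integral_sub i3 hF.memf.integrable_sq]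
  refine integral_congr_ae (ae_of_all _ fun x => ?_)
  ring

/-- A sequence that is Cauchy in `L²` converges. -/
theorem exists_L2Tendsto_of_cauchy {F : ℕ → X → ℝ} (hF : ∀ n, MemLp (F n) 2 ν)
    (hc : ∀ ε > 0, ∃ N, ∀ m ≥ N, ∀ n ≥ N, ∫ x, (F m x - F n x) ^ 2 ∂ν ≤ ε) :
    ∃ f, L2Tendsto ν F f := by
  have hcs : CauchySeq fun n => (hF n).toLp (F n) := by
    rw [Metric.cauchySeq_iff]
    intro ε hε
    obtain ⟨N, hN⟩ := hc (ε ^ 2 / 4) (by positivity)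
    refine ⟨N, fun m hm n hn => ?_⟩
    rw [dist_eq_norm, ← MemLp.toLp_sub, Lp.norm_toLp,
      sq_eLpNorm_eq_integral ((hF m).sub (hF n)), ENNReal.toReal_ofReal (Real.sqrt_nonneg _)]
    have h1 : Real.sqrt (∫ x, (F m - F n) x ^ 2 ∂ν) ≤ Real.sqrt ((ε / 2) ^ 2) := by
      refine Real.sqrt_le_sqrt ((hN m hm n hn).trans (le_of_eq (by ring)))
    rw [Real.sqrt_sq (by positivity)] at h1
    linarith
  obtain ⟨f, hf⟩ := cauchySeq_tendsto_of_complete hcs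
  refine ⟨f, .of_eLpNorm hF (Lp.memLp f) ?_⟩
  rw [Lp.tendsto_Lp_iff_tendsto_eLpNorm'] at hf
  refine hf.congr fun n => eLpNorm_congr_ae ?_
  filter_upwards [(hF n).coeFn_toLp] with x hx
  simp [hx]

theorem sum_abs_integral_mul_le {ι : Type*} (s : Finset ι) {a b : ι → X → ℝ}
    (ha : ∀ i ∈ s, MemLp (a i) 2 ν) (hb : ∀ i ∈ s, MemLp (b i) 2 ν) :
    |∑ i ∈ s, ∫ x, a i x * b i x ∂ν| ≤
      Real.sqrt (∑ i ∈ s, ∫ x, a i x ^ 2 ∂ν) * Real.sqrt (∑ i ∈ s, ∫ x, b i x ^ 2 ∂ν) := by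
  refine (Finset.abs_sum_le_sum_abs _ _).trans ?_
  refine (Finset.sum_le_sum fun i hi => abs_integral_mul_le_sqrt (ha i hi) (hb i hi)).trans ?_
  exact Real.sum_sqrt_mul_sqrt_le s (fun i => integral_nonneg fun x => sq_nonneg _)
    (fun i => integral_nonneg fun x => sq_nonneg _)

end L2

theorem memLp_of_continuous {ν : Measure (Space d)} {S : Set (Space d)} (hS : IsCompact S)
    (hν : ν S < ⊤) {f : Space d → ℝ} (hf : Continuous f) (p : ENNReal) :
    MemLp f p (ν.restrict S) := by
  have : IsFiniteMeasure (ν.restrict S) := ⟨by simpa using hν⟩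
  obtain ⟨C, hC⟩ := hS.exists_bound_of_continuousOn hf.continuousOn
  exact MemLp.of_bound hf.aestronglyMeasurable C (ae_restrict_of_forall_mem hS.measurableSet hC)

theorem memLp_volume_of_continuous {S : Set (Space d)} (hS : Bornology.IsBounded S)
    {f : Space d → ℝ} (hf : Continuous f) (p : ENNReal) : MemLp f p (volume.restrict S) := by
  have hc : IsCompact (closure S) := hS.isCompact_closure
  exact (memLp_of_continuous hc hc.measure_lt_top hf p).mono_measure
    (Measure.restrict_mono subset_closure le_rfl)

/-! ### Integration over cones -/

/-- The cone with apex `a` over `F`. -/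
def coneOver (a : Space d) (F : Set (Space d)) : Set (Space d) :=
  (fun p : ℝ × Space d => a + p.1 • (p.2 - a)) '' (Set.Icc 0 1 ×ˢ F)

theorem isCompact_coneOver (a : Space d) {F : Set (Space d)} (hF : IsCompact F) :
    IsCompact (coneOver a F) :=
  (isCompact_Icc.prod hF).image (by fun_prop)

section Cone

variable (n a : Space d) (H : ℝ) (F : Set (Space d))

/-- The hyperplane orthogonal to `n`. -/
abbrev hyper (n : Space d) : Submodule ℝ (Space d) := (ℝ ∙ n)ᗮ

theorem inner_hyper (v : hyper n) : inner ℝ n (v : Space d) = 0 :=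
  Submodule.mem_orthogonal_singleton_iff_inner_right.1 v.2

/-- The coordinates in the hyperplane of the points of `F`. -/
def sliceSet : Set (hyper n) := {v | a + ((v : Space d) + H • n) ∈ F}

variable {n a H F}

theorem finrank_hyper (hn : ‖n‖ = 1) : Module.finrank ℝ (hyper n) = d - 1 := by
  have h0 : n ≠ 0 := by rintro rfl; simp at hn
  have h := (ℝ ∙ n).finrank_add_finrank_orthogonal
  rw [finrank_span_singleton h0, finrank_euclideanSpace_fin] at h
  change Module.finrank ℝ (ℝ ∙ n)ᗮ = d - 1
  omega

theorem exists_hyper_eq (hn : ‖n‖ = 1) (hF : ∀ y ∈ F, inner ℝ n (y - a) = H) {y : Space d}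
    (hy : y ∈ F) : ∃ v : hyper n, y = a + ((v : Space d) + H • n) := by
  refine ⟨⟨y - a - H • n, ?_⟩, by simp⟩
  rw [Submodule.mem_orthogonal_singleton_iff_inner_right, inner_sub_right, hF y hy,
    inner_smul_right, real_inner_self_eq_norm_sq, hn]
  simp

theorem isometry_slice : Isometry fun v : hyper n => a + ((v : Space d) + H • n) := by
  refine Isometry.of_dist_eq fun v w => ?_
  rw [dist_add_left, dist_add_right, Subtype.dist_eq]

theorem isCompact_sliceSet (hF : IsCompact F) : IsCompact (sliceSet n a H F) :=
  (isometry_slice (n := n) (a := a) (H := H)).isClosedEmbedding.isCompact_preimage hF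

/-- The hyperplane that contains `F` is an isometric copy of `hyper n`. Isometries preserve
Hausdorff measure, and the normalised Hausdorff measure of full dimension is Lebesgue measure. -/
theorem surface_integral_eq (hn : ‖n‖ = 1) (hFc : IsCompact F)
    (hF : ∀ y ∈ F, inner ℝ n (y - a) = H) (g : Space d → ℝ) :
    ∫ x in F, g x ∂(surface d) = ∫ v in sliceSet n a H F, g (a + ((v : Space d) + H • n)) := by
  have hi := isometry_slice (n := n) (a := a) (H := H)
  have hmap := hi.map_euclideanHausdorffMeasure (d := d - 1)
  have hvol : (Measure.euclideanHausdorffMeasure (d - 1) : Measure (hyper n)) = volume := by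
    rw [← finrank_hyper hn, InnerProductSpace.euclideanHausdorffMeasure_eq_volume]
  rw [hvol] at hmap
  have hsub : F ⊆ Set.range fun v : hyper n => a + ((v : Space d) + H • n) := fun y hy => by
    obtain ⟨v, hv⟩ := exists_hyper_eq hn hF hy
    exact ⟨v, hv.symm⟩
  have h1 : (surface d).restrict F
      = (volume.map fun v : hyper n => a + ((v : Space d) + H • n)).restrict F := by
    rw [hmap, Measure.restrict_restrict hFc.measurableSet, Set.inter_eq_left.2 hsub, surface]
  have hme := hi.isClosedEmbedding.measurableEmbedding
  rw [h1, hme.restrict_map, hme.integral_map]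
  rfl

theorem surface_lt_top (hn : ‖n‖ = 1) (hFc : IsCompact F)
    (hF : ∀ y ∈ F, inner ℝ n (y - a) = H) : surface d F < ⊤ := by
  have hi := isometry_slice (n := n) (a := a) (H := H)
  have himg : F = (fun v : hyper n => a + ((v : Space d) + H • n)) '' sliceSet n a H F := by
    ext y
    constructor
    · intro hy
      obtain ⟨v, rfl⟩ := exists_hyper_eq hn hF hy
      exact ⟨v, hy, rfl⟩
    · rintro ⟨v, hv, rfl⟩
      exact hv
  rw [himg, surface, hi.euclideanHausdorffMeasure_image, ← finrank_hyper hn,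
    InnerProductSpace.euclideanHausdorffMeasure_eq_volume]
  exact (isCompact_sliceSet hFc).measure_lt_top

/-- At height `t` the cone is its base scaled by `t / H`. The height of the apex, where the scaling
degenerates, is excluded. -/
theorem mem_coneOver_iff (hn : ‖n‖ = 1) (hH : 0 < H)
    (hF : ∀ y ∈ F, inner ℝ n (y - a) = H) {t : ℝ} (ht : t ≠ 0) (v : hyper n) :
    a + ((v : Space d) + t • n) ∈ coneOver a F ↔
      t ∈ Set.Ioc 0 H ∧ (t / H)⁻¹ • v ∈ sliceSet n a H F := by
  constructor
  · rintro ⟨⟨s, y⟩, ⟨hs, hy⟩, he⟩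
    simp only at hs hy he
    obtain ⟨w, rfl⟩ := exists_hyper_eq hn hF hy
    have he' : s • ((w : Space d) + H • n) = (v : Space d) + t • n := by
      have := add_left_cancel he
      simpa using this
    have hts : s * H = t := by
      have := congrArg (fun z => inner ℝ n z) he'
      simp only [inner_smul_right, inner_add_right, inner_hyper, real_inner_self_eq_norm_sq,
        hn] at this
      simpa using this
    have hvw : s • (w : Space d) = v := by
      rw [smul_add, smul_smul, hts] at he'
      exact add_right_cancel he'
    have hs0 : s ≠ 0 := by rintro rfl; simp at hts; exact ht hts.symm
    have hsH : t / H = s := by rw [← hts]; field_simp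
    refine ⟨⟨?_, ?_⟩, ?_⟩
    · rw [← hts]; exact mul_pos (lt_of_le_of_ne hs.1 (Ne.symm hs0)) hH
    · rw [← hts]; nlinarith [hs.2]
    · rw [hsH]
      have : s⁻¹ • v = w := by
        apply Subtype.ext
        rw [Submodule.coe_smul, ← hvw, smul_smul, inv_mul_cancel₀ hs0, one_smul]
      rw [this]
      exact hy
  · rintro ⟨⟨h0, h1⟩, hm⟩
    refine ⟨(t / H, a + (((t / H)⁻¹ • v : hyper n) + H • n)), ⟨⟨by positivity, ?_⟩, hm⟩, ?_⟩
    · exact (div_le_one hH).2 h1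
    · have : t / H ≠ 0 := by positivity
      simp only [add_sub_cancel_left, smul_add, Submodule.coe_smul, smul_smul,
        mul_inv_cancel₀ this, one_smul, div_mul_cancel₀ _ hH.ne']

theorem integral_eq_integral_hyper (hn : ‖n‖ = 1) {G : Space d → ℝ} (hG : Integrable G) :
    ∫ x, G x = ∫ t : ℝ, ∫ v : hyper n, G (a + ((v : Space d) + t • n)) := by
  have hmp := (ℝ ∙ n).measurePreserving_measurableEquivProd a
  rw [finrank_euclideanSpace_fin, EuclideanSpace.euclideanHausdorffMeasure_eq_volume] at hmp
  have hu : MeasurePreserving (LinearIsometryEquiv.toSpanUnitSingleton (𝕜 := ℝ) n hn) volume volume :=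
    (LinearIsometryEquiv.toSpanUnitSingleton (𝕜 := ℝ) n hn).measurePreserving
  have h2 := (hu.prod (MeasurePreserving.id (volume : Measure (hyper n))))
  have hsymm := hmp.symm
  have h3 := hsymm.comp h2
  let ψ : ℝ × hyper n → Space d := fun p => a + ((p.2 : Space d) + p.1 • n)
  have hfun : ψ = ((ℝ ∙ n).measurableEquivProd a).symm ∘
      Prod.map (LinearIsometryEquiv.toSpanUnitSingleton (𝕜 := ℝ) n hn) id := by
    funext p
    simp [ψ, add_comm]
  have hψ : MeasurePreserving ψ ((volume : Measure ℝ).prod volume) volume := hfun ▸ h3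
  have hemb : MeasurableEmbedding ψ := by
    have e1 : MeasurableEmbedding (LinearIsometryEquiv.toSpanUnitSingleton (𝕜 := ℝ) n hn) :=
      (LinearIsometryEquiv.toSpanUnitSingleton (𝕜 := ℝ) n hn).toHomeomorph.measurableEmbedding
    rw [hfun]
    exact ((ℝ ∙ n).measurableEquivProd a).symm.measurableEmbedding.comp
      (e1.prodMap (MeasurableEmbedding.id (α := hyper n)))
  rw [← hψ.integral_comp hemb G]
  rw [integral_prod (fun p => G (ψ p)) ((hψ.integrable_comp_emb hemb).2 hG)]

/-- Fubini over the heights: the slice at height `t` is a dilate of the base, with Jacobian `(t / H)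
^ (d - 1)`. -/
theorem integral_coneOver (hn : ‖n‖ = 1) (hH : 0 < H) (hFc : IsCompact F)
    (hF : ∀ y ∈ F, inner ℝ n (y - a) = H) {G : Space d → ℝ} (hG : Continuous G) :
    ∫ x in coneOver a F, G x = ∫ v in sliceSet n a H F,
      ∫ t in Set.Ioc 0 H, (t / H) ^ (d - 1) * G (a + (t / H) • ((v : Space d) + H • n)) := by
  have hKc := isCompact_coneOver a hFc
  have hSc := isCompact_sliceSet (n := n) (a := a) (H := H) hFc
  have hint : Integrable ((coneOver a F).indicator G) :=
    (hG.continuousOn.integrableOn_compact hKc).integrable_indicator hKc.measurableSet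
  rw [← integral_indicator hKc.measurableSet, integral_eq_integral_hyper (a := a) hn hint]
  have hslice : ∀ᵐ t : ℝ, ∫ v : hyper n, (coneOver a F).indicator G (a + ((v : Space d) + t • n))
      = (Set.Ioc 0 H).indicator (fun t => ∫ v in sliceSet n a H F,
          (t / H) ^ (d - 1) * G (a + (t / H) • ((v : Space d) + H • n))) t := by
    have hne : ∀ᵐ t : ℝ, t ≠ 0 := by simp [ae_iff]
    filter_upwards [hne] with t ht
    by_cases htI : t ∈ Set.Ioc 0 H
    · have hs : 0 < t / H := div_pos htI.1 hH
      rw [Set.indicator_of_mem htI]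
      have hfun : (fun v : hyper n => (coneOver a F).indicator G (a + ((v : Space d) + t • n)))
          = fun v : hyper n => (sliceSet n a H F).indicator
            (fun w : hyper n => G (a + (t / H) • ((w : Space d) + H • n))) ((t / H)⁻¹ • v) := by
        ext v
        have := mem_coneOver_iff hn hH hF ht v
        by_cases hv : (t / H)⁻¹ • v ∈ sliceSet n a H F
        · rw [Set.indicator_of_mem (this.2 ⟨htI, hv⟩), Set.indicator_of_mem hv]
          congr 2
          simp only [smul_add, Submodule.coe_smul, smul_smul, mul_inv_cancel₀ hs.ne', one_smul,
            div_mul_cancel₀ _ hH.ne']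
        · rw [Set.indicator_of_notMem (fun h => hv (this.1 h).2), Set.indicator_of_notMem hv]
      rw [hfun, Measure.integral_comp_inv_smul, finrank_hyper hn,
        abs_of_nonneg (pow_nonneg hs.le _), integral_indicator hSc.measurableSet,
        integral_const_mul, smul_eq_mul]
    · rw [Set.indicator_of_notMem htI]
      have hfun : (fun v : hyper n => (coneOver a F).indicator G (a + ((v : Space d) + t • n)))
          = 0 := by
        ext v
        exact Set.indicator_of_notMem (fun h => htI ((mem_coneOver_iff hn hH hF ht v).1 h).1) _
      rw [hfun]
      simp
  rw [integral_congr_ae hslice, integral_indicator measurableSet_Ioc]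
  -- The inner integral is to run along a ray from the apex, where the fundamental theorem of
  -- calculus applies.
  refine integral_integral_swap ?_
  rw [Measure.prod_restrict]
  have hcont : Continuous fun p : ℝ × hyper n =>
      (p.1 / H) ^ (d - 1) * G (a + (p.1 / H) • ((p.2 : Space d) + H • n)) := by fun_prop
  exact (hcont.continuousOn.integrableOn_compact (isCompact_Icc.prod hSc)).mono_set
    (Set.prod_mono Set.Ioc_subset_Icc_self subset_rfl)

/-- The divergence theorem on a cone for radial fields. -/
theorem integral_radial_coneOver (hd : 1 ≤ d) (hn : ‖n‖ = 1) (hH : 0 < H) (hFc : IsCompact F)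
    (hF : ∀ y ∈ F, inner ℝ n (y - a) = H) {g : Space d → ℝ} (hg : ContDiff ℝ 1 g) :
    ∫ x in coneOver a F, (d * g x + fderiv ℝ g x (x - a))
      = H * ∫ x in F, g x ∂(surface d) := by
  have hg' : Continuous fun x => fderiv ℝ g x (x - a) :=
    (hg.continuous_fderiv (by norm_num)).clm_apply (by fun_prop)
  have hgc := hg.continuous
  rw [integral_coneOver hn hH hFc hF (by fun_prop), surface_integral_eq hn hFc hF,
    ← integral_const_mul]
  refine integral_congr_ae (ae_of_all _ fun v => ?_)
  simp only
  set z : Space d := (v : Space d) + H • n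
  rw [← intervalIntegral.integral_of_le hH.le]
  -- Along a ray the divergence of the radial field, weighted by the Jacobian, is an exact
  -- derivative. Its primitive vanishes at the apex since `d ≥ 1`, and equals `H g` on the base.
  have hderiv : ∀ t ∈ Set.uIcc 0 H, HasDerivAt (fun t => H * ((t / H) ^ d * g (a + (t / H) • z)))
      ((t / H) ^ (d - 1) * (d * g (a + (t / H) • z)
        + fderiv ℝ g (a + (t / H) • z) (a + (t / H) • z - a))) t := by
    intro t _
    have h1 : HasDerivAt (fun t : ℝ => t / H) (1 / H) t := (hasDerivAt_id t).div_const H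
    have h2 : HasDerivAt (fun t : ℝ => a + (t / H) • z) ((1 / H) • z) t :=
      (h1.smul_const z).const_add a
    have h3 := ((hg.differentiable (by norm_num)) (a + (t / H) • z)).hasFDerivAt.comp_hasDerivAt
      t h2
    have h4 := ((h1.pow d).mul h3).const_mul H
    refine h4.congr_deriv ?_
    obtain ⟨m, rfl⟩ : ∃ m, d = m + 1 := ⟨d - 1, by omega⟩
    simp only [Pi.pow_apply, Function.comp_apply, add_sub_cancel_left, map_smul, smul_eq_mul,
      add_tsub_cancel_right]
    have hH1 : H * (1 / H) = 1 := by field_simp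
    generalize t / H = s
    linear_combination (s ^ m * (((m + 1 : ℕ) : ℝ) * g (a + s • z)
      + s * fderiv ℝ g (a + s • z) z)) * hH1
  rw [intervalIntegral.integral_eq_sub_of_hasDerivAt hderiv]
  · have : H / H = 1 := div_self hH.ne'
    have hd0 : d ≠ 0 := by omega
    simp [this, hd0]
  · apply Continuous.intervalIntegrable
    have : Continuous fun t : ℝ => fderiv ℝ g (a + (t / H) • z) (a + (t / H) • z - a) :=
      hg'.comp (by fun_prop : Continuous fun t : ℝ => a + (t / H) • z)
    fun_prop

end Cone

/-! ### Geometry of simplices -/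

/-- The vertices of a nondegenerate `d`-simplex. -/
structure IsElement (K : Finset (Space d)) : Prop where
  indep : AffineIndependent ℝ ((↑) : K → Space d)
  card : K.card = d + 1

/-- The height of the simplex `K` over its facet opposite to `a`. -/
def height (K : Finset (Space d)) (a : Space d) : ℝ :=
  ‖(vectorSpan ℝ (facet K a : Set (Space d)))ᗮ.starProjection
    ((facet K a).centroid ℝ id - a)‖

theorem mem_facet {K : Finset (Space d)} {a b : Space d} : b ∈ facet K a ↔ b ≠ a ∧ b ∈ K := by
  simp [facet]

theorem isCompact_hull (s : Finset (Space d)) : IsCompact (hull s) :=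
  s.finite_toSet.isCompact_convexHull ℝ

theorem convex_hull (s : Finset (Space d)) : Convex ℝ (hull s) := convex_convexHull ℝ _

theorem subset_hull {s : Finset (Space d)} {x : Space d} (hx : x ∈ s) : x ∈ hull s :=
  subset_convexHull ℝ _ hx

theorem hull_mono {s t : Finset (Space d)} (h : s ⊆ t) : hull s ⊆ hull t :=
  convexHull_mono (by exact_mod_cast h)

namespace IsElement

variable {K : Finset (Space d)} (hK : IsElement K) (hd : 1 ≤ d)
include hK

theorem card_facet {a : Space d} (ha : a ∈ K) : (facet K a).card = d := by
  classical
  have : (facet K a).card = K.card - 1 := by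
    unfold facet
    convert Finset.card_erase_of_mem ha
  rw [this, hK.card]; rfl

theorem vectorSpan_eq_top : vectorSpan ℝ (K : Set (Space d)) = ⊤ := by
  have h := hK.indep.vectorSpan_eq_top_of_card_eq_finrank_add_one
    (by simp [hK.card])
  simpa using h

theorem affineSpan_eq_top : affineSpan ℝ (K : Set (Space d)) = ⊤ := by
  have h := hK.indep.affineSpan_eq_top_iff_card_eq_finrank_add_one.2 (by simp [hK.card])
  simpa using h

/-- A linear identity that holds for the edges of a simplex holds for all vectors. -/
theorem linear_ext {M : Type*} [AddCommGroup M] [Module ℝ M] {f g : Space d →ₗ[ℝ] M}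
    (h : ∀ a ∈ K, ∀ b ∈ K, f (b - a) = g (b - a)) : f = g := by
  ext1 e
  have he : e ∈ vectorSpan ℝ (K : Set (Space d)) := by rw [hK.vectorSpan_eq_top]; trivial
  rw [vectorSpan] at he
  induction he using Submodule.span_induction with
  | mem x hx =>
    obtain ⟨b, hb, a, ha, rfl⟩ := hx
    exact h a ha b hb
  | zero => simp
  | add x y _ _ hx hy => simp [hx, hy]
  | smul c x _ hx => simp [hx]

include hd

theorem facet_nonempty {a : Space d} (ha : a ∈ K) : (facet K a).Nonempty := by
  rw [← Finset.card_pos, hK.card_facet ha]; omega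

theorem centroid_mem {a : Space d} (ha : a ∈ K) :
    (facet K a).centroid ℝ id ∈ affineSpan ℝ (facet K a : Set (Space d)) := by
  exact convexHull_subset_affineSpan _
    (Finset.centroid_mem_convexHull (R := ℝ) _ (hK.facet_nonempty hd ha))

/-- A vanishing height would put `a` in the affine span of the opposite facet, against affine
independence. -/
theorem height_pos {a : Space d} (ha : a ∈ K) : 0 < height K a := by
  refine lt_of_le_of_ne (norm_nonneg _) fun h => ?_
  have h0 := norm_eq_zero.1 h.symm
  rw [Submodule.starProjection_apply_eq_zero_iff, Submodule.orthogonal_orthogonal] at h0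
  have hc := hK.centroid_mem hd ha
  have hmem : a ∈ affineSpan ℝ (facet K a : Set (Space d)) := by
    rw [← direction_affineSpan] at h0
    have := AffineSubspace.vadd_mem_of_mem_direction (Submodule.neg_mem _ h0) hc
    simpa using this
  have hni := hK.indep.notMem_affineSpan_sdiff ⟨a, ha⟩ Set.univ
  apply hni
  refine affineSpan_mono ℝ ?_ hmem
  intro b hb
  have hb' := mem_facet.1 (Finset.mem_coe.1 hb)
  exact ⟨⟨b, hb'.2⟩, by simpa using hb'.1, rfl⟩

theorem norm_normal {a : Space d} (ha : a ∈ K) : ‖normal K a‖ = 1 := by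
  have h := hK.height_pos hd ha
  rw [normal]
  change ‖(height K a)⁻¹ • _‖ = 1
  rw [norm_smul, norm_inv, Real.norm_eq_abs, abs_of_pos h]
  exact inv_mul_cancel₀ h.ne'

/-- The centroid in the definition of the normal is only a reference point: moving it within the
affine span of the facet changes the vector by something orthogonal to the normal. -/
theorem inner_normal_affineSpan {a y : Space d} (ha : a ∈ K)
    (hy : y ∈ affineSpan ℝ (facet K a : Set (Space d))) :
    inner ℝ (normal K a) (y - a) = height K a := by
  have h := hK.height_pos hd ha
  have hc := hK.centroid_mem hd ha
  set w := (vectorSpan ℝ (facet K a : Set (Space d)))ᗮ.starProjection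
    ((facet K a).centroid ℝ id - a) with hw
  have hwmem : w ∈ (vectorSpan ℝ (facet K a : Set (Space d)))ᗮ :=
    Submodule.starProjection_apply_mem _ _
  have hn : normal K a = (height K a)⁻¹ • w := rfl
  have hH : height K a = ‖w‖ := rfl
  have e : y - a = (y - (facet K a).centroid ℝ id) + ((facet K a).centroid ℝ id - a) := by abel
  have h1 : inner ℝ w (y - (facet K a).centroid ℝ id) = 0 := by
    have := AffineSubspace.vsub_mem_direction hy hc
    rw [direction_affineSpan] at this
    exact Submodule.inner_left_of_mem_orthogonal this hwmem
  have h2 : inner ℝ w ((facet K a).centroid ℝ id - a) = ‖w‖ ^ 2 := by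
    rw [← real_inner_self_eq_norm_sq]
    have := Submodule.starProjection_inner_eq_zero (K := (vectorSpan ℝ (facet K a : Set (Space d)))ᗮ)
      ((facet K a).centroid ℝ id - a) w hwmem
    rw [inner_sub_left, ← hw] at this
    rw [real_inner_comm]
    linarith
  rw [hn, e, inner_smul_left, inner_add_right, h1, h2, zero_add, hH]
  simp only [conj_trivial]
  rw [hH] at h
  field_simp

theorem inner_normal_hull {a y : Space d} (ha : a ∈ K) (hy : y ∈ hull (facet K a)) :
    inner ℝ (normal K a) (y - a) = height K a :=
  hK.inner_normal_affineSpan hd ha (convexHull_subset_affineSpan _ hy)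

theorem inner_normal_vertex {a b : Space d} (ha : a ∈ K) (hb : b ∈ K) (hab : b ≠ a) :
    inner ℝ (normal K a) (b - a) = height K a :=
  hK.inner_normal_hull hd ha (subset_hull (mem_facet.2 ⟨hab, hb⟩))

theorem inner_normal_edge {a b c : Space d} (ha : a ∈ K) (hb : b ∈ K) (hc : c ∈ K)
    (hab : b ≠ a) (hac : c ≠ a) : inner ℝ (normal K a) (c - b) = 0 := by
  have e : c - b = (c - a) - (b - a) := by abel
  rw [e, inner_sub_right, hK.inner_normal_vertex hd ha hb hab,
    hK.inner_normal_vertex hd ha hc hac, sub_self]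

theorem hull_eq_coneOver {a : Space d} (ha : a ∈ K) :
    hull K = coneOver a (hull (facet K a)) := by
  classical
  have hins : (K : Set (Space d)) = insert a (facet K a : Set (Space d)) := by
    ext b
    simp only [Finset.mem_coe, Set.mem_insert_iff, mem_facet]
    constructor
    · intro hb; by_cases h : b = a
      · exact Or.inl h
      · exact Or.inr ⟨h, hb⟩
    · rintro (rfl | h)
      · exact ha
      · exact h.2
  rw [hull, hins, convexHull_insert (by simpa using hK.facet_nonempty hd ha)]
  ext x
  simp only [convexJoin_singleton_left, Set.mem_iUnion, segment_eq_image', coneOver,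
    Set.mem_image, Set.mem_prod, Prod.exists]
  constructor
  · rintro ⟨y, hy, s, hs, rfl⟩
    exact ⟨s, y, ⟨hs, hy⟩, rfl⟩
  · rintro ⟨s, y, ⟨hs, hy⟩, rfl⟩
    exact ⟨y, hy, s, hs, rfl⟩

theorem inner_normal_mem_Icc {a x : Space d} (ha : a ∈ K) (hx : x ∈ hull K) :
    inner ℝ (normal K a) (x - a) ∈ Set.Icc 0 (height K a) := by
  rw [hK.hull_eq_coneOver hd ha] at hx
  obtain ⟨⟨s, y⟩, ⟨hs, hy⟩, rfl⟩ := hx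
  have h := hK.height_pos hd ha
  simp only [add_sub_cancel_left, inner_smul_right, hK.inner_normal_hull hd ha hy]
  exact ⟨mul_nonneg hs.1 h.le, by nlinarith [hs.2]⟩

theorem surface_facet_lt_top {a : Space d} (ha : a ∈ K) : surface d (hull (facet K a)) < ⊤ :=
  surface_lt_top (hK.norm_normal hd ha) (isCompact_hull _)
    fun _ hy => hK.inner_normal_hull hd ha hy

/-- The divergence theorem on a simplex for radial fields centred at a vertex. -/
theorem integral_radial {a : Space d} (ha : a ∈ K) {g : Space d → ℝ} (hg : ContDiff ℝ 1 g) :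
    ∫ x in hull K, (d * g x + fderiv ℝ g x (x - a))
      = height K a * ∫ x in hull (facet K a), g x ∂(surface d) := by
  rw [hK.hull_eq_coneOver hd ha]
  exact integral_radial_coneOver hd (hK.norm_normal hd ha) (hK.height_pos hd ha)
    (isCompact_hull _) (fun _ hy => hK.inner_normal_hull hd ha hy) hg

/-- The radial identity for `g = 1`, that is, volume is base times height over `d`. -/
theorem card_mul_volume {a : Space d} (ha : a ∈ K) :
    d * volume.real (hull K) = height K a * (surface d).real (hull (facet K a)) := by
  have h := hK.integral_radial hd ha (g := fun _ => 1) contDiff_const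
  simp at h
  linarith

/-- The divergence theorem on a simplex. -/
theorem integral_fderiv {g : Space d → ℝ} (hg : ContDiff ℝ 1 g) (e : Space d) :
    ∫ x in hull K, fderiv ℝ g x e
      = ∑ a ∈ K, inner ℝ (normal K a) e * ∫ x in hull (facet K a), g x ∂(surface d) := by
  have hint : ∀ e : Space d, Integrable (fun x => fderiv ℝ g x e) (volume.restrict (hull K)) :=
    fun e => ((hg.continuous_fderiv (by norm_num)).clm_apply
      continuous_const).continuousOn.integrableOn_compact (isCompact_hull K)
  let f₁ : Space d →ₗ[ℝ] ℝ :=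
    { toFun := fun e => ∫ x in hull K, fderiv ℝ g x e
      map_add' := fun e e' => by simp only [map_add]; exact integral_add (hint e) (hint e')
      map_smul' := fun c e => by
        simp only [map_smul, smul_eq_mul, RingHom.id_apply]; exact integral_const_mul _ _ }
  let f₂ : Space d →ₗ[ℝ] ℝ :=
    ∑ a ∈ K, (∫ x in hull (facet K a), g x ∂(surface d)) •
      (innerSL ℝ (normal K a) : Space d →L[ℝ] ℝ).toLinearMap
  -- Both sides are linear in the direction, and the edges span. For the edge `b - a` the field `g(b
  -- - a)` is the difference of the radial fields centred at `a` and `b`, each with flux through one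
  -- facet only. The other facets contain this edge, so their normals are orthogonal to it.
  have key : f₁ = f₂ := by
    refine hK.linear_ext fun a ha b hb => ?_
    change ∫ x in hull K, fderiv ℝ g x (b - a) = f₂ (b - a)
    simp only [f₂, LinearMap.sum_apply, LinearMap.smul_apply, ContinuousLinearMap.coe_coe,
      innerSL_apply_apply, smul_eq_mul]
    rcases eq_or_ne b a with rfl | hab
    · simp
    classical
    have hrad : ∀ c : Space d, Integrable (fun x => d * g x + fderiv ℝ g x (x - c))
        (volume.restrict (hull K)) := fun c => by
      have : Continuous fun x => d * g x + fderiv ℝ g x (x - c) := by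
        have h1 : Continuous fun x => fderiv ℝ g x (x - c) :=
          (hg.continuous_fderiv (by norm_num)).clm_apply (by fun_prop)
        have := hg.continuous
        fun_prop
      exact this.continuousOn.integrableOn_compact (isCompact_hull K)
    have hA := hK.integral_radial hd ha hg
    have hB := hK.integral_radial hd hb hg
    have hsub : ∫ x in hull K, fderiv ℝ g x (b - a)
        = height K a * (∫ x in hull (facet K a), g x ∂(surface d))
          - height K b * ∫ x in hull (facet K b), g x ∂(surface d) := by
      rw [← hA, ← hB, ← integral_sub (hrad a) (hrad b)]
      refine integral_congr_ae (ae_of_all _ fun x => ?_)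
      simp only [map_sub]; ring
    rw [hsub, ← Finset.add_sum_erase K _ ha,
      ← Finset.add_sum_erase _ _ (Finset.mem_erase.2 ⟨hab, hb⟩), Finset.sum_eq_zero]
    · rw [hK.inner_normal_vertex hd ha hb hab, ← neg_sub a b, inner_neg_right,
        hK.inner_normal_vertex hd hb ha hab.symm]
      ring
    · intro c hc
      simp only [Finset.mem_erase] at hc
      rw [hK.inner_normal_edge hd hc.2.2 ha hb (Ne.symm hc.2.1) (Ne.symm hc.1), mul_zero]
  have h := congrArg (fun f => f e) key
  simp only [f₁, f₂, LinearMap.coe_mk, AddHom.coe_mk, LinearMap.sum_apply, LinearMap.smul_apply,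
    ContinuousLinearMap.coe_coe, innerSL_apply_apply, smul_eq_mul] at h
  rw [h]
  exact Finset.sum_congr rfl fun a _ => mul_comm _ _

/-- Every vector is recovered from its normal components. -/
theorem sum_normal_component (x c : Space d) :
    ∑ a ∈ K, (inner ℝ (normal K a) c / height K a) • (x - a) = c := by
  let f₂ : Space d →ₗ[ℝ] Space d :=
    ∑ a ∈ K, (((height K a)⁻¹ • (innerSL ℝ (normal K a) : Space d →L[ℝ] ℝ).toLinearMap)).smulRight
      (x - a)
  -- On the edge `b - a` only the terms of `a` and `b` survive, with coefficients `1` and `-1`, and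
  -- `(x - a) - (x - b) = b - a`.
  have key : f₂ = LinearMap.id := by
    refine hK.linear_ext fun a ha b hb => ?_
    simp only [f₂, LinearMap.sum_apply, LinearMap.smul_apply, ContinuousLinearMap.coe_coe,
      innerSL_apply_apply, smul_eq_mul, LinearMap.smulRight_apply, LinearMap.id_apply]
    rcases eq_or_ne b a with rfl | hab
    · simp
    classical
    rw [← Finset.add_sum_erase K _ ha,
      ← Finset.add_sum_erase _ _ (Finset.mem_erase.2 ⟨hab, hb⟩), Finset.sum_eq_zero]
    · rw [hK.inner_normal_vertex hd ha hb hab, ← neg_sub a b, inner_neg_right,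
        hK.inner_normal_vertex hd hb ha hab.symm, mul_neg,
        inv_mul_cancel₀ (hK.height_pos hd ha).ne', inv_mul_cancel₀ (hK.height_pos hd hb).ne']
      simp
    · intro e he
      simp only [Finset.mem_erase] at he
      rw [hK.inner_normal_edge hd he.2.2 ha hb (Ne.symm he.2.1) (Ne.symm he.1), mul_zero,
        zero_smul]
  have := congrArg (fun f => f c) key
  simpa [f₂, div_eq_inv_mul] using this

omit hd in
theorem interior_nonempty : (interior (hull K)).Nonempty :=
  interior_convexHull_nonempty_iff_affineSpan_eq_top.2 hK.affineSpan_eq_top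

omit hd in
theorem volume_pos : 0 < volume.real (hull K) := by
  refine ENNReal.toReal_pos ?_ (isCompact_hull K).measure_lt_top.ne
  exact (Measure.measure_pos_of_nonempty_interior _ hK.interior_nonempty).ne'

theorem surface_facet_pos {a : Space d} (ha : a ∈ K) :
    0 < (surface d).real (hull (facet K a)) := by
  have h := hK.card_mul_volume hd ha
  have h1 := hK.volume_pos
  have h2 := hK.height_pos hd ha
  have h3 : (0 : ℝ) < d := by exact_mod_cast hd
  by_contra hneg
  have : (surface d).real (hull (facet K a)) = 0 :=
    le_antisymm (not_lt.1 hneg) measureReal_nonneg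
  rw [this, mul_zero] at h
  exact absurd h (by positivity)

/-- Heights are bounded below by the diameter of an inscribed ball. -/
theorem two_mul_le_height {a c : Space d} (ha : a ∈ K) {r : ℝ} (hr : 0 ≤ r)
    (hball : Metric.closedBall c r ⊆ hull K) : 2 * r ≤ height K a := by
  have hn := hK.norm_normal hd ha
  have h1 := hK.inner_normal_mem_Icc hd ha (x := c + r • normal K a) (hball (by
    simp [norm_smul, hn, abs_of_nonneg hr]))
  have h2 := hK.inner_normal_mem_Icc hd ha (x := c - r • normal K a) (hball (by
    simp [norm_smul, hn, abs_of_nonneg hr]))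
  have e1 : inner ℝ (normal K a) (c + r • normal K a - a)
      = inner ℝ (normal K a) (c - a) + r := by
    rw [add_sub_right_comm, inner_add_right, inner_smul_right, real_inner_self_eq_norm_sq, hn]
    ring
  have e2 : inner ℝ (normal K a) (c - r • normal K a - a)
      = inner ℝ (normal K a) (c - a) - r := by
    rw [sub_right_comm, inner_sub_right, inner_smul_right, real_inner_self_eq_norm_sq, hn]
    ring
  rw [e1] at h1
  rw [e2] at h2
  linarith [h1.2, h2.1]

theorem height_le_diam {a : Space d} (ha : a ∈ K) : height K a ≤ Metric.diam (hull K) := by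
  obtain ⟨b, hb⟩ := hK.facet_nonempty hd ha
  have hb' := mem_facet.1 hb
  rw [← hK.inner_normal_vertex hd ha hb'.2 hb'.1]
  refine (real_inner_le_norm _ _).trans ?_
  rw [hK.norm_normal hd ha, one_mul, ← dist_eq_norm]
  exact Metric.dist_le_diam_of_mem (isCompact_hull K).isBounded (subset_hull hb'.2)
    (subset_hull ha)

end IsElement

/-! ### Polynomial functions -/

/-- The function of a polynomial. -/
def polyFun (p : MvPolynomial (Fin d) ℝ) (x : Space d) : ℝ := MvPolynomial.eval (fun i => x i) p

theorem isPoly_polyFun {p : MvPolynomial (Fin d) ℝ} {m : ℕ} (h : p.totalDegree ≤ m) :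
    IsPoly m (polyFun p) := ⟨p, h, fun _ => rfl⟩

theorem IsPoly.exists_polyFun {m : ℕ} {f : Space d → ℝ} (h : IsPoly m f) :
    ∃ p : MvPolynomial (Fin d) ℝ, p.totalDegree ≤ m ∧ f = polyFun p := by
  obtain ⟨p, hp, hf⟩ := h
  exact ⟨p, hp, funext hf⟩

/-- The polynomial functions of degree at most `m`. -/
def polySub (d m : ℕ) : Submodule ℝ (Space d → ℝ) :=
  (MvPolynomial.restrictTotalDegree (Fin d) ℝ m).map
    ({ toFun := polyFun
       map_add' := fun p q => by ext x; simp [polyFun]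
       map_smul' := fun c p => by ext x; simp [polyFun, MvPolynomial.smul_eval] } :
      MvPolynomial (Fin d) ℝ →ₗ[ℝ] (Space d → ℝ))

theorem mem_polySub {m : ℕ} {f : Space d → ℝ} : f ∈ polySub d m ↔ IsPoly m f := by
  constructor
  · rintro ⟨p, hp, rfl⟩
    exact isPoly_polyFun ((MvPolynomial.mem_restrictTotalDegree _ _ _).1 hp)
  · intro h
    obtain ⟨p, hp, rfl⟩ := h.exists_polyFun
    exact ⟨p, (MvPolynomial.mem_restrictTotalDegree _ _ _).2 hp, rfl⟩

instance (m : ℕ) : FiniteDimensional ℝ (polySub d m) := by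
  unfold polySub
  infer_instance

namespace IsPoly

variable {m n : ℕ} {f g : Space d → ℝ}

theorem add (hf : IsPoly m f) (hg : IsPoly m g) : IsPoly m (fun x => f x + g x) :=
  mem_polySub.1 ((polySub d m).add_mem (mem_polySub.2 hf) (mem_polySub.2 hg))

theorem const_mul (hf : IsPoly m f) (c : ℝ) : IsPoly m (fun x => c * f x) :=
  mem_polySub.1 ((polySub d m).smul_mem c (mem_polySub.2 hf))

theorem sub (hf : IsPoly m f) (hg : IsPoly m g) : IsPoly m (fun x => f x - g x) :=
  mem_polySub.1 ((polySub d m).sub_mem (mem_polySub.2 hf) (mem_polySub.2 hg))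

theorem sum {ι : Type*} (s : Finset ι) {F : ι → Space d → ℝ} (h : ∀ i ∈ s, IsPoly m (F i)) :
    IsPoly m (fun x => ∑ i ∈ s, F i x) := by
  have := (polySub d m).sum_mem (t := s) (f := F) fun i hi => mem_polySub.2 (h i hi)
  have h2 := mem_polySub.1 this
  convert h2 using 1
  ext x; simp

theorem mono (hf : IsPoly m f) (h : m ≤ n) : IsPoly n f := by
  obtain ⟨p, hp, hf⟩ := hf
  exact ⟨p, hp.trans h, hf⟩

theorem const (m : ℕ) (c : ℝ) : IsPoly m (fun _ : Space d => c) :=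
  ⟨MvPolynomial.C c, by simp, by simp⟩

theorem mul (hf : IsPoly m f) (hg : IsPoly n g) : IsPoly (m + n) (fun x => f x * g x) := by
  obtain ⟨p, hp, hf⟩ := hf
  obtain ⟨q, hq, hg⟩ := hg
  exact ⟨p * q, (MvPolynomial.totalDegree_mul _ _).trans (add_le_add hp hq),
    fun x => by simp [hf, hg]⟩

theorem coord (i : Fin d) : IsPoly 1 (fun x : Space d => x i) :=
  ⟨MvPolynomial.X i, by simp, by simp⟩

theorem inner_sub (v a : Space d) : IsPoly 1 (fun x : Space d => inner ℝ v (x - a)) := by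
  have : (fun x : Space d => inner ℝ v (x - a)) = fun x => ∑ i, (v i * x i - v i * a i) := by
    ext x
    simp [PiLp.inner_apply, mul_sub, mul_comm]
  rw [this]
  exact sum _ fun i _ => ((coord i).const_mul _).sub (const _ _)

theorem contDiff (hf : IsPoly m f) : ContDiff ℝ ∞ f := by
  obtain ⟨p, -, rfl⟩ := hf.exists_polyFun
  clear hf
  induction p using MvPolynomial.induction_on with
  | C c =>
    have : polyFun (MvPolynomial.C c : MvPolynomial (Fin d) ℝ) = fun _ => c := by
      ext x; simp [polyFun]
    rw [this]; exact contDiff_const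
  | add p q hp hq =>
    have : polyFun (p + q) = fun x => polyFun p x + polyFun q x := by ext x; simp [polyFun]
    rw [this]; exact hp.add hq
  | mul_X p i hp =>
    have : polyFun (p * MvPolynomial.X i) = fun x => polyFun p x * x i := by
      ext x; simp [polyFun]
    rw [this]; exact hp.mul (by fun_prop)

theorem continuous (hf : IsPoly m f) : Continuous f := hf.contDiff.continuous

theorem differentiable (hf : IsPoly m f) : Differentiable ℝ f :=
  hf.contDiff.differentiable (by simp)

end IsPoly

theorem partialDeriv_polyFun (i : Fin d) (p : MvPolynomial (Fin d) ℝ) :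
    partialDeriv i (polyFun p) = polyFun (MvPolynomial.pderiv i p) := by
  have hdiff : ∀ q : MvPolynomial (Fin d) ℝ, Differentiable ℝ (polyFun q) := fun q =>
    (isPoly_polyFun le_rfl).differentiable
  induction p using MvPolynomial.induction_on with
  | C c =>
    have : polyFun (MvPolynomial.C c : MvPolynomial (Fin d) ℝ) = fun _ => c := by
      ext x; simp [polyFun]
    ext x
    rw [this]
    simp [partialDeriv, polyFun]
  | add p q hp hq =>
    have e : ∀ p q : MvPolynomial (Fin d) ℝ,
        polyFun (p + q) = fun x => polyFun p x + polyFun q x := by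
      intro p q; ext x; simp [polyFun]
    rw [map_add, e, e]
    ext x
    rw [← hp, ← hq]
    simp only [partialDeriv]
    rw [fderiv_fun_add (hdiff p x) (hdiff q x)]
    rfl
  | mul_X p j hp =>
    have e : polyFun (p * MvPolynomial.X j) = fun x => polyFun p x * x j := by
      ext x; simp [polyFun]
    ext x
    have h2 : HasFDerivAt (fun x : Space d => x j) (EuclideanSpace.proj j : Space d →L[ℝ] ℝ) x :=
      (EuclideanSpace.proj j : Space d →L[ℝ] ℝ).hasFDerivAt
    have h3 : HasFDerivAt (fun x : Space d => polyFun p x * x j)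
        (polyFun p x • (EuclideanSpace.proj j : Space d →L[ℝ] ℝ)
          + x j • fderiv ℝ (polyFun p) x) x := (hdiff p x).hasFDerivAt.mul h2
    have hp' := congrFun hp x
    simp only [partialDeriv] at hp'
    simp only [partialDeriv]
    rw [e, h3.fderiv]
    simp only [add_apply, smul_apply, smul_eq_mul, hp',
      PiLp.proj_apply]
    rw [Derivation.leibniz]
    rcases eq_or_ne i j with rfl | hij
    · simp [polyFun]
    · simp [polyFun, MvPolynomial.pderiv_X_of_ne (R := ℝ) hij.symm, hij.symm]

/-- Degrees of derivatives and Euler's identity are read off from homogeneous components. -/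
theorem IsPoly.exists_homogeneous {m : ℕ} {f : Space d → ℝ} (h : IsPoly m f) :
    ∃ q : ℕ → MvPolynomial (Fin d) ℝ, (∀ j, (q j).IsHomogeneous j) ∧
      f = polyFun (∑ j ∈ Finset.range (m + 1), q j) := by
  obtain ⟨p, hp, rfl⟩ := h.exists_polyFun
  refine ⟨fun j => MvPolynomial.homogeneousComponent j p,
    fun j => MvPolynomial.homogeneousComponent_isHomogeneous j p, ?_⟩
  congr 1
  conv_lhs => rw [← MvPolynomial.sum_homogeneousComponent p]
  refine Finset.sum_subset (Finset.range_mono (by omega)) fun j _ hj => ?_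
  exact MvPolynomial.homogeneousComponent_eq_zero _ _ (by simpa [Nat.lt_succ_iff] using hj)

/-- For `m = 0` the truncated `m - 1` is `0`, which is harmless because the derivative is then zero.
-/
theorem IsPoly.partialDeriv {m : ℕ} {f : Space d → ℝ} (h : IsPoly m f) (i : Fin d) :
    IsPoly (m - 1) (partialDeriv i f) := by
  obtain ⟨q, hq, rfl⟩ := h.exists_homogeneous
  rw [partialDeriv_polyFun, map_sum]
  refine isPoly_polyFun (MvPolynomial.totalDegree_finsetSum_le fun j hj => ?_)
  have := (hq j).pderiv (i := i)
  exact this.totalDegree_le.trans (by have := Finset.mem_range.1 hj; omega)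

theorem fderiv_apply_eq_sum (f : Space d → ℝ) (x e : Space d) :
    fderiv ℝ f x e = ∑ i, e i * partialDeriv i f x := by
  conv_lhs => rw [← (EuclideanSpace.basisFun (Fin d) ℝ).sum_repr e]
  simp [partialDeriv]

theorem gradient_apply (f : Space d → ℝ) (x : Space d) (i : Fin d) :
    gradient f x i = partialDeriv i f x := by
  have h : inner ℝ (gradient f x) (EuclideanSpace.single i (1 : ℝ)) = partialDeriv i f x := by
    rw [gradient, InnerProductSpace.toDual_symm_apply, partialDeriv]
  rw [← h, EuclideanSpace.inner_single_right]
  simp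

/-- Euler's identity, modulo polynomials of lower degree. -/
theorem IsPoly.euler {m : ℕ} (hm : 1 ≤ m) {f : Space d → ℝ} (h : IsPoly m f) (a : Space d) :
    IsPoly (m - 1) (fun x => fderiv ℝ f x (x - a) - m * f x) := by
  have e : (fun x => fderiv ℝ f x (x - a) - m * f x)
      = fun x => (∑ i, x i * HDG.partialDeriv i f x - m * f x)
        - ∑ i, a i * HDG.partialDeriv i f x := by
    ext x
    rw [fderiv_apply_eq_sum]
    simp only [PiLp.sub_apply, sub_mul, Finset.sum_sub_distrib]
    ring
  rw [e]
  refine IsPoly.sub ?_ (IsPoly.sum _ fun i _ => (h.partialDeriv i).const_mul _)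
  obtain ⟨q, hq, rfl⟩ := h.exists_homogeneous
  -- The component of degree `j` is multiplied by `j - m`, so the top one disappears. The shift of
  -- the centre to `a` has been split off; it costs first derivatives only.
  have e2 : (fun x : Space d => ∑ i, x i * HDG.partialDeriv i
        (polyFun (∑ j ∈ Finset.range (m + 1), q j)) x
        - m * polyFun (∑ j ∈ Finset.range (m + 1), q j) x)
      = fun x => ∑ j ∈ Finset.range (m + 1), ((j : ℝ) - m) * polyFun (q j) x := by
    ext x
    have h1 : ∑ i, MvPolynomial.X i * MvPolynomial.pderiv i (∑ j ∈ Finset.range (m + 1), q j)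
        = ∑ j ∈ Finset.range (m + 1), j • q j := by
      simp_rw [map_sum, Finset.mul_sum]
      rw [Finset.sum_comm]
      exact Finset.sum_congr rfl fun j _ => (hq j).sum_X_mul_pderiv
    have h2 := congrArg (fun p => polyFun p x) h1
    simp only [polyFun, map_sum, map_mul, MvPolynomial.eval_X, nsmul_eq_mul, map_natCast] at h2
    simp only [partialDeriv_polyFun]
    simp only [polyFun, map_sum, sub_mul, Finset.sum_sub_distrib, Finset.mul_sum] at h2 ⊢
    rw [h2]
  rw [e2]
  refine IsPoly.sum _ fun j hj => ?_
  rcases eq_or_ne j m with rfl | hne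
  · simp only [sub_self, zero_mul]; exact IsPoly.const _ _
  · refine ((isPoly_polyFun (hq j).totalDegree_le).mono ?_).const_mul _
    have := Finset.mem_range.1 hj; omega

/-! ### Riesz representation on finite-dimensional spaces -/

/-- The form `b` may be degenerate. The functional `l` annihilates the kernel of `b`, hence lies in
the range of the dual map of `b`. Uniqueness of `p` is neither available nor needed. -/
theorem exists_riesz {S : Type*} [AddCommGroup S] [Module ℝ S] [FiniteDimensional ℝ S]
    (b : S →ₗ[ℝ] S →ₗ[ℝ] ℝ) (hb : ∀ s t, b s t = b t s) (l : S →ₗ[ℝ] ℝ)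
    (h : ∀ s, b s s = 0 → l s = 0) : ∃ p, ∀ s, b p s = l s := by
  have hl : l ∈ (LinearMap.ker b).dualAnnihilator := by
    rw [Submodule.mem_dualAnnihilator]
    intro s hs
    exact h s (by rw [LinearMap.mem_ker.1 hs]; rfl)
  rw [← LinearMap.range_dualMap_eq_dualAnnihilator_ker] at hl
  obtain ⟨φ, hφ⟩ := hl
  obtain ⟨p, rfl⟩ := (Module.evalEquiv ℝ S).surjective φ
  refine ⟨p, fun s => ?_⟩
  rw [← hφ, hb]
  rfl

/-- Weighted `L²` projection, with several measures, onto a finite-dimensional space. -/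
theorem exists_projection {ι : Type*} (s : Finset ι) (ν : ι → Measure (Space d)) (c : ι → ℝ)
    (hc : ∀ i ∈ s, 0 ≤ c i) (S : Submodule ℝ (Space d → ℝ)) [FiniteDimensional ℝ S]
    (hS : ∀ f ∈ S, ∀ i ∈ s, MemLp f 2 (ν i)) (g : ι → Space d → ℝ)
    (hg : ∀ i ∈ s, MemLp (g i) 2 (ν i)) :
    ∃ p ∈ S, ∀ f ∈ S, ∑ i ∈ s, c i * ∫ x, p x * f x ∂(ν i)
      = ∑ i ∈ s, c i * ∫ x, g i x * f x ∂(ν i) := by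
  have hint : ∀ f f' : S, ∀ i ∈ s, Integrable (fun x => f.1 x * f'.1 x) (ν i) :=
    fun f f' i hi => integrable_mul_of_memLp (hS f f.2 i hi) (hS f' f'.2 i hi)
  have hintg : ∀ f : S, ∀ i ∈ s, Integrable (fun x => g i x * f.1 x) (ν i) :=
    fun f i hi => integrable_mul_of_memLp (hg i hi) (hS f f.2 i hi)
  let b : S →ₗ[ℝ] S →ₗ[ℝ] ℝ := LinearMap.mk₂ ℝ
    (fun f f' => ∑ i ∈ s, c i * ∫ x, f.1 x * f'.1 x ∂(ν i))
    (fun f₁ f₂ f' => by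
      rw [← Finset.sum_add_distrib]
      refine Finset.sum_congr rfl fun i hi => ?_
      rw [← mul_add, ← integral_add (hint _ _ i hi) (hint _ _ i hi)]
      refine congrArg (c i * ·) (integral_congr_ae (ae_of_all _ fun x => ?_)); simp [add_mul])
    (fun r f f' => by
      rw [smul_eq_mul, Finset.mul_sum]
      refine Finset.sum_congr rfl fun i hi => ?_
      rw [mul_left_comm, ← integral_const_mul r]
      refine congrArg (c i * ·) (integral_congr_ae (ae_of_all _ fun x => ?_)); simp [mul_assoc])
    (fun f f₁ f₂ => by
      rw [← Finset.sum_add_distrib]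
      refine Finset.sum_congr rfl fun i hi => ?_
      rw [← mul_add, ← integral_add (hint _ _ i hi) (hint _ _ i hi)]
      refine congrArg (c i * ·) (integral_congr_ae (ae_of_all _ fun x => ?_)); simp [mul_add])
    (fun r f f' => by
      rw [smul_eq_mul, Finset.mul_sum]
      refine Finset.sum_congr rfl fun i hi => ?_
      rw [mul_left_comm, ← integral_const_mul r]
      refine congrArg (c i * ·) (integral_congr_ae (ae_of_all _ fun x => ?_)); simp [mul_left_comm])
  let l : S →ₗ[ℝ] ℝ :=
    { toFun := fun f => ∑ i ∈ s, c i * ∫ x, g i x * f.1 x ∂(ν i)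
      map_add' := fun f f' => by
        rw [← Finset.sum_add_distrib]
        refine Finset.sum_congr rfl fun i hi => ?_
        rw [← mul_add, ← integral_add (hintg _ i hi) (hintg _ i hi)]
        refine congrArg (c i * ·) (integral_congr_ae (ae_of_all _ fun x => ?_)); simp [mul_add]
      map_smul' := fun r f => by
        rw [RingHom.id_apply, smul_eq_mul, Finset.mul_sum]
        refine Finset.sum_congr rfl fun i hi => ?_
        rw [mul_left_comm, ← integral_const_mul r]
        refine congrArg (c i * ·) (integral_congr_ae (ae_of_all _ fun x => ?_)); simp [mul_left_comm] }
  -- Weights may be zero, and `f` may vanish almost everywhere for some of the measures. If the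
  -- weighted norm of `f` is zero, then each term with a nonzero weight has `f = 0` almost
  -- everywhere, so the right-hand side vanishes as well.
  obtain ⟨p, hp⟩ := exists_riesz b
    (fun f f' => Finset.sum_congr rfl fun i _ => by
      refine congrArg (c i * ·) (integral_congr_ae (ae_of_all _ fun x => ?_)); exact mul_comm _ _) l (fun f hf => by
    have hf' : ∑ i ∈ s, c i * ∫ x, f.1 x * f.1 x ∂(ν i) = 0 := hf
    have hnn : ∀ i ∈ s, 0 ≤ c i * ∫ x, f.1 x * f.1 x ∂(ν i) := fun i hi =>
      mul_nonneg (hc i hi) (integral_nonneg fun x => mul_self_nonneg _)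
    refine Finset.sum_eq_zero fun i hi => ?_
    rcases mul_eq_zero.1 ((Finset.sum_eq_zero_iff_of_nonneg hnn).1 hf' i hi) with h0 | h0
    · rw [h0, zero_mul]
    · have hz := (integral_eq_zero_iff_of_nonneg (fun x => mul_self_nonneg (f.1 x))
        (hint f f i hi)).1 h0
      rw [integral_eq_zero_of_ae, mul_zero]
      filter_upwards [hz] with x hx
      have : f.1 x = 0 := by simpa using hx
      simp [this])
  exact ⟨p, p.2, fun f hf => hp ⟨f, hf⟩⟩

/-! ### Weak gradients, componentwise -/

/-- `u` and `g i` are in `L²(D)`, and `g i` is the weak `i`-th partial derivative of `u`. -/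
structure WeakGrad (D : Set (Space d)) (u : Space d → ℝ) (g : Fin d → Space d → ℝ) : Prop where
  memu : MemLp u 2 (volume.restrict D)
  memg : ∀ i, MemLp (g i) 2 (volume.restrict D)
  ibp : ∀ φ : Space d → ℝ, IsTestFunction D φ → ∀ i : Fin d,
    ∫ x in D, u x * partialDeriv i φ x = -∫ x in D, g i x * φ x

theorem memLp_coord {ν : Measure (Space d)} {G : Space d → Space d} (hG : MemLp G 2 ν)
    (i : Fin d) : MemLp (fun x => G x i) 2 ν :=
  (EuclideanSpace.proj i : Space d →L[ℝ] ℝ).comp_memLp' hG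

theorem HasWeakGradient.weakGrad {D : Set (Space d)} {u : Space d → ℝ} {G : Space d → Space d}
    (h : HasWeakGradient D u G) : WeakGrad D u (fun i x => G x i) :=
  ⟨h.1, memLp_coord h.2.1, h.2.2⟩

/-! ### Mollification -/

/-- Convolution with a mollifier. -/
def moll (η : ContDiffBump (0 : Space d)) (f : Space d → ℝ) (x : Space d) : ℝ :=
  MeasureTheory.convolution (η.normed volume) f (ContinuousLinearMap.lsmul ℝ ℝ) volume x

section Moll

variable (η : ContDiffBump (0 : Space d)) {f g : Space d → ℝ}

theorem moll_eq (f : Space d → ℝ) (x : Space d) :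
    moll η f x = ∫ t, η.normed volume t * f (x - t) := rfl

theorem moll_eq_swap (f : Space d → ℝ) (x : Space d) :
    moll η f x = ∫ t, η.normed volume (x - t) * f t :=
  convolution_lsmul_swap

theorem contDiff_moll (hf : LocallyIntegrable f volume) : ContDiff ℝ ∞ (moll η f) :=
  η.hasCompactSupport_normed.contDiff_convolution_left (n := ⊤) _ η.contDiff_normed hf

/-- Jensen's inequality for the probability density `η`, obtained from Cauchy-Schwarz by writing `η`
as the product of two square roots. -/
theorem sq_moll_le (hf : MemLp f 2 volume) (x : Space d) :
    moll η f x ^ 2 ≤ moll η (fun y => f y ^ 2) x := by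
  have hf2 : Integrable (fun y => f y ^ 2) := hf.integrable_sq
  have hex : Integrable (fun t => η.normed volume t * f (x - t) ^ 2) :=
    η.hasCompactSupport_normed.convolutionExists_left (ContinuousLinearMap.lsmul ℝ ℝ)
      η.continuous_normed hf2.locallyIntegrable x
  have hmeas : AEStronglyMeasurable (fun t => f (x - t)) volume :=
    hf.1.comp_measurePreserving (Measure.measurePreserving_sub_left volume x)
  have hs : Continuous fun t => Real.sqrt (η.normed volume t) :=
    Real.continuous_sqrt.comp η.continuous_normed
  have m1 : MemLp (fun t => Real.sqrt (η.normed volume t)) 2 volume := by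
    refine (memLp_two_iff_integrable_sq hs.aestronglyMeasurable).2 ?_
    simp_rw [Real.sq_sqrt (η.nonneg_normed (μ := volume) _)]
    exact η.integrable_normed
  have m2 : MemLp (fun t => Real.sqrt (η.normed volume t) * f (x - t)) 2 volume := by
    refine (memLp_two_iff_integrable_sq (hs.aestronglyMeasurable.mul hmeas)).2 ?_
    simp_rw [Pi.mul_apply, mul_pow, Real.sq_sqrt (η.nonneg_normed (μ := volume) _)]
    exact hex
  have h := abs_integral_mul_le_sqrt m1 m2
  have e1 : ∀ t, Real.sqrt (η.normed volume t) * (Real.sqrt (η.normed volume t) * f (x - t))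
      = η.normed volume t * f (x - t) := fun t => by
    rw [← mul_assoc, Real.mul_self_sqrt (η.nonneg_normed _)]
  simp only [e1, mul_pow, Real.sq_sqrt (η.nonneg_normed (μ := volume) _), η.integral_normed,
    Real.sqrt_one, one_mul] at h
  rw [moll_eq, moll_eq, ← sq_abs]
  refine (pow_le_pow_left₀ (abs_nonneg _) h 2).trans ?_
  rw [Real.sq_sqrt]
  exact integral_nonneg fun t => mul_nonneg (η.nonneg_normed _) (sq_nonneg _)

theorem memLp_moll (hf : MemLp f 2 volume) : MemLp (moll η f) 2 volume := by
  have hl : LocallyIntegrable f volume := hf.locallyIntegrable (by norm_num)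
  have hc := (contDiff_moll η hl).continuous
  refine (memLp_two_iff_integrable_sq hc.aestronglyMeasurable).2 ?_
  have hI : Integrable (moll η (fun y => f y ^ 2)) :=
    η.integrable_normed.integrable_convolution _ hf.integrable_sq
  refine hI.mono' (hc.pow 2).aestronglyMeasurable (ae_of_all _ fun x => ?_)
  rw [Real.norm_eq_abs, abs_of_nonneg (sq_nonneg _)]
  exact sq_moll_le η hf x

theorem integral_sq_moll_le (hf : MemLp f 2 volume) :
    ∫ x, moll η f x ^ 2 ≤ ∫ x, f x ^ 2 := by
  have hI : Integrable (moll η (fun y => f y ^ 2)) :=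
    η.integrable_normed.integrable_convolution _ hf.integrable_sq
  refine (integral_mono (memLp_moll η hf).integrable_sq hI (sq_moll_le η hf)).trans ?_
  have := integral_convolution (ContinuousLinearMap.lsmul ℝ ℝ) (μ := volume) (ν := volume)
    η.integrable_normed hf.integrable_sq
  refine le_of_eq (this.trans ?_)
  simp [η.integral_normed]

end Moll

/-- The dilation with centre `c` and factor `l`. -/
def dil (c : Space d) (l : ℝ) (x : Space d) : Space d := c + l • (x - c)

theorem integral_comp_dil (c : Space d) {l : ℝ} (hl : 0 < l) (f : Space d → ℝ) :
    ∫ x, f (dil c l x) = (l ^ d)⁻¹ * ∫ x, f x := by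
  have h1 : ∫ x, f (dil c l x) = ∫ x, f (c + l • x) :=
    integral_sub_right_eq_self (fun x => f (c + l • x)) c
  rw [h1, Measure.integral_comp_smul volume (fun x => f (c + x)) l,
    integral_add_left_eq_self]
  simp [abs_of_pos hl]

theorem integrable_comp_dil (c : Space d) {l : ℝ} (hl : 0 < l) {f : Space d → ℝ}
    (hf : Integrable f) : Integrable (fun x => f (dil c l x)) := by
  have h1 : Integrable (fun x => f (c + l • x)) :=
    (hf.comp_add_left c).comp_smul hl.ne'
  exact h1.comp_sub_right c

/-- The factors `1 - 1/(n+2)`. -/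
def fac (n : ℕ) : ℝ := 1 - 1 / ((n : ℝ) + 2)

theorem fac_bounds (n : ℕ) : 1 / 2 ≤ fac n ∧ fac n < 1 := by
  have h : (0 : ℝ) ≤ n := Nat.cast_nonneg n
  have h2 : 1 / ((n : ℝ) + 2) ≤ 1 / 2 := by gcongr; linarith
  have h3 : 0 < 1 / ((n : ℝ) + 2) := by positivity
  unfold fac
  constructor <;> linarith

theorem tendsto_fac : Tendsto (fun n => 1 - fac n) atTop (𝓝 0) := by
  have h := (tendsto_const_div_atTop_nhds_zero_nat (1 : ℝ)).comp (tendsto_add_atTop_nat 2)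
  refine h.congr fun n => ?_
  simp [fac]

/-- Mollifiers of radius `(1 - fac n) r / 2`. -/
def bump (r : ℝ) (hr : 0 < r) (n : ℕ) : ContDiffBump (0 : Space d) where
  rIn := (1 - fac n) * r / 4
  rOut := (1 - fac n) * r / 2
  rIn_pos := by have := (fac_bounds n).2; have : 0 < 1 - fac n := by linarith
                positivity
  rIn_lt_rOut := by
    have := (fac_bounds n).2; have : 0 < 1 - fac n := by linarith
    have : 0 < (1 - fac n) * r := by positivity
    linarith

/-- Mollification composed with a contraction. -/
def smear (c : Space d) (r : ℝ) (hr : 0 < r) (n : ℕ) (f : Space d → ℝ) (x : Space d) : ℝ :=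
  moll (bump r hr n) f (dil c (fac n) x)

section Smear

variable (c : Space d) (r : ℝ) (hr : 0 < r) {f : Space d → ℝ}

theorem contDiff_smear (n : ℕ) (hf : LocallyIntegrable f volume) :
    ContDiff ℝ ∞ (smear c r hr n f) :=
  (contDiff_moll _ hf).comp (by unfold dil; fun_prop)

theorem memLp_smear (n : ℕ) (hf : MemLp f 2 volume) : MemLp (smear c r hr n f) 2 volume := by
  have hl : LocallyIntegrable f volume := hf.locallyIntegrable (by norm_num)
  refine (memLp_two_iff_integrable_sq
    (contDiff_smear c r hr n hl).continuous.aestronglyMeasurable).2 ?_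
  exact integrable_comp_dil c (by linarith [(fac_bounds n).1])
    (memLp_moll (bump r hr n) hf).integrable_sq

/-- Mollification does not increase the norm, and the dilation costs a Jacobian of at most `2 ^ d`
because `fac n ≥ 1/2`. -/
theorem integral_sq_smear_le (n : ℕ) (hf : MemLp f 2 volume) :
    ∫ x, smear c r hr n f x ^ 2 ≤ 2 ^ d * ∫ x, f x ^ 2 := by
  have hb := fac_bounds n
  have hpos : 0 < fac n := by linarith
  have h := integral_comp_dil c hpos (fun x => moll (bump r hr n) f x ^ 2)
  change ∫ x, smear c r hr n f x ^ 2 = _ at h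
  rw [h]
  refine mul_le_mul ?_ (integral_sq_moll_le _ hf) (integral_nonneg fun x => sq_nonneg _)
    (by positivity)
  rw [← inv_pow]
  refine pow_le_pow_left₀ (by positivity) ?_ d
  rw [inv_le_comm₀ hpos (by norm_num)]
  linarith

/-- Contraction and mollification together move the argument by at most `(1 - fac n)(|R| + r)`, so
uniform continuity of `f` suffices. -/
theorem tendsto_smear_of_continuous {S : Set (Space d)} (hS : Bornology.IsBounded S)
    (hSm : MeasurableSet S) (hf : Continuous f) (hc : HasCompactSupport f) :
    Tendsto (fun n => ∫ x in S, (smear c r hr n f x - f x) ^ 2) atTop (𝓝 0) := by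
  obtain ⟨R, hR⟩ := hS.subset_closedBall c
  have huc := hc.uniformContinuous_of_continuous hf
  have hSfin : volume S < ⊤ := hS.measure_lt_top
  rw [Metric.tendsto_atTop]
  intro ε hε
  set V := volume.real S
  have hV : 0 ≤ V := measureReal_nonneg
  obtain ⟨ε', hε', hεV⟩ : ∃ ε' > 0, ε' ^ 2 * V < ε := by
    refine ⟨Real.sqrt (ε / (V + 1)), by positivity, ?_⟩
    rw [Real.sq_sqrt (by positivity), div_mul_eq_mul_div, div_lt_iff₀ (by positivity)]
    nlinarith
  obtain ⟨δ, hδ, hδf⟩ := Metric.uniformContinuous_iff.1 huc (ε' / 2) (by positivity)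
  have ht : Tendsto (fun n => (1 - fac n) * (|R| + r)) atTop (𝓝 0) := by
    simpa using tendsto_fac.mul_const (|R| + r)
  obtain ⟨N, hN⟩ := (ht.eventually (gt_mem_nhds hδ)).exists_forall_of_atTop
  refine ⟨N, fun n hn => ?_⟩
  have hb := fac_bounds n
  have hb1 : 0 < 1 - fac n := by linarith
  have hNn := hN n hn
  have hpt : ∀ x ∈ S, |smear c r hr n f x - f x| ≤ ε' := by
    intro x hx
    have hxR : ‖x - c‖ ≤ |R| := by
      have := hR hx
      rw [Metric.mem_closedBall, dist_eq_norm] at this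
      exact this.trans (le_abs_self R)
    have hdx : dist (dil c (fac n) x) x ≤ (1 - fac n) * |R| := by
      have : dil c (fac n) x - x = -((1 - fac n) • (x - c)) := by
        simp only [dil, sub_smul, one_smul]; abel
      rw [dist_eq_norm, this, norm_neg, norm_smul, Real.norm_eq_abs, abs_of_pos hb1]
      gcongr
    have h1 : dist (moll (bump r hr n) f (dil c (fac n) x)) (f (dil c (fac n) x)) ≤ ε' / 2 := by
      refine ContDiffBump.dist_normed_convolution_le hf.aestronglyMeasurable fun y hy => ?_
      refine (hδf ?_).le
      have hy' : dist y (dil c (fac n) x) < (1 - fac n) * r / 2 := hy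
      have : 0 < (1 - fac n) * r := by positivity
      have : 0 ≤ (1 - fac n) * |R| := by positivity
      nlinarith
    have h2 : dist (f (dil c (fac n) x)) (f x) ≤ ε' / 2 := by
      refine (hδf (hdx.trans_lt ?_)).le
      have : 0 < (1 - fac n) * r := by positivity
      nlinarith
    have := (dist_triangle _ _ _).trans (add_le_add h1 h2)
    rw [Real.dist_eq] at this
    exact this.trans (by linarith)
  have hle : ∫ x in S, (smear c r hr n f x - f x) ^ 2 ≤ ε' ^ 2 * V := by
    have hfin : IsFiniteMeasure (volume.restrict S) := ⟨by simpa using hSfin⟩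
    calc ∫ x in S, (smear c r hr n f x - f x) ^ 2 ≤ ∫ x in S, ε' ^ 2 := by
          refine integral_mono_of_nonneg (ae_of_all _ fun x => sq_nonneg _)
            (integrable_const _) ?_
          refine ae_restrict_of_forall_mem hSm fun x hx => ?_
          exact sq_le_sq' (by linarith [neg_abs_le (smear c r hr n f x - f x), hpt x hx])
            ((le_abs_self _).trans (hpt x hx))
      _ = ε' ^ 2 * V := by simp [V, mul_comm, measureReal_def]
  rw [Real.dist_eq, sub_zero, abs_of_nonneg (integral_nonneg fun x => sq_nonneg _)]
  exact hle.trans_lt hεV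

/-- The operators are bounded on `L²` uniformly in `n`, so convergence on the dense set of
continuous functions with compact support is enough. -/
theorem tendsto_smear {S : Set (Space d)} (hS : Bornology.IsBounded S)
    (hSm : MeasurableSet S) (hf : MemLp f 2 volume) :
    Tendsto (fun n => ∫ x in S, (smear c r hr n f x - f x) ^ 2) atTop (𝓝 0) := by
  rw [Metric.tendsto_atTop]
  intro ε hε
  -- The left-hand side is what two uses of `(a + b)² ≤ 2a² + 2b²` produce below for the three parts
  -- of the error.
  obtain ⟨ε', hε', hlt⟩ : ∃ ε' : ℝ, 0 < ε' ∧ 4 * (2 ^ d * ε' + ε') + 2 * ε' < ε := by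
    refine ⟨ε / (8 * (2 ^ d + 2)), by positivity, ?_⟩
    have hp : (0 : ℝ) < 2 ^ d := by positivity
    rw [show 4 * (2 ^ d * (ε / (8 * (2 ^ d + 2))) + ε / (8 * (2 ^ d + 2)))
      + 2 * (ε / (8 * (2 ^ d + 2))) = ε * ((4 * 2 ^ d + 6) / (8 * (2 ^ d + 2))) by
        field_simp; ring]
    have : (4 * 2 ^ d + 6 : ℝ) / (8 * (2 ^ d + 2)) < 1 := by
      rw [div_lt_one (by positivity)]; linarith
    nlinarith
  obtain ⟨g, hgc, hgf, hgcont, hgm⟩ := hf.exists_hasCompactSupport_eLpNorm_sub_le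
    (by norm_num) (ε := ENNReal.ofReal (Real.sqrt ε'))
    (by simpa using Real.sqrt_pos.2 hε')
  have hfg : MemLp (fun x => f x - g x) 2 volume := hf.sub hgm
  have hfg2 : ∫ x, (f x - g x) ^ 2 ≤ ε' := by
    have h1 := sq_eLpNorm_eq_integral hfg
    have h2 : eLpNorm (fun x => f x - g x) 2 volume ≤ ENNReal.ofReal (Real.sqrt ε') := hgf
    rw [h1, ENNReal.ofReal_le_ofReal_iff (Real.sqrt_nonneg _)] at h2
    exact (Real.sqrt_le_sqrt_iff hε'.le).1 h2
  obtain ⟨N, hN⟩ := Metric.tendsto_atTop.1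
    (tendsto_smear_of_continuous c r hr hS hSm hgcont hgc) ε' hε'
  refine ⟨N, fun n hn => ?_⟩
  have hNn := hN n hn
  rw [Real.dist_eq, sub_zero, abs_of_nonneg (integral_nonneg fun x => sq_nonneg _)] at hNn ⊢
  have hsub : ∀ x, smear c r hr n f x
      = smear c r hr n (fun y => f y - g y) x + smear c r hr n g x := by
    intro x
    have hl : ∀ {k : Space d → ℝ}, MemLp k 2 volume →
        Integrable (fun t => (bump r hr n).normed volume t * k (dil c (fac n) x - t)) :=
      fun {k} hk => (bump r hr n).hasCompactSupport_normed.convolutionExists_left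
        (ContinuousLinearMap.lsmul ℝ ℝ) (bump r hr n).continuous_normed
        (hk.locallyIntegrable (by norm_num)) _
    simp only [smear, moll_eq]
    rw [← integral_add (hl hfg) (hl hgm)]
    congr 1; ext t; ring
  have mS : ∀ {k : Space d → ℝ}, MemLp k 2 volume → MemLp k 2 (volume.restrict S) :=
    fun hk => hk.mono_measure Measure.restrict_le_self
  have e : ∀ x, smear c r hr n f x - f x
      = (smear c r hr n (fun y => f y - g y) x + (g x - f x)) + (smear c r hr n g x - g x) := by
    intro x; rw [hsub]; ring
  have m1 := mS (memLp_smear c r hr n hfg)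
  have m2 : MemLp (fun x => g x - f x) 2 (volume.restrict S) := mS (hgm.sub hf)
  have m3 : MemLp (fun x => smear c r hr n g x - g x) 2 (volume.restrict S) :=
    mS ((memLp_smear c r hr n hgm).sub hgm)
  have h1 := integral_sq_add_le (m1.add m2) m3
  have h2 := integral_sq_add_le m1 m2
  simp only [Pi.add_apply] at h1
  simp_rw [e]
  have h3 : ∫ x in S, smear c r hr n (fun y => f y - g y) x ^ 2 ≤ 2 ^ d * ε' :=
    (setIntegral_le_integral (memLp_smear c r hr n hfg).integrable_sq
      (ae_of_all _ fun x => sq_nonneg _)).trans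
      ((integral_sq_smear_le c r hr n hfg).trans (by gcongr))
  have h4 : ∫ x in S, (g x - f x) ^ 2 ≤ ε' := by
    simp_rw [fun x => show (g x - f x) ^ 2 = (f x - g x) ^ 2 by ring]
    exact (setIntegral_le_integral hfg.integrable_sq
      (ae_of_all _ fun x => sq_nonneg _)).trans hfg2
  linarith

end Smear

/-- Smooth functions are dense in `H¹` of a bounded convex open set. -/
theorem WeakGrad.exists_smooth {D : Set (Space d)} (hD : IsOpen D) (hconv : Convex ℝ D)
    (hb : Bornology.IsBounded D) (hne : D.Nonempty) {u : Space d → ℝ}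
    {g : Fin d → Space d → ℝ} (h : WeakGrad D u g) :
    ∃ φ : ℕ → Space d → ℝ, (∀ n, ContDiff ℝ ∞ (φ n)) ∧
      L2Tendsto (volume.restrict D) φ u ∧
      ∀ i, L2Tendsto (volume.restrict D) (fun n => partialDeriv i (φ n)) (g i) := by
  obtain ⟨c, hc⟩ := hne
  obtain ⟨r, hr, hball⟩ := Metric.isOpen_iff.1 hD c hc
  have mext : ∀ {k : Space d → ℝ}, MemLp k 2 (volume.restrict D) →
      MemLp (D.indicator k) 2 volume := fun hk => (memLp_indicator_iff_restrict
        hD.measurableSet).2 hk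
  have hu := mext h.memu
  have hul : LocallyIntegrable (D.indicator u) volume := hu.locallyIntegrable (by norm_num)
  have tend : ∀ {k : Space d → ℝ}, MemLp k 2 (volume.restrict D) →
      L2Tendsto (volume.restrict D) (fun n => smear c r hr n (D.indicator k)) k := by
    intro k hk
    refine ⟨fun n => (memLp_smear c r hr n (mext hk)).mono_measure Measure.restrict_le_self,
      hk, (tendsto_smear c r hr hb hD.measurableSet (mext hk)).congr fun n => ?_⟩
    refine setIntegral_congr_fun hD.measurableSet fun x hx => ?_
    simp only [Set.indicator_of_mem hx]
  refine ⟨fun n => smear c r hr n (D.indicator u), fun n => contDiff_smear c r hr n hul,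
    tend h.memu, fun i => ?_⟩
  -- The derivative falls on the mollifier. Its reflected translate is a test function in `D`, so
  -- the weak derivative can be moved onto `u`; the chain rule for the contraction gives the factor
  -- `fac n`.
  have hgrad : ∀ n, ∀ x ∈ D, partialDeriv i (smear c r hr n (D.indicator u)) x
      = fac n * smear c r hr n (D.indicator (g i)) x := by
    intro n x hx
    have hfb := fac_bounds n
    have hf1 : 0 < 1 - fac n := by linarith
    set y := dil c (fac n) x with hy
    set η : Space d → ℝ := (bump r hr n).normed volume with hη
    have hηs : ContDiff ℝ ∞ η := (bump r hr n).contDiff_normed (n := ⊤)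
    have hηc : HasCompactSupport η := (bump r hr n).hasCompactSupport_normed
    -- A point of this ball is `fac n • x + (1 - fac n) • w` with `w` within `r / 2` of `c`, and `D`
    -- is convex. This is why contraction towards an interior point precedes mollification.
    have hsub : Metric.closedBall y ((1 - fac n) * r / 2) ⊆ D := by
      intro z hz
      have hz' : ‖z - y‖ ≤ (1 - fac n) * r / 2 := by simpa [dist_eq_norm] using hz
      have hw : c + (1 - fac n)⁻¹ • (z - y) ∈ D := by
        apply hball
        rw [Metric.mem_ball, dist_eq_norm, add_sub_cancel_left, norm_smul, norm_inv,
          Real.norm_eq_abs, abs_of_pos hf1]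
        calc (1 - fac n)⁻¹ * ‖z - y‖ ≤ (1 - fac n)⁻¹ * ((1 - fac n) * r / 2) := by gcongr
          _ = r / 2 := by field_simp
          _ < r := by linarith
      have := hconv hx hw (by linarith : 0 ≤ fac n) hf1.le (by ring)
      convert this using 1
      rw [smul_add, smul_smul, mul_inv_cancel₀ hf1.ne', one_smul, hy, dil, smul_sub, sub_smul,
        one_smul]
      abel
    have htest : IsTestFunction D (fun z => η (y - z)) := by
      refine ⟨hηs.comp (by fun_prop), ?_, ?_⟩
      · exact hηc.comp_homeomorph (Homeomorph.subLeft y)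
      · have hcl : tsupport (fun z => η (y - z)) ⊆ Metric.closedBall y ((1 - fac n) * r / 2) := by
          refine closure_minimal (fun z hz => ?_) Metric.isClosed_closedBall
          have hz' : y - z ∈ Function.support η := hz
          rw [hη, ContDiffBump.support_normed_eq] at hz'
          rw [Metric.mem_closedBall, dist_comm, dist_eq_norm]
          rw [Metric.mem_ball, dist_zero_right] at hz'
          exact hz'.le
        exact hcl.trans hsub
    have hpd : ∀ z, partialDeriv i (fun z => η (y - z)) z
        = -(fderiv ℝ η (y - z) (EuclideanSpace.single i 1)) := by
      intro z
      have h1 : HasFDerivAt (fun z => y - z) (-(ContinuousLinearMap.id ℝ (Space d))) z := by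
        simpa using (hasFDerivAt_id z).const_sub y
      have h2 := ((hηs.differentiable (by simp)) (y - z)).hasFDerivAt.comp z h1
      have h3 : fderiv ℝ (fun z => η (y - z)) z = _ := h2.fderiv
      rw [partialDeriv, h3]
      simp
    have hder : HasFDerivAt (moll (bump r hr n) (D.indicator u))
        (MeasureTheory.convolution (fderiv ℝ η) (D.indicator u)
          ((ContinuousLinearMap.lsmul ℝ ℝ).precompL (Space d)) volume y) y :=
      hηc.hasFDerivAt_convolution_left _ (hηs.of_le (by simp)) hul y
    have hdil : HasFDerivAt (dil c (fac n))
        (fac n • ContinuousLinearMap.id ℝ (Space d)) x := by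
      have := (((hasFDerivAt_id (𝕜 := ℝ) x).sub_const c).const_smul (fac n)).const_add c
      exact this
    have hcomp := hder.comp x hdil
    have hfd : fderiv ℝ (smear c r hr n (D.indicator u)) x = _ := hcomp.fderiv
    have hconvapp : MeasureTheory.convolution (fderiv ℝ η) (D.indicator u)
          ((ContinuousLinearMap.lsmul ℝ ℝ).precompL (Space d)) volume y
          (EuclideanSpace.single i 1)
        = ∫ z in D, u z * fderiv ℝ η (y - z) (EuclideanSpace.single i 1) := by
      rw [convolution_eq_swap, ContinuousLinearMap.integral_apply]
      · rw [← integral_indicator hD.measurableSet]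
        congr 1; ext z
        by_cases hz : z ∈ D
        · simp [Set.indicator_of_mem hz, mul_comm, ContinuousLinearMap.precompL_apply]
        · simp [Set.indicator_of_notMem hz]
      · have := (hηc.fderiv ℝ).convolutionExists_left
          ((ContinuousLinearMap.lsmul ℝ ℝ : ℝ →L[ℝ] ℝ →L[ℝ] ℝ).precompL (Space d))
          (hηs.continuous_fderiv (by simp)) hul y
        have h2 := this.integrable_swap
        exact h2
    have hib := h.ibp _ htest i
    simp_rw [hpd, mul_neg, integral_neg] at hib
    rw [neg_inj] at hib
    rw [partialDeriv, hfd]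
    simp only [ContinuousLinearMap.comp_apply, smul_apply,
      ContinuousLinearMap.id_apply, map_smul, smul_eq_mul]
    rw [hconvapp, hib, smear, moll_eq_swap, ← integral_indicator hD.measurableSet]
    congr 2; ext z
    by_cases hz : z ∈ D
    · simp [Set.indicator_of_mem hz, mul_comm, hη, hy]
    · simp [Set.indicator_of_notMem hz]
  have ht := tend (h.memg i)
  have hfacl : Tendsto fac atTop (𝓝 1) := by
    have := tendsto_fac.const_sub 1
    simpa using this
  have hmem : ∀ n, MemLp (fun x => fac n * smear c r hr n (D.indicator (g i)) x) 2
      (volume.restrict D) := fun n => (ht.memF n).const_mul _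
  have hae : ∀ n, partialDeriv i (smear c r hr n (D.indicator u)) =ᵐ[volume.restrict D]
      fun x => fac n * smear c r hr n (D.indicator (g i)) x :=
    fun n => ae_restrict_of_forall_mem hD.measurableSet (hgrad n)
  refine ⟨fun n => (memLp_congr_ae (hae n)).2 (hmem n), h.memg i, ?_⟩
  -- The factor `fac n` tends to `1`, so its defect contributes `(1 - fac n)² ‖g i‖²`, which
  -- vanishes in the limit.
  have hlim := (ht.lim.const_mul 2).add
    (((tendsto_fac.pow 2).mul_const (2 * ∫ x in D, g i x ^ 2)))
  simp only [mul_zero, ne_eq, OfNat.ofNat_ne_zero, not_false_eq_true, zero_pow, zero_mul,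
    add_zero] at hlim
  refine squeeze_zero (fun n => integral_nonneg fun x => sq_nonneg _) (fun n => ?_) hlim
  have hfb := fac_bounds n
  have e : ∫ x in D, (partialDeriv i (smear c r hr n (D.indicator u)) x - g i x) ^ 2
      = ∫ x in D, (fac n * (smear c r hr n (D.indicator (g i)) x - g i x)
        + (-(1 - fac n)) * g i x) ^ 2 := by
    refine integral_congr_ae ?_
    filter_upwards [hae n] with x hx
    rw [hx]; ring
  rw [e]
  have h1 := integral_sq_add_le (((ht.memF n).sub (h.memg i)).const_mul (fac n))
    ((h.memg i).const_mul (-(1 - fac n)))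
  refine h1.trans ?_
  simp only [Pi.sub_apply, mul_pow, integral_const_mul, neg_sq]
  have h0 : 0 ≤ ∫ x in D, (smear c r hr n (D.indicator (g i)) x - g i x) ^ 2 :=
    integral_nonneg fun x => sq_nonneg _
  have h2 : fac n ^ 2 ≤ 1 := by nlinarith
  nlinarith

/-! ### The Poincaré inequality -/

theorem sq_fderiv_le (f : Space d → ℝ) (x e : Space d) :
    fderiv ℝ f x e ^ 2 ≤ ‖e‖ ^ 2 * ∑ i, partialDeriv i f x ^ 2 := by
  rw [fderiv_apply_eq_sum, EuclideanSpace.norm_sq_eq]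
  simpa using Finset.sum_mul_sq_le_sq_mul_sq Finset.univ (fun i => e i)
    (fun i => partialDeriv i f x)

theorem continuous_partialDeriv {f : Space d → ℝ} (hf : ContDiff ℝ 1 f) (i : Fin d) :
    Continuous (partialDeriv i f) :=
  (hf.continuous_fderiv (by norm_num)).clm_apply continuous_const

theorem sq_sub_le_integral_segment {f : Space d → ℝ} (hf : ContDiff ℝ 1 f) (x y : Space d) :
    (f x - f y) ^ 2 ≤ ‖x - y‖ ^ 2 *
      ∫ t in Set.Icc (0 : ℝ) 1, ∑ i, partialDeriv i f (y + t • (x - y)) ^ 2 := by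
  have hder : ∀ t : ℝ, HasDerivAt (fun t : ℝ => f (y + t • (x - y)))
      (fderiv ℝ f (y + t • (x - y)) (x - y)) t := fun t => by
    have h1 : HasDerivAt (fun t : ℝ => y + t • (x - y)) (x - y) t := by
      simpa using ((hasDerivAt_id t).smul_const (x - y)).const_add y
    exact ((hf.differentiable (by norm_num)) _).hasFDerivAt.comp_hasDerivAt t h1
  have hcont : Continuous fun t : ℝ => fderiv ℝ f (y + t • (x - y)) (x - y) :=
    ((hf.continuous_fderiv (by norm_num)).comp (by fun_prop)).clm_apply continuous_const
  have hG : Continuous fun t : ℝ => ∑ i, partialDeriv i f (y + t • (x - y)) ^ 2 :=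
    continuous_finsetSum _ fun i _ =>
      ((continuous_partialDeriv hf i).comp (by fun_prop : Continuous fun t : ℝ =>
        y + t • (x - y))).pow 2
  have hftc : ∫ t in Set.Icc (0 : ℝ) 1, fderiv ℝ f (y + t • (x - y)) (x - y) = f x - f y := by
    rw [integral_Icc_eq_integral_Ioc, ← intervalIntegral.integral_of_le zero_le_one,
      intervalIntegral.integral_eq_sub_of_hasDerivAt (fun t _ => hder t)
        (hcont.intervalIntegrable _ _)]
    simp
  have m1 : MemLp (fun t : ℝ => fderiv ℝ f (y + t • (x - y)) (x - y)) 2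
      (volume.restrict (Set.Icc (0 : ℝ) 1)) := by
    refine (memLp_two_iff_integrable_sq hcont.aestronglyMeasurable).2 ?_
    exact (hcont.pow 2).continuousOn.integrableOn_compact isCompact_Icc
  have m2 : MemLp (fun _ : ℝ => (1 : ℝ)) 2 (volume.restrict (Set.Icc (0 : ℝ) 1)) :=
    memLp_const _
  have h := abs_integral_mul_le_sqrt m1 m2
  simp only [mul_one, hftc, one_pow, integral_const, measureReal_restrict_apply_univ,
    Real.volume_real_Icc_of_le zero_le_one, sub_zero, smul_eq_mul, Real.sqrt_one] at h
  rw [← sq_abs]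
  refine (pow_le_pow_left₀ (abs_nonneg _) h 2).trans ?_
  rw [Real.sq_sqrt (integral_nonneg fun t => sq_nonneg _), ← integral_const_mul]
  refine integral_mono m1.integrable_sq
    ((hG.const_mul _).continuousOn.integrableOn_compact isCompact_Icc) fun t => ?_
  exact sq_fderiv_le f _ _

/-- For `t ≤ 1/2`, contraction towards a point of a convex set. -/
theorem integral_comp_contract_le {S : Set (Space d)} (hS : IsCompact S) (hc : Convex ℝ S)
    {G : Space d → ℝ} (hG : Continuous G) (h0 : ∀ x, 0 ≤ G x) {y : Space d} (hy : y ∈ S)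
    {s : ℝ} (hs : 1 / 2 ≤ s) (hs1 : s ≤ 1) :
    ∫ x in S, G (y + s • (x - y)) ≤ 2 ^ d * ∫ x in S, G x := by
  have hpos : 0 < s := by linarith
  have hint : Integrable (S.indicator G) :=
    (hG.continuousOn.integrableOn_compact hS).integrable_indicator hS.measurableSet
  have h1 : ∫ x in S, G (y + s • (x - y)) ≤ ∫ x, S.indicator G (dil y s x) := by
    rw [← integral_indicator hS.measurableSet]
    refine integral_mono ?_ (integrable_comp_dil y hpos hint) fun x => ?_
    · refine IntegrableOn.integrable_indicator ?_ hS.measurableSet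
      exact (hG.comp (by fun_prop : Continuous fun x : Space d =>
        y + s • (x - y))).continuousOn.integrableOn_compact hS
    · by_cases hx : x ∈ S
      · rw [Set.indicator_of_mem hx, Set.indicator_of_mem]
        · rfl
        · have := hc hy hx (by linarith : 0 ≤ 1 - s) hpos.le (by ring)
          convert this using 1
          rw [dil, smul_sub, sub_smul, one_smul]; abel
      · rw [Set.indicator_of_notMem hx]
        exact Set.indicator_nonneg (fun z _ => h0 z) _
  refine h1.trans ?_
  rw [integral_comp_dil y hpos, integral_indicator hS.measurableSet]
  refine mul_le_mul_of_nonneg_right ?_ (integral_nonneg h0)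
  rw [← inv_pow]
  refine pow_le_pow_left₀ (by positivity) ?_ d
  rw [inv_le_comm₀ hpos (by norm_num)]
  linarith

/-- The mean of `u` over `S`. -/
def mean (S : Set (Space d)) (u : Space d → ℝ) : ℝ := (volume.real S)⁻¹ * ∫ x in S, u x

/-- In this form the variance passes to `L²` limits and can be compared with the double integral of
`(f x - f y)²`. -/
theorem integral_sub_mean_sq {S : Set (Space d)} (hS : 0 < volume.real S)
    (hfin : volume S < ⊤) {u : Space d → ℝ} (hu : MemLp u 2 (volume.restrict S)) :
    ∫ x in S, (u x - mean S u) ^ 2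
      = (∫ x in S, u x ^ 2) - (volume.real S)⁻¹ * (∫ x in S, u x) ^ 2 := by
  have hf : IsFiniteMeasure (volume.restrict S) := ⟨by simpa using hfin⟩
  have hi : Integrable u (volume.restrict S) := hu.integrable (by norm_num)
  have e : ∀ x, (u x - mean S u) ^ 2 = u x ^ 2 - (2 * mean S u * u x - mean S u ^ 2) := by
    intro x; ring
  have i2 : Integrable (fun x => 2 * mean S u * u x) (volume.restrict S) := hi.const_mul _
  have i3 : Integrable (fun x => 2 * mean S u * u x - mean S u ^ 2) (volume.restrict S) :=
    i2.sub (integrable_const _)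
  simp_rw [e]
  rw [integral_sub hu.integrable_sq i3, integral_sub i2 (integrable_const _),
    integral_const_mul, integral_const, measureReal_restrict_apply_univ, smul_eq_mul]
  unfold mean
  field_simp
  ring

/-- Twice the measure of `S` times the variance is the double integral of `(f x - f y)²`. The
difference is bounded by the gradient along the segment from `y` to `x`, and the order of
integration is exchanged. Only convexity enters, so the constant does not see the shape of `S`. -/
theorem poincare_smooth {S : Set (Space d)} (hS : IsCompact S) (hc : Convex ℝ S)
    (hpos : 0 < volume.real S) {f : Space d → ℝ} (hf : ContDiff ℝ 1 f) :
    ∫ x in S, (f x - mean S f) ^ 2 ≤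
      2 ^ d * Metric.diam S ^ 2 * ∫ x in S, ∑ i, partialDeriv i f x ^ 2 := by
  set G : Space d → ℝ := fun x => ∑ i, partialDeriv i f x ^ 2 with hGdef
  have hG : Continuous G := continuous_finsetSum _ fun i _ => (continuous_partialDeriv hf i).pow 2
  have hG0 : ∀ x, 0 ≤ G x := fun x => Finset.sum_nonneg fun i _ => sq_nonneg _
  have hfin := hS.measure_lt_top (μ := volume)
  have hfm : IsFiniteMeasure (volume.restrict S) := ⟨by simpa using hfin⟩
  set V := volume.real S with hV
  set h := Metric.diam S
  set ν := (volume.restrict S).prod (volume.restrict S) with hν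
  have hνeq : ν = (volume.prod volume).restrict (S ×ˢ S) := by rw [hν, Measure.prod_restrict]
  have hSS := hS.prod hS
  have intc : ∀ {k : Space d × Space d → ℝ}, Continuous k → Integrable k ν := fun hk => by
    rw [hνeq]; exact hk.continuousOn.integrableOn_compact hSS
  have hfc := hf.continuous
  have hi : ∀ {k : Space d → ℝ}, Continuous k → Integrable k (volume.restrict S) := fun hk =>
    hk.continuousOn.integrableOn_compact hS
  have hdouble : ∫ p, (f p.1 - f p.2) ^ 2 ∂ν
      = 2 * V * (∫ x in S, f x ^ 2) - 2 * (∫ x in S, f x) ^ 2 := by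
    rw [integral_prod _ (intc (by fun_prop))]
    have inner : ∀ x, ∫ y in S, (f x - f y) ^ 2
        = V * f x ^ 2 - 2 * (∫ y in S, f y) * f x + ∫ y in S, f y ^ 2 := by
      intro x
      have e : ∀ y, (f x - f y) ^ 2 = (f x ^ 2 - (2 * f x) * f y) + f y ^ 2 := by intro y; ring
      simp_rw [e]
      rw [integral_add (hi (by fun_prop)) (hi (by fun_prop)),
        integral_sub (hi (by fun_prop)) (hi (by fun_prop)), integral_const_mul, integral_const,
        measureReal_restrict_apply_univ, smul_eq_mul]
      ring
    simp_rw [inner]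
    rw [integral_add (hi (by fun_prop)) (hi (by fun_prop)),
      integral_sub (hi (by fun_prop)) (hi (by fun_prop)), integral_const_mul, integral_const_mul,
      integral_const, measureReal_restrict_apply_univ, smul_eq_mul]
    ring
  have hle : ∫ p, (f p.1 - f p.2) ^ 2 ∂ν ≤
      ∫ p, h ^ 2 * (∫ t in Set.Icc (0 : ℝ) 1, G (p.2 + t • (p.1 - p.2))) ∂ν := by
    refine integral_mono_ae (intc (by fun_prop)) ?_ ?_
    · refine intc (continuous_const.mul ?_)
      refine continuous_parametric_integral_of_continuous (by fun_prop) isCompact_Icc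
    · rw [hνeq]
      refine ae_restrict_of_forall_mem hSS.measurableSet fun p hp => ?_
      refine (sq_sub_le_integral_segment hf p.1 p.2).trans ?_
      refine mul_le_mul_of_nonneg_right ?_ (integral_nonneg fun t => hG0 _)
      refine pow_le_pow_left₀ (norm_nonneg _) ?_ 2
      rw [← dist_eq_norm]
      exact Metric.dist_le_diam_of_mem hS.isBounded hp.1 hp.2
  have hswap : ∫ p, (∫ t in Set.Icc (0 : ℝ) 1, G (p.2 + t • (p.1 - p.2))) ∂ν
      = ∫ t in Set.Icc (0 : ℝ) 1, ∫ p, G (p.2 + t • (p.1 - p.2)) ∂ν := by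
    refine integral_integral_swap ?_
    rw [hνeq, Measure.prod_restrict]
    have : Continuous (Function.uncurry fun (p : Space d × Space d) (t : ℝ) =>
        G (p.2 + t • (p.1 - p.2))) := by
      simp only [Function.uncurry_def]; fun_prop
    exact this.continuousOn.integrableOn_compact (hSS.prod isCompact_Icc)
  have hJ : ∀ t ∈ Set.Icc (0 : ℝ) 1, ∫ p, G (p.2 + t • (p.1 - p.2)) ∂ν
      ≤ V * (2 ^ d * ∫ x in S, G x) := by
    intro t ht
    have hconst : ∀ A : ℝ, ∫ y in S, A = V * A := fun A => by
      rw [integral_const, measureReal_restrict_apply_univ, smul_eq_mul]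
    have hcont : Continuous fun p : Space d × Space d => G (p.2 + t • (p.1 - p.2)) := by fun_prop
    -- The point `y + t(x - y)` is a contraction of `x` towards `y` by `t`, and of `y` towards `x`
    -- by `1 - t`. One of the two factors is at least `1/2`, so the Jacobian is at most `2 ^ d`.
    rcases le_total (1 / 2) t with h1 | h1
    · rw [integral_prod_symm _ (intc hcont), ← hconst]
      refine integral_mono_ae ?_ (integrable_const _) ?_
      · exact (intc hcont).integral_prod_right
      · exact ae_restrict_of_forall_mem hS.measurableSet fun y hy =>
          integral_comp_contract_le hS hc hG hG0 hy h1 ht.2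
    · rw [integral_prod _ (intc hcont), ← hconst]
      refine integral_mono_ae ?_ (integrable_const _) ?_
      · exact (intc hcont).integral_prod_left
      · refine ae_restrict_of_forall_mem hS.measurableSet fun x hx => ?_
        have := integral_comp_contract_le hS hc hG hG0 hx (s := 1 - t) (by linarith)
          (by linarith [ht.1])
        refine le_trans (le_of_eq ?_) this
        refine integral_congr_ae (ae_of_all _ fun y => ?_)
        simp only
        congr 1
        simp only [sub_smul, smul_sub, one_smul]; abel
  have hfinal : ∫ p, (f p.1 - f p.2) ^ 2 ∂ν ≤ h ^ 2 * (V * (2 ^ d * ∫ x in S, G x)) := by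
    refine hle.trans ?_
    rw [integral_const_mul, hswap]
    refine mul_le_mul_of_nonneg_left ?_ (sq_nonneg _)
    have : ∫ t in Set.Icc (0 : ℝ) 1, V * (2 ^ d * ∫ x in S, G x)
        = V * (2 ^ d * ∫ x in S, G x) := by simp
    rw [← this]
    refine setIntegral_mono_on ?_ continuous_const.integrableOn_Icc measurableSet_Icc hJ
    refine Continuous.integrableOn_Icc ?_
    rw [hνeq]
    exact continuous_parametric_integral_of_continuous (by fun_prop) hSS
  rw [integral_sub_mean_sq hpos hfin (memLp_of_continuous hS hfin hfc 2)]
  rw [hdouble] at hfinal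
  have hGi : 0 ≤ ∫ x in S, G x := integral_nonneg hG0
  have e : (∫ x in S, f x ^ 2) - V⁻¹ * (∫ x in S, f x) ^ 2
      = (2 * V)⁻¹ * (2 * V * (∫ x in S, f x ^ 2) - 2 * (∫ x in S, f x) ^ 2) := by
    field_simp
  rw [e]
  calc (2 * V)⁻¹ * (2 * V * (∫ x in S, f x ^ 2) - 2 * (∫ x in S, f x) ^ 2)
      ≤ (2 * V)⁻¹ * (h ^ 2 * (V * (2 ^ d * ∫ x in S, G x))) := by gcongr
    _ = (1 / 2) * (2 ^ d * h ^ 2 * ∫ x in S, G x) := by field_simp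
    _ ≤ 2 ^ d * h ^ 2 * ∫ x in S, G x := by
      have : 0 ≤ 2 ^ d * h ^ 2 * ∫ x in S, G x := by positivity
      linarith

/-- The frontier of a convex set is null. Weak derivatives need the open simplex, while facets and
compactness need the closed one. -/
theorem restrict_interior_hull (K : Finset (Space d)) :
    volume.restrict (interior (hull K)) = volume.restrict (hull K) := by
  refine Measure.restrict_congr_set ?_
  refine (LE.le.eventuallyLE (interior_subset (s := hull K))).antisymm ?_
  have h := (convex_hull K).addHaar_frontier (volume : Measure (Space d))
  rw [frontier, (isCompact_hull K).isClosed.closure_eq] at h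
  exact ae_le_set.2 h

/-- `φ n` are smooth and converge to `u` in `H¹(K)`, with weak gradient `g`. -/
structure H1Approx (K : Finset (Space d)) (u : Space d → ℝ) (g : Fin d → Space d → ℝ)
    (φ : ℕ → Space d → ℝ) : Prop where
  smooth : ∀ n, ContDiff ℝ ∞ (φ n)
  lim : L2Tendsto (volume.restrict (hull K)) φ u
  lim_grad : ∀ i, L2Tendsto (volume.restrict (hull K)) (fun n => partialDeriv i (φ n)) (g i)

theorem WeakGrad.exists_H1Approx {K : Finset (Space d)} (hK : IsElement K) {u : Space d → ℝ}
    {g : Fin d → Space d → ℝ} (h : WeakGrad (interior (hull K)) u g) :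
    ∃ φ, H1Approx K u g φ := by
  obtain ⟨φ, h1, h2, h3⟩ := h.exists_smooth isOpen_interior (convex_hull K).interior
    ((isCompact_hull K).isBounded.subset interior_subset) hK.interior_nonempty
  rw [restrict_interior_hull] at h2 h3
  exact ⟨φ, h1, h2, h3⟩

theorem H1Approx.poincare {K : Finset (Space d)} (hK : IsElement K) {u : Space d → ℝ}
    {g : Fin d → Space d → ℝ} {φ : ℕ → Space d → ℝ} (h : H1Approx K u g φ) :
    ∫ x in hull K, (u x - mean (hull K) u) ^ 2 ≤
      2 ^ d * Metric.diam (hull K) ^ 2 * ∑ i, ∫ x in hull K, g i x ^ 2 := by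
  have hfin := (isCompact_hull K).measure_lt_top (μ := volume)
  rw [integral_sub_mean_sq hK.volume_pos hfin h.lim.memf]
  have hf : IsFiniteMeasure (volume.restrict (hull K)) := ⟨by simpa using hfin⟩
  have h1 := h.lim.integral_mul_of_memLp (memLp_const (1 : ℝ))
  simp only [mul_one] at h1
  have h2 := h.lim.integral_sq.sub ((h1.pow 2).const_mul (volume.real (hull K))⁻¹)
  have h3 := (tendsto_finsetSum Finset.univ fun i _ => (h.lim_grad i).integral_sq).const_mul
    (2 ^ d * Metric.diam (hull K) ^ 2)
  refine le_of_tendsto_of_tendsto' h2 h3 fun n => ?_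
  rw [← integral_sub_mean_sq hK.volume_pos hfin (h.lim.memF n)]
  refine (poincare_smooth (isCompact_hull K) (convex_hull K) hK.volume_pos
    ((h.smooth n).of_le (by simp))).trans (le_of_eq ?_)
  rw [integral_finsetSum _ fun i _ => ((h.lim_grad i).memF n).integrable_sq]

theorem WeakGrad.poincare {K : Finset (Space d)} (hK : IsElement K) {u : Space d → ℝ}
    {g : Fin d → Space d → ℝ} (h : WeakGrad (interior (hull K)) u g) :
    ∫ x in hull K, (u x - mean (hull K) u) ^ 2 ≤
      2 ^ d * Metric.diam (hull K) ^ 2 * ∑ i, ∫ x in hull K, g i x ^ 2 := by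
  obtain ⟨φ, hφ⟩ := h.exists_H1Approx hK
  exact hφ.poincare hK

/-! ### Weak gradients: uniqueness and restriction -/

theorem ae_eq_of_forall_test {D : Set (Space d)} (hD : IsOpen D) {f g : Space d → ℝ}
    (hf : MemLp f 2 (volume.restrict D)) (hg : MemLp g 2 (volume.restrict D))
    (h : ∀ φ, IsTestFunction D φ → ∫ x in D, f x * φ x = ∫ x in D, g x * φ x) :
    f =ᵐ[volume.restrict D] g := by
  have hm : MemLp (D.indicator fun x => f x - g x) 2 volume :=
    (memLp_indicator_iff_restrict hD.measurableSet).2 (hf.sub hg)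
  have hl : LocallyIntegrable (D.indicator fun x => f x - g x) volume :=
    hm.locallyIntegrable (by norm_num)
  have := hD.ae_eq_zero_of_integral_contDiff_smul_eq_zero (hl.locallyIntegrableOn D)
    (fun φ h1 h2 h3 => by
      have hφm : MemLp φ 2 (volume.restrict D) :=
        (h1.continuous.memLp_of_hasCompactSupport h2).mono_measure Measure.restrict_le_self
      have hφ := h φ ⟨h1, h2, h3⟩
      have e : (fun x => φ x • D.indicator (fun x => f x - g x) x)
          = D.indicator fun x => f x * φ x - g x * φ x := by
        ext x
        by_cases hx : x ∈ D
        · simp only [Set.indicator_of_mem hx, smul_eq_mul]; ring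
        · simp [Set.indicator_of_notMem hx]
      rw [e, integral_indicator hD.measurableSet, integral_sub
        (integrable_mul_of_memLp hf hφm) (integrable_mul_of_memLp hg hφm), hφ, sub_self])
  rw [Filter.EventuallyEq, ae_restrict_iff' hD.measurableSet]
  filter_upwards [this] with x hx hxD
  have := hx hxD
  rw [Set.indicator_of_mem hxD] at this
  linarith

theorem WeakGrad.unique {D : Set (Space d)} (hD : IsOpen D) {u : Space d → ℝ}
    {g g' : Fin d → Space d → ℝ} (h : WeakGrad D u g) (h' : WeakGrad D u g') (i : Fin d) :
    g i =ᵐ[volume.restrict D] g' i := by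
  refine ae_eq_of_forall_test hD (h.memg i) (h'.memg i) fun φ hφ => ?_
  have h1 := h.ibp φ hφ i
  have h2 := h'.ibp φ hφ i
  linarith

theorem IsTestFunction.partialDeriv {D : Set (Space d)} {φ : Space d → ℝ}
    (h : IsTestFunction D φ) (i : Fin d) : IsTestFunction D (partialDeriv i φ) := by
  have hsub : tsupport (HDG.partialDeriv i φ) ⊆ tsupport φ :=
    (closure_mono fun x hx => by
      have : fderiv ℝ φ x ≠ 0 := fun h0 => hx (by simp [HDG.partialDeriv, h0])
      exact this).trans (tsupport_fderiv_subset ℝ)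
  exact ⟨(h.smooth.fderiv_right (m := ∞) (by simp)).clm_apply contDiff_const,
    h.compact.mono' (subset_closure.trans hsub), hsub.trans h.support_subset⟩

theorem IsTestFunction.mono {D D' : Set (Space d)} (hDD : D' ⊆ D) {φ : Space d → ℝ}
    (h : IsTestFunction D' φ) : IsTestFunction D φ :=
  ⟨h.smooth, h.compact, h.support_subset.trans hDD⟩

theorem IsTestFunction.setIntegral_eq {D D' : Set (Space d)}
    (hD : MeasurableSet D) (hDD : D' ⊆ D) {φ : Space d → ℝ} (h : IsTestFunction D' φ)
    (u : Space d → ℝ) : ∫ x in D', u x * φ x = ∫ x in D, u x * φ x := by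
  refine (setIntegral_eq_of_subset_of_forall_sdiff_eq_zero hD hDD fun x hx => ?_).symm
  have : φ x = 0 := image_eq_zero_of_notMem_tsupport fun hx' => hx.2 (h.support_subset hx')
  rw [this, mul_zero]

theorem WeakGrad.mono {D D' : Set (Space d)}
    (hD : MeasurableSet D) (hDD : D' ⊆ D) {u : Space d → ℝ} {g : Fin d → Space d → ℝ}
    (h : WeakGrad D u g) : WeakGrad D' u g := by
  have hr : volume.restrict D' ≤ volume.restrict D := Measure.restrict_mono hDD le_rfl
  refine ⟨h.memu.mono_measure hr, fun i => (h.memg i).mono_measure hr, fun φ hφ i => ?_⟩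
  rw [(hφ.partialDeriv i).setIntegral_eq hD hDD, hφ.setIntegral_eq hD hDD]
  exact h.ibp φ (hφ.mono hDD) i

theorem WeakGrad.congr {D : Set (Space d)} {u u' : Space d → ℝ} {g g' : Fin d → Space d → ℝ}
    (h : WeakGrad D u g) (hu : u =ᵐ[volume.restrict D] u')
    (hg : ∀ i, g i =ᵐ[volume.restrict D] g' i) : WeakGrad D u' g' := by
  refine ⟨(memLp_congr_ae hu).1 h.memu, fun i => (memLp_congr_ae (hg i)).1 (h.memg i),
    fun φ hφ i => ?_⟩
  have e1 : ∫ x in D, u' x * HDG.partialDeriv i φ x = ∫ x in D, u x * HDG.partialDeriv i φ x :=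
    integral_congr_ae (by filter_upwards [hu] with x hx; rw [hx])
  have e2 : ∫ x in D, g' i x * φ x = ∫ x in D, g i x * φ x :=
    integral_congr_ae (by filter_upwards [hg i] with x hx; rw [hx])
  rw [e1, e2]
  exact h.ibp φ hφ i

theorem weakGrad_of_smooth {D : Set (Space d)} (hb : Bornology.IsBounded D) {f : Space d → ℝ} (hf : ContDiff ℝ ∞ f) :
    WeakGrad D f (fun i => partialDeriv i f) := by
  have hf1 : ContDiff ℝ 1 f := hf.of_le (by simp)
  have hc := fun i => continuous_partialDeriv hf1 i
  refine ⟨memLp_volume_of_continuous hb hf.continuous 2,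
    fun i => memLp_volume_of_continuous hb (hc i) 2, fun φ hφ i => ?_⟩
  have hφu : IsTestFunction Set.univ φ := hφ.mono (Set.subset_univ _)
  rw [(hφ.partialDeriv i).setIntegral_eq MeasurableSet.univ (Set.subset_univ _),
    hφ.setIntegral_eq MeasurableSet.univ (Set.subset_univ _), setIntegral_univ,
    setIntegral_univ]
  have hφc := hφ.smooth.continuous
  have hpc := (hφ.partialDeriv i).smooth.continuous
  exact integral_mul_fderiv_eq_neg_fderiv_mul_of_integrable
    (((hc i).mul hφc).integrable_of_hasCompactSupport hφ.compact.mul_left)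
    ((hf.continuous.mul hpc).integrable_of_hasCompactSupport
      (hφ.partialDeriv i).compact.mul_left)
    ((hf.continuous.mul hφc).integrable_of_hasCompactSupport hφ.compact.mul_left)
    (fun x _ => hf1.differentiable (by norm_num) x)
    (fun x _ => hφ.smooth.differentiable (by simp) x)

theorem WeakGrad.sub {D : Set (Space d)} {u v : Space d → ℝ} {g k : Fin d → Space d → ℝ}
    (hu : WeakGrad D u g) (hv : WeakGrad D v k) :
    WeakGrad D (fun x => u x - v x) (fun i x => g i x - k i x) := by
  refine ⟨hu.memu.sub hv.memu, fun i => (hu.memg i).sub (hv.memg i), fun φ hφ i => ?_⟩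
  have m : ∀ {ψ}, IsTestFunction D ψ → MemLp ψ 2 (volume.restrict D) := fun hψ =>
    (hψ.smooth.continuous.memLp_of_hasCompactSupport hψ.compact).mono_measure
      Measure.restrict_le_self
  simp_rw [sub_mul]
  rw [integral_sub (integrable_mul_of_memLp hu.memu (m (hφ.partialDeriv i)))
    (integrable_mul_of_memLp hv.memu (m (hφ.partialDeriv i))),
    integral_sub (integrable_mul_of_memLp (hu.memg i) (m hφ))
    (integrable_mul_of_memLp (hv.memg i) (m hφ)), hu.ibp φ hφ, hv.ibp φ hφ]
  ring

/-! ### Traces on the facets of an element -/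

/-- The surface measure on the facet of `K` opposite to `a`. -/
abbrev facetMeasure (K : Finset (Space d)) (a : Space d) : Measure (Space d) :=
  (surface d).restrict (hull (facet K a))

theorem IsElement.memLp_facet {K : Finset (Space d)} (hK : IsElement K) (hd : 1 ≤ d)
    {a : Space d} (ha : a ∈ K) {f : Space d → ℝ} (hf : Continuous f) :
    MemLp f 2 (facetMeasure K a) :=
  memLp_of_continuous (isCompact_hull _) (hK.surface_facet_lt_top hd ha) hf 2

theorem memLp_hull (K : Finset (Space d)) {f : Space d → ℝ} (hf : Continuous f) :
    MemLp f 2 (volume.restrict (hull K)) :=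
  memLp_of_continuous (isCompact_hull _) (isCompact_hull K).measure_lt_top hf 2

/-- The radial identity for `f²`, with `2 f ∇f·(x - a) ≤ f² + |x - a|² |∇f|²`. Having the height on
the left avoids any shape assumption. -/
theorem IsElement.trace_ineq_smooth {K : Finset (Space d)} (hK : IsElement K) (hd : 1 ≤ d)
    {a : Space d} (ha : a ∈ K) {f : Space d → ℝ} (hf : ContDiff ℝ 1 f) :
    height K a * ∫ x, f x ^ 2 ∂(facetMeasure K a) ≤
      (d + 1) * (∫ x in hull K, f x ^ 2)
        + Metric.diam (hull K) ^ 2 * ∑ i, ∫ x in hull K, partialDeriv i f x ^ 2 := by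
  have hc := fun i => continuous_partialDeriv hf i
  have hfc := hf.continuous
  have hi : ∀ {k : Space d → ℝ}, Continuous k → Integrable k (volume.restrict (hull K)) :=
    fun hk => hk.continuousOn.integrableOn_compact (isCompact_hull K)
  have hi2 : ∀ i ∈ Finset.univ, Integrable (fun x => partialDeriv i f x ^ 2)
      (volume.restrict (hull K)) := fun i _ => hi ((hc i).pow 2)
  rw [← hK.integral_radial hd ha (hf.pow 2), ← integral_const_mul,
    ← integral_finsetSum _ hi2, ← integral_const_mul,
    ← integral_add (hi (by fun_prop)) (hi (by fun_prop))]
  refine setIntegral_mono_on (hi ?_) (hi (by fun_prop)) (isCompact_hull K).measurableSet ?_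
  · have h1 : Continuous fun x => fderiv ℝ (fun x => f x ^ 2) x (x - a) :=
      ((hf.pow 2).continuous_fderiv (by norm_num)).clm_apply (by fun_prop)
    fun_prop
  · intro x hx
    have hder : fderiv ℝ (fun x => f x ^ 2) x (x - a) = 2 * f x * fderiv ℝ f x (x - a) := by
      have := ((hf.differentiable (by norm_num) x).hasFDerivAt.pow 2).fderiv
      rw [this]; simp
    have h1 := sq_fderiv_le f x (x - a)
    have h2 : ‖x - a‖ ^ 2 ≤ Metric.diam (hull K) ^ 2 := by
      refine pow_le_pow_left₀ (norm_nonneg _) ?_ 2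
      rw [← dist_eq_norm]
      exact Metric.dist_le_diam_of_mem (isCompact_hull K).isBounded hx (subset_hull ha)
    have h3 : (0 : ℝ) ≤ ∑ i, partialDeriv i f x ^ 2 := Finset.sum_nonneg fun i _ => sq_nonneg _
    have h4 := mul_le_mul_of_nonneg_right h2 h3
    rw [hder]
    nlinarith [sq_nonneg (f x - fderiv ℝ f x (x - a))]

/-- `t a` is the trace of `u ∈ H¹(K)`, with weak gradient `g`, on the facet opposite to `a`. -/
def IsElemTrace (K : Finset (Space d)) (u : Space d → ℝ) (g : Fin d → Space d → ℝ)
    (t : Space d → Space d → ℝ) : Prop :=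
  ∃ φ, H1Approx K u g φ ∧ ∀ a ∈ K, L2Tendsto (facetMeasure K a) φ (t a)

theorem H1Approx.const {K : Finset (Space d)} {f : Space d → ℝ} (hf : ContDiff ℝ ∞ f) :
    H1Approx K f (fun i => partialDeriv i f) (fun _ => f) :=
  ⟨fun _ => hf, .const (memLp_hull K hf.continuous),
    fun i => .const (memLp_hull K (continuous_partialDeriv (hf.of_le (by simp)) i))⟩

theorem isElemTrace_of_smooth {K : Finset (Space d)} (hK : IsElement K) (hd : 1 ≤ d)
    {f : Space d → ℝ} (hf : ContDiff ℝ ∞ f) :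
    IsElemTrace K f (fun i => partialDeriv i f) (fun _ => f) :=
  ⟨_, .const hf, fun _ ha => .const (hK.memLp_facet hd ha hf.continuous)⟩

theorem partialDeriv_sub {f g : Space d → ℝ} (hf : Differentiable ℝ f)
    (hg : Differentiable ℝ g) (i : Fin d) (x : Space d) :
    partialDeriv i (fun x => f x - g x) x = partialDeriv i f x - partialDeriv i g x := by
  simp only [partialDeriv]
  rw [fderiv_fun_sub (hf x) (hg x)]
  rfl

theorem H1Approx.sub {K : Finset (Space d)} {u v : Space d → ℝ} {g k : Fin d → Space d → ℝ}
    {φ ψ : ℕ → Space d → ℝ} (h : H1Approx K u g φ) (h' : H1Approx K v k ψ) :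
    H1Approx K (fun x => u x - v x) (fun i x => g i x - k i x) (fun n x => φ n x - ψ n x) := by
  refine ⟨fun n => (h.smooth n).sub (h'.smooth n), h.lim.sub h'.lim, fun i => ?_⟩
  have := (h.lim_grad i).sub (h'.lim_grad i)
  convert this using 2 with n
  ext x
  exact partialDeriv_sub ((h.smooth n).differentiable (by simp))
    ((h'.smooth n).differentiable (by simp)) i x

theorem IsElemTrace.sub {K : Finset (Space d)} {u v : Space d → ℝ} {g k : Fin d → Space d → ℝ}
    {t s : Space d → Space d → ℝ} (h : IsElemTrace K u g t) (h' : IsElemTrace K v k s) :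
    IsElemTrace K (fun x => u x - v x) (fun i x => g i x - k i x) (fun a x => t a x - s a x) := by
  obtain ⟨φ, h1, h2⟩ := h
  obtain ⟨ψ, h3, h4⟩ := h'
  exact ⟨_, h1.sub h3, fun a ha => (h2 a ha).sub (h4 a ha)⟩

theorem H1Approx.tendsto_bound {K : Finset (Space d)} {u : Space d → ℝ}
    {g : Fin d → Space d → ℝ} {φ : ℕ → Space d → ℝ} (h : H1Approx K u g φ) :
    Tendsto (fun n => (d + 1) * (∫ x in hull K, φ n x ^ 2)
        + Metric.diam (hull K) ^ 2 * ∑ i, ∫ x in hull K, partialDeriv i (φ n) x ^ 2) atTop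
      (𝓝 ((d + 1) * (∫ x in hull K, u x ^ 2)
        + Metric.diam (hull K) ^ 2 * ∑ i, ∫ x in hull K, g i x ^ 2)) :=
  (h.lim.integral_sq.const_mul _).add
    ((tendsto_finsetSum Finset.univ fun i _ => (h.lim_grad i).integral_sq).const_mul _)

theorem IsElemTrace.trace_ineq {K : Finset (Space d)} (hK : IsElement K) (hd : 1 ≤ d)
    {a : Space d} (ha : a ∈ K) {u : Space d → ℝ} {g : Fin d → Space d → ℝ}
    {t : Space d → Space d → ℝ} (h : IsElemTrace K u g t) :
    height K a * ∫ x, t a x ^ 2 ∂(facetMeasure K a) ≤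
      (d + 1) * (∫ x in hull K, u x ^ 2)
        + Metric.diam (hull K) ^ 2 * ∑ i, ∫ x in hull K, g i x ^ 2 := by
  obtain ⟨φ, h1, h2⟩ := h
  exact le_of_tendsto_of_tendsto' ((h2 a ha).integral_sq.const_mul _) h1.tendsto_bound
    fun n => hK.trace_ineq_smooth hd ha ((h1.smooth n).of_le (by simp))

theorem IsElemTrace.memLp {K : Finset (Space d)} {a : Space d} (ha : a ∈ K) {u : Space d → ℝ}
    {g : Fin d → Space d → ℝ} {t : Space d → Space d → ℝ} (h : IsElemTrace K u g t) :
    MemLp (t a) 2 (facetMeasure K a) := by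
  obtain ⟨φ, -, h2⟩ := h
  exact (h2 a ha).memf

theorem IsElemTrace.memu {K : Finset (Space d)} {u : Space d → ℝ}
    {g : Fin d → Space d → ℝ} {t : Space d → Space d → ℝ} (h : IsElemTrace K u g t) :
    MemLp u 2 (volume.restrict (hull K)) := by
  obtain ⟨φ, h1, -⟩ := h
  exact h1.lim.memf

theorem IsElemTrace.memg {K : Finset (Space d)} {u : Space d → ℝ}
    {g : Fin d → Space d → ℝ} {t : Space d → Space d → ℝ} (h : IsElemTrace K u g t) (i : Fin d) :
    MemLp (g i) 2 (volume.restrict (hull K)) := by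
  obtain ⟨φ, h1, -⟩ := h
  exact (h1.lim_grad i).memf

/-- The limit of the traces of two approximating sequences is the same. -/
theorem H1Approx.trace_unique {K : Finset (Space d)} (hK : IsElement K) (hd : 1 ≤ d)
    {a : Space d} (ha : a ∈ K) {u : Space d → ℝ} {g : Fin d → Space d → ℝ}
    {φ ψ : ℕ → Space d → ℝ} (h : H1Approx K u g φ) (h' : H1Approx K u g ψ) {t s : Space d → ℝ}
    (ht : L2Tendsto (facetMeasure K a) φ t) (hs : L2Tendsto (facetMeasure K a) ψ s) :
    t =ᵐ[facetMeasure K a] s := by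
  have h0 := (h.sub h').tendsto_bound
  simp only [sub_self, ne_eq, OfNat.ofNat_ne_zero, not_false_eq_true, zero_pow, integral_zero,
    mul_zero, Finset.sum_const_zero, add_zero] at h0
  have h1 := (ht.sub hs).integral_sq.const_mul (height K a)
  have h2 : height K a * ∫ x, (t x - s x) ^ 2 ∂(facetMeasure K a) ≤ 0 :=
    le_of_tendsto_of_tendsto' h1 h0 fun n =>
      hK.trace_ineq_smooth hd ha (((h.sub h').smooth n).of_le (by simp))
  have h3 : ∫ x, (t x - s x) ^ 2 ∂(facetMeasure K a) = 0 := by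
    refine le_antisymm ?_ (integral_nonneg fun x => sq_nonneg _)
    by_contra hneg
    exact absurd h2 (not_le.2 (mul_pos (hK.height_pos hd ha) (not_le.1 hneg)))
  have h4 := (integral_eq_zero_iff_of_nonneg (fun x => sq_nonneg (t x - s x))
    (ht.sub hs).memf.integrable_sq).1 h3
  filter_upwards [h4] with x hx
  simpa [sub_eq_zero] using hx

/-- An approximating sequence has traces. -/
theorem H1Approx.exists_trace {K : Finset (Space d)} (hK : IsElement K) (hd : 1 ≤ d)
    {u : Space d → ℝ} {g : Fin d → Space d → ℝ} {φ : ℕ → Space d → ℝ} (h : H1Approx K u g φ)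
    {a : Space d} (ha : a ∈ K) : ∃ t, L2Tendsto (facetMeasure K a) φ t := by
  refine exists_L2Tendsto_of_cauchy
    (fun n => hK.memLp_facet hd ha (h.smooth n).continuous) fun ε hε => ?_
  have hH := hK.height_pos hd ha
  have h1 := (h.lim.lim.const_mul ((d + 1 : ℝ) * 4)).add
    ((tendsto_finsetSum Finset.univ fun i _ => (h.lim_grad i).lim).const_mul
      (Metric.diam (hull K) ^ 2 * 4))
  simp only [mul_zero, Finset.sum_const_zero, add_zero] at h1
  obtain ⟨N, hN⟩ := (h1.eventually (gt_mem_nhds (mul_pos hH hε))).exists_forall_of_atTop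
  have hquad : ∀ {k : ℕ → Space d → ℝ} {l : Space d → ℝ},
      L2Tendsto (volume.restrict (hull K)) k l → ∀ m n, ∫ x in hull K, (k m x - k n x) ^ 2 ≤
      2 * (∫ x in hull K, (k m x - l x) ^ 2) + 2 * ∫ x in hull K, (k n x - l x) ^ 2 := by
    intro k l hk m n
    have := integral_sq_sub_le ((hk.memF m).sub hk.memf) ((hk.memF n).sub hk.memf)
    refine le_trans (le_of_eq (integral_congr_ae (ae_of_all _ fun x => ?_))) this
    simp only [Pi.sub_apply]; ring
  refine ⟨N, fun m hm n hn => ?_⟩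
  -- The trace inequality for the difference of two members of the sequence turns a Cauchy sequence
  -- in `H¹(K)` into one in `L²` of the facet.
  have hmn := hK.trace_ineq_smooth hd ha
    (((h.smooth m).sub (h.smooth n)).of_le (m := 1) (by simp))
  have hp : ∀ i x, partialDeriv i (fun x => φ m x - φ n x) x
      = partialDeriv i (φ m) x - partialDeriv i (φ n) x := fun i x =>
    partialDeriv_sub ((h.smooth m).differentiable (by simp))
      ((h.smooth n).differentiable (by simp)) i x
  simp_rw [hp] at hmn
  have hm' := hN m hm
  have hn' := hN n hn
  have b1 := hquad h.lim m n
  have b2 : ∑ i, ∫ x in hull K, (partialDeriv i (φ m) x - partialDeriv i (φ n) x) ^ 2 ≤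
      2 * (∑ i, ∫ x in hull K, (partialDeriv i (φ m) x - g i x) ^ 2)
        + 2 * ∑ i, ∫ x in hull K, (partialDeriv i (φ n) x - g i x) ^ 2 := by
    rw [Finset.mul_sum, Finset.mul_sum, ← Finset.sum_add_distrib]
    exact Finset.sum_le_sum fun i _ => hquad (h.lim_grad i) m n
  have c1 := mul_le_mul_of_nonneg_left b1 (by positivity : (0 : ℝ) ≤ d + 1)
  have c2 := mul_le_mul_of_nonneg_left b2 (by positivity : (0 : ℝ) ≤ Metric.diam (hull K) ^ 2)
  have : height K a * ∫ x, (φ m x - φ n x) ^ 2 ∂(facetMeasure K a) ≤ height K a * ε := by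
    linarith
  exact le_of_mul_le_mul_left this hH

theorem WeakGrad.exists_trace {K : Finset (Space d)} (hK : IsElement K) (hd : 1 ≤ d)
    {u : Space d → ℝ} {g : Fin d → Space d → ℝ} (h : WeakGrad (interior (hull K)) u g) :
    ∃ t, IsElemTrace K u g t := by
  classical
  obtain ⟨φ, hφ⟩ := h.exists_H1Approx hK
  choose! t ht using fun a (ha : a ∈ K) => hφ.exists_trace hK hd ha
  exact ⟨t, φ, hφ, ht⟩

/-- The trace inequality for `u` minus its mean, whose `L²(K)` part is absorbed by the Poincaré
inequality. -/
theorem IsElemTrace.poincare_trace {K : Finset (Space d)} (hK : IsElement K) (hd : 1 ≤ d)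
    {a : Space d} (ha : a ∈ K) {u : Space d → ℝ} {g : Fin d → Space d → ℝ}
    {t : Space d → Space d → ℝ} (h : IsElemTrace K u g t) :
    height K a * ∫ x, (t a x - mean (hull K) u) ^ 2 ∂(facetMeasure K a) ≤
      ((d + 1) * 2 ^ d + 1) * Metric.diam (hull K) ^ 2 * ∑ i, ∫ x in hull K, g i x ^ 2 := by
  obtain ⟨φ, h1, h2⟩ := h
  have hp := h1.poincare hK
  have h3 := (IsElemTrace.sub (⟨φ, h1, h2⟩ : IsElemTrace K u g t)
    (isElemTrace_of_smooth hK hd (f := fun _ => mean (hull K) u) contDiff_const)).trace_ineq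
      hK hd ha
  have e : ∀ i (x : Space d), partialDeriv i (fun _ : Space d => mean (hull K) u) x = 0 := by
    intro i x; simp [partialDeriv]
  simp only [e, sub_zero] at h3
  refine h3.trans ?_
  have := mul_le_mul_of_nonneg_left hp (by positivity : (0 : ℝ) ≤ d + 1)
  linarith

/-- Green's formula on an element. -/
theorem IsElemTrace.green {K : Finset (Space d)} (hK : IsElement K) (hd : 1 ≤ d)
    {u : Space d → ℝ} {g : Fin d → Space d → ℝ} {t : Space d → Space d → ℝ}
    (h : IsElemTrace K u g t) {ψ : Space d → ℝ} (hψ : ContDiff ℝ ∞ ψ) (i : Fin d) :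
    (∫ x in hull K, g i x * ψ x) + ∫ x in hull K, u x * partialDeriv i ψ x
      = ∑ a ∈ K, normal K a i * ∫ x, t a x * ψ x ∂(facetMeasure K a) := by
  obtain ⟨φ, h1, h2⟩ := h
  have hψ1 : ContDiff ℝ 1 ψ := hψ.of_le (by simp)
  have mψ := memLp_hull K hψ.continuous
  have mdψ := memLp_hull K (continuous_partialDeriv hψ1 i)
  have l1 := ((h1.lim_grad i).integral_mul_of_memLp mψ).add (h1.lim.integral_mul_of_memLp mdψ)
  have l2 := tendsto_finsetSum K fun a ha => ((h2 a ha).integral_mul_of_memLp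
    (hK.memLp_facet hd ha hψ.continuous)).const_mul (normal K a i)
  refine tendsto_nhds_unique l1 (l2.congr fun n => ?_)
  have hφ1 : ContDiff ℝ 1 (φ n) := (h1.smooth n).of_le (by simp)
  have := hK.integral_fderiv hd (hφ1.mul hψ1) (EuclideanSpace.single i 1)
  simp only [EuclideanSpace.inner_single_right, one_mul, conj_trivial] at this
  rw [← this, ← integral_add (integrable_mul_of_memLp ((h1.lim_grad i).memF n) mψ)
    (integrable_mul_of_memLp (h1.lim.memF n) mdψ)]
  refine integral_congr_ae (ae_of_all _ fun x => ?_)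
  have hd1 : HasFDerivAt (fun y => φ n y * ψ y) _ x :=
    (hφ1.differentiable (by norm_num) x).hasFDerivAt.mul
      (hψ1.differentiable (by norm_num) x).hasFDerivAt
  simp only
  rw [hd1.fderiv]
  simp only [add_apply, smul_apply, smul_eq_mul, partialDeriv]
  ring

/-- Green's formula on an element for a vector field. -/
theorem IsElemTrace.green_vec {K : Finset (Space d)} (hK : IsElement K) (hd : 1 ≤ d)
    {u : Space d → ℝ} {g : Fin d → Space d → ℝ} {t : Space d → Space d → ℝ}
    (h : IsElemTrace K u g t) {r : Space d → Space d} (hr : ∀ i, ContDiff ℝ ∞ fun x => r x i) :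
    (∑ i, ∫ x in hull K, g i x * r x i)
        + ∫ x in hull K, u x * ∑ i, partialDeriv i (fun y => r y i) x
      = ∑ a ∈ K, ∫ x, t a x * inner ℝ (r x) (normal K a) ∂(facetMeasure K a) := by
  have hc := fun i => continuous_partialDeriv ((hr i).of_le (m := 1) (by simp)) i
  have e1 : ∫ x in hull K, u x * ∑ i, partialDeriv i (fun y => r y i) x
      = ∑ i, ∫ x in hull K, u x * partialDeriv i (fun y => r y i) x := by
    rw [← integral_finsetSum _ fun i _ =>
      integrable_mul_of_memLp h.memu (memLp_hull K (hc i))]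
    simp_rw [Finset.mul_sum]
  rw [e1, ← Finset.sum_add_distrib]
  simp_rw [fun i => h.green hK hd (hr i) i]
  rw [Finset.sum_comm]
  refine Finset.sum_congr rfl fun a ha => ?_
  simp_rw [← integral_const_mul]
  rw [← integral_finsetSum _ fun i _ => (integrable_mul_of_memLp (h.memLp ha)
    (hK.memLp_facet hd ha (hr i).continuous)).const_mul _]
  refine integral_congr_ae (ae_of_all _ fun x => ?_)
  simp only [PiLp.inner_apply, RCLike.inner_apply, conj_trivial, Finset.mul_sum]
  exact Finset.sum_congr rfl fun i _ => by ring

/-! ### Traces in the sense of approximation -/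

theorem HasTrace.exists_approx {D S : Set (Space d)} (hD : Bornology.IsBounded D)
    (hS : IsCompact S) (hSf : surface d S < ⊤) {u t : Space d → ℝ} (h : HasTrace D S u t) :
    ∃ g φ, WeakGrad D u g ∧ (∀ n, ContDiff ℝ ∞ (φ n)) ∧ L2Tendsto (volume.restrict D) φ u ∧
      (∀ i, L2Tendsto (volume.restrict D) (fun n => partialDeriv i (φ n)) (g i)) ∧
      L2Tendsto ((surface d).restrict S) φ t := by
  obtain ⟨ht, G, hG, φ, hφ, h1, h2, h3⟩ := h
  have hw := hG.weakGrad
  refine ⟨fun i x => G x i, φ, hw, hφ, .of_eLpNorm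
    (fun n => memLp_volume_of_continuous hD (hφ n).continuous 2) hw.memu h1,
    fun i => .of_eLpNorm (fun n => memLp_volume_of_continuous hD
      (continuous_partialDeriv ((hφ n).of_le (by simp)) i) 2) (hw.memg i) ?_,
    .of_eLpNorm (fun n => memLp_of_continuous hS hSf (hφ n).continuous 2) ht h3⟩
  refine tendsto_of_tendsto_of_tendsto_of_le_of_le tendsto_const_nhds h2
    (fun _ => zero_le) fun n => eLpNorm_mono fun x => ?_
  rw [← gradient_apply, ← PiLp.sub_apply]
  exact PiLp.norm_apply_le _ i

/-- A trace in the sense of approximation is the trace on the element. -/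
theorem IsElemTrace.ae_eq_of_hasTrace {K : Finset (Space d)} (hK : IsElement K) (hd : 1 ≤ d)
    {a : Space d} (ha : a ∈ K) {u : Space d → ℝ} {g : Fin d → Space d → ℝ}
    {t : Space d → Space d → ℝ} (h : IsElemTrace K u g t)
    (hw : WeakGrad (interior (hull K)) u g) {s : Space d → ℝ}
    (hs : HasTrace (interior (hull K)) (hull (facet K a)) u s) :
    t a =ᵐ[facetMeasure K a] s := by
  obtain ⟨φ, h1, h2⟩ := h
  obtain ⟨g', ψ, hw', h3, h4, h5, h6⟩ := hs.exists_approx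
    ((isCompact_hull K).isBounded.subset interior_subset) (isCompact_hull _)
    (hK.surface_facet_lt_top hd ha)
  have hu := fun i => hw'.unique isOpen_interior hw i
  have h7 : H1Approx K u g ψ := by
    refine ⟨h3, by rwa [restrict_interior_hull] at h4, fun i => ?_⟩
    have := (h5 i).congr (hu i)
    rwa [restrict_interior_hull] at this
  exact h1.trace_unique hK hd ha h7 (h2 a ha) h6

/-! ### Polynomials orthogonal to those of lower degree -/

/-- The polynomials of degree at most `k` that are `L²(K)`-orthogonal to those of degree at
most `k - 1`. -/
def polyPerp (K : Finset (Space d)) (k : ℕ) : Submodule ℝ (Space d → ℝ) where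
  carrier := {z | IsPoly k z ∧ ∀ s, IsPoly (k - 1) s → ∫ x in hull K, z x * s x = 0}
  zero_mem' := ⟨IsPoly.const k 0, fun s _ => by simp⟩
  add_mem' := fun {z w} hz hw => ⟨hz.1.add hw.1, fun s hs => by
    have h1 := integrable_mul_of_memLp (memLp_hull K hz.1.continuous) (memLp_hull K hs.continuous)
    have h2 := integrable_mul_of_memLp (memLp_hull K hw.1.continuous) (memLp_hull K hs.continuous)
    simp only [Pi.add_apply, add_mul]
    rw [integral_add h1 h2, hz.2 s hs, hw.2 s hs, add_zero]⟩
  smul_mem' := fun c z hz => ⟨hz.1.const_mul c, fun s hs => by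
    simp only [Pi.smul_apply, smul_eq_mul, mul_assoc]
    rw [integral_const_mul, hz.2 s hs, mul_zero]⟩

theorem polyPerp_le (K : Finset (Space d)) (k : ℕ) : polyPerp K k ≤ polySub d k :=
  fun _ hz => mem_polySub.2 hz.1

instance (K : Finset (Space d)) (k : ℕ) : FiniteDimensional ℝ (polyPerp K k) :=
  Submodule.finiteDimensional_of_le (polyPerp_le K k)

/-- `L²(K)`-projection onto polynomials. -/
theorem exists_poly_projection (K : Finset (Space d)) (k : ℕ) {u : Space d → ℝ}
    (hu : MemLp u 2 (volume.restrict (hull K))) :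
    ∃ v, IsPoly k v ∧ ∀ s, IsPoly k s → ∫ x in hull K, v x * s x = ∫ x in hull K, u x * s x := by
  obtain ⟨p, hp, h⟩ := exists_projection (Finset.univ : Finset Unit)
    (fun _ => volume.restrict (hull K)) (fun _ => 1) (by simp) (polySub d k)
    (fun f hf _ _ => memLp_hull K (mem_polySub.1 hf).continuous) (fun _ => u) (fun _ _ => hu)
  exact ⟨p, mem_polySub.1 hp, fun s hs => by simpa using h s (mem_polySub.2 hs)⟩

/-- Orthogonal projections do not increase the norm. -/
theorem integral_sq_projection_le {v u : Space d → ℝ}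
    {ν : Measure (Space d)} (hv : MemLp v 2 ν) (hu : MemLp u 2 ν)
    (h : ∫ x, v x * v x ∂ν = ∫ x, u x * v x ∂ν) :
    ∫ x, v x ^ 2 ∂ν ≤ ∫ x, u x ^ 2 ∂ν := by
  have hcs : 0 ≤ ∫ x, (u x - v x) ^ 2 ∂ν := integral_nonneg fun x => sq_nonneg _
  have e : ∀ x, (u x - v x) ^ 2 = u x ^ 2 - 2 * (u x * v x) + v x * v x := by intro x; ring
  simp_rw [e] at hcs
  have i1 := integrable_mul_of_memLp hv hv
  have i2 := (integrable_mul_of_memLp hu hv).const_mul 2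
  have i3 : Integrable (fun x => u x ^ 2 - 2 * (u x * v x)) ν := hu.integrable_sq.sub i2
  rw [integral_add i3 i1, integral_sub hu.integrable_sq i2, integral_const_mul, ← h] at hcs
  simp_rw [pow_two (v _)]
  linarith

namespace IsElement

variable {K : Finset (Space d)} (hK : IsElement K) (hd : 1 ≤ d)
include hK hd

/-- On polynomials orthogonal to those of lower degree the norms on the element and on a facet
are proportional. -/
theorem integral_sq_polyPerp {k : ℕ} (hk : 1 ≤ k) {z : Space d → ℝ} (hz : z ∈ polyPerp K k)
    {a : Space d} (ha : a ∈ K) :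
    height K a * ∫ x, z x ^ 2 ∂(facetMeasure K a) = (d + 2 * k) * ∫ x in hull K, z x ^ 2 := by
  have hz1 : ContDiff ℝ 1 z := hz.1.contDiff.of_le (by simp)
  -- By Euler's identity `∇z·(x - a)` is `k z` up to a polynomial of degree `k - 1`, to which `z` is
  -- orthogonal. The radial identity for `z²` then has exactly the factor `d + 2k`.
  have he := hz.1.euler hk a
  have horth := hz.2 _ he
  have hzc := hz.1.continuous
  have hi : ∀ {k : Space d → ℝ}, Continuous k → Integrable k (volume.restrict (hull K)) :=
    fun hk => hk.continuousOn.integrableOn_compact (isCompact_hull K)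
  rw [← hK.integral_radial hd ha (hz1.pow 2)]
  have hec := he.continuous
  have e : ∀ x, d * z x ^ 2 + fderiv ℝ (fun x => z x ^ 2) x (x - a)
      = (d + 2 * k) * z x ^ 2 + 2 * (z x * (fderiv ℝ z x (x - a) - k * z x)) := by
    intro x
    have := ((hz1.differentiable (by norm_num) x).hasFDerivAt.pow 2).fderiv
    rw [this]
    simp
    ring
  simp_rw [e]
  have i2 : Integrable (fun x => 2 * (z x * (fderiv ℝ z x (x - a) - k * z x)))
      (volume.restrict (hull K)) := hi (continuous_const.mul (hzc.mul hec))
  rw [integral_add (hi (by fun_prop)) i2, integral_const_mul, integral_const_mul, horth]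
  ring

omit hK in
/-- Inverse trace inequality for polynomials. -/
theorem _root_.HDG.exists_inverse_trace (k : ℕ) : ∃ C : ℝ, 0 ≤ C ∧
    ∀ K : Finset (Space d), IsElement K → ∀ a ∈ K, ∀ p, IsPoly k p →
      height K a * ∫ x, p x ^ 2 ∂(facetMeasure K a) ≤ C * ∫ x in hull K, p x ^ 2 := by
  induction k with
  | zero =>
    -- For constants the inequality is the formula for the volume of a cone.
    refine ⟨d, Nat.cast_nonneg d, fun K hK a ha p hp => ?_⟩
    obtain ⟨P, hP, rfl⟩ := hp.exists_polyFun
    have hc := MvPolynomial.totalDegree_eq_zero_iff_eq_C.1 (Nat.le_zero.1 hP)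
    rw [hc]
    have h := hK.card_mul_volume hd ha
    simp only [polyFun, MvPolynomial.eval_C, integral_const, measureReal_restrict_apply_univ,
      smul_eq_mul]
    rw [← mul_assoc, ← mul_assoc, h]
  | succ k ih =>
    obtain ⟨C, hC, ih⟩ := ih
    refine ⟨2 * C + 2 * (d + 2 * (k + 1)), by positivity, fun K hK a ha p hp => ?_⟩
    have hH := hK.height_pos hd ha
    -- The polynomial splits into its projection `v` onto degree `k`, covered by induction, and an
    -- orthogonal remainder with a known ratio of norms. Neither part exceeds `p` in `L²(K)`.
    obtain ⟨v, hv, hvp⟩ := exists_poly_projection K k (memLp_hull K hp.continuous)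
    have hz : (fun x => p x - v x) ∈ polyPerp K (k + 1) := by
      refine ⟨hp.sub (hv.mono (by omega)), fun s hs => ?_⟩
      simp only [add_tsub_cancel_right] at hs
      simp_rw [sub_mul]
      rw [integral_sub (integrable_mul_of_memLp (memLp_hull K hp.continuous)
        (memLp_hull K hs.continuous)) (integrable_mul_of_memLp (memLp_hull K hv.continuous)
        (memLp_hull K hs.continuous)), hvp s hs, sub_self]
    have h1 := ih K hK a ha v hv
    have h2 := hK.integral_sq_polyPerp hd (by omega) hz ha
    have h3 := integral_sq_projection_le (memLp_hull K hv.continuous)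
      (memLp_hull K hp.continuous) (hvp v hv)
    have hzm := memLp_hull K hz.1.continuous
    have h4 : ∫ x in hull K, (p x - v x) ^ 2 ≤ ∫ x in hull K, p x ^ 2 := by
      refine integral_sq_projection_le hzm (memLp_hull K hp.continuous) ?_
      have e : ∀ x, p x * (p x - v x) = (p x - v x) * (p x - v x) + (p x - v x) * v x := by
        intro x; ring
      simp_rw [e]
      rw [integral_add (integrable_mul_of_memLp hzm hzm)
        (integrable_mul_of_memLp hzm (memLp_hull K hv.continuous)), hz.2 v hv, add_zero]
    have h5 := integral_sq_add_le (hK.memLp_facet hd ha hv.continuous)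
      (hK.memLp_facet hd ha hz.1.continuous)
    simp only [add_sub_cancel] at h5
    push_cast at h2
    calc height K a * ∫ x, p x ^ 2 ∂(facetMeasure K a)
        ≤ 2 * (height K a * ∫ x, v x ^ 2 ∂(facetMeasure K a))
          + 2 * (height K a * ∫ x, (p x - v x) ^ 2 ∂(facetMeasure K a)) := by
          have := mul_le_mul_of_nonneg_left h5 hH.le
          linarith
      _ ≤ 2 * (C * ∫ x in hull K, p x ^ 2)
          + 2 * ((d + 2 * (k + 1)) * ∫ x in hull K, p x ^ 2) := by
          rw [h2]
          have h7 := mul_le_mul_of_nonneg_left h3 hC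
          have h6 := mul_le_mul_of_nonneg_left h4 (by positivity : (0 : ℝ) ≤ d + 2 * (k + 1))
          linarith
      _ = _ := by ring

/-- Polynomials on a facet extend to polynomials orthogonal to those of lower degree. -/
theorem exists_polyPerp_eq {k : ℕ} (hk : 1 ≤ k) {a : Space d} (ha : a ∈ K) {p : Space d → ℝ}
    (hp : IsPoly k p) : ∃ z ∈ polyPerp K k, ∀ x ∈ hull (facet K a), z x = p x := by
  -- The affine function `l` vanishes on the facet and is positive inside `K`. Hence `p - l s`
  -- agrees with `p` on the facet for every `s`, and `s` of degree `k - 1` is left to achieve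
  -- orthogonality.
  set l : Space d → ℝ := fun x => height K a - inner ℝ (normal K a) (x - a) with hl
  have hlp : IsPoly 1 l := (IsPoly.const 1 _).sub (IsPoly.inner_sub _ _)
  have hlpos : ∀ᵐ x ∂(volume.restrict (hull K)), 0 < l x := by
    rw [← restrict_interior_hull]
    refine ae_restrict_of_forall_mem isOpen_interior.measurableSet fun x hx => ?_
    obtain ⟨ε, hε, hb⟩ := Metric.isOpen_iff.1 isOpen_interior x hx
    have hn := hK.norm_normal hd ha
    have hmem : x + (ε / 2) • normal K a ∈ hull K := by
      apply interior_subset; apply hb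
      rw [Metric.mem_ball, dist_eq_norm, add_sub_cancel_left, norm_smul, hn,
        Real.norm_eq_abs, abs_of_pos (by positivity)]
      linarith
    have h1 := (hK.inner_normal_mem_Icc hd ha hmem).2
    rw [add_sub_right_comm, inner_add_right, inner_smul_right, real_inner_self_eq_norm_sq,
      hn] at h1
    simp only [hl]
    linarith
  have hmul : ∀ s, IsPoly (k - 1) s → IsPoly k (fun x => l x * s x) := fun s hs => by
    have := hlp.mul hs
    rwa [show 1 + (k - 1) = k by omega] at this
  have mS : ∀ s : polySub d (k - 1), MemLp s.1 2 (volume.restrict (hull K)) := fun s =>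
    memLp_hull K (mem_polySub.1 s.2).continuous
  have mlS : ∀ s : polySub d (k - 1), MemLp (fun x => l x * s.1 x) 2
      (volume.restrict (hull K)) := fun s =>
    memLp_hull K (hmul s.1 (mem_polySub.1 s.2)).continuous
  have mp := memLp_hull K hp.continuous
  let b : polySub d (k - 1) →ₗ[ℝ] polySub d (k - 1) →ₗ[ℝ] ℝ := LinearMap.mk₂ ℝ
    (fun s t => ∫ x in hull K, (l x * s.1 x) * t.1 x)
    (fun s s' t => by
      rw [← integral_add (integrable_mul_of_memLp (mlS s) (mS t))
        (integrable_mul_of_memLp (mlS s') (mS t))]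
      refine integral_congr_ae (ae_of_all _ fun x => ?_); simp; ring)
    (fun c s t => by
      rw [smul_eq_mul, ← integral_const_mul]
      refine integral_congr_ae (ae_of_all _ fun x => ?_); simp; ring)
    (fun s t t' => by
      rw [← integral_add (integrable_mul_of_memLp (mlS s) (mS t))
        (integrable_mul_of_memLp (mlS s) (mS t'))]
      refine integral_congr_ae (ae_of_all _ fun x => ?_); simp; ring)
    (fun c s t => by
      rw [smul_eq_mul, ← integral_const_mul]
      refine integral_congr_ae (ae_of_all _ fun x => ?_); simp; ring)
  let L : polySub d (k - 1) →ₗ[ℝ] ℝ :=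
    { toFun := fun s => ∫ x in hull K, p x * s.1 x
      map_add' := fun s t => by
        rw [← integral_add (integrable_mul_of_memLp mp (mS s)) (integrable_mul_of_memLp mp (mS t))]
        refine integral_congr_ae (ae_of_all _ fun x => ?_); simp; ring
      map_smul' := fun c s => by
        rw [RingHom.id_apply, smul_eq_mul, ← integral_const_mul]
        refine integral_congr_ae (ae_of_all _ fun x => ?_); simp; ring }
  -- Orthogonality of `p - l s` means that `s` represents `p` in the inner product with weight `l`,
  -- which is definite as `l > 0` almost everywhere.
  obtain ⟨s, hs⟩ := exists_riesz b
    (fun s t => integral_congr_ae (ae_of_all _ fun x => by simp only; ring)) L (fun s hs => by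
      have hs' : ∫ x in hull K, (l x * s.1 x) * s.1 x = 0 := hs
      rw [integral_eq_zero_iff_of_nonneg_ae ?_
        (integrable_mul_of_memLp (mlS s) (mS s))] at hs'
      · refine integral_eq_zero_of_ae ?_
        filter_upwards [hs', hlpos] with x h1 h2
        have h3 : l x * (s.1 x) ^ 2 = 0 := by
          have : l x * s.1 x * s.1 x = 0 := h1
          linarith
        rcases mul_eq_zero.1 h3 with h4 | h4
        · exact absurd h4 h2.ne'
        · have : s.1 x = 0 := by simpa using h4
          simp [this]
      · filter_upwards [hlpos] with x hx
        have : l x * s.1 x * s.1 x = l x * s.1 x ^ 2 := by ring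
        rw [this]; exact mul_nonneg hx.le (sq_nonneg _))
  have hsp := hmul s.1 (mem_polySub.1 s.2)
  refine ⟨fun x => p x - l x * s.1 x, ⟨hp.sub hsp, fun t ht => ?_⟩, fun x hx => ?_⟩
  · simp_rw [sub_mul]
    rw [integral_sub (integrable_mul_of_memLp mp (memLp_hull K ht.continuous))
      (integrable_mul_of_memLp (mlS s) (memLp_hull K ht.continuous))]
    have h : ∫ x in hull K, (l x * s.1 x) * t x = ∫ x in hull K, p x * t x :=
      hs ⟨t, mem_polySub.2 ht⟩
    rw [h, sub_self]
  · have : l x = 0 := by simp only [hl, hK.inner_normal_hull hd ha hx, sub_self]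
    simp [this]

end IsElement

/-! ### A local projection of the dual solution -/

theorem memLp_const_hull (K : Finset (Space d)) (c : ℝ) :
    MemLp (fun _ => c) 2 (volume.restrict (hull K)) := memLp_hull K continuous_const

theorem diam_hull_nonneg (K : Finset (Space d)) : 0 ≤ Metric.diam (hull K) := Metric.diam_nonneg

theorem sum_integral_sq_nonneg {ι X : Type*} [MeasurableSpace X] {ν : Measure X} (s : Finset ι)
    (g : ι → X → ℝ) : 0 ≤ ∑ i ∈ s, ∫ x, g i x ^ 2 ∂ν :=
  Finset.sum_nonneg fun _ _ => integral_nonneg fun _ => sq_nonneg _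

/-- The projection of `u` is its mean `m` plus the projection of `u - m`. On a facet, `t - m` is
controlled by the Poincaré inequality for traces, and the polynomial part by the inverse trace
inequality. -/
theorem exists_low_order_approx (hd : 1 ≤ d) (k : ℕ) : ∃ C : ℝ, 0 ≤ C ∧
    ∀ K : Finset (Space d), IsElement K → ∀ u g t, IsElemTrace K u g t →
      ∃ v, IsPoly k v ∧ (∀ s, IsPoly k s → ∫ x in hull K, v x * s x = ∫ x in hull K, u x * s x) ∧
        ∀ a ∈ K, height K a * ∫ x, (t a x - v x) ^ 2 ∂(facetMeasure K a) ≤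
          C * Metric.diam (hull K) ^ 2 * ∑ i, ∫ x in hull K, g i x ^ 2 := by
  obtain ⟨C, hC, hinv⟩ := exists_inverse_trace hd k
  refine ⟨2 * ((d + 1) * 2 ^ d + 1) + 2 * (C * 2 ^ d), by positivity, fun K hK u g t h => ?_⟩
  set m := mean (hull K) u with hm
  have hum : MemLp (fun x => u x - m) 2 (volume.restrict (hull K)) :=
    h.memu.sub (memLp_const_hull K m)
  obtain ⟨v, hv, hvp⟩ := exists_poly_projection K k hum
  have hvm := memLp_hull K hv.continuous
  refine ⟨fun x => m + v x, (IsPoly.const k m).add hv, fun s hs => ?_, fun a ha => ?_⟩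
  · have hsm := memLp_hull K hs.continuous
    have h1 := hvp s hs
    simp_rw [sub_mul] at h1
    rw [integral_sub (integrable_mul_of_memLp h.memu hsm)
      (integrable_mul_of_memLp (memLp_const_hull K m) hsm)] at h1
    simp_rw [add_mul]
    rw [integral_add (integrable_mul_of_memLp (memLp_const_hull K m) hsm)
      (integrable_mul_of_memLp hvm hsm), h1]
    ring
  · have h1 := integral_sq_projection_le hvm hum (hvp v hv)
    obtain ⟨φ, hφ, -⟩ := id h
    have h2 := hφ.poincare hK
    have h3 := h.poincare_trace hK hd ha
    have h4 := hinv K hK a ha v hv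
    have htm : MemLp (fun x => t a x - m) 2 (facetMeasure K a) :=
      (h.memLp ha).sub (hK.memLp_facet hd ha continuous_const)
    have h5 := integral_sq_sub_le htm (hK.memLp_facet hd ha hv.continuous)
    simp_rw [sub_sub] at h5
    have h6 := mul_le_mul_of_nonneg_left h5 (hK.height_pos hd ha).le
    have h7 := mul_le_mul_of_nonneg_left (h1.trans h2) hC
    simp only [← hm] at h3
    linarith

/-- Take `v = v₀ + w`, where `v₀` projects `u` onto degree `k - 1` and `w`, orthogonal to that
degree, minimises the facet distance to the trace with weights `|τ|`. The sum over facets is the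
optimality condition for `w`; since `τ` has one sign on `K`, it holds for `τ` as well as for `|τ|`.
-/
theorem exists_local_scalar (hd : 1 ≤ d) {k : ℕ} (hk : 1 ≤ k) {c : ℝ} (hc : 0 < c) :
    ∃ C : ℝ, 0 ≤ C ∧ ∀ K : Finset (Space d), IsElement K →
      (∀ a ∈ K, c * Metric.diam (hull K) ≤ height K a) →
      ∀ (τ : Space d → ℝ) (γ : ℝ), ((∀ a ∈ K, 0 ≤ τ a) ∨ ∀ a ∈ K, τ a ≤ 0) →
      (∀ a ∈ K, |τ a| ≤ γ) → ∀ u g t, IsElemTrace K u g t →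
      ∃ v, IsPoly k v ∧
        (∀ s, IsPoly (k - 1) s → ∫ x in hull K, v x * s x = ∫ x in hull K, u x * s x) ∧
        (∀ z ∈ polyPerp K k,
          ∑ a ∈ K, τ a * ∫ x, (v x - t a x) * z x ∂(facetMeasure K a) = 0) ∧
        ∀ a ∈ K, τ a ^ 2 * ∫ x, (v x - t a x) ^ 2 ∂(facetMeasure K a) ≤
          C * γ ^ 2 * Metric.diam (hull K) * ∑ i, ∫ x in hull K, g i x ^ 2 := by
  obtain ⟨C, hC, happ⟩ := exists_low_order_approx hd (k - 1)
  refine ⟨(d + 1) * (C / c), by positivity, fun K hK hcK τ γ hsign hτ u g t h => ?_⟩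
  obtain ⟨v₀, hv₀, hv₀p, hv₀t⟩ := happ K hK u g t h
  have ht0 : ∀ a ∈ K, MemLp (fun x => t a x - v₀ x) 2 (facetMeasure K a) := fun a ha =>
    (h.memLp ha).sub (hK.memLp_facet hd ha hv₀.continuous)
  obtain ⟨w, hw, hwp⟩ := exists_projection K (facetMeasure K) (fun a => |τ a|)
    (fun a _ => abs_nonneg _) (polyPerp K k)
    (fun f hf a ha => hK.memLp_facet hd ha hf.1.continuous) (fun a x => t a x - v₀ x) ht0
  have hv₀k : IsPoly k v₀ := hv₀.mono (by omega)
  have hwm : ∀ a ∈ K, MemLp w 2 (facetMeasure K a) := fun a ha =>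
    hK.memLp_facet hd ha hw.1.continuous
  have hvt : ∀ a ∈ K, MemLp (fun x => v₀ x + w x - t a x) 2 (facetMeasure K a) := fun a ha =>
    (hK.memLp_facet hd ha (hv₀k.add hw.1).continuous).sub (h.memLp ha)
  have horth : ∀ z ∈ polyPerp K k,
      ∑ a ∈ K, |τ a| * ∫ x, (v₀ x + w x - t a x) * z x ∂(facetMeasure K a) = 0 := fun z hz => by
    have h1 := hwp z hz
    rw [← sub_eq_zero, ← Finset.sum_sub_distrib] at h1
    rw [← h1]
    refine Finset.sum_congr rfl fun a ha => ?_
    have mz := hK.memLp_facet hd ha hz.1.continuous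
    rw [← mul_sub, ← integral_sub (integrable_mul_of_memLp (hwm a ha) mz)
      (integrable_mul_of_memLp (ht0 a ha) mz)]
    refine congrArg (_ * ·) (integral_congr_ae (ae_of_all _ fun x => ?_))
    ring
  -- Optimality: the minimiser is at least as good as the choice `w = 0`.
  have hpyth : ∑ a ∈ K, |τ a| * ∫ x, (v₀ x + w x - t a x) ^ 2 ∂(facetMeasure K a) ≤
      ∑ a ∈ K, |τ a| * ∫ x, (t a x - v₀ x) ^ 2 ∂(facetMeasure K a) := by
    have h1 := horth w hw
    have h2 : ∀ a ∈ K, |τ a| * ∫ x, (t a x - v₀ x) ^ 2 ∂(facetMeasure K a) =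
        |τ a| * (∫ x, (v₀ x + w x - t a x) ^ 2 ∂(facetMeasure K a))
          - 2 * (|τ a| * ∫ x, (v₀ x + w x - t a x) * w x ∂(facetMeasure K a))
          + |τ a| * ∫ x, w x ^ 2 ∂(facetMeasure K a) := fun a ha => by
      have i1 := (hvt a ha).integrable_sq
      have i2 := (integrable_mul_of_memLp (hvt a ha) (hwm a ha)).const_mul 2
      have i3 : Integrable (fun x => (v₀ x + w x - t a x) ^ 2
        - 2 * ((v₀ x + w x - t a x) * w x)) (facetMeasure K a) := i1.sub i2
      have e : ∀ x, (t a x - v₀ x) ^ 2 = ((v₀ x + w x - t a x) ^ 2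
        - 2 * ((v₀ x + w x - t a x) * w x)) + w x ^ 2 := fun x => by ring
      simp_rw [e]
      rw [integral_add i3 (hwm a ha).integrable_sq, integral_sub i1 i2, integral_const_mul]
      ring
    rw [Finset.sum_congr rfl h2, Finset.sum_add_distrib, Finset.sum_sub_distrib,
      ← Finset.mul_sum, h1, mul_zero, sub_zero]
    exact le_add_of_nonneg_right (Finset.sum_nonneg fun a _ =>
      mul_nonneg (abs_nonneg _) (integral_nonneg fun x => sq_nonneg _))
  refine ⟨fun x => v₀ x + w x, hv₀k.add hw.1, fun s hs => ?_, fun z hz => ?_, fun a ha => ?_⟩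
  · have hsm := memLp_hull K hs.continuous
    simp_rw [add_mul]
    rw [integral_add (integrable_mul_of_memLp (memLp_hull K hv₀.continuous) hsm)
      (integrable_mul_of_memLp (memLp_hull K hw.1.continuous) hsm), hw.2 s hs, add_zero,
      hv₀p s hs]
  · have h1 := horth z hz
    rcases hsign with hs | hs
    · rw [← h1]
      exact Finset.sum_congr rfl fun a ha => by rw [abs_of_nonneg (hs a ha)]
    · rw [← neg_eq_zero, ← Finset.sum_neg_distrib, ← h1]
      exact Finset.sum_congr rfl fun a ha => by rw [abs_of_nonpos (hs a ha), neg_mul]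
  · have hγ : 0 ≤ γ := (abs_nonneg _).trans (hτ a ha)
    set S := ∑ i, ∫ x in hull K, g i x ^ 2 with hS
    have hS0 : 0 ≤ S := sum_integral_sq_nonneg _ _
    -- The bound has the squared diameter over the height; shape regularity reduces this to one
    -- power of the diameter.
    have hT : ∀ b ∈ K, ∫ x, (t b x - v₀ x) ^ 2 ∂(facetMeasure K b)
        ≤ C / c * Metric.diam (hull K) * S := fun b hb => by
      have h1 := hv₀t b hb
      have hH := hK.height_pos hd hb
      have hh : 0 < Metric.diam (hull K) := hH.trans_le (hK.height_le_diam hd hb)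
      have h2 := mul_le_mul_of_nonneg_right (hcK b hb)
        (integral_nonneg (μ := facetMeasure K b) fun x => sq_nonneg (t b x - v₀ x))
      have h3 := h2.trans h1
      rw [div_mul_eq_mul_div, div_mul_eq_mul_div, le_div_iff₀ hc]
      refine le_of_mul_le_mul_right ?_ hh
      linarith
    have hI : ∀ b, 0 ≤ ∫ x, (v₀ x + w x - t b x) ^ 2 ∂(facetMeasure K b) := fun b =>
      integral_nonneg fun x => sq_nonneg _
    -- One factor `|τ a|` is bounded by `γ`; the other stays as a weight so that optimality can be
    -- used. The sum over the `d + 1` facets gives the factor `d + 1`.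
    calc τ a ^ 2 * ∫ x, (v₀ x + w x - t a x) ^ 2 ∂(facetMeasure K a)
        = |τ a| * (|τ a| * ∫ x, (v₀ x + w x - t a x) ^ 2 ∂(facetMeasure K a)) := by
          rw [← mul_assoc, ← pow_two, sq_abs]
      _ ≤ γ * (|τ a| * ∫ x, (v₀ x + w x - t a x) ^ 2 ∂(facetMeasure K a)) :=
          mul_le_mul_of_nonneg_right (hτ a ha) (mul_nonneg (abs_nonneg _) (hI a))
      _ ≤ γ * ∑ b ∈ K, |τ b| * ∫ x, (t b x - v₀ x) ^ 2 ∂(facetMeasure K b) := by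
          refine mul_le_mul_of_nonneg_left ?_ hγ
          exact (Finset.single_le_sum (f := fun b => |τ b| *
            ∫ x, (v₀ x + w x - t b x) ^ 2 ∂(facetMeasure K b))
            (fun b _ => mul_nonneg (abs_nonneg _) (hI b)) ha).trans hpyth
      _ ≤ γ * ∑ b ∈ K, γ * (C / c * Metric.diam (hull K) * S) := by
          refine mul_le_mul_of_nonneg_left (Finset.sum_le_sum fun b hb => ?_) hγ
          exact mul_le_mul (hτ b hb) (hT b hb) (integral_nonneg fun x => sq_nonneg _) hγ
      _ = _ := by
          rw [Finset.sum_const, hK.card, nsmul_eq_mul]; push_cast; ring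

/-- A field with components orthogonal to degree `k - 1` can be given its normal components on all
facets but one. On the last facet they are forced by Green's formula, whose volume terms vanish, and
`horth` is precisely the compatibility condition. -/
theorem exists_local_vector (hd : 1 ≤ d) {k : ℕ} (hk : 1 ≤ k) {c : ℝ} (hc : 0 < c)
    {K : Finset (Space d)} (hK : IsElement K)
    (hcK : ∀ a ∈ K, c * Metric.diam (hull K) ≤ height K a)
    {E : ℝ} {τ : Space d → ℝ} {y : Space d → Space d → ℝ}
    (hy : ∀ a ∈ K, MemLp (y a) 2 (facetMeasure K a))
    (horth : ∀ z ∈ polyPerp K k, ∑ a ∈ K, τ a * ∫ x, y a x * z x ∂(facetMeasure K a) = 0)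
    (hE : ∀ a ∈ K, τ a ^ 2 * ∫ x, y a x ^ 2 ∂(facetMeasure K a) ≤ E) :
    ∃ r : Space d → Space d, IsPolyVec k r ∧
      (∀ i, ∀ s, IsPoly (k - 1) s → ∫ x in hull K, r x i * s x = 0) ∧
      (∀ a ∈ K, ∀ μ, IsPoly k μ →
        ∫ x, inner ℝ (r x) (normal K a) * μ x ∂(facetMeasure K a)
          = τ a * ∫ x, y a x * μ x ∂(facetMeasure K a)) ∧
      ∑ i, ∫ x in hull K, r x i ^ 2 ≤ d ^ 3 / c ^ 2 * Metric.diam (hull K) * E := by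
  classical
  obtain ⟨a₀, ha₀⟩ : K.Nonempty := by rw [← Finset.card_pos, hK.card]; omega
  have hex : ∀ a ∈ K, ∃ z ∈ polyPerp K k, ∀ f ∈ polyPerp K k,
      ∫ x, z x * f x ∂(facetMeasure K a) = τ a * ∫ x, y a x * f x ∂(facetMeasure K a) :=
    fun a ha => by
      obtain ⟨z, hz, h⟩ := exists_projection (Finset.univ : Finset Unit)
        (fun _ => facetMeasure K a) (fun _ => 1) (by simp) (polyPerp K k)
        (fun f hf _ _ => hK.memLp_facet hd ha hf.1.continuous) (fun _ x => τ a * y a x)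
        (fun _ _ => (hy a ha).const_mul _)
      refine ⟨z, hz, fun f hf => ?_⟩
      have := h f hf
      simpa [mul_assoc, integral_const_mul] using this
  choose! z hz hzp using hex
  have hzp' : ∀ a ∈ K, ∀ f, IsPoly k f →
      ∫ x, z a x * f x ∂(facetMeasure K a) = τ a * ∫ x, y a x * f x ∂(facetMeasure K a) := by
    intro a ha f hf
    obtain ⟨f', hf', he⟩ := hK.exists_polyPerp_eq hd hk ha hf
    have key : ∀ w : Space d → ℝ, ∫ x, w x * f x ∂(facetMeasure K a)
        = ∫ x, w x * f' x ∂(facetMeasure K a) := fun w =>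
      setIntegral_congr_fun (isCompact_hull _).measurableSet fun x hx => by
        simp only [he x hx]
    rw [key, key, hzp a ha f' hf']
  -- The function `z a` is a projection of `τ a • y a` on the facet, so its facet norm is bounded by
  -- `E`; the exact ratio of norms carries the bound to the element.
  have hzn : ∀ a ∈ K, ∫ x in hull K, z a x ^ 2 ≤ Metric.diam (hull K) * E := fun a ha => by
    have mz := hK.memLp_facet hd ha (hz a ha).1.continuous
    have h1 := integral_sq_projection_le mz ((hy a ha).const_mul (τ a)) (by
      rw [hzp a ha _ (hz a ha), ← integral_const_mul]
      exact integral_congr_ae (ae_of_all _ fun x => (mul_assoc _ _ _).symm))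
    simp_rw [mul_pow] at h1
    rw [integral_const_mul] at h1
    have h2 := hK.integral_sq_polyPerp hd hk (hz a ha) ha
    have h3 : 0 ≤ ∫ x in hull K, z a x ^ 2 := integral_nonneg fun x => sq_nonneg _
    have h4 : (1 : ℝ) ≤ d + 2 * k := by
      have : (1 : ℝ) ≤ d := by exact_mod_cast hd
      have : (0 : ℝ) ≤ k := k.cast_nonneg
      linarith
    calc ∫ x in hull K, z a x ^ 2 ≤ (d + 2 * k) * ∫ x in hull K, z a x ^ 2 :=
          le_mul_of_one_le_left h3 h4
      _ = height K a * ∫ x, z a x ^ 2 ∂(facetMeasure K a) := h2.symm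
      _ ≤ Metric.diam (hull K) * E :=
          mul_le_mul (hK.height_le_diam hd ha) (h1.trans (hE a ha))
            (integral_nonneg fun x => sq_nonneg _) (diam_hull_nonneg K)
  -- The edge `a₀ - a` is tangential to every facet except those opposite to `a` and `a₀`, and has
  -- normal component `height K a` on the former. So `r` has normal component `z b` on the facet
  -- opposite to each `b ≠ a₀`.
  set r : Space d → Space d := fun x => ∑ a ∈ K.erase a₀, (z a x / height K a) • (a₀ - a) with hr
  have hri : ∀ i x, r x i = ∑ a ∈ K.erase a₀, (a₀ i - a i) / height K a * z a x := fun i x => by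
    simp only [hr, WithLp.ofLp_sum, Finset.sum_apply]
    refine Finset.sum_congr rfl fun a _ => ?_
    simp only [PiLp.smul_apply, PiLp.sub_apply, smul_eq_mul]
    ring
  have hmem : ∀ a ∈ K.erase a₀, a ∈ K := fun a ha => Finset.mem_of_mem_erase ha
  have hrS : ∀ i, (fun x => r x i) ∈ polyPerp K k := fun i => by
    have : (fun x => r x i) = ∑ a ∈ K.erase a₀, ((a₀ i - a i) / height K a) • z a := by
      ext x; rw [hri]; simp
    rw [this]
    exact Submodule.sum_mem _ fun a ha => Submodule.smul_mem _ _ (hz a (hmem a ha))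
  have hnb : ∀ b ∈ K.erase a₀, ∀ x, inner ℝ (r x) (normal K b) = z b x := fun b hb x => by
    have hbK := hmem b hb
    have hb0 := (Finset.mem_erase.1 hb).1
    have hH := hK.height_pos hd hbK
    simp only [hr, sum_inner, inner_smul_left]
    rw [Finset.sum_eq_single_of_mem b hb]
    · rw [real_inner_comm, hK.inner_normal_vertex hd hbK ha₀ hb0.symm]
      simp only [conj_trivial]
      field_simp
    · intro a ha hab
      rw [real_inner_comm, hK.inner_normal_edge hd hbK (hmem a ha) ha₀ hab hb0.symm, mul_zero]
  refine ⟨r, fun i => (hrS i).1, fun i s hs => (hrS i).2 s hs, fun a ha μ hμ => ?_, ?_⟩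
  · by_cases haa : a = a₀
    · subst haa
      obtain ⟨f, hf, he⟩ := hK.exists_polyPerp_eq hd hk ha hμ
      have key : ∀ w : Space d → ℝ, ∫ x, w x * μ x ∂(facetMeasure K a)
          = ∫ x, w x * f x ∂(facetMeasure K a) := fun w =>
        setIntegral_congr_fun (isCompact_hull _).measurableSet fun x hx => by
          simp only [he x hx]
      rw [key, key]
      -- Green's formula for `f` and `r`: both are orthogonal to degree `k - 1`, so the boundary
      -- terms sum to zero. Subtracting `horth` leaves the identity on the remaining facet.
      have hg := (isElemTrace_of_smooth hK hd hf.1.contDiff).green_vec hK hd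
        (r := r) (fun i => (hrS i).1.contDiff)
      have z1 : ∀ i, ∫ x in hull K, partialDeriv i f x * r x i = 0 := fun i => by
        rw [← (hrS i).2 _ (hf.1.partialDeriv i)]
        exact integral_congr_ae (ae_of_all _ fun x => mul_comm _ _)
      have z2 : ∫ x in hull K, f x * ∑ i, partialDeriv i (fun y => r y i) x = 0 :=
        hf.2 _ (IsPoly.sum _ fun i _ => (hrS i).1.partialDeriv i)
      rw [z2, Finset.sum_eq_zero fun i _ => z1 i, ← Finset.add_sum_erase K _ ha] at hg
      have ho := horth f hf
      rw [← Finset.add_sum_erase K _ ha] at ho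
      have e2 : ∑ b ∈ K.erase a, ∫ x, f x * inner ℝ (r x) (normal K b) ∂(facetMeasure K b)
          = ∑ b ∈ K.erase a, τ b * ∫ x, y b x * f x ∂(facetMeasure K b) :=
        Finset.sum_congr rfl fun b hb => by
          rw [← hzp b (hmem b hb) f hf]
          refine integral_congr_ae (ae_of_all _ fun x => ?_)
          simp only [hnb b hb x, mul_comm]
      have e3 : ∫ x, inner ℝ (r x) (normal K a) * f x ∂(facetMeasure K a)
          = ∫ x, f x * inner ℝ (r x) (normal K a) ∂(facetMeasure K a) :=
        integral_congr_ae (ae_of_all _ fun x => mul_comm _ _)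
      rw [e3]
      linarith
    · have haE := Finset.mem_erase.2 ⟨haa, ha⟩
      simp_rw [hnb a haE]
      exact hzp' a ha μ hμ
  -- Edges are no longer than the diameter, and heights are at least `c` times the diameter.
  · have hcoef : ∀ a ∈ K, ∀ i, ((a₀ i - a i) / height K a) ^ 2 ≤ 1 / c ^ 2 := fun a ha i => by
      have hH := hK.height_pos hd ha
      have hh : 0 < Metric.diam (hull K) := hH.trans_le (hK.height_le_diam hd ha)
      have h1 : |a₀ i - a i| ≤ Metric.diam (hull K) := by
        have h2 : ‖(a₀ - a) i‖ ≤ ‖a₀ - a‖ := PiLp.norm_apply_le _ i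
        rw [PiLp.sub_apply, Real.norm_eq_abs] at h2
        refine h2.trans ?_
        rw [← dist_eq_norm]
        exact Metric.dist_le_diam_of_mem (isCompact_hull K).isBounded (subset_hull ha₀)
          (subset_hull ha)
      have h3 := hcK a ha
      rw [div_pow, div_le_div_iff₀ (by positivity) (by positivity), one_mul, ← mul_pow]
      refine sq_le_sq' ?_ ?_
      · have := neg_abs_le (a₀ i - a i)
        nlinarith
      · have := le_abs_self (a₀ i - a i)
        nlinarith
    have hi : ∀ i, ∫ x in hull K, r x i ^ 2 ≤ d ^ 2 / c ^ 2 * (Metric.diam (hull K) * E) := by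
      intro i
      have hcardE : (K.erase a₀).card = d := by
        rw [Finset.card_erase_of_mem ha₀, hK.card]; rfl
      have iz : ∀ a ∈ K.erase a₀, Integrable (fun x => z a x ^ 2) (volume.restrict (hull K)) :=
        fun a ha => (memLp_hull K (hz a (hmem a ha)).1.continuous).integrable_sq
      have hpt : ∀ x, r x i ^ 2 ≤ ∑ a ∈ K.erase a₀, d * (1 / c ^ 2) * z a x ^ 2 := fun x => by
        rw [hri]
        refine (sq_sum_le_card_mul_sum_sq).trans ?_
        rw [hcardE, Finset.mul_sum]
        refine Finset.sum_le_sum fun a ha => ?_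
        rw [mul_pow, mul_assoc]
        refine mul_le_mul_of_nonneg_left ?_ d.cast_nonneg
        exact mul_le_mul_of_nonneg_right (hcoef a (hmem a ha) i) (sq_nonneg _)
      have iR : Integrable (fun x => ∑ a ∈ K.erase a₀, d * (1 / c ^ 2) * z a x ^ 2)
        (volume.restrict (hull K)) := integrable_finsetSum _ fun a ha => (iz a ha).const_mul _
      refine (integral_mono (memLp_hull K (hrS i).1.continuous).integrable_sq iR hpt).trans ?_
      rw [integral_finsetSum _ fun a ha => (iz a ha).const_mul _]
      simp_rw [integral_const_mul]
      calc ∑ a ∈ K.erase a₀, (d : ℝ) * (1 / c ^ 2) * ∫ x in hull K, z a x ^ 2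
          ≤ ∑ a ∈ K.erase a₀, (d : ℝ) * (1 / c ^ 2) * (Metric.diam (hull K) * E) :=
            Finset.sum_le_sum fun a ha =>
              mul_le_mul_of_nonneg_left (hzn a (hmem a ha)) (by positivity)
        _ = _ := by rw [Finset.sum_const, hcardE, nsmul_eq_mul]; ring
    refine (Finset.sum_le_sum fun i _ => hi i).trans (le_of_eq ?_)
    rw [Finset.sum_const, Finset.card_univ, Fintype.card_fin, nsmul_eq_mul]; ring

/-- This is the HDG projection of `(0, u)` with the sign of `τ` reversed, as the adjoint method
requires: the facet condition reads `r·n - τ v = -τ u`. The estimate contains no inverse of `τ`, so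
facets with `τ = 0` do no harm. -/
theorem exists_local_dual (hd : 1 ≤ d) {k : ℕ} (hk : 1 ≤ k) {c : ℝ} (hc : 0 < c) :
    ∃ C : ℝ, 0 ≤ C ∧ ∀ K : Finset (Space d), IsElement K →
      (∀ a ∈ K, c * Metric.diam (hull K) ≤ height K a) →
      ∀ (τ : Space d → ℝ) (γ : ℝ), ((∀ a ∈ K, 0 ≤ τ a) ∨ ∀ a ∈ K, τ a ≤ 0) →
      (∀ a ∈ K, |τ a| ≤ γ) → ∀ u g t, IsElemTrace K u g t →
      ∃ (v : Space d → ℝ) (r : Space d → Space d), IsPoly k v ∧ IsPolyVec k r ∧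
        (∀ s, IsPoly (k - 1) s → ∫ x in hull K, v x * s x = ∫ x in hull K, u x * s x) ∧
        (∀ i, ∀ s, IsPoly (k - 1) s → ∫ x in hull K, r x i * s x = 0) ∧
        (∀ a ∈ K, ∀ μ, IsPoly k μ →
          ∫ x, inner ℝ (r x) (normal K a) * μ x ∂(facetMeasure K a)
            = τ a * ∫ x, (v x - t a x) * μ x ∂(facetMeasure K a)) ∧
        ∑ i, ∫ x in hull K, r x i ^ 2 ≤
          C * γ ^ 2 * Metric.diam (hull K) ^ 2 * ∑ i, ∫ x in hull K, g i x ^ 2 := by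
  obtain ⟨C, hC, h1⟩ := exists_local_scalar hd hk hc
  refine ⟨d ^ 3 / c ^ 2 * C, by positivity, fun K hK hcK τ γ hsign hτ u g t h => ?_⟩
  obtain ⟨v, hv, hvp, horth, hE⟩ := h1 K hK hcK τ γ hsign hτ u g t h
  obtain ⟨r, hr, hr1, hr2, hr3⟩ := exists_local_vector hd hk hc hK hcK (τ := τ)
    (y := fun a x => v x - t a x)
    (fun a ha => (hK.memLp_facet hd ha hv.continuous).sub (h.memLp ha)) horth hE
  exact ⟨v, r, hv, hr, hvp, hr1, hr2, hr3.trans (le_of_eq (by ring))⟩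

/-! ### Lowest order Raviart-Thomas interpolation -/

/-- The lowest order Raviart-Thomas function whose normal component on the facet opposite to `a`
is `m a`. -/
def raviartThomas (K : Finset (Space d)) (m : Space d → ℝ) (x : Space d) : Space d :=
  ∑ a ∈ K, (m a / height K a) • (x - a)

theorem raviartThomas_apply (K : Finset (Space d)) (m : Space d → ℝ) (x : Space d) (i : Fin d) :
    raviartThomas K m x i = ∑ a ∈ K, m a / height K a * (x i - a i) := by
  simp [raviartThomas]

theorem isPolyVec_raviartThomas (K : Finset (Space d)) (m : Space d → ℝ) :
    IsPolyVec 1 (raviartThomas K m) := fun i => by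
  simp_rw [raviartThomas_apply]
  exact IsPoly.sum _ fun a _ => ((IsPoly.coord i).sub (IsPoly.const 1 _)).const_mul _

theorem partialDeriv_raviartThomas (K : Finset (Space d)) (m : Space d → ℝ) (i : Fin d)
    (x : Space d) :
    partialDeriv i (fun y => raviartThomas K m y i) x = ∑ a ∈ K, m a / height K a := by
  have h : (fun y => raviartThomas K m y i)
      = fun y => ∑ a ∈ K, m a / height K a * (y i - a i) := funext fun y => raviartThomas_apply ..
  have h1 : HasFDerivAt (fun y : Space d => y i)
      (EuclideanSpace.proj i : Space d →L[ℝ] ℝ) x :=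
    (EuclideanSpace.proj i : Space d →L[ℝ] ℝ).hasFDerivAt
  have h2 : HasFDerivAt (fun y : Space d => ∑ a ∈ K, m a / height K a * (y i - a i))
      (∑ a ∈ K, (m a / height K a) • (EuclideanSpace.proj i : Space d →L[ℝ] ℝ)) x :=
    HasFDerivAt.fun_sum fun a _ => (h1.sub_const (a i)).const_mul (m a / height K a)
  rw [partialDeriv, h, h2.fderiv]
  simp

theorem div_raviartThomas (K : Finset (Space d)) (m : Space d → ℝ) (x : Space d) :
    ∑ i, partialDeriv i (fun y => raviartThomas K m y i) x
      = d * ∑ a ∈ K, m a / height K a := by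
  simp [partialDeriv_raviartThomas]

theorem sq_integral_le {X : Type*} [MeasurableSpace X] {ν : Measure X} [IsFiniteMeasure ν]
    {f : X → ℝ} (hf : MemLp f 2 ν) : (∫ x, f x ∂ν) ^ 2 ≤ ν.real Set.univ * ∫ x, f x ^ 2 ∂ν := by
  have h := abs_integral_mul_le_sqrt (memLp_const (1 : ℝ)) hf
  simp only [one_mul, one_pow, integral_const, smul_eq_mul, mul_one] at h
  rw [← Real.sqrt_mul measureReal_nonneg] at h
  have h2 := pow_le_pow_left₀ (abs_nonneg _) h 2
  rwa [sq_abs, Real.sq_sqrt (mul_nonneg measureReal_nonneg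
    (integral_nonneg fun x => sq_nonneg _))] at h2

/-- The mean over the facet opposite to `a` of the normal component of the field with
traces `t`. -/
def meanFlux (K : Finset (Space d)) (t : Fin d → Space d → Space d → ℝ) (a : Space d) : ℝ :=
  ((surface d).real (hull (facet K a)))⁻¹ *
    ∫ x, ∑ i, t i a x * normal K a i ∂(facetMeasure K a)

namespace IsElement

variable {K : Finset (Space d)} (hK : IsElement K) (hd : 1 ≤ d)
include hK hd

theorem inner_raviartThomas_normal (m : Space d → ℝ) {b x : Space d} (hb : b ∈ K)
    (hx : x ∈ hull (facet K b)) : inner ℝ (raviartThomas K m x) (normal K b) = m b := by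
  have hH := hK.height_pos hd hb
  simp only [raviartThomas, sum_inner, inner_smul_left, conj_trivial]
  rw [Finset.sum_eq_single_of_mem b hb]
  · rw [real_inner_comm, hK.inner_normal_hull hd hb hx]
    field_simp
  · intro a ha hab
    have e : x - a = (x - b) - (a - b) := by abel
    rw [real_inner_comm, e, inner_sub_right, hK.inner_normal_hull hd hb hx,
      hK.inner_normal_vertex hd hb ha hab, sub_self, mul_zero]

theorem surface_mul_meanFlux (t : Fin d → Space d → Space d → ℝ) {a : Space d} (ha : a ∈ K) :
    (surface d).real (hull (facet K a)) * meanFlux K t a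
      = ∫ x, ∑ i, t i a x * normal K a i ∂(facetMeasure K a) := by
  rw [meanFlux, mul_inv_cancel_left₀ (hK.surface_facet_pos hd ha).ne']

theorem isFiniteMeasure_facet {a : Space d} (ha : a ∈ K) : IsFiniteMeasure (facetMeasure K a) :=
  ⟨by simpa using hK.surface_facet_lt_top hd ha⟩

theorem volume_mul_div_raviartThomas (m : Space d → ℝ) :
    volume.real (hull K) * (d * ∑ a ∈ K, m a / height K a)
      = ∑ a ∈ K, (surface d).real (hull (facet K a)) * m a := by
  rw [Finset.mul_sum, Finset.mul_sum]
  refine Finset.sum_congr rfl fun a ha => ?_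
  have h := hK.card_mul_volume hd ha
  have hH := hK.height_pos hd ha
  field_simp
  linear_combination (m a) * h

variable {Φ : Fin d → Space d → ℝ} {g : Fin d → Fin d → Space d → ℝ}
  {t : Fin d → Space d → Space d → ℝ} (h : ∀ i, IsElemTrace K (Φ i) (g i) (t i))
include h

theorem integral_div_eq :
    ∑ i, ∫ x in hull K, g i i x
      = ∑ a ∈ K, ∫ x, ∑ i, t i a x * normal K a i ∂(facetMeasure K a) := by
  have h1 : ∀ i, ∫ x in hull K, g i i x
      = ∑ a ∈ K, ∫ x, t i a x * normal K a i ∂(facetMeasure K a) := fun i => by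
    have := (h i).green hK hd (ψ := fun _ => 1) contDiff_const i
    have e : ∀ x, partialDeriv i (fun _ : Space d => (1 : ℝ)) x = 0 := fun x => by
      simp [partialDeriv]
    simp only [mul_one, e, mul_zero, integral_zero, add_zero] at this
    rw [this]
    refine Finset.sum_congr rfl fun a _ => ?_
    rw [integral_mul_const, mul_comm]
  simp_rw [h1]
  rw [Finset.sum_comm]
  refine Finset.sum_congr rfl fun a ha => ?_
  have := hK.isFiniteMeasure_facet hd ha
  rw [integral_finsetSum _ fun i _ => (((h i).memLp ha).integrable (by norm_num)).mul_const _]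

/-- The commuting property: the constant divergence of the interpolant is the mean of the divergence
of the field, since both have the same facet fluxes. -/
theorem volume_mul_div_raviartThomas_meanFlux :
    volume.real (hull K) * (d * ∑ a ∈ K, meanFlux K t a / height K a)
      = ∑ i, ∫ x in hull K, g i i x := by
  rw [hK.volume_mul_div_raviartThomas hd, hK.integral_div_eq hd h]
  exact Finset.sum_congr rfl fun a ha => hK.surface_mul_meanFlux hd t ha

/-- The square of a facet mean is at most the mean square. Writing `d` times the volume as height
times facet area leaves the left-hand side of the Poincaré inequality for traces, with the vector
`c` of element means subtracted. -/
theorem sq_meanFlux_sub_le {a : Space d} (ha : a ∈ K) (c : Space d)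
    (hc : ∀ i, c i = mean (hull K) (Φ i)) :
    d * volume.real (hull K) * (meanFlux K t a - inner ℝ (normal K a) c) ^ 2 ≤
      ((d + 1) * 2 ^ d + 1) * Metric.diam (hull K) ^ 2 *
        ∑ i, ∑ j, ∫ x in hull K, g i j x ^ 2 := by
  have hfin := hK.isFiniteMeasure_facet hd ha
  have hs := hK.surface_facet_pos hd ha
  set s := (surface d).real (hull (facet K a)) with hsdef
  have mt : ∀ i, MemLp (fun x => t i a x - c i) 2 (facetMeasure K a) := fun i =>
    ((h i).memLp ha).sub (memLp_const _)
  have e1 : s * (meanFlux K t a - inner ℝ (normal K a) c)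
      = ∫ x, ∑ i, (t i a x - c i) * normal K a i ∂(facetMeasure K a) := by
    have e2 : ∀ x, ∑ i, (t i a x - c i) * normal K a i
        = (∑ i, t i a x * normal K a i) - inner ℝ (normal K a) c := fun x => by
      rw [PiLp.inner_apply, ← Finset.sum_sub_distrib]
      refine Finset.sum_congr rfl fun i _ => ?_
      simp; ring
    simp_rw [e2]
    rw [integral_sub (integrable_finsetSum _ fun i _ =>
      (((h i).memLp ha).integrable (by norm_num)).mul_const _) (integrable_const _),
      ← hK.surface_mul_meanFlux hd t ha, integral_const, measureReal_restrict_apply_univ,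
      smul_eq_mul]
    ring
  have msum : MemLp (fun x => ∑ i, (t i a x - c i) * normal K a i) 2 (facetMeasure K a) :=
    memLp_finsetSum _ fun i _ => (mt i).mul_const _
  have h1 := sq_integral_le msum
  rw [← e1, measureReal_restrict_apply_univ, ← hsdef] at h1
  have h2 : ∫ x, (∑ i, (t i a x - c i) * normal K a i) ^ 2 ∂(facetMeasure K a)
      ≤ ∑ i, ∫ x, (t i a x - c i) ^ 2 ∂(facetMeasure K a) := by
    rw [← integral_finsetSum _ fun i _ => (mt i).integrable_sq]
    refine integral_mono msum.integrable_sq (integrable_finsetSum _ fun i _ =>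
      (mt i).integrable_sq) fun x => ?_
    have := Finset.sum_mul_sq_le_sq_mul_sq Finset.univ (fun i => t i a x - c i)
      (fun i => normal K a i)
    have hn : ∑ i, normal K a i ^ 2 = 1 := by
      have := EuclideanSpace.norm_sq_eq (normal K a)
      rw [hK.norm_normal hd ha] at this
      simpa using this.symm
    rwa [hn, mul_one] at this
  have h3 : height K a * ∑ i, ∫ x, (t i a x - c i) ^ 2 ∂(facetMeasure K a) ≤
      ((d + 1) * 2 ^ d + 1) * Metric.diam (hull K) ^ 2 *
        ∑ i, ∑ j, ∫ x in hull K, g i j x ^ 2 := by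
    rw [Finset.mul_sum, Finset.mul_sum]
    refine Finset.sum_le_sum fun i _ => ?_
    rw [hc i]
    exact (h i).poincare_trace hK hd ha
  have h4 : s * (meanFlux K t a - inner ℝ (normal K a) c) ^ 2
      ≤ ∑ i, ∫ x, (t i a x - c i) ^ 2 ∂(facetMeasure K a) := by
    refine le_trans ?_ h2
    refine le_of_mul_le_mul_left ?_ hs
    linarith
  have h5 := mul_le_mul_of_nonneg_left h4 (hK.height_pos hd ha).le
  rw [hK.card_mul_volume hd ha]
  linarith

/-- Approximation by the lowest order Raviart-Thomas interpolant. -/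
theorem raviartThomas_error {c : ℝ} (hc : 0 < c)
    (hcK : ∀ a ∈ K, c * Metric.diam (hull K) ≤ height K a) :
    ∑ i, ∫ x in hull K, (raviartThomas K (meanFlux K t) x i - Φ i x) ^ 2 ≤
      (2 * (d * (d + 1) ^ 2 / c ^ 2 * ((d + 1) * 2 ^ d + 1)) + 2 * 2 ^ d)
        * Metric.diam (hull K) ^ 2 * ∑ i, ∑ j, ∫ x in hull K, g i j x ^ 2 := by
  have hd' : (1 : ℝ) ≤ d := by exact_mod_cast hd
  set S := ∑ i, ∑ j, ∫ x in hull K, g i j x ^ 2 with hS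
  set D := Metric.diam (hull K) with hD
  set C₁ : ℝ := ((d + 1) * 2 ^ d + 1) * D ^ 2 * S with hC₁
  have hS0 : 0 ≤ S := Finset.sum_nonneg fun i _ => sum_integral_sq_nonneg _ _
  have hC₁0 : 0 ≤ C₁ := by positivity
  have hvol := hK.volume_pos
  have hfinK : IsFiniteMeasure (volume.restrict (hull K)) :=
    ⟨by simpa using (isCompact_hull K).measure_lt_top⟩
  set m := meanFlux K t
  set b : Space d := WithLp.toLp 2 fun i => mean (hull K) (Φ i) with hb
  have hbi : ∀ i, b i = mean (hull K) (Φ i) := fun i => rfl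
  set e : Space d → ℝ := fun a => m a - inner ℝ (normal K a) b with he
  have he2 : ∀ a ∈ K, volume.real (hull K) * e a ^ 2 ≤ C₁ := fun a ha => by
    have h1 := hK.sq_meanFlux_sub_le hd h ha b hbi
    refine le_trans ?_ h1
    rw [mul_assoc]
    exact le_mul_of_one_le_left (mul_nonneg hvol.le (sq_nonneg _)) hd'
  -- A constant vector is its own Raviart-Thomas interpolant, so only the flux defects `e a` remain
  -- as coefficients.
  have hrb : ∀ x i, raviartThomas K m x i - b i
      = ∑ a ∈ K, e a / height K a * (x i - a i) := fun x i => by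
    have h1 := congrArg (fun y : Space d => y i) (hK.sum_normal_component hd x b)
    simp only [WithLp.ofLp_sum, Finset.sum_apply, PiLp.smul_apply, PiLp.sub_apply,
      smul_eq_mul] at h1
    rw [← h1, raviartThomas_apply, ← Finset.sum_sub_distrib]
    refine Finset.sum_congr rfl fun a _ => ?_
    simp only [he]; ring
  have mr : ∀ i, MemLp (fun x => raviartThomas K m x i - b i) 2 (volume.restrict (hull K)) :=
    fun i => (memLp_hull K (isPolyVec_raviartThomas K m i).continuous).sub (memLp_const _)
  have hrc : ∀ i, ∫ x in hull K, (raviartThomas K m x i - b i) ^ 2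
      ≤ (d + 1) ^ 2 / c ^ 2 * C₁ := fun i => by
    have hpt : ∀ x ∈ hull K, (raviartThomas K m x i - b i) ^ 2
        ≤ (d + 1) * ∑ a ∈ K, e a ^ 2 * (1 / c ^ 2) := fun x hx => by
      rw [hrb]
      refine sq_sum_le_card_mul_sum_sq.trans ?_
      rw [hK.card]; push_cast
      refine mul_le_mul_of_nonneg_left (Finset.sum_le_sum fun a ha => ?_) (by positivity)
      have hH := hK.height_pos hd ha
      have hh : 0 < D := hH.trans_le (hK.height_le_diam hd ha)
      have h1 : |x i - a i| ≤ D := by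
        have h2 : ‖(x - a) i‖ ≤ ‖x - a‖ := PiLp.norm_apply_le _ i
        rw [PiLp.sub_apply, Real.norm_eq_abs] at h2
        refine h2.trans ?_
        rw [← dist_eq_norm]
        exact Metric.dist_le_diam_of_mem (isCompact_hull K).isBounded hx (subset_hull ha)
      have h3 := hcK a ha
      rw [div_mul_eq_mul_div, mul_div_assoc, mul_pow]
      refine mul_le_mul_of_nonneg_left ?_ (sq_nonneg _)
      rw [div_pow, div_le_div_iff₀ (by positivity) (by positivity), one_mul, ← mul_pow]
      refine sq_le_sq' ?_ ?_
      · have := neg_abs_le (x i - a i)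
        nlinarith
      · have := le_abs_self (x i - a i)
        nlinarith
    refine (setIntegral_mono_on (mr i).integrable_sq (integrable_const _)
      (isCompact_hull K).measurableSet hpt).trans ?_
    rw [integral_const, measureReal_restrict_apply_univ, smul_eq_mul]
    calc volume.real (hull K) * ((d + 1) * ∑ a ∈ K, e a ^ 2 * (1 / c ^ 2))
        = (d + 1) / c ^ 2 * ∑ a ∈ K, volume.real (hull K) * e a ^ 2 := by
          rw [← Finset.sum_mul, ← Finset.mul_sum]; ring
      _ ≤ (d + 1) / c ^ 2 * ∑ a ∈ K, C₁ :=
          mul_le_mul_of_nonneg_left (Finset.sum_le_sum he2) (by positivity)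
      _ = _ := by
          rw [Finset.sum_const, hK.card, nsmul_eq_mul]; push_cast; ring
  have hfin : ∀ i, ∫ x in hull K, (raviartThomas K m x i - Φ i x) ^ 2 ≤
      2 * ((d + 1) ^ 2 / c ^ 2 * C₁)
        + 2 * (2 ^ d * D ^ 2 * ∑ j, ∫ x in hull K, g i j x ^ 2) := fun i => by
    obtain ⟨φ, hφ, -⟩ := h i
    have h2 := hφ.poincare hK
    have mΦ : MemLp (fun x => Φ i x - b i) 2 (volume.restrict (hull K)) :=
      (h i).memu.sub (memLp_const _)
    have h1 := integral_sq_sub_le (mr i) mΦ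
    have e1 : ∀ x, raviartThomas K m x i - b i - (Φ i x - b i)
        = raviartThomas K m x i - Φ i x := fun x => by ring
    simp_rw [e1] at h1
    have := hrc i
    simp only [hbi] at h1 this
    linarith
  refine (Finset.sum_le_sum fun i _ => hfin i).trans (le_of_eq ?_)
  rw [Finset.sum_add_distrib, Finset.sum_const, ← Finset.mul_sum, ← Finset.mul_sum, ← hS,
    Finset.card_univ, Fintype.card_fin, nsmul_eq_mul]
  ring

end IsElement

/-! ### Derivatives of higher order -/

theorem contDiff_partialDeriv {φ : Space d → ℝ} (h : ContDiff ℝ ∞ φ) (i : Fin d) :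
    ContDiff ℝ ∞ (partialDeriv i φ) :=
  (h.fderiv_right (m := ∞) (by simp)).clm_apply contDiff_const

theorem partialDeriv_comm {φ : Space d → ℝ} (h : ContDiff ℝ ∞ φ) (i j : Fin d) :
    partialDeriv i (partialDeriv j φ) = partialDeriv j (partialDeriv i φ) := by
  have hd : Differentiable ℝ (fderiv ℝ φ) :=
    (h.fderiv_right (m := ∞) (by simp)).differentiable (by simp)
  have key : ∀ (i j : Fin d) x, partialDeriv i (partialDeriv j φ) x
      = fderiv ℝ (fderiv ℝ φ) x (EuclideanSpace.single i 1) (EuclideanSpace.single j 1) := by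
    intro i j x
    have := ((hd x).hasFDerivAt.clm_apply
      (hasFDerivAt_const (EuclideanSpace.single j (1 : ℝ) : Space d) x)).fderiv
    change fderiv ℝ (fun y => fderiv ℝ φ y (EuclideanSpace.single j 1)) x _ = _
    rw [this]
    simp
  ext x
  rw [key, key]
  exact (h.contDiffAt.isSymmSndFDerivAt (by
    rw [minSmoothness_of_isRCLikeNormedField]; exact WithTop.coe_le_coe.2 (le_top : (2 : ℕ∞) ≤ ⊤))) _ _

theorem contDiff_iterate_partialDeriv {φ : Space d → ℝ} (h : ContDiff ℝ ∞ φ) (i : Fin d) (n : ℕ) :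
    ContDiff ℝ ∞ ((partialDeriv i)^[n] φ) := by
  induction n with
  | zero => exact h
  | succ n ih => rw [Function.iterate_succ_apply']; exact contDiff_partialDeriv ih i

theorem iterate_partialDeriv_comm {φ : Space d → ℝ} (h : ContDiff ℝ ∞ φ) (i j : Fin d) (n : ℕ) :
    (partialDeriv i)^[n] (partialDeriv j φ) = partialDeriv j ((partialDeriv i)^[n] φ) := by
  induction n with
  | zero => rfl
  | succ n ih =>
    rw [Function.iterate_succ_apply', ih, Function.iterate_succ_apply',
      partialDeriv_comm (contDiff_iterate_partialDeriv h i n)]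

section foldr

variable {φ : Space d → ℝ} (h : ContDiff ℝ ∞ φ) (α : Fin d → ℕ)
include h

theorem contDiff_foldr_partialDeriv (l : List (Fin d)) :
    ContDiff ℝ ∞ (l.foldr (fun i ψ => (partialDeriv i)^[α i] ψ) φ) := by
  induction l with
  | nil => exact h
  | cons i l ih => exact contDiff_iterate_partialDeriv ih i _

theorem foldr_partialDeriv_comm (l : List (Fin d)) (j : Fin d) :
    l.foldr (fun i ψ => (partialDeriv i)^[α i] ψ) (partialDeriv j φ)
      = partialDeriv j (l.foldr (fun i ψ => (partialDeriv i)^[α i] ψ) φ) := by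
  induction l with
  | nil => rfl
  | cons i l ih =>
    rw [List.foldr_cons, ih, iterate_partialDeriv_comm (contDiff_foldr_partialDeriv h α l)]
    rfl

theorem foldr_partialDeriv_add_single (l : List (Fin d)) (hl : l.Nodup) (j : Fin d) :
    l.foldr (fun i ψ => (partialDeriv i)^[(α + Pi.single j 1 : Fin d → ℕ) i] ψ) φ
      = if j ∈ l then partialDeriv j (l.foldr (fun i ψ => (partialDeriv i)^[α i] ψ) φ)
        else l.foldr (fun i ψ => (partialDeriv i)^[α i] ψ) φ := by
  induction l with
  | nil => simp
  | cons i l ih =>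
    obtain ⟨hi, hl⟩ := List.nodup_cons.1 hl
    rw [List.foldr_cons, ih hl]
    by_cases hij : i = j
    · subst hij
      simp [hi, Function.iterate_succ_apply']
    · have hji : j ≠ i := fun h => hij h.symm
      simp only [List.mem_cons, hji, false_or, Pi.add_apply, Pi.single_apply, hij, if_false,
        add_zero, List.foldr_cons]
      split_ifs
      · rw [iterate_partialDeriv_comm (contDiff_foldr_partialDeriv h α l)]
      · rfl

theorem multiDeriv_add_single (j : Fin d) :
    multiDeriv (α + Pi.single j 1) φ = partialDeriv j (multiDeriv α φ) := by
  have := foldr_partialDeriv_add_single h α (List.finRange d) (List.nodup_finRange d) j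
  rwa [if_pos (List.mem_finRange j)] at this

theorem multiDeriv_partialDeriv (j : Fin d) :
    multiDeriv α (partialDeriv j φ) = partialDeriv j (multiDeriv α φ) :=
  foldr_partialDeriv_comm h α _ j

theorem contDiff_multiDeriv : ContDiff ℝ ∞ (multiDeriv α φ) :=
  contDiff_foldr_partialDeriv h α _

end foldr

theorem multiDeriv_zero_index (φ : Space d → ℝ) : multiDeriv 0 φ = φ := by
  have : ∀ l : List (Fin d),
      l.foldr (fun i ψ => (partialDeriv i)^[(0 : Fin d → ℕ) i] ψ) φ = φ := fun l => by
    induction l with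
    | nil => rfl
    | cons i l ih => rw [List.foldr_cons, ih]; rfl
  exact this _

theorem exists_eq_add_single {α : Fin d → ℕ} {n : ℕ} (h : ∑ i, α i = n + 1) :
    ∃ (β : Fin d → ℕ) (i : Fin d), α = β + Pi.single i 1 ∧ ∑ i, β i = n := by
  obtain ⟨i, hi⟩ : ∃ i, α i ≠ 0 := by
    by_contra hcon
    push Not at hcon
    simp [hcon] at h
  have he : α = (α - Pi.single i 1) + Pi.single i 1 := by
    ext j
    by_cases hj : j = i
    · subst hj; simp; omega
    · simp [hj]
  refine ⟨α - Pi.single i 1, i, he, ?_⟩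
  have h1 : ∑ j, α j = ∑ j, (α - Pi.single i 1 : Fin d → ℕ) j + 1 := by
    conv_lhs => rw [he]
    simp [Finset.sum_add_distrib]
  omega

theorem sum_add_single (α : Fin d → ℕ) (i : Fin d) :
    ∑ j, (α + Pi.single i 1 : Fin d → ℕ) j = ∑ j, α j + 1 := by
  simp [Finset.sum_add_distrib]

/-- Induction over multi-indices. -/
theorem multiIndex_induction {p : (Fin d → ℕ) → Prop} (h0 : p 0)
    (h : ∀ α i, p α → p (α + Pi.single i 1)) (α : Fin d → ℕ) : p α := by
  obtain ⟨n, hn⟩ : ∃ n, ∑ i, α i = n := ⟨_, rfl⟩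
  induction n generalizing α with
  | zero =>
    have : α = 0 := by ext i; simpa using (Finset.sum_eq_zero_iff.1 hn) i
    rwa [this]
  | succ n ih =>
    obtain ⟨β, i, rfl, hβ⟩ := exists_eq_add_single hn
    exact h β i (ih β hβ)

theorem partialDeriv_const_mul {φ : Space d → ℝ} (h : Differentiable ℝ φ) (c : ℝ) (i : Fin d) :
    partialDeriv i (fun x => c * φ x) = fun x => c * partialDeriv i φ x := by
  ext x
  simp only [partialDeriv]
  rw [fderiv_const_mul (h x)]
  rfl

theorem multiDeriv_sub {φ ψ : Space d → ℝ} (h : ContDiff ℝ ∞ φ) (h' : ContDiff ℝ ∞ ψ)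
    (α : Fin d → ℕ) :
    multiDeriv α (fun x => φ x - ψ x) = fun x => multiDeriv α φ x - multiDeriv α ψ x := by
  induction α using multiIndex_induction with
  | h0 => simp [multiDeriv_zero_index]
  | h α i ih =>
    rw [multiDeriv_add_single (h.sub h'), ih, multiDeriv_add_single h, multiDeriv_add_single h']
    ext x
    exact partialDeriv_sub ((contDiff_multiDeriv h α).differentiable (by simp))
      ((contDiff_multiDeriv h' α).differentiable (by simp)) i x

theorem multiDeriv_const_mul {φ : Space d → ℝ} (h : ContDiff ℝ ∞ φ) (c : ℝ)
    (α : Fin d → ℕ) :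
    multiDeriv α (fun x => c * φ x) = fun x => c * multiDeriv α φ x := by
  induction α using multiIndex_induction with
  | h0 => simp [multiDeriv_zero_index]
  | h α i ih =>
    rw [multiDeriv_add_single (contDiff_const.mul h), ih, multiDeriv_add_single h,
      partialDeriv_const_mul ((contDiff_multiDeriv h α).differentiable (by simp))]

theorem multiDeriv_zero (α : Fin d → ℕ) : multiDeriv α (fun _ : Space d => (0 : ℝ)) = fun _ => 0 := by
  have := multiDeriv_const_mul (φ := fun _ : Space d => (0 : ℝ)) contDiff_const 0 α
  simpa using this

theorem multiDeriv_sum {ι : Type*} (s : Finset ι) {F : ι → Space d → ℝ}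
    (h : ∀ i ∈ s, ContDiff ℝ ∞ (F i)) (α : Fin d → ℕ) :
    multiDeriv α (fun x => ∑ i ∈ s, F i x) = fun x => ∑ i ∈ s, multiDeriv α (F i) x := by
  classical
  induction s using Finset.induction_on with
  | empty => simp [multiDeriv_zero]
  | insert i s hi ih =>
    have hF := h i (Finset.mem_insert_self i s)
    have hs : ∀ j ∈ s, ContDiff ℝ ∞ (F j) := fun j hj => h j (Finset.mem_insert_of_mem hj)
    have hneg : ContDiff ℝ ∞ (fun x => (-1) * ∑ i ∈ s, F i x) :=
      contDiff_const.mul (ContDiff.sum hs)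
    have e : (fun x => ∑ j ∈ insert i s, F j x)
        = fun x => F i x - (-1) * ∑ j ∈ s, F j x := by
      ext x; rw [Finset.sum_insert hi]; ring
    rw [e, multiDeriv_sub hF hneg, multiDeriv_const_mul (ContDiff.sum hs), ih hs]
    ext x
    rw [Finset.sum_insert hi]; ring

theorem partialDeriv_of_isPoly_zero {p : Space d → ℝ} (h : IsPoly 0 p) (i : Fin d) :
    partialDeriv i p = fun _ => 0 := by
  obtain ⟨P, hP, rfl⟩ := h.exists_polyFun
  rw [MvPolynomial.totalDegree_eq_zero_iff_eq_C.1 (Nat.le_zero.1 hP), partialDeriv_polyFun]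
  ext x; simp [polyFun]

theorem multiDeriv_eq_zero {n : ℕ} {p : Space d → ℝ} (hp : IsPoly n p) {α : Fin d → ℕ}
    (h : n < ∑ i, α i) : multiDeriv α p = fun _ => 0 := by
  induction n generalizing p α with
  | zero =>
    obtain ⟨m, hm⟩ : ∃ m, ∑ i, α i = m + 1 := ⟨_, (Nat.succ_pred_eq_of_pos h).symm⟩
    obtain ⟨β, i, rfl, -⟩ := exists_eq_add_single hm
    rw [multiDeriv_add_single hp.contDiff, ← multiDeriv_partialDeriv hp.contDiff,
      partialDeriv_of_isPoly_zero hp, multiDeriv_zero]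
  | succ n ih =>
    obtain ⟨m, hm⟩ : ∃ m, ∑ i, α i = m + 1 := ⟨_, (Nat.succ_pred_eq_of_pos (by omega)).symm⟩
    obtain ⟨β, i, rfl, hβ⟩ := exists_eq_add_single hm
    rw [multiDeriv_add_single hp.contDiff, ← multiDeriv_partialDeriv hp.contDiff]
    exact ih (hp.partialDeriv i) (by omega)

/-- The monomial function with exponent `α` and coefficient `a`. -/
def monoFun (α : Fin d → ℕ) (a : ℝ) : Space d → ℝ :=
  polyFun (MvPolynomial.monomial (Finsupp.equivFunOnFinite.symm α) a)

theorem isPoly_monoFun (α : Fin d → ℕ) (a : ℝ) : IsPoly (∑ i, α i) (monoFun α a) := by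
  refine isPoly_polyFun ((MvPolynomial.totalDegree_monomial_le _ _).trans (le_of_eq ?_))
  rw [Finsupp.sum_fintype _ _ (by simp)]
  rfl

theorem partialDeriv_monoFun_add_single (α : Fin d → ℕ) (a : ℝ) (i : Fin d) :
    partialDeriv i (monoFun (α + Pi.single i 1) a) = monoFun α (a * (α i + 1)) := by
  have e : (Finsupp.equivFunOnFinite.symm (α + Pi.single i 1 : Fin d → ℕ) : Fin d →₀ ℕ)
      - Finsupp.single i 1 = Finsupp.equivFunOnFinite.symm α := by
    ext j
    by_cases hj : j = i
    · subst hj; simp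
    · simp [hj]
  rw [monoFun, partialDeriv_polyFun, MvPolynomial.pderiv_monomial, monoFun, e]
  simp

theorem partialDeriv_monoFun_eq_zero {α : Fin d → ℕ} (a : ℝ) {i : Fin d} (h : α i = 0) :
    partialDeriv i (monoFun α a) = fun _ => 0 := by
  rw [monoFun, partialDeriv_polyFun, MvPolynomial.pderiv_monomial]
  ext x
  simp [h, polyFun]

theorem multiDeriv_monoFun_self (α : Fin d → ℕ) {a : ℝ} (ha : a ≠ 0) :
    ∃ c : ℝ, c ≠ 0 ∧ multiDeriv α (monoFun α a) = fun _ => c := by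
  induction α using multiIndex_induction generalizing a with
  | h0 =>
    refine ⟨a, ha, ?_⟩
    rw [multiDeriv_zero_index]
    ext x
    have : (Finsupp.equivFunOnFinite.symm (0 : Fin d → ℕ) : Fin d →₀ ℕ) = 0 := by ext; rfl
    simp [monoFun, polyFun, this]
  | h α i ih =>
    have hs := (isPoly_monoFun (α + Pi.single i 1) a).contDiff
    rw [multiDeriv_add_single hs, ← multiDeriv_partialDeriv hs, partialDeriv_monoFun_add_single]
    exact ih (mul_ne_zero ha (by positivity))

theorem multiDeriv_monoFun_of_ne {n : ℕ} {α β : Fin d → ℕ} (hα : ∑ i, α i = n)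
    (hβ : ∑ i, β i = n) (hne : α ≠ β) (a : ℝ) : multiDeriv β (monoFun α a) = fun _ => 0 := by
  induction n generalizing α β a with
  | zero =>
    refine absurd ?_ hne
    ext i
    rw [(Finset.sum_eq_zero_iff.1 hα) i (Finset.mem_univ i),
      (Finset.sum_eq_zero_iff.1 hβ) i (Finset.mem_univ i)]
  | succ n ih =>
    obtain ⟨β', i, rfl, hβ'⟩ := exists_eq_add_single hβ
    have hs := (isPoly_monoFun α a).contDiff
    rw [multiDeriv_add_single hs, ← multiDeriv_partialDeriv hs]
    by_cases h0 : α i = 0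
    · rw [partialDeriv_monoFun_eq_zero a h0, multiDeriv_zero]
    · have he : α = (α - Pi.single i 1) + Pi.single i 1 := by
        ext j
        by_cases hj : j = i
        · subst hj; simp; omega
        · simp [hj]
      rw [he] at hα hne ⊢
      rw [partialDeriv_monoFun_add_single]
      rw [sum_add_single] at hα
      exact ih (by omega) hβ' (fun h => hne (by rw [h])) _

/-- Polynomials with prescribed derivatives of order `n`. -/
theorem exists_poly_multiDeriv_eq (n : ℕ) (c : (Fin d → ℕ) → ℝ) :
    ∃ p, IsPoly n p ∧ ∀ β : Fin d → ℕ, ∑ i, β i = n → multiDeriv β p = fun _ => c β := by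
  classical
  choose b hb0 hb using fun α : Fin d → ℕ => multiDeriv_monoFun_self α one_ne_zero
  set s := Finset.piAntidiag (Finset.univ : Finset (Fin d)) n with hs
  have hsm : ∀ α, α ∈ s ↔ ∑ i, α i = n := fun α => by simp [hs, Finset.mem_piAntidiag]
  have hP : ∀ α ∈ s, IsPoly n (monoFun α 1) := fun α hα =>
    (isPoly_monoFun α 1).mono ((hsm α).1 hα).le
  -- Derivatives of order `n` are dual to the monomials of degree `n`: the derivative of index `β`
  -- kills all of them but its own, which becomes the constant `b β`.
  refine ⟨fun x => ∑ α ∈ s, c α / b α * monoFun α 1 x, IsPoly.sum s fun α hα =>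
    (hP α hα).const_mul _, fun β hβ => ?_⟩
  rw [multiDeriv_sum s fun α hα => ((hP α hα).const_mul _).contDiff]
  ext x
  rw [Finset.sum_eq_single_of_mem β ((hsm β).2 hβ)]
  · rw [multiDeriv_const_mul (isPoly_monoFun β 1).contDiff, hb]
    exact div_mul_cancel₀ _ (hb0 β)
  · intro α hα hne
    rw [multiDeriv_const_mul (isPoly_monoFun α 1).contDiff,
      multiDeriv_monoFun_of_ne ((hsm α).1 hα) hβ hne]
    exact mul_zero _

/-! ### Polynomial approximation -/

section BrambleHilbert

variable {K : Finset (Space d)} (hK : IsElement K) {m : ℕ} {U : (Fin d → ℕ) → Space d → ℝ}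
  (hU : ∀ α : Fin d → ℕ, ∑ i, α i < m →
    WeakGrad (interior (hull K)) (U α) fun i => U (α + Pi.single i 1))
include hK hU

/-- The means of the derivatives are matched from the highest order downwards. After `j` steps the
orders from `m - j` to `m - 1` agree. -/
theorem exists_poly_mean_eq (j : ℕ) (hj : j ≤ m) :
    ∃ p, IsPoly (m - 1) p ∧ ∀ β : Fin d → ℕ, m - j ≤ ∑ i, β i → ∑ i, β i < m →
      ∫ x in hull K, (U β x - multiDeriv β p x) = 0 := by
  induction j with
  | zero => exact ⟨_, IsPoly.const _ 0, fun β h h' => by omega⟩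
  | succ j ih =>
    obtain ⟨p, hp, h⟩ := ih (by omega)
    have hvol := hK.volume_pos
    obtain ⟨q, hq, hqc⟩ := exists_poly_multiDeriv_eq (d := d) (m - (j + 1)) fun β =>
      mean (hull K) fun x => multiDeriv β p x - U β x
    refine ⟨fun x => p x - q x, hp.sub (hq.mono (by omega)), fun β h1 h2 => ?_⟩
    rw [multiDeriv_sub hp.contDiff hq.contDiff]
    have hfin : IsFiniteMeasure (volume.restrict (hull K)) :=
      ⟨by simpa using (isCompact_hull K).measure_lt_top⟩
    have iU : Integrable (U β) (volume.restrict (hull K)) := by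
      rw [← restrict_interior_hull] at hfin ⊢
      exact (hU β h2).memu.integrable (by norm_num)
    have ip : Integrable (multiDeriv β p) (volume.restrict (hull K)) :=
      (memLp_hull K (contDiff_multiDeriv hp.contDiff β).continuous).integrable (by norm_num)
    -- The correction `q` has degree `m - (j + 1)`, so it does not disturb the means of higher order
    -- already matched.
    by_cases hlt : m - (j + 1) < ∑ i, β i
    · rw [multiDeriv_eq_zero hq hlt]
      simpa using h β (by omega) h2
    · rw [hqc β (by omega)]
      have e : ∀ (c : ℝ) x, U β x - (multiDeriv β p x - c) = (U β x - multiDeriv β p x) + c :=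
        fun c x => by ring
      have id : Integrable (fun x => U β x - multiDeriv β p x) (volume.restrict (hull K)) :=
        iU.sub ip
      simp_rw [e]
      rw [integral_add id (integrable_const _), integral_const,
        measureReal_restrict_apply_univ, smul_eq_mul, mean, mul_inv_cancel_left₀ hvol.ne',
        integral_sub ip iU, integral_sub iU ip]
      ring

/-- Once all means agree, each use of the Poincaré inequality trades one order of differentiation
for a factor `2 ^ d * d` times the squared diameter. Going from order `m` down to order `1` takes `m
- 1` uses. -/
theorem exists_poly_approx (hm : 1 ≤ m) :
    ∃ p, IsPoly (m - 1) p ∧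
      ∑ i, ∫ x in hull K, (U (Pi.single i 1) x - partialDeriv i p x) ^ 2 ≤
        d * (2 ^ d * d) ^ (m - 1) * Metric.diam (hull K) ^ (2 * (m - 1)) *
          ∑ α ∈ Finset.piAntidiag (Finset.univ : Finset (Fin d)) m,
            ∫ x in hull K, U α x ^ 2 := by
  obtain ⟨p, hp, h⟩ := exists_poly_mean_eq hK hU m le_rfl
  refine ⟨p, hp, ?_⟩
  set M := ∑ α ∈ Finset.piAntidiag (Finset.univ : Finset (Fin d)) m,
    ∫ x in hull K, U α x ^ 2 with hM
  have hV : ∀ α : Fin d → ℕ, ∑ i, α i < m → WeakGrad (interior (hull K))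
      (fun x => U α x - multiDeriv α p x)
      (fun i x => U (α + Pi.single i 1) x - multiDeriv (α + Pi.single i 1) p x) := fun α hα => by
    have h1 := (hU α hα).sub (weakGrad_of_smooth
      ((isCompact_hull K).isBounded.subset interior_subset) (contDiff_multiDeriv hp.contDiff α))
    simp_rw [multiDeriv_add_single hp.contDiff α]
    exact h1
  have key : ∀ l, l ≤ m → ∀ β : Fin d → ℕ, ∑ i, β i = m - l →
      ∫ x in hull K, (U β x - multiDeriv β p x) ^ 2
        ≤ (2 ^ d * d) ^ l * Metric.diam (hull K) ^ (2 * l) * M := by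
    intro l
    induction l with
    | zero =>
      intro _ β hβ
      -- Derivatives of order `m` of a polynomial of degree `m - 1` vanish, since `m ≥ 1`.
      rw [multiDeriv_eq_zero hp (by omega)]
      simp only [sub_zero, pow_zero, one_mul, mul_zero]
      refine Finset.single_le_sum (f := fun α => ∫ x in hull K, U α x ^ 2)
        (fun α _ => integral_nonneg fun x => sq_nonneg _) ?_
      simpa [Finset.mem_piAntidiag] using hβ
    | succ l ih =>
      intro hl β hβ
      have h1 := (hV β (by omega)).poincare hK
      have h2 : mean (hull K) (fun x => U β x - multiDeriv β p x) = 0 := by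
        rw [mean, h β (by omega) (by omega), mul_zero]
      simp only [h2, sub_zero] at h1
      refine h1.trans ?_
      have h3 : ∑ i, ∫ x in hull K,
          (U (β + Pi.single i 1) x - multiDeriv (β + Pi.single i 1) p x) ^ 2
          ≤ ∑ _i : Fin d, (2 ^ d * d) ^ l * Metric.diam (hull K) ^ (2 * l) * M :=
        Finset.sum_le_sum fun i _ => ih (by omega) _ (by rw [sum_add_single]; omega)
      refine (mul_le_mul_of_nonneg_left h3 (by positivity)).trans (le_of_eq ?_)
      rw [Finset.sum_const, Finset.card_univ, Fintype.card_fin, nsmul_eq_mul]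
      ring
  have h4 : ∀ i : Fin d, ∫ x in hull K, (U (Pi.single i 1) x - partialDeriv i p x) ^ 2
      ≤ (2 ^ d * d) ^ (m - 1) * Metric.diam (hull K) ^ (2 * (m - 1)) * M := fun i => by
    have h5 := key (m - 1) (by omega) (0 + Pi.single i 1) (by rw [sum_add_single]; simp; omega)
    rwa [multiDeriv_add_single hp.contDiff, multiDeriv_zero_index, zero_add] at h5
  refine (Finset.sum_le_sum fun i _ => h4 i).trans (le_of_eq ?_)
  rw [Finset.sum_const, Finset.card_univ, Fintype.card_fin, nsmul_eq_mul]
  ring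

end BrambleHilbert

/-! ### Families of weak derivatives -/

theorem MemSobolev.isWeakDeriv {D : Set (Space d)} {m : ℕ} {u : Space d → ℝ}
    (h : MemSobolev D m u) {α : Fin d → ℕ} (hα : ∑ i, α i ≤ m) :
    IsWeakDeriv D α u (weakDeriv D α u) := by
  have hex := h α hα
  rw [weakDeriv, dif_pos hex]
  exact hex.choose_spec

/-- Weak derivatives given separately for each index form a coherent family: `U (α + e_i)` is the
weak `i`-th derivative of `U α`, which is seen by testing with `∂_i φ`. -/
theorem MemSobolev.exists_derivs {D : Set (Space d)} (hD : IsOpen D) {m : ℕ} {u : Space d → ℝ}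
    (h : MemSobolev D m u) :
    ∃ U : (Fin d → ℕ) → Space d → ℝ, U 0 = u ∧
      (∀ α, ∑ i, α i ≤ m → MemLp (U α) 2 (volume.restrict D)) ∧
      (∀ α, ∑ i, α i < m → WeakGrad D (U α) fun i => U (α + Pi.single i 1)) ∧
      ∀ j ≤ m, ∑ α ∈ Finset.piAntidiag (Finset.univ : Finset (Fin d)) j,
        ∫ x in D, U α x ^ 2 ≤ sobolevNorm D m u ^ 2 := by
  classical
  -- At the index `0` the chosen weak derivative equals `u` only almost everywhere; here `u` itself
  -- is taken.
  set U : (Fin d → ℕ) → Space d → ℝ := fun α => if α = 0 then u else weakDeriv D α u with hUdef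
  have hu : MemLp u 2 (volume.restrict D) := (h.isWeakDeriv (α := 0) (by simp)).1
  have hU : ∀ α, ∑ i, α i ≤ m → IsWeakDeriv D α u (U α) := fun α hα => by
    by_cases h0 : α = 0
    · subst h0
      simp only [hUdef, if_true]
      exact ⟨hu, hu, fun φ _ => by simp [multiDeriv_zero_index]⟩
    · simp only [hUdef, if_neg h0]
      exact h.isWeakDeriv hα
  have hUsq : ∀ α, ∑ i, α i ≤ m →
      ∫ x in D, U α x ^ 2 = ∫ x in D, weakDeriv D α u x ^ 2 := fun α hα => by
    by_cases h0 : α = 0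
    · have hw := h.isWeakDeriv (α := α) hα
      have hae : U α =ᵐ[volume.restrict D] weakDeriv D α u :=
        ae_eq_of_forall_test hD (hU α hα).2.1 hw.2.1 fun φ hφ => by
          have e1 := (hU α hα).2.2 φ hφ
          have e2 := hw.2.2 φ hφ
          rw [e1] at e2
          exact mul_left_cancel₀ (pow_ne_zero _ (by norm_num)) e2
      exact integral_congr_ae (by filter_upwards [hae] with x hx; rw [hx])
    · simp only [hUdef, if_neg h0]
  refine ⟨U, by simp [hUdef], fun α hα => (hU α hα).2.1, fun α hα => ?_, fun j hj => ?_⟩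
  · refine ⟨(hU α hα.le).2.1, fun i => (hU _ (by rw [sum_add_single]; omega)).2.1,
      fun φ hφ i => ?_⟩
    have e1 := (hU α hα.le).2.2 _ (hφ.partialDeriv i)
    have e2 := (hU (α + Pi.single i 1) (by rw [sum_add_single]; omega)).2.2 φ hφ
    rw [multiDeriv_partialDeriv hφ.smooth, ← multiDeriv_add_single hφ.smooth, e2,
      sum_add_single, pow_succ, mul_assoc] at e1
    have e3 := mul_left_cancel₀ (pow_ne_zero _ (by norm_num)) e1
    rw [← e3]; ring
  · rw [sobolevNorm, Real.sq_sqrt (Finset.sum_nonneg fun j _ => sum_integral_sq_nonneg _ _)]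
    have hsum : ∑ α ∈ Finset.piAntidiag (Finset.univ : Finset (Fin d)) j, ∫ x in D, U α x ^ 2
        = ∑ α ∈ Finset.piAntidiag (Finset.univ : Finset (Fin d)) j,
          ∫ x in D, weakDeriv D α u x ^ 2 :=
      Finset.sum_congr rfl fun α hα => hUsq α (by
        have : ∑ i, α i = j := (Finset.mem_piAntidiag.1 hα).1
        omega)
    rw [hsum]
    exact Finset.single_le_sum (f := fun j =>
      ∑ α ∈ Finset.piAntidiag (Finset.univ : Finset (Fin d)) j, ∫ x in D, weakDeriv D α u x ^ 2)
      (fun j _ => sum_integral_sq_nonneg _ _) (Finset.mem_range.2 (by omega))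

/-! ### Triangulations -/

theorem finrank_vectorSpan_lt {G : Finset (Space d)} (hG : G.Nonempty) :
    Module.finrank ℝ (vectorSpan ℝ (G : Set (Space d))) < G.card := by
  have h := finrank_vectorSpan_range_le ℝ ((↑) : G → Space d)
    (n := G.card - 1) (by have := hG.card_pos; simp; omega)
  rw [Subtype.range_coe_subtype] at h
  have := hG.card_pos
  have e : {x | x ∈ G} = (G : Set (Space d)) := rfl
  rw [e] at h
  omega

/-- Fewer than `d` points span dimension less than `d - 1`. Together with the intersection property
of the complex, distinct facets overlap in a null set. -/
theorem surface_hull_eq_zero {G : Finset (Space d)} (hG : G.card < d) :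
    surface d (hull G) = 0 := by
  rcases G.eq_empty_or_nonempty with rfl | hne
  · simp [hull]
  · have h1 : dimH (hull G) < ((d - 1 : ℕ) : NNReal) := by
      have hd := Real.Convex.dimH_eq_finrank_vectorSpan (convex_hull G)
        ((hne.to_set).convexHull (𝕜 := ℝ))
      rw [hd]
      have : Module.finrank ℝ (vectorSpan ℝ (hull G)) < d - 1 := by
        rw [← direction_affineSpan, hull, affineSpan_convexHull, direction_affineSpan]
        have := finrank_vectorSpan_lt hne
        omega
      exact_mod_cast this
    have h2 := hausdorffMeasure_of_dimH_lt h1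
    rw [surface, Measure.euclideanHausdorffMeasure_def, Measure.smul_apply]
    simp only [NNReal.coe_natCast] at h2
    rw [h2, smul_zero]

theorem volume_hull_eq_zero {G : Finset (Space d)} (hG : G.card < d + 1) :
    volume (hull G) = 0 := by
  rcases G.eq_empty_or_nonempty with rfl | hne
  · simp [hull]
  · refine measure_mono_null (convexHull_subset_affineSpan _)
      (Measure.addHaar_affineSubspace volume _ fun h => ?_)
    have h1 := finrank_vectorSpan_lt hne
    rw [← direction_affineSpan, h, AffineSubspace.direction_top, finrank_top,
      finrank_euclideanSpace_fin] at h1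
    omega

namespace Triangulation

variable {P : Problem d} (T : Triangulation P)

variable {T}

theorem mem_elements {K : Finset (Space d)} :
    K ∈ T.elements ↔ K ∈ T.complex.faces ∧ K.card = d + 1 := by
  simp [elements]

theorem mem_facets {F : Finset (Space d)} :
    F ∈ T.facets ↔ F ∈ T.complex.faces ∧ F.card = d := by
  simp [facets]

theorem isElement {K : Finset (Space d)} (hK : K ∈ T.elements) : IsElement K :=
  ⟨T.complex.indep (mem_elements.1 hK).1, (mem_elements.1 hK).2⟩

theorem facet_mem (hd : 1 ≤ d) {K : Finset (Space d)} (hK : K ∈ T.elements) {a : Space d}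
    (ha : a ∈ K) : facet K a ∈ T.facets :=
  mem_facets.2 ⟨T.complex.down_closed (mem_elements.1 hK).1 (Finset.erase_subset _ _)
    ((isElement hK).facet_nonempty hd ha), (isElement hK).card_facet ha⟩

theorem hull_inter_hull {s t : Finset (Space d)} (hs : s ∈ T.complex.faces)
    (ht : t ∈ T.complex.faces) [DecidableEq (Space d)] : hull s ∩ hull t ⊆ hull (s ∩ t) := by
  have := T.complex.inter_subset_convexHull hs ht
  simpa [hull] using this

theorem card_inter_lt {s t : Finset (Space d)} [DecidableEq (Space d)] (h : s.card = t.card)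
    (hne : s ≠ t) : (s ∩ t).card < s.card := by
  refine lt_of_le_of_ne (Finset.card_le_card Finset.inter_subset_left) fun he => hne ?_
  have h1 := Finset.eq_of_subset_of_card_le (Finset.inter_subset_left (s₁ := s) (s₂ := t)) he.ge
  have h2 : s ⊆ t := fun x hx => (Finset.mem_inter.1 (h1.symm ▸ hx)).2
  exact Finset.eq_of_subset_of_card_le h2 h.ge

theorem surface_inter_eq_zero {F F' : Finset (Space d)} (hF : F ∈ T.facets)
    (hF' : F' ∈ T.facets) (hne : F ≠ F') : surface d (hull F ∩ hull F') = 0 := by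
  classical
  obtain ⟨h1, h2⟩ := mem_facets.1 hF
  obtain ⟨h1', h2'⟩ := mem_facets.1 hF'
  refine measure_mono_null (hull_inter_hull h1 h1') (surface_hull_eq_zero ?_)
  exact (card_inter_lt (h2.trans h2'.symm) hne).trans_eq h2

theorem disjoint_interior {K K' : Finset (Space d)} (hK : K ∈ T.elements)
    (hK' : K' ∈ T.elements) (hne : K ≠ K') :
    Disjoint (interior (hull K)) (interior (hull K')) := by
  classical
  obtain ⟨h1, h2⟩ := mem_elements.1 hK
  obtain ⟨h1', h2'⟩ := mem_elements.1 hK'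
  have h0 : volume (interior (hull K) ∩ interior (hull K')) = 0 := by
    refine measure_mono_null ((Set.inter_subset_inter interior_subset interior_subset).trans
      (hull_inter_hull h1 h1')) (volume_hull_eq_zero ?_)
    exact (card_inter_lt (h2.trans h2'.symm) hne).trans_eq h2
  rw [Set.disjoint_iff_inter_eq_empty]
  exact (isOpen_interior.inter isOpen_interior).eq_empty_of_measure_zero h0

theorem interior_subset_Ω {K : Finset (Space d)} (hK : K ∈ T.elements) :
    interior (hull K) ⊆ P.Ω := by
  obtain ⟨h1, h2⟩ := mem_elements.1 hK
  rcases T.element_subset K h1 h2 with h | h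
  · exact h.trans P.Ωp_subset
  · exact h.trans P.Ωm_subset

theorem space_subset : closure P.Ω ⊆ ⋃ K ∈ T.elements, hull K := by
  rw [← T.space_eq]
  intro x hx
  obtain ⟨s, hs, hxs⟩ := Geometry.SimplicialComplex.mem_space_iff.1 hx
  obtain ⟨K, hK, hsK, hcard⟩ := T.pure s hs
  exact Set.mem_biUnion (mem_elements.2 ⟨hK, hcard⟩) (hull_mono hsK hxs)

variable (T)

theorem ae_subset : ∀ᵐ x ∂(volume : Measure (Space d)), x ∈ P.Ω →
    x ∈ ⋃ K ∈ T.elements, interior (hull K) := by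
  have h : ∀ K ∈ T.elements, ∀ᵐ x ∂(volume : Measure (Space d)), x ∉ frontier (hull K) :=
    fun K _ => measure_eq_zero_iff_ae_notMem.1
      ((convex_hull K).addHaar_frontier (volume : Measure (Space d)))
  have h' := (eventually_all_finset T.elements).2 h
  filter_upwards [h'] with x hx hxΩ
  obtain ⟨K, hK, hxK⟩ := Set.mem_iUnion₂.1 (T.space_subset (subset_closure hxΩ))
  refine Set.mem_biUnion hK ?_
  by_contra hcon
  exact hx K hK ⟨subset_closure hxK, hcon⟩

/-- Up to the null frontiers of the elements, `Ω` is the disjoint union of their interiors, so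
integrals over `Ω` are sums over elements. -/
theorem restrict_Ω : (volume : Measure (Space d)).restrict P.Ω
    = volume.restrict (⋃ K ∈ T.elements, interior (hull K)) := by
  refine Measure.restrict_congr_set ?_
  refine EventuallyLE.antisymm (T.ae_subset.mono fun x hx => hx) ?_
  exact (LE.le.eventuallyLE (Set.iUnion₂_subset fun K hK => interior_subset_Ω hK))

theorem integral_eq {g : Space d → ℝ} (hg : Integrable g (volume.restrict P.Ω)) :
    T.integral (fun _ => g) = ∫ x in P.Ω, g x := by
  rw [T.restrict_Ω, integral_biUnion_finset T.elements
    (fun K _ => isOpen_interior.measurableSet)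
    (fun K hK K' hK' hne => disjoint_interior hK hK' hne)
    (fun K hK => hg.mono_measure (Measure.restrict_mono (interior_subset_Ω hK) le_rfl))]
  exact Finset.sum_congr rfl fun K _ => by rw [restrict_interior_hull]

variable {T}

theorem restrict_hull_le {K : Finset (Space d)} (hK : K ∈ T.elements) :
    (volume : Measure (Space d)).restrict (hull K) ≤ volume.restrict P.Ω := by
  rw [← restrict_interior_hull]
  exact Measure.restrict_mono (interior_subset_Ω hK) le_rfl

theorem diam_le_h {K : Finset (Space d)} (hK : K ∈ T.elements) :
    Metric.diam (hull K) ≤ T.h :=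
  le_csSup ((T.elements.finite_toSet.image _).bddAbove) ⟨K, hK, rfl⟩

theorem h_nonneg : 0 ≤ T.h :=
  Real.sSup_nonneg (by rintro _ ⟨K, -, rfl⟩; exact Metric.diam_nonneg)

/-- The inscribed ball of radius `ρ h_K` has width `2 ρ h_K` in the direction of the normal. -/
theorem isElement_height_le (hd : 1 ≤ d) {ρ : ℝ} (hρ : 0 < ρ) (h : T.ShapeRegular ρ)
    {K : Finset (Space d)} (hK : K ∈ T.elements) {a : Space d} (ha : a ∈ K) :
    2 * ρ * Metric.diam (hull K) ≤ height K a := by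
  obtain ⟨c, hc⟩ := h K hK
  rw [mul_assoc]
  exact (isElement hK).two_mul_le_height hd ha (mul_nonneg hρ.le Metric.diam_nonneg) hc

variable (P) in
/-- The value of the coefficient on an element. -/
theorem sigma_cases {K : Finset (Space d)} (hK : K ∈ T.elements) :
    (interior (hull K) ⊆ P.Ωp ∧ ∀ᵐ x ∂(volume.restrict (hull K)), P.σ x = P.σp) ∨
      (interior (hull K) ⊆ P.Ωm ∧ ∀ᵐ x ∂(volume.restrict (hull K)), P.σ x = P.σm) := by
  obtain ⟨h1, h2⟩ := mem_elements.1 hK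
  rw [← restrict_interior_hull]
  rcases T.element_subset K h1 h2 with h | h
  · exact .inl ⟨h, ae_restrict_of_forall_mem isOpen_interior.measurableSet fun x hx => by
      simp [Problem.σ, h hx]⟩
  · exact .inr ⟨h, ae_restrict_of_forall_mem isOpen_interior.measurableSet fun x hx => by
      have : x ∉ P.Ωp := fun hx' => (Set.disjoint_left.1 P.disjoint hx') (h hx)
      simp [Problem.σ, this]⟩

variable (T)

/-- Weak derivatives on the two subdomains, put together. -/
theorem exists_derivs {m : ℕ} {u : Space d → ℝ} (hp : MemSobolev P.Ωp m u)
    (hm : MemSobolev P.Ωm m u) :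
    ∃ U : (Fin d → ℕ) → Space d → ℝ, U 0 = u ∧
      (∀ K ∈ T.elements, ∀ α, ∑ i, α i < m →
        WeakGrad (interior (hull K)) (U α) fun i => U (α + Pi.single i 1)) ∧
      ∀ j ≤ m, ∑ K ∈ T.elements, ∑ α ∈ Finset.piAntidiag (Finset.univ : Finset (Fin d)) j,
        ∫ x in hull K, U α x ^ 2 ≤ (sobolevNorm P.Ωp m u + sobolevNorm P.Ωm m u) ^ 2 := by
  classical
  obtain ⟨V, hV0, hVm, hVg, hVn⟩ := hp.exists_derivs P.isOpen_Ωp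
  obtain ⟨W, hW0, hWm, hWg, hWn⟩ := hm.exists_derivs P.isOpen_Ωm
  set U : (Fin d → ℕ) → Space d → ℝ := fun α x => if x ∈ P.Ωp then V α x else W α x with hU
  have eV : ∀ α, ∀ x ∈ P.Ωp, U α x = V α x := fun α x hx => by simp [hU, hx]
  have eW : ∀ α, ∀ x ∈ P.Ωm, U α x = W α x := fun α x hx => by
    have : x ∉ P.Ωp := fun hx' => (Set.disjoint_left.1 P.disjoint hx') hx
    simp [hU, this]
  refine ⟨U, ?_, fun K hK α hα => ?_, fun j hj => ?_⟩
  · ext x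
    simp [hU, hV0, hW0]
  · obtain ⟨h1, h2⟩ := mem_elements.1 hK
    rcases T.element_subset K h1 h2 with h | h
    · exact ((hVg α hα).mono P.isOpen_Ωp.measurableSet h).congr
        (ae_restrict_of_forall_mem isOpen_interior.measurableSet fun x hx => (eV _ x (h hx)).symm)
        fun i => ae_restrict_of_forall_mem isOpen_interior.measurableSet
          fun x hx => (eV _ x (h hx)).symm
    · exact ((hWg α hα).mono P.isOpen_Ωm.measurableSet h).congr
        (ae_restrict_of_forall_mem isOpen_interior.measurableSet fun x hx => (eW _ x (h hx)).symm)
        fun i => ae_restrict_of_forall_mem isOpen_interior.measurableSet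
          fun x hx => (eW _ x (h hx)).symm
  · rw [Finset.sum_comm]
    have hsum : ∀ α ∈ Finset.piAntidiag (Finset.univ : Finset (Fin d)) j,
        ∑ K ∈ T.elements, ∫ x in hull K, U α x ^ 2
          ≤ (∫ x in P.Ωp, V α x ^ 2) + ∫ x in P.Ωm, W α x ^ 2 := fun α hα => by
      have hαj : ∑ i, α i = j := (Finset.mem_piAntidiag.1 hα).1
      have mV : IntegrableOn (fun x => U α x ^ 2) P.Ωp :=
        (hVm α (by omega)).integrable_sq.congr
          (ae_restrict_of_forall_mem P.isOpen_Ωp.measurableSet fun x hx => by simp only [eV _ x hx])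
      have mW : IntegrableOn (fun x => U α x ^ 2) P.Ωm :=
        (hWm α (by omega)).integrable_sq.congr
          (ae_restrict_of_forall_mem P.isOpen_Ωm.measurableSet fun x hx => by simp only [eW _ x hx])
      have mU := mV.union mW
      have hsub : ⋃ K ∈ T.elements, interior (hull K) ⊆ P.Ωp ∪ P.Ωm :=
        Set.iUnion₂_subset fun K hK => by
          obtain ⟨h1, h2⟩ := mem_elements.1 hK
          rcases T.element_subset K h1 h2 with h | h
          · exact h.trans Set.subset_union_left
          · exact h.trans Set.subset_union_right
      calc ∑ K ∈ T.elements, ∫ x in hull K, U α x ^ 2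
          = ∫ x in ⋃ K ∈ T.elements, interior (hull K), U α x ^ 2 := by
            rw [integral_biUnion_finset T.elements (fun K _ => isOpen_interior.measurableSet)
              (fun K hK K' hK' hne => disjoint_interior hK hK' hne)
              (fun K hK => mU.mono_set ((Set.subset_biUnion_of_mem (u := fun K : Finset (Space d) =>
                interior (hull K)) hK).trans hsub))]
            exact Finset.sum_congr rfl fun K _ => by rw [restrict_interior_hull]
        _ ≤ ∫ x in P.Ωp ∪ P.Ωm, U α x ^ 2 :=
            setIntegral_mono_set mU (ae_of_all _ fun x => sq_nonneg _) hsub.eventuallyLE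
        _ = _ := by
            rw [setIntegral_union P.disjoint P.isOpen_Ωm.measurableSet mV mW]
            congr 1
            · exact setIntegral_congr_fun P.isOpen_Ωp.measurableSet
                fun x hx => by simp only [eV _ x hx]
            · exact setIntegral_congr_fun P.isOpen_Ωm.measurableSet
                fun x hx => by simp only [eW _ x hx]
    refine (Finset.sum_le_sum hsum).trans ?_
    rw [Finset.sum_add_distrib]
    have h1 := hVn j hj
    have h2 := hWn j hj
    have h3 : 0 ≤ sobolevNorm P.Ωp m u := Real.sqrt_nonneg _
    have h4 : 0 ≤ sobolevNorm P.Ωm m u := Real.sqrt_nonneg _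
    nlinarith [mul_nonneg h3 h4]

end Triangulation

/-! ### Conservation of the normal flux -/

theorem hasWeakGradient_of_smooth {D : Set (Space d)} (hD : Bornology.IsBounded D)
    {ψ : Space d → ℝ} (h : ContDiff ℝ ∞ ψ) : HasWeakGradient D ψ (gradient ψ) := by
  have hw := weakGrad_of_smooth hD h
  refine ⟨hw.memu, ?_, fun φ hφ i => ?_⟩
  · have hc : Continuous (gradient ψ) := by
      refine (InnerProductSpace.toDual ℝ (Space d)).symm.continuous.comp ?_
      exact h.continuous_fderiv (by simp)
    have hcl := hD.isCompact_closure
    obtain ⟨C, hC⟩ := hcl.exists_bound_of_continuousOn hc.continuousOn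
    have : IsFiniteMeasure (volume.restrict D) := ⟨by simpa using hD.measure_lt_top⟩
    refine MemLp.of_bound hc.aestronglyMeasurable C ?_
    have h1 : ∀ᵐ x ∂(volume.restrict (closure D)), ‖gradient ψ x‖ ≤ C :=
      ae_restrict_of_forall_mem hcl.measurableSet hC
    exact ae_mono (Measure.restrict_mono subset_closure le_rfl) h1
  · simp_rw [gradient_apply]
    exact hw.ibp φ hφ i

theorem Problem.memH1D_of_smooth (P : Problem d) {ψ : Space d → ℝ} (h : ContDiff ℝ ∞ ψ)
    (h0 : ∀ x ∈ closure P.ΓD, ψ x = 0) : P.MemH1D ψ (gradient ψ) := by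
  have hw := hasWeakGradient_of_smooth P.isBounded_Ω h
  refine ⟨hw, MemLp.zero, _, hw, fun _ => ψ, fun _ => h, by simp, by simp, ?_⟩
  have : (fun x => ψ x - (0 : Space d → ℝ) x) =ᵐ[(surface d).restrict (closure P.ΓD)] 0 :=
    ae_restrict_of_forall_mem isClosed_closure.measurableSet fun x hx => by simp [h0 x hx]
  simp only [eLpNorm_congr_ae this, eLpNorm_zero, tendsto_const_nhds]

theorem inner_gradient (v : Space d) (ψ : Space d → ℝ) (x : Space d) :
    inner ℝ v (gradient ψ x) = ∑ i, v i * partialDeriv i ψ x := by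
  rw [PiLp.inner_apply]
  exact Finset.sum_congr rfl fun i _ => by rw [gradient_apply]; simp [mul_comm]

namespace Triangulation

variable {P : Problem d} (T : Triangulation P)

theorem integrable_Ω {f : Space d → ℝ}
    (h : ∀ K ∈ T.elements, Integrable f (volume.restrict (hull K))) :
    Integrable f (volume.restrict P.Ω) := by
  rw [T.restrict_Ω]
  refine (integrableOn_finset_iUnion).2 fun K hK => ?_
  rw [IntegrableOn, restrict_interior_hull]
  exact h K hK

/-- `q` is of class `H¹` on each element, with weak gradients `g` and traces `t` of its
components. -/
def IsBrokenField (q : Space d → Space d) (g : Finset (Space d) → Fin d → Fin d → Space d → ℝ)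
    (t : Finset (Space d) → Fin d → Space d → Space d → ℝ) : Prop :=
  ∀ K ∈ T.elements, ∀ i, WeakGrad (interior (hull K)) (fun x => q x i) (g K i) ∧
    IsElemTrace K (fun x => q x i) (g K i) (t K i)

variable {T}

theorem closure_ΓD_subset : closure P.ΓD ⊆ frontier P.Ω :=
  isClosed_frontier.closure_subset_iff.2 P.ΓD_subset

theorem exists_facet_of_mem_ΓD {x : Space d} (hx : x ∈ closure P.ΓD) :
    ∃ F ∈ T.facets, hull F ⊆ closure P.ΓD ∧ x ∈ hull F := by
  rw [T.dirichlet_eq] at hx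
  obtain ⟨F, ⟨h1, h2, h3⟩, hxF⟩ := Set.mem_iUnion₂.1 hx
  exact ⟨F, mem_facets.2 ⟨h1, h2⟩, h3, hxF⟩

section

variable (hd : 1 ≤ d) {q : Space d → Space d} {g : Space d → ℝ}
  (hg : MemLp g 2 (volume.restrict P.Ω))
  (hq : ∀ (v : Space d → ℝ) (Gv : Space d → Space d), P.MemH1D v Gv →
    ∫ x in P.Ω, inner ℝ (q x) (Gv x) = -∫ x in P.Ω, g x * v x)
  {gq : Finset (Space d) → Fin d → Fin d → Space d → ℝ}
  {tq : Finset (Space d) → Fin d → Space d → Space d → ℝ} (hb : T.IsBrokenField q gq tq)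

include hg hq hb

/-- The divergence of the flux on each element. -/
theorem div_eq {K : Finset (Space d)} (hK : K ∈ T.elements) :
    (fun x => ∑ i, gq K i i x) =ᵐ[volume.restrict (hull K)] g := by
  rw [← restrict_interior_hull]
  have hgK : MemLp g 2 (volume.restrict (interior (hull K))) :=
    hg.mono_measure (Measure.restrict_mono (interior_subset_Ω hK) le_rfl)
  refine ae_eq_of_forall_test isOpen_interior
    (memLp_finsetSum _ fun i _ => (hb K hK i).1.memg i) hgK fun φ hφ => ?_
  have hφm : ∀ {ψ}, IsTestFunction (interior (hull K)) ψ →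
      MemLp ψ 2 (volume.restrict (interior (hull K))) := fun hψ =>
    (hψ.smooth.continuous.memLp_of_hasCompactSupport hψ.compact).mono_measure
      Measure.restrict_le_self
  -- A test function in the open element vanishes on the closure of `Γ_D`, which lies in the
  -- frontier of the open set `Ω`; it is therefore admissible in the global weak form.
  have h1 := hq φ _ (P.memH1D_of_smooth hφ.smooth fun x hx => by
    refine image_eq_zero_of_notMem_tsupport fun hx' => ?_
    have h2 := closure_ΓD_subset hx
    rw [P.isOpen_Ω.frontier_eq] at h2
    exact h2.2 (interior_subset_Ω hK (hφ.support_subset hx')))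
  have h2 : ∫ x in P.Ω, inner ℝ (q x) (gradient φ x)
      = ∫ x in interior (hull K), inner ℝ (q x) (gradient φ x) := by
    refine setIntegral_eq_of_subset_of_forall_sdiff_eq_zero P.isOpen_Ω.measurableSet
      (interior_subset_Ω hK) fun x hx => ?_
    rw [inner_gradient]
    refine Finset.sum_eq_zero fun i _ => ?_
    rw [image_eq_zero_of_notMem_tsupport (f := partialDeriv i φ) fun hx' =>
      hx.2 ((hφ.partialDeriv i).support_subset hx'), mul_zero]
  rw [h2, ← hφ.setIntegral_eq P.isOpen_Ω.measurableSet (interior_subset_Ω hK)] at h1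
  simp_rw [inner_gradient] at h1
  rw [integral_finsetSum _ fun i _ => integrable_mul_of_memLp (hb K hK i).1.memu
    (hφm (hφ.partialDeriv i)), Finset.sum_congr rfl fun i _ => (hb K hK i).1.ibp φ hφ i,
    Finset.sum_neg_distrib, neg_inj] at h1
  rw [← h1]
  simp_rw [Finset.sum_mul]
  exact integral_finsetSum _ fun i _ => integrable_mul_of_memLp ((hb K hK i).1.memg i) (hφm hφ)

include hd in
-- Summing Green's formula over the elements gives the boundary sum. The volume terms cancel, by the
-- global weak form and because the elementwise divergence is `g`.
theorem bdryIntegral_eq_zero_of_smooth {v : Space d → ℝ} (hv : ContDiff ℝ ∞ v)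
    (h0 : ∀ x ∈ closure P.ΓD, v x = 0) :
    T.bdryIntegral (fun K a x => (∑ i, tq K i a x * normal K a i) * v x) = 0 := by
  have h1 := hq v _ (P.memH1D_of_smooth hv h0)
  have hvm := memLp_volume_of_continuous P.isBounded_Ω hv.continuous 2
  have hpm := fun i => continuous_partialDeriv (hv.of_le (m := 1) (by simp)) i
  have i1 : ∀ K ∈ T.elements, ∀ i, Integrable (fun x => q x i * partialDeriv i v x)
      (volume.restrict (hull K)) := fun K hK i =>
    integrable_mul_of_memLp (hb K hK i).2.memu (memLp_hull K (hpm i))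
  have i2 : Integrable (fun x => inner ℝ (q x) (gradient v x)) (volume.restrict P.Ω) :=
    T.integrable_Ω fun K hK => by
      simp_rw [inner_gradient]
      exact integrable_finsetSum _ fun i _ => i1 K hK i
  have i3 : Integrable (fun x => g x * v x) (volume.restrict P.Ω) :=
    integrable_mul_of_memLp hg hvm
  rw [← T.integral_eq i2, ← T.integral_eq i3, ← sub_eq_zero, sub_neg_eq_add, Triangulation.integral,
    Triangulation.integral, ← Finset.sum_add_distrib] at h1
  rw [← h1, bdryIntegral]
  refine Finset.sum_congr rfl fun K hK => ?_
  have hKe := isElement hK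
  have hgr := fun i => (hb K hK i).2.green hKe hd hv i
  simp_rw [inner_gradient]
  have hdiv : ∫ x in hull K, g x * v x = ∑ i, ∫ x in hull K, gq K i i x * v x := by
    rw [← integral_finsetSum _ fun i _ => integrable_mul_of_memLp ((hb K hK i).2.memg i)
      (memLp_hull K hv.continuous)]
    refine integral_congr_ae ?_
    filter_upwards [div_eq hg hq hb hK] with x hx
    rw [← hx, Finset.sum_mul]
  rw [hdiv, integral_finsetSum _ fun i _ => i1 K hK i, ← Finset.sum_add_distrib,
    Finset.sum_congr rfl fun i _ => add_comm _ _, Finset.sum_congr rfl fun i _ => hgr i,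
    Finset.sum_comm]
  refine Finset.sum_congr rfl fun a ha => ?_
  have hvF := hKe.memLp_facet hd ha hv.continuous
  have e : ∀ x, (∑ i, tq K i a x * normal K a i) * v x
      = ∑ i, normal K a i * (tq K i a x * v x) := fun x => by
    rw [Finset.sum_mul]
    exact Finset.sum_congr rfl fun i _ => by ring
  simp_rw [e]
  rw [integral_finsetSum _ fun i _ => (integrable_mul_of_memLp ((hb K hK i).2.memLp ha)
    hvF).const_mul _]
  simp_rw [integral_const_mul]

include hd in
-- Localisation to one facet: `ψ` is multiplied by smooth cutoffs that vanish on all other facets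
-- and tend to `1` almost everywhere on `F`. Since `F` is not a Dirichlet facet, all Dirichlet
-- facets are among the others, and the products are admissible test functions.
theorem bdryIntegral_single_facet {F : Finset (Space d)} (hF : F ∈ T.facets)
    (hFD : ¬ hull F ⊆ closure P.ΓD) {ψ : Space d → ℝ} (hψ : ContDiff ℝ ∞ ψ)
    [DecidableEq (Finset (Space d))] :
    ∑ K ∈ T.elements, ∑ a ∈ K, (if facet K a = F then
      ∫ x, (∑ i, tq K i a x * normal K a i) * ψ x ∂(facetMeasure K a) else 0) = 0 := by
  set Z : Set (Space d) := ⋃ F' ∈ T.facets.erase F, hull F' with hZ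
  have hZc : IsClosed Z := (T.facets.erase F).finite_toSet.isClosed_biUnion
    fun F' _ => (isCompact_hull F').isClosed
  obtain ⟨f, hfs, hf, hfr⟩ := hZc.isOpen_compl.exists_contDiff_support_eq (n := ⊤)
  have hf0 : ∀ F' ∈ T.facets, F' ≠ F → ∀ x ∈ hull F', f x = 0 := fun F' hF' hne x hx => by
    have hxZ : x ∈ Z := Set.mem_biUnion (Finset.mem_erase.2 ⟨hne, hF'⟩) hx
    by_contra hcon
    have : x ∈ Function.support f := hcon
    rw [hfs] at this
    exact this hxZ
  have hfpos : ∀ x, x ∉ Z → 0 < f x := fun x hx => by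
    have h1 : x ∈ Function.support f := by rw [hfs]; exact hx
    exact lt_of_le_of_ne (hfr ⟨x, rfl⟩).1 (Ne.symm h1)
  set v : ℕ → Space d → ℝ := fun n x => ψ x * Real.smoothTransition (n * f x) with hv
  have hvs : ∀ n, ContDiff ℝ ∞ (v n) := fun n =>
    hψ.mul (Real.smoothTransition.contDiff.comp (contDiff_const.mul hf))
  have hv0 : ∀ n, ∀ F' ∈ T.facets, F' ≠ F → ∀ x ∈ hull F', v n x = 0 :=
    fun n F' hF' hne x hx => by simp [hv, hf0 F' hF' hne x hx]
  have hzero : ∀ n, T.bdryIntegral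
      (fun K a x => (∑ i, tq K i a x * normal K a i) * v n x) = 0 := fun n =>
    bdryIntegral_eq_zero_of_smooth hd hg hq hb (hvs n) fun x hx => by
      obtain ⟨F', h1, h2, h3⟩ := exists_facet_of_mem_ΓD (T := T) hx
      exact hv0 n F' h1 (fun h => hFD (h ▸ h2)) x h3
  have hnull : ∀ᵐ x ∂((surface d).restrict (hull F)), x ∉ Z := by
    rw [← measure_eq_zero_iff_ae_notMem, Measure.restrict_apply hZc.measurableSet, hZ,
      Set.iUnion₂_inter]
    refine (measure_biUnion_null_iff (T.facets.erase F).countable_toSet).2 fun F' hF' => ?_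
    have := Finset.mem_erase.1 hF'
    exact surface_inter_eq_zero this.2 hF this.1
  refine tendsto_nhds_unique (f := fun n => T.bdryIntegral
    (fun K a x => (∑ i, tq K i a x * normal K a i) * v n x)) (l := atTop) ?_
    (tendsto_const_nhds.congr fun n => (hzero n).symm)
  refine tendsto_finsetSum _ fun K hK => tendsto_finsetSum _ fun a ha => ?_
  have hKe := isElement hK
  have hFm := facet_mem hd hK ha
  have mt : MemLp (fun x => ∑ i, tq K i a x * normal K a i) 2 (facetMeasure K a) :=
    memLp_finsetSum _ fun i _ => ((hb K hK i).2.memLp ha).mul_const _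
  by_cases hKF : facet K a = F
  · rw [if_pos hKF]
    refine tendsto_integral_of_dominated_convergence
      (fun x => ‖(∑ i, tq K i a x * normal K a i) * ψ x‖)
      (fun n => (integrable_mul_of_memLp mt
        (hKe.memLp_facet hd ha (hvs n).continuous)).aestronglyMeasurable)
      (integrable_mul_of_memLp mt (hKe.memLp_facet hd ha hψ.continuous)).norm
      (fun n => ae_of_all _ fun x => ?_) ?_
    · simp only [hv]
      rw [← mul_assoc, norm_mul]
      refine mul_le_of_le_one_right (norm_nonneg _) ?_
      rw [Real.norm_eq_abs, abs_of_nonneg (Real.smoothTransition.nonneg _)]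
      exact Real.smoothTransition.le_one _
    · rw [hKF]
      filter_upwards [hnull] with x hx
      have hfx := hfpos x hx
      refine tendsto_const_nhds.congr' ?_
      obtain ⟨N, hN⟩ := exists_nat_ge (1 / f x)
      filter_upwards [eventually_ge_atTop N] with n hn
      have h1 : 1 ≤ n * f x := by
        have : (N : ℝ) ≤ n := by exact_mod_cast hn
        rw [← div_le_iff₀ hfx]; exact hN.trans this
      simp only [hv]
      rw [Real.smoothTransition.one_of_one_le h1, mul_one]
  · rw [if_neg hKF]
    refine tendsto_const_nhds.congr fun n => ?_
    rw [setIntegral_congr_fun (g := fun _ => 0) (isCompact_hull _).measurableSet fun x hx => by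
      simp only [hv0 n _ hFm hKF x hx, mul_zero]]
    simp

include hd in
/-- The normal flux is single valued on facets, and vanishes on the Neumann boundary. -/
theorem bdryIntegral_flux_eq_zero {μ : Finset (Space d) → Space d → ℝ}
    (hμ : ∀ F ∈ T.facets, ContDiff ℝ ∞ (μ F))
    (hμ0 : ∀ F ∈ T.facets, hull F ⊆ closure P.ΓD → ∀ x ∈ hull F, μ F x = 0) :
    T.bdryIntegral
      (fun K a x => (∑ i, tq K i a x * normal K a i) * μ (facet K a) x) = 0 := by
  classical
  -- The polynomials `μ F` on different facets need not match, so the sum is treated facet by facet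
  -- with `μ F` taken as a function on the whole space.
  have h1 : ∀ F ∈ T.facets, ∑ K ∈ T.elements, ∑ a ∈ K, (if facet K a = F then
      ∫ x, (∑ i, tq K i a x * normal K a i) * μ F x ∂(facetMeasure K a) else 0) = 0 := by
    intro F hF
    by_cases hFD : hull F ⊆ closure P.ΓD
    · refine Finset.sum_eq_zero fun K _ => Finset.sum_eq_zero fun a _ => ?_
      split_ifs with h
      · rw [setIntegral_congr_fun (g := fun _ => 0) (isCompact_hull _).measurableSet fun x hx => by
          rw [h] at hx
          simp only [hμ0 F hF hFD x hx, mul_zero]]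
        simp
      · rfl
    · exact bdryIntegral_single_facet hd hg hq hb hF hFD (hμ F hF)
  rw [← Finset.sum_eq_zero h1, Finset.sum_comm, bdryIntegral]
  refine Finset.sum_congr rfl fun K hK => ?_
  rw [Finset.sum_comm]
  refine Finset.sum_congr rfl fun a ha => ?_
  rw [Finset.sum_ite_eq, if_pos (facet_mem hd hK ha)]

end

/-! ### Traces of functions in `H¹(Ω)` -/

theorem L2Tendsto_mono {X : Type*} [MeasurableSpace X] {ν ν' : Measure X} {F : ℕ → X → ℝ}
    {f : X → ℝ} (h : L2Tendsto ν F f) (hν : ν' ≤ ν) : L2Tendsto ν' F f :=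
  .of_eLpNorm (fun n => (h.memF n).mono_measure hν) (h.memf.mono_measure hν)
    (tendsto_of_tendsto_of_tendsto_of_le_of_le tendsto_const_nhds h.eLpNorm
      (fun _ => zero_le) fun _ => eLpNorm_mono_measure _ hν)

/-- One sequence of smooth functions on the whole space approximates `v` on all elements at once.
Its limit on a facet does not refer to an element, so the trace can be indexed by facets. On
Dirichlet facets the limit is given to be `0`. -/
theorem exists_single_valued_trace (hd : 1 ≤ d) {v : Space d → ℝ} {G : Space d → Space d}
    (h : P.MemH1D v G) :
    ∃ t : Finset (Space d) → Space d → ℝ,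
      (∀ K ∈ T.elements, IsElemTrace K v (fun i x => G x i) (fun a => t (facet K a))) ∧
      ∀ F, hull F ⊆ closure P.ΓD → t F = 0 := by
  classical
  have hcp : IsCompact (closure P.ΓD) :=
    P.isBounded_Ω.isCompact_closure.of_isClosed_subset isClosed_closure
      (closure_ΓD_subset.trans frontier_subset_closure)
  have hfacet : ∀ F ∈ T.facets, surface d (hull F) < ⊤ := fun F hF => by
    obtain ⟨h1, h2⟩ := mem_facets.1 hF
    obtain ⟨K, hK, hFK, hcard⟩ := T.pure F h1
    obtain ⟨a, ha⟩ : ∃ a, a ∈ K \ F := by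
      rw [← Finset.Nonempty, ← Finset.card_pos, Finset.card_sdiff_of_subset hFK]; omega
    obtain ⟨haK, haF⟩ := Finset.mem_sdiff.1 ha
    have hKel : K ∈ T.elements := mem_elements.2 ⟨hK, hcard⟩
    have e : F = facet K a := by
      refine Finset.eq_of_subset_of_card_le (fun x hx => mem_facet.2
        ⟨fun h => haF (h ▸ hx), hFK hx⟩) ?_
      rw [(isElement hKel).card_facet haK, h2]
    rw [e]
    exact (isElement hKel).surface_facet_lt_top hd haK
  -- The closure of `Γ_D` is covered by finitely many facets of finite measure, so continuous
  -- functions are square integrable on it.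
  have hfin : surface d (closure P.ΓD) < ⊤ := by
    refine (measure_mono (t := ⋃ F ∈ T.facets, hull F) fun x hx => ?_).trans_lt
      ((measure_biUnion_finset_le _ _).trans_lt (ENNReal.sum_lt_top.2 hfacet))
    obtain ⟨F, hF, -, hxF⟩ := exists_facet_of_mem_ΓD (T := T) hx
    exact Set.mem_biUnion hF hxF
  obtain ⟨g, φ, hw, hφ, h1, h2, h3⟩ := h.2.exists_approx P.isBounded_Ω hcp hfin
  have hgG := fun i => hw.unique P.isOpen_Ω h.1.weakGrad i
  have hH1 : ∀ K ∈ T.elements, H1Approx K v (fun i x => G x i) φ := fun K hK =>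
    ⟨hφ, L2Tendsto_mono h1 (restrict_hull_le hK),
      fun i => L2Tendsto_mono ((h2 i).congr (hgG i)) (restrict_hull_le hK)⟩
  have hex : ∀ F : Finset (Space d), ∃ t : Space d → ℝ,
      ((∃ K ∈ T.elements, ∃ a ∈ K, facet K a = F) →
        L2Tendsto ((surface d).restrict (hull F)) φ t) ∧
      (hull F ⊆ closure P.ΓD → t = 0) := fun F => by
    by_cases hFD : hull F ⊆ closure P.ΓD
    · exact ⟨0, fun _ => L2Tendsto_mono h3 (Measure.restrict_mono hFD le_rfl), fun _ => rfl⟩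
    · by_cases hF : ∃ K ∈ T.elements, ∃ a ∈ K, facet K a = F
      · obtain ⟨K, hK, a, ha, rfl⟩ := hF
        obtain ⟨t, ht⟩ := (hH1 K hK).exists_trace (isElement hK) hd ha
        exact ⟨t, fun _ => ht, fun h => absurd h hFD⟩
      · exact ⟨0, fun h => absurd h hF, fun _ => rfl⟩
  choose t ht ht0 using hex
  exact ⟨t, fun K hK => ⟨φ, hH1 K hK, fun a ha => ht _ ⟨K, hK, a, ha, rfl⟩⟩, ht0⟩

end Triangulation

/-! ### Error equations -/

theorem inner_eq_sum (v w : Space d) : inner ℝ v w = ∑ i, v i * w i := by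
  rw [PiLp.inner_apply]
  exact Finset.sum_congr rfl fun i _ => by simp [mul_comm]

theorem IsPolyVec.inner_const {m : ℕ} {r : Space d → Space d} (h : IsPolyVec m r) (n : Space d) :
    IsPoly m fun x => inner ℝ (r x) n := by
  simp_rw [inner_eq_sum]
  exact IsPoly.sum _ fun i _ => by simpa [mul_comm] using (h i).const_mul (n i)

theorem IsPolyVec.sub {m : ℕ} {r r' : Space d → Space d} (h : IsPolyVec m r)
    (h' : IsPolyVec m r') : IsPolyVec m fun x => r x - r' x := fun i => by
  simpa using (h i).sub (h' i)

theorem IsPolyVec.div {m : ℕ} {r : Space d → Space d} (h : IsPolyVec m r) :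
    IsPoly (m - 1) fun x => ∑ i, partialDeriv i (fun y => r y i) x :=
  IsPoly.sum _ fun i _ => (h i).partialDeriv i

theorem IsPoly.gradient {m : ℕ} {v : Space d → ℝ} (h : IsPoly m v) :
    IsPolyVec (m - 1) (gradient v) := fun i => by
  simp_rw [gradient_apply]
  exact h.partialDeriv i

theorem integral_inner_eq_sum {ν : Measure (Space d)} {v w : Space d → Space d}
    (hv : ∀ i, MemLp (fun x => v x i) 2 ν) (hw : ∀ i, MemLp (fun x => w x i) 2 ν) :
    ∫ x, inner ℝ (v x) (w x) ∂ν = ∑ i, ∫ x, v x i * w x i ∂ν := by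
  simp_rw [inner_eq_sum]
  exact integral_finsetSum _ fun i _ => integrable_mul_of_memLp (hv i) (hw i)

theorem integral_norm_sq_eq_sum {ν : Measure (Space d)} {v : Space d → Space d}
    (hv : ∀ i, MemLp (fun x => v x i) 2 ν) :
    ∫ x, ‖v x‖ ^ 2 ∂ν = ∑ i, ∫ x, v x i ^ 2 ∂ν := by
  simp_rw [EuclideanSpace.norm_sq_eq, Real.norm_eq_abs, sq_abs]
  exact integral_finsetSum _ fun i _ => (hv i).integrable_sq

theorem IsPolyVec.memLp_hull {m : ℕ} {r : Space d → Space d} (h : IsPolyVec m r)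
    (K : Finset (Space d)) (i : Fin d) : MemLp (fun x => r x i) 2 (volume.restrict (hull K)) :=
  HDG.memLp_hull K (h i).continuous

theorem integral_sub_mul {X : Type*} [MeasurableSpace X] {ν : Measure X} {f g w : X → ℝ}
    (hf : MemLp f 2 ν) (hg : MemLp g 2 ν) (hw : MemLp w 2 ν) :
    ∫ x, (f x - g x) * w x ∂ν = (∫ x, f x * w x ∂ν) - ∫ x, g x * w x ∂ν := by
  simp_rw [sub_mul]
  exact integral_sub (integrable_mul_of_memLp hf hw) (integrable_mul_of_memLp hg hw)

theorem integral_add_mul {X : Type*} [MeasurableSpace X] {ν : Measure X} {f g w : X → ℝ}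
    (hf : MemLp f 2 ν) (hg : MemLp g 2 ν) (hw : MemLp w 2 ν) :
    ∫ x, (f x + g x) * w x ∂ν = (∫ x, f x * w x ∂ν) + ∫ x, g x * w x ∂ν := by
  simp_rw [add_mul]
  exact integral_add (integrable_mul_of_memLp hf hw) (integrable_mul_of_memLp hg hw)

/-- The properties of the exact solution `(q, u)` and of its projection `(pq, pu)` that enter
the error analysis. Here `s K` is the value of the coefficient on `K`, `Gu` the gradient
of `u`, `tu` and `tq` are traces. -/
structure IsExact {P : Problem d} (T : Triangulation P) (k : ℕ) (τ : Finset (Space d) → ℝ)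
    (f : Space d → ℝ) (q : Space d → Space d) (u : Space d → ℝ)
    (pq : Finset (Space d) → Space d → Space d) (pu : Finset (Space d) → Space d → ℝ)
    (s : Finset (Space d) → ℝ) (Gu : Space d → Space d) (tu : Finset (Space d) → Space d → ℝ)
    (gq : Finset (Space d) → Fin d → Fin d → Space d → ℝ)
    (tq : Finset (Space d) → Fin d → Space d → Space d → ℝ) : Prop where
  memf : MemLp f 2 (volume.restrict P.Ω)
  sigma : ∀ K ∈ T.elements, ∀ᵐ x ∂(volume.restrict (hull K)), P.σ x = s K
  grad : ∀ K ∈ T.elements, ∀ i,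
    (fun x => (s K)⁻¹ * q x i) =ᵐ[volume.restrict (hull K)] fun x => -Gu x i
  trace : ∀ K ∈ T.elements, IsElemTrace K u (fun i x => Gu x i) (fun a => tu (facet K a))
  trace_zero : ∀ F, hull F ⊆ closure P.ΓD → tu F = 0
  broken : T.IsBrokenField q gq tq
  weak : ∀ (v : Space d → ℝ) (Gv : Space d → Space d), P.MemH1D v Gv →
    ∫ x in P.Ω, inner ℝ (q x) (Gv x) = -∫ x in P.Ω, -f x * v x
  proj : IsHDGProjection T k τ q u pq pu
  facet_moment : ∀ K ∈ T.elements, ∀ a ∈ K, ∀ l : Space d → ℝ, IsPoly k l →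
    ∫ x, (inner ℝ (pq K x) (normal K a) + τ (facet K a) * pu K x) * l x ∂(facetMeasure K a)
      = ∫ x, ((∑ i, tq K i a x * normal K a i) + τ (facet K a) * tu (facet K a) x) * l x
        ∂(facetMeasure K a)

section

variable {P : Problem d} {T : Triangulation P} {k : ℕ} {τ : Finset (Space d) → ℝ}
  {f : Space d → ℝ} {q : Space d → Space d} {u : Space d → ℝ}
  {pq : Finset (Space d) → Space d → Space d} {pu : Finset (Space d) → Space d → ℝ}
  {s : Finset (Space d) → ℝ} {Gu : Space d → Space d} {tu : Finset (Space d) → Space d → ℝ}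
  {gq : Finset (Space d) → Fin d → Fin d → Space d → ℝ}
  {tq : Finset (Space d) → Fin d → Space d → Space d → ℝ}
  {qh : Finset (Space d) → Space d → Space d} {uh ubar : Finset (Space d) → Space d → ℝ}
  (hd : 1 ≤ d) (hE : IsExact T k τ f q u pq pu s Gu tu gq tq)
  (hH : IsHDGSolution T k τ f qh uh ubar)

include hE in
theorem IsExact.memq {K : Finset (Space d)} (hK : K ∈ T.elements) (i : Fin d) :
    MemLp (fun x => q x i) 2 (volume.restrict (hull K)) := (hE.broken K hK i).2.memu

include hE in
theorem IsExact.integral_sigma_inner {K : Finset (Space d)} (hK : K ∈ T.elements)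
    {v w : Space d → Space d} (hv : ∀ i, MemLp (fun x => v x i) 2 (volume.restrict (hull K)))
    (hw : ∀ i, MemLp (fun x => w x i) 2 (volume.restrict (hull K))) :
    ∫ x in hull K, (P.σ x)⁻¹ * inner ℝ (v x) (w x)
      = (s K)⁻¹ * ∑ i, ∫ x in hull K, v x i * w x i := by
  rw [← integral_inner_eq_sum hv hw, ← integral_const_mul]
  refine integral_congr_ae ?_
  filter_upwards [hE.sigma K hK] with x hx
  rw [hx]

include hd hE hH

/-- The error equation for the flux. -/
theorem error_flux {r : Finset (Space d) → Space d → Space d} (hr : MemV T k r) :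
    ∑ K ∈ T.elements, (s K)⁻¹ * ∑ i, ∫ x in hull K, (q x i - qh K x i) * r K x i
      = ∑ K ∈ T.elements, ((∫ x in hull K, (u x - uh K x) *
          ∑ i, partialDeriv i (fun y => r K y i) x)
        - ∑ a ∈ K, ∫ x, (tu (facet K a) x - ubar (facet K a) x) *
          inner ℝ (r K x) (normal K a) ∂(facetMeasure K a)) := by
  have h1 := hH.eq1 r hr
  rw [Triangulation.integral, Triangulation.integral, Triangulation.bdryIntegral,
    ← Finset.sum_add_distrib, ← Finset.sum_sub_distrib] at h1
  rw [← sub_eq_zero, ← Finset.sum_sub_distrib, ← neg_eq_zero, ← Finset.sum_neg_distrib, ← h1]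
  refine Finset.sum_congr rfl fun K hK => ?_
  have hKe := Triangulation.isElement hK
  have hrK := hr K hK
  have hqK := hH.memV K hK
  have huK := hH.memW K hK
  have mr := hrK.memLp_hull K
  have mdiv := memLp_hull K hrK.div.continuous
  have mn := fun a (ha : a ∈ K) => hKe.memLp_facet hd ha (hrK.inner_const (normal K a)).continuous
  have mub := fun a (ha : a ∈ K) => hKe.memLp_facet hd ha
    (hH.memM _ (Triangulation.facet_mem hd hK ha)).1.continuous
  have muh := fun a (ha : a ∈ K) => hKe.memLp_facet hd ha huK.continuous
  -- Green's formula for `u_h` undoes the integration by parts in the method; for `u` it expresses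
  -- `σ⁻¹ q = -∇u`. The difference is the error equation.
  have g1 := (isElemTrace_of_smooth hKe hd huK.contDiff).green_vec hKe hd
    fun i => (hrK i).contDiff
  have g2 := (hE.trace K hK).green_vec hKe hd fun i => (hrK i).contDiff
  have e1 := hE.integral_sigma_inner hK (hqK.memLp_hull K) mr
  have e2 : ∫ x in hull K, inner ℝ (gradient (uh K) x) (r K x)
      = ∑ i, ∫ x in hull K, partialDeriv i (uh K) x * r K x i := by
    rw [integral_inner_eq_sum (huK.gradient.memLp_hull K) mr]
    simp_rw [gradient_apply]
  have e3 : ∑ a ∈ K, ∫ x, (uh K x - ubar (facet K a) x) * inner ℝ (r K x) (normal K a)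
        ∂(facetMeasure K a)
      = (∑ a ∈ K, ∫ x, uh K x * inner ℝ (r K x) (normal K a) ∂(facetMeasure K a))
        - ∑ a ∈ K, ∫ x, ubar (facet K a) x * inner ℝ (r K x) (normal K a)
          ∂(facetMeasure K a) := by
    rw [← Finset.sum_sub_distrib]
    exact Finset.sum_congr rfl fun a ha => integral_sub_mul (muh a ha) (mub a ha) (mn a ha)
  have e4 : ∑ a ∈ K, ∫ x, (tu (facet K a) x - ubar (facet K a) x) *
        inner ℝ (r K x) (normal K a) ∂(facetMeasure K a)
      = (∑ a ∈ K, ∫ x, tu (facet K a) x * inner ℝ (r K x) (normal K a) ∂(facetMeasure K a))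
        - ∑ a ∈ K, ∫ x, ubar (facet K a) x * inner ℝ (r K x) (normal K a)
          ∂(facetMeasure K a) := by
    rw [← Finset.sum_sub_distrib]
    exact Finset.sum_congr rfl fun a ha =>
      integral_sub_mul ((hE.trace K hK).memLp ha) (mub a ha) (mn a ha)
  have e5 := integral_sub_mul (hE.trace K hK).memu (memLp_hull K huK.continuous) mdiv
  have e6 : (s K)⁻¹ * ∑ i, ∫ x in hull K, (q x i - qh K x i) * r K x i
      = -(∑ i, ∫ x in hull K, Gu x i * r K x i)
        - (s K)⁻¹ * ∑ i, ∫ x in hull K, qh K x i * r K x i := by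
    rw [Finset.sum_congr rfl fun i _ => integral_sub_mul (hE.memq hK i)
      (hqK.memLp_hull K i) (mr i), Finset.sum_sub_distrib, mul_sub]
    congr 1
    rw [Finset.mul_sum, ← Finset.sum_neg_distrib]
    refine Finset.sum_congr rfl fun i _ => ?_
    rw [← integral_const_mul, ← integral_neg]
    refine integral_congr_ae ?_
    filter_upwards [hE.grad K hK i] with x hx
    rw [← mul_assoc, hx, neg_mul]
  rw [e1, e2, e3, e4, e5, e6]
  linarith

/-- The normal component of the error of the numerical flux, for the projected solution. -/
def fluxError (τ : Finset (Space d) → ℝ) (pq qh : Finset (Space d) → Space d → Space d)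
    (pu uh tu ubar : Finset (Space d) → Space d → ℝ) (K : Finset (Space d)) (a x : Space d) : ℝ :=
  inner ℝ (pq K x - qh K x) (normal K a)
    + τ (facet K a) * (pu K x - uh K x - (tu (facet K a) x - ubar (facet K a) x))

/-- Against polynomials of degree `k` the facet moments of the projection make `Π_V q·n + τ(Π_W u -
u)` equal to the exact normal flux. So `fluxError` acts as exact flux minus numerical flux. -/
theorem integral_fluxError {K : Finset (Space d)} (hK : K ∈ T.elements) {a : Space d}
    (ha : a ∈ K) {l : Space d → ℝ} (hl : IsPoly k l) :
    ∫ x, fluxError τ pq qh pu uh tu ubar K a x * l x ∂(facetMeasure K a)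
      = (∫ x, (∑ i, tq K i a x * normal K a i) * l x ∂(facetMeasure K a))
        - ∫ x, (inner ℝ (qh K x) (normal K a)
            + τ (facet K a) * (uh K x - ubar (facet K a) x)) * l x ∂(facetMeasure K a) := by
  have hKe := Triangulation.isElement hK
  have hF := Triangulation.facet_mem hd hK ha
  have h1 := hE.facet_moment K hK a ha l hl
  have ml := hKe.memLp_facet hd ha hl.continuous
  have m1 : MemLp (fun x => inner ℝ (pq K x) (normal K a) + τ (facet K a) * pu K x) 2
      (facetMeasure K a) := (hKe.memLp_facet hd ha
        ((hE.proj.memV K hK).inner_const _).continuous).add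
      ((hKe.memLp_facet hd ha (hE.proj.memW K hK).continuous).const_mul _)
  have m2 : MemLp (fun x => inner ℝ (qh K x) (normal K a)
      + τ (facet K a) * (uh K x - ubar (facet K a) x)) 2 (facetMeasure K a) :=
    hKe.memLp_facet hd ha (((hH.memV K hK).inner_const _).add
      (((hH.memW K hK).sub (hH.memM _ hF).1).const_mul _)).continuous
  have m3 : MemLp (fun x => τ (facet K a) * tu (facet K a) x) 2 (facetMeasure K a) :=
    ((hE.trace K hK).memLp ha).const_mul _
  have m4 : MemLp (fun x => ∑ i, tq K i a x * normal K a i) 2 (facetMeasure K a) :=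
    memLp_finsetSum _ fun i _ => ((hE.broken K hK i).2.memLp ha).mul_const _
  rw [integral_add_mul m4 m3 ml] at h1
  have e : ∀ x, fluxError τ pq qh pu uh tu ubar K a x
      = (inner ℝ (pq K x) (normal K a) + τ (facet K a) * pu K x
          - τ (facet K a) * tu (facet K a) x)
        - (inner ℝ (qh K x) (normal K a)
            + τ (facet K a) * (uh K x - ubar (facet K a) x)) := fun x => by
    rw [fluxError, inner_sub_left]; ring
  have m5 : MemLp (fun x => inner ℝ (pq K x) (normal K a) + τ (facet K a) * pu K x
          - τ (facet K a) * tu (facet K a) x) 2 (facetMeasure K a) := m1.sub m3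
  simp_rw [e]
  rw [integral_sub_mul m5 m2 ml, integral_sub_mul m1 m3 ml]
  linarith

/-- Green's formula for `q` and `v` minus the second HDG equation. As `∇v` has degree `k - 1`, the
moments of the projection allow `q` to be replaced by `Π_V q`; this requires `k ≥ 1`. -/
theorem error_mass {v : Finset (Space d) → Space d → ℝ} (hk : 1 ≤ k) (hv : MemW T k v) :
    ∑ K ∈ T.elements, ((∑ i, ∫ x in hull K, (pq K x i - qh K x i) * partialDeriv i (v K) x)
      - ∑ a ∈ K, ∫ x, fluxError τ pq qh pu uh tu ubar K a x * v K x ∂(facetMeasure K a)) = 0 := by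
  have h2 := hH.eq2 v hv
  rw [Triangulation.integral, Triangulation.integral, Triangulation.bdryIntegral,
    ← Finset.sum_sub_distrib, ← sub_eq_zero, ← Finset.sum_sub_distrib] at h2
  rw [← neg_eq_zero, ← Finset.sum_neg_distrib, ← h2]
  refine Finset.sum_congr rfl fun K hK => ?_
  have hKe := Triangulation.isElement hK
  have hvK := hv K hK
  have mv := hvK.gradient.memLp_hull K
  have mvF := fun a (ha : a ∈ K) => hKe.memLp_facet hd ha hvK.continuous
  have hdiv : ∑ i, ∫ x in hull K, gq K i i x * v K x = -∫ x in hull K, f x * v K x := by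
    rw [← integral_finsetSum _ fun i _ => integrable_mul_of_memLp ((hE.broken K hK i).2.memg i)
      (memLp_hull K hvK.continuous), ← integral_neg]
    refine integral_congr_ae ?_
    filter_upwards [Triangulation.div_eq hE.memf.neg hE.weak hE.broken hK] with x hx
    rw [← Finset.sum_mul, hx]
    simp
  have hgr := Finset.sum_congr rfl fun (i : Fin d) (_ : i ∈ Finset.univ) =>
    (hE.broken K hK i).2.green hKe hd hvK.contDiff i
  rw [Finset.sum_add_distrib, hdiv, Finset.sum_comm] at hgr
  have hmom : ∑ i, ∫ x in hull K, pq K x i * partialDeriv i (v K) x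
      = ∑ i, ∫ x in hull K, q x i * partialDeriv i (v K) x := by
    have := hE.proj.moment_q K hK (k - 1) (by omega) _ hvK.gradient
    rw [integral_inner_eq_sum ((hE.proj.memV K hK).memLp_hull K) mv,
      integral_inner_eq_sum (hE.memq hK) mv] at this
    simpa only [gradient_apply] using this
  have hqh : ∫ x in hull K, inner ℝ (qh K x) (gradient (v K) x)
      = ∑ i, ∫ x in hull K, qh K x i * partialDeriv i (v K) x := by
    rw [integral_inner_eq_sum ((hH.memV K hK).memLp_hull K) mv]
    simp_rw [gradient_apply]
  have hsub : ∑ i, ∫ x in hull K, (pq K x i - qh K x i) * partialDeriv i (v K) x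
      = (∑ i, ∫ x in hull K, pq K x i * partialDeriv i (v K) x)
        - ∑ i, ∫ x in hull K, qh K x i * partialDeriv i (v K) x := by
    rw [← Finset.sum_sub_distrib]
    refine Finset.sum_congr rfl fun i _ => ?_
    have := mv i
    simp_rw [gradient_apply] at this
    exact integral_sub_mul ((hE.proj.memV K hK).memLp_hull K i) ((hH.memV K hK).memLp_hull K i)
      this
  have hfl : ∑ a ∈ K, ∫ x, fluxError τ pq qh pu uh tu ubar K a x * v K x ∂(facetMeasure K a)
      = (∑ a ∈ K, ∑ i, normal K a i * ∫ x, tq K i a x * v K x ∂(facetMeasure K a))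
        - ∑ a ∈ K, ∫ x, (inner ℝ (qh K x) (normal K a)
            + τ (facet K a) * (uh K x - ubar (facet K a) x)) * v K x ∂(facetMeasure K a) := by
    rw [← Finset.sum_sub_distrib]
    refine Finset.sum_congr rfl fun a ha => ?_
    rw [integral_fluxError hd hE hH hK ha hvK]
    congr 1
    have e : ∀ x, (∑ i, tq K i a x * normal K a i) * v K x
        = ∑ i, normal K a i * (tq K i a x * v K x) := fun x => by
      rw [Finset.sum_mul]
      exact Finset.sum_congr rfl fun i _ => by ring
    simp_rw [e]
    rw [integral_finsetSum _ fun i _ => (integrable_mul_of_memLp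
      ((hE.broken K hK i).2.memLp ha) (mvF a ha)).const_mul _]
    simp_rw [integral_const_mul]
  rw [hqh, hsub, hmom, hfl]
  linarith

/-- Both the exact and the numerical flux are orthogonal to `M_h`, the exact one because its normal
component is single valued and vanishes on the Neumann part. -/
theorem error_conservation {μ : Finset (Space d) → Space d → ℝ} (hμ : MemM T k μ) :
    ∑ K ∈ T.elements, ∑ a ∈ K,
      ∫ x, fluxError τ pq qh pu uh tu ubar K a x * μ (facet K a) x ∂(facetMeasure K a) = 0 := by
  have h3 := hH.eq3 μ hμ
  have h4 := Triangulation.bdryIntegral_flux_eq_zero hd hE.memf.neg hE.weak hE.broken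
    (μ := μ) (fun F hF => (hμ F hF).1.contDiff) fun F hF => (hμ F hF).2
  rw [Triangulation.bdryIntegral] at h3 h4
  rw [← sub_zero (0 : ℝ)]
  nth_rewrite 1 [← h4]
  rw [← h3, ← Finset.sum_sub_distrib]
  refine Finset.sum_congr rfl fun K hK => ?_
  rw [← Finset.sum_sub_distrib]
  exact Finset.sum_congr rfl fun a ha => integral_fluxError hd hE hH hK ha
    (hμ _ (Triangulation.facet_mem hd hK ha)).1

end

/-! ### The duality identity -/

/-- Traces are not polynomials. Their facetwise `L²` projections have the same moments and vanish on
Dirichlet facets, so they belong to `M_h` and can be used as test functions. -/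
theorem Triangulation.exists_facet_projection {P : Problem d} {T : Triangulation P} (hd : 1 ≤ d)
    (k : ℕ) {t : Finset (Space d) → Space d → ℝ}
    (ht : ∀ K ∈ T.elements, ∀ a ∈ K, MemLp (t (facet K a)) 2 (facetMeasure K a))
    (ht0 : ∀ F, hull F ⊆ closure P.ΓD → t F = 0) :
    ∃ p, MemM T k p ∧ ∀ K ∈ T.elements, ∀ a ∈ K, ∀ l, IsPoly k l →
      ∫ x, p (facet K a) x * l x ∂(facetMeasure K a)
        = ∫ x, t (facet K a) x * l x ∂(facetMeasure K a) := by
  have hex : ∀ F : Finset (Space d), ∃ p : Space d → ℝ, IsPoly k p ∧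
      (hull F ⊆ closure P.ΓD → p = 0) ∧
      ((∃ K ∈ T.elements, ∃ a ∈ K, facet K a = F) → ∀ l, IsPoly k l →
        ∫ x, p x * l x ∂((surface d).restrict (hull F))
          = ∫ x, t F x * l x ∂((surface d).restrict (hull F))) := fun F => by
    by_cases hFD : hull F ⊆ closure P.ΓD
    · exact ⟨0, IsPoly.const k 0, fun _ => rfl, fun _ l _ => by simp [ht0 F hFD]⟩
    · by_cases hF : ∃ K ∈ T.elements, ∃ a ∈ K, facet K a = F
      · obtain ⟨K, hK, a, ha, rfl⟩ := hF
        obtain ⟨p, hp, h⟩ := exists_projection (Finset.univ : Finset Unit)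
          (fun _ => facetMeasure K a) (fun _ => 1) (by simp) (polySub d k)
          (fun f hf _ _ => (isElement hK).memLp_facet hd ha (mem_polySub.1 hf).continuous)
          (fun _ => t (facet K a)) (fun _ _ => ht K hK a ha)
        exact ⟨p, mem_polySub.1 hp, fun h => absurd h hFD,
          fun _ l hl => by simpa using h l (mem_polySub.2 hl)⟩
      · exact ⟨0, IsPoly.const k 0, fun _ => rfl, fun h => absurd h hF⟩
  choose p hp hp0 hpt using hex
  exact ⟨p, fun F _ => ⟨hp F, fun h x _ => by simp [hp0 F h]⟩,
    fun K hK a ha l hl => hpt _ ⟨K, hK, a, ha, rfl⟩ l hl⟩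

/-- Integrate `(Π_V q - q_h, ∇φ)` by parts. The divergence has degree `k - 1`, so `φ` can be
replaced by `v` inside elements, and integrating back gives the volume term of the mass equation.
The boundary terms left over are jumps `v - φ`, which the facet condition on `r` converts into
`r·n`. These are the facet terms of the flux error equation tested with `r`. -/
theorem duality_identity {P : Problem d} {T : Triangulation P} {k : ℕ}
    {τ : Finset (Space d) → ℝ} {f : Space d → ℝ} {q : Space d → Space d} {u : Space d → ℝ}
    {pq : Finset (Space d) → Space d → Space d} {pu : Finset (Space d) → Space d → ℝ}
    {s : Finset (Space d) → ℝ} {Gu : Space d → Space d} {tu : Finset (Space d) → Space d → ℝ}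
    {gq : Finset (Space d) → Fin d → Fin d → Space d → ℝ}
    {tq : Finset (Space d) → Fin d → Space d → Space d → ℝ}
    {qh : Finset (Space d) → Space d → Space d} {uh ubar : Finset (Space d) → Space d → ℝ}
    (hd : 1 ≤ d) (hk : 1 ≤ k) (hE : IsExact T k τ f q u pq pu s Gu tu gq tq)
    (hH : IsHDGSolution T k τ f qh uh ubar)
    {φ : Space d → ℝ} {Gφ : Space d → Space d} {tφ : Finset (Space d) → Space d → ℝ}
    (hφ : ∀ K ∈ T.elements, IsElemTrace K φ (fun i x => Gφ x i) (fun a => tφ (facet K a)))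
    (hφ0 : ∀ F, hull F ⊆ closure P.ΓD → tφ F = 0)
    {v : Finset (Space d) → Space d → ℝ} {r : Finset (Space d) → Space d → Space d}
    (hv : MemW T k v) (hr : MemV T k r)
    (h1 : ∀ K ∈ T.elements, ∀ l, IsPoly (k - 1) l →
      ∫ x in hull K, v K x * l x = ∫ x in hull K, φ x * l x)
    (h2 : ∀ K ∈ T.elements, ∀ i, ∀ l, IsPoly (k - 1) l → ∫ x in hull K, r K x i * l x = 0)
    (h3 : ∀ K ∈ T.elements, ∀ a ∈ K, ∀ μ, IsPoly k μ →
      ∫ x, inner ℝ (r K x) (normal K a) * μ x ∂(facetMeasure K a)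
        = τ (facet K a) * ∫ x, (v K x - tφ (facet K a) x) * μ x ∂(facetMeasure K a)) :
    ∑ K ∈ T.elements, ∑ i, ∫ x in hull K, (pq K x i - qh K x i) * Gφ x i
      = ∑ K ∈ T.elements, (s K)⁻¹ * ∑ i, ∫ x in hull K, (q x i - qh K x i) * r K x i := by
  obtain ⟨p, hpM, hp⟩ := Triangulation.exists_facet_projection hd k
    (fun K hK a ha => (hφ K hK).memLp ha) hφ0
  obtain ⟨p', hpM', hp'⟩ := Triangulation.exists_facet_projection hd k
    (fun K hK a ha => (hE.trace K hK).memLp ha) hE.trace_zero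
  have hmass := error_mass hd hE hH hk hv
  have hcons := error_conservation hd hE hH hpM
  -- The mass equation for `v` and the conservation equation for the projection `p` of the trace of
  -- `φ` are inserted as zeros, after which the identity holds on each element separately.
  rw [error_flux hd hE hH hr, ← add_zero (∑ K ∈ T.elements, (_ - _)), ← add_zero (0 : ℝ)]
  nth_rewrite 1 [← hmass]
  rw [← hcons, ← Finset.sum_add_distrib, ← Finset.sum_add_distrib]
  refine Finset.sum_congr rfl fun K hK => ?_
  have hKe := Triangulation.isElement hK
  have hvK := hv K hK
  have hrK := hr K hK
  have hxK := (hE.proj.memV K hK).sub (hH.memV K hK)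
  have hyK := (hE.proj.memW K hK).sub (hH.memW K hK)
  have mn := fun a (ha : a ∈ K) => hKe.memLp_facet hd ha (hrK.inner_const (normal K a)).continuous
  have hub := fun a (ha : a ∈ K) => (hH.memM _ (Triangulation.facet_mem hd hK ha)).1
  have hpp := fun a (ha : a ∈ K) => (hpM _ (Triangulation.facet_mem hd hK ha)).1
  have hpp' := fun a (ha : a ∈ K) => (hpM' _ (Triangulation.facet_mem hd hK ha)).1
  have mtφ := fun a (ha : a ∈ K) => (hφ K hK).memLp ha
  have mtu := fun a (ha : a ∈ K) => (hE.trace K hK).memLp ha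
  -- the elements
  have g1 := (hφ K hK).green_vec hKe hd fun i => (hxK i).contDiff
  have g2 := (isElemTrace_of_smooth hKe hd hvK.contDiff).green_vec hKe hd
    fun i => (hxK i).contDiff
  have g3 := (isElemTrace_of_smooth hKe hd hyK.contDiff).green_vec hKe hd
    fun i => (hrK i).contDiff
  rw [h1 K hK _ hxK.div] at g2
  have z3 : ∑ i, ∫ x in hull K, partialDeriv i (fun x => pu K x - uh K x) x * r K x i = 0 :=
    Finset.sum_eq_zero fun i _ => by
      rw [← h2 K hK i _ (hyK.partialDeriv i)]
      exact integral_congr_ae (ae_of_all _ fun x => mul_comm _ _)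
  rw [z3, zero_add] at g3
  have mdiv := memLp_hull K hrK.div.continuous
  have hu : ∫ x in hull K, (u x - uh K x) * ∑ i, partialDeriv i (fun y => r K y i) x
      = ∫ x in hull K, (pu K x - uh K x) * ∑ i, partialDeriv i (fun y => r K y i) x := by
    rw [integral_sub_mul (hE.trace K hK).memu (memLp_hull K (hH.memW K hK).continuous) mdiv,
      integral_sub_mul (memLp_hull K (hE.proj.memW K hK).continuous)
        (memLp_hull K (hH.memW K hK).continuous) mdiv,
      hE.proj.moment_u K hK (k - 1) (by omega) _ hrK.div]
  rw [hu, g3]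
  have c1 : ∑ i, ∫ x in hull K, Gφ x i * (pq K x - qh K x) i
      = ∑ i, ∫ x in hull K, (pq K x i - qh K x i) * Gφ x i :=
    Finset.sum_congr rfl fun i _ => integral_congr_ae (ae_of_all _ fun x => mul_comm _ _)
  have c2 : ∑ i, ∫ x in hull K, partialDeriv i (v K) x * (pq K x - qh K x) i
      = ∑ i, ∫ x in hull K, (pq K x i - qh K x i) * partialDeriv i (v K) x :=
    Finset.sum_congr rfl fun i _ => integral_congr_ae (ae_of_all _ fun x => mul_comm _ _)
  rw [c1] at g1
  rw [c2] at g2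
  -- the facets
  have hfac : ∀ a ∈ K,
      (∫ x, fluxError τ pq qh pu uh tu ubar K a x * v K x ∂(facetMeasure K a))
        - (∫ x, fluxError τ pq qh pu uh tu ubar K a x * p (facet K a) x ∂(facetMeasure K a))
        - (∫ x, v K x * inner ℝ (pq K x - qh K x) (normal K a) ∂(facetMeasure K a))
        + (∫ x, tφ (facet K a) x * inner ℝ (pq K x - qh K x) (normal K a) ∂(facetMeasure K a))
      = (∫ x, (pu K x - uh K x) * inner ℝ (r K x) (normal K a) ∂(facetMeasure K a))
        - ∫ x, (tu (facet K a) x - ubar (facet K a) x) * inner ℝ (r K x) (normal K a)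
          ∂(facetMeasure K a) := by
    intro a ha
    have mP : ∀ {l}, IsPoly k l → MemLp l 2 (facetMeasure K a) := fun hl =>
      hKe.memLp_facet hd ha hl.continuous
    have hxn := hxK.inner_const (normal K a)
    have hrn := hrK.inner_const (normal K a)
    have hvp := hvK.sub (hpp a ha)
    -- The factor of `τ` in `fluxError` with the trace of `u` replaced by its projection `p'`. It is
    -- a polynomial, so it may enter the facet condition on `r`.
    set w : Space d → ℝ := fun x => pu K x - uh K x - (p' (facet K a) x - ubar (facet K a) x)
      with hw
    have hwP : IsPoly k w := hyK.sub ((hpp' a ha).sub (hub a ha))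
    have e0 : ∀ {m l : Space d → ℝ} , (∫ x, m x * l x ∂(facetMeasure K a))
        = ∫ x, l x * m x ∂(facetMeasure K a) := fun {m l} =>
      integral_congr_ae (ae_of_all _ fun x => mul_comm _ _)
    have mJ1 : MemLp (fun x => inner ℝ (pq K x - qh K x) (normal K a)) 2 (facetMeasure K a) :=
      mP hxn
    have mtub : MemLp (fun x => tu (facet K a) x - ubar (facet K a) x) 2 (facetMeasure K a) :=
      (mtu a ha).sub (mP (hub a ha))
    have mJ2 : MemLp (fun x => pu K x - uh K x - (tu (facet K a) x - ubar (facet K a) x)) 2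
        (facetMeasure K a) := (mP hyK).sub mtub
    have mJ3 : MemLp (fun x => τ (facet K a) *
        (pu K x - uh K x - (tu (facet K a) x - ubar (facet K a) x))) 2 (facetMeasure K a) :=
      mJ2.const_mul _
    have hJ : ∀ l, IsPoly k l → ∫ x, fluxError τ pq qh pu uh tu ubar K a x * l x
          ∂(facetMeasure K a)
        = (∫ x, inner ℝ (pq K x - qh K x) (normal K a) * l x ∂(facetMeasure K a))
          + τ (facet K a) * ∫ x, w x * l x ∂(facetMeasure K a) := fun l hl => by
      simp_rw [fluxError]
      rw [integral_add_mul mJ1 mJ3 (mP hl)]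
      simp_rw [mul_assoc]
      rw [integral_const_mul, integral_sub_mul (mP hyK) mtub (mP hl),
        integral_sub_mul (mtu a ha) (mP (hub a ha)) (mP hl), ← hp' K hK a ha l hl,
        ← integral_sub_mul (mP (hpp' a ha)) (mP (hub a ha)) (mP hl),
        ← integral_sub_mul (mP hyK) (mP ((hpp' a ha).sub (hub a ha))) (mP hl)]
    have t1 : ∫ x, tφ (facet K a) x * inner ℝ (pq K x - qh K x) (normal K a) ∂(facetMeasure K a)
        = ∫ x, inner ℝ (pq K x - qh K x) (normal K a) * p (facet K a) x ∂(facetMeasure K a) := by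
      rw [← hp K hK a ha _ hxn, e0]
    have t2 : ∫ x, v K x * inner ℝ (pq K x - qh K x) (normal K a) ∂(facetMeasure K a)
        = ∫ x, inner ℝ (pq K x - qh K x) (normal K a) * v K x ∂(facetMeasure K a) := e0
    have t3 := h3 K hK a ha w hwP
    rw [integral_sub_mul (mP hvK) (mtφ a ha) (mP hwP), ← hp K hK a ha w hwP] at t3
    have t4 : ∫ x, inner ℝ (r K x) (normal K a) * w x ∂(facetMeasure K a)
        = (∫ x, (pu K x - uh K x) * inner ℝ (r K x) (normal K a) ∂(facetMeasure K a))
        - ∫ x, (tu (facet K a) x - ubar (facet K a) x) * inner ℝ (r K x) (normal K a)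
          ∂(facetMeasure K a) := by
      rw [e0, integral_sub_mul (mP hyK) (mP ((hpp' a ha).sub (hub a ha))) (mP hrn),
        integral_sub_mul (mP (hpp' a ha)) (mP (hub a ha)) (mP hrn),
        integral_sub_mul (mtu a ha) (mP (hub a ha)) (mP hrn), hp' K hK a ha _ hrn]
    have t5 : ∫ x, v K x * w x ∂(facetMeasure K a) = ∫ x, w x * v K x ∂(facetMeasure K a) := e0
    have t6 : ∫ x, p (facet K a) x * w x ∂(facetMeasure K a)
        = ∫ x, w x * p (facet K a) x ∂(facetMeasure K a) := e0
    rw [hJ _ hvK, hJ _ (hpp a ha), t1, t2, ← t4, t3, t5, t6]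
    ring
  have hsum := Finset.sum_congr rfl hfac
  rw [Finset.sum_add_distrib, Finset.sum_sub_distrib, Finset.sum_sub_distrib,
    Finset.sum_sub_distrib] at hsum
  linarith

/-! ### The dual solution -/

namespace Triangulation

variable {P : Problem d} (T : Triangulation P)

/-- The squared `L²` norm of a vector field that is given element by element. -/
def normSq (a : Finset (Space d) → Fin d → Space d → ℝ) : ℝ :=
  ∑ K ∈ T.elements, ∑ i, ∫ x in hull K, a K i x ^ 2

variable {T}

theorem normSq_nonneg (a : Finset (Space d) → Fin d → Space d → ℝ) : 0 ≤ T.normSq a :=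
  Finset.sum_nonneg fun _ _ => sum_integral_sq_nonneg _ _

theorem abs_sum_weighted_le {a b : Finset (Space d) → Fin d → Space d → ℝ}
    (ha : ∀ K ∈ T.elements, ∀ i, MemLp (a K i) 2 (volume.restrict (hull K)))
    (hb : ∀ K ∈ T.elements, ∀ i, MemLp (b K i) 2 (volume.restrict (hull K)))
    {w : Finset (Space d) → ℝ} {S : ℝ} (hw : ∀ K ∈ T.elements, |w K| ≤ S) (hS : 0 ≤ S) :
    |∑ K ∈ T.elements, w K * ∑ i, ∫ x in hull K, a K i x * b K i x|
      ≤ S * (Real.sqrt (T.normSq a) * Real.sqrt (T.normSq b)) := by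
  refine (Finset.abs_sum_le_sum_abs _ _).trans ?_
  have h1 : ∀ K ∈ T.elements, |w K * ∑ i, ∫ x in hull K, a K i x * b K i x|
      ≤ S * (Real.sqrt (∑ i, ∫ x in hull K, a K i x ^ 2)
        * Real.sqrt (∑ i, ∫ x in hull K, b K i x ^ 2)) := fun K hK => by
    rw [abs_mul]
    exact mul_le_mul (hw K hK) (sum_abs_integral_mul_le Finset.univ (fun i _ => ha K hK i)
      fun i _ => hb K hK i) (abs_nonneg _) hS
  refine (Finset.sum_le_sum h1).trans ?_
  rw [← Finset.mul_sum]
  exact mul_le_mul_of_nonneg_left (Real.sum_sqrt_mul_sqrt_le T.elements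
    (fun K => sum_integral_sq_nonneg _ _) fun K => sum_integral_sq_nonneg _ _) hS

/-- The function with the constant value `c K` on each element `K`. -/
def piecewise (T : Triangulation P) (c : Finset (Space d) → ℝ) (x : Space d) : ℝ :=
  ∑ K ∈ T.elements, (interior (hull K)).indicator (fun _ => c K) x

theorem piecewise_ae_eq (c : Finset (Space d) → ℝ) {K : Finset (Space d)} (hK : K ∈ T.elements) :
    T.piecewise c =ᵐ[volume.restrict (hull K)] fun _ => c K := by
  rw [← restrict_interior_hull]
  refine ae_restrict_of_forall_mem isOpen_interior.measurableSet fun x hx => ?_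
  rw [piecewise, Finset.sum_eq_single_of_mem K hK, Set.indicator_of_mem hx]
  intro K' hK' hne
  exact Set.indicator_of_notMem
    (fun hx' => Set.disjoint_left.1 (disjoint_interior hK' hK hne) hx' hx) _

theorem memLp_piecewise (c : Finset (Space d) → ℝ) :
    MemLp (T.piecewise c) 2 (volume.restrict P.Ω) := by
  have h : ∀ K ∈ T.elements, MemLp ((interior (hull K)).indicator fun _ => c K) 2
      (volume.restrict P.Ω) := fun K _ => by
    refine memLp_indicator_const 2 isOpen_interior.measurableSet _ (.inr ?_)
    refine ((Measure.restrict_apply_le _ _).trans_lt ?_).ne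
    exact (measure_mono interior_subset).trans_lt (isCompact_hull K).measure_lt_top
  exact memLp_finsetSum T.elements h

theorem integral_sq_piecewise (c : Finset (Space d) → ℝ) :
    ∫ x in P.Ω, T.piecewise c x ^ 2 = ∑ K ∈ T.elements, volume.real (hull K) * c K ^ 2 := by
  rw [← T.integral_eq (memLp_piecewise c).integrable_sq]
  refine Finset.sum_congr rfl fun K hK => ?_
  rw [integral_congr_ae (g := fun _ => c K ^ 2) (by
    filter_upwards [piecewise_ae_eq c hK] with x hx; simp only [hx]), integral_const,
    measureReal_restrict_apply_univ, smul_eq_mul]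

/-- Facet averaging is symmetric: pairing the mean flux with `w` equals pairing the flux with the
facet mean of `w`, a constant to which conservation applies. -/
theorem sum_meanFlux_eq_zero (hd : 1 ≤ d) {q : Space d → Space d} {g : Space d → ℝ}
    (hg : MemLp g 2 (volume.restrict P.Ω))
    (hq : ∀ (v : Space d → ℝ) (Gv : Space d → Space d), P.MemH1D v Gv →
      ∫ x in P.Ω, inner ℝ (q x) (Gv x) = -∫ x in P.Ω, g x * v x)
    {gq : Finset (Space d) → Fin d → Fin d → Space d → ℝ}
    {tq : Finset (Space d) → Fin d → Space d → Space d → ℝ} (hb : T.IsBrokenField q gq tq)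
    {w : Finset (Space d) → Space d → ℝ}
    (hw : ∀ F ∈ T.facets, hull F ⊆ closure P.ΓD → ∀ x ∈ hull F, w F x = 0) :
    ∑ K ∈ T.elements, ∑ a ∈ K,
      meanFlux K (tq K) a * ∫ x, w (facet K a) x ∂(facetMeasure K a) = 0 := by
  have h := bdryIntegral_flux_eq_zero hd hg hq hb
    (μ := fun F _ => ((surface d).real (hull F))⁻¹ * ∫ x in hull F, w F x ∂(surface d))
    (fun F _ => contDiff_const) (fun F hF hFD x _ => by
      rw [setIntegral_congr_fun (g := fun _ => 0) (isCompact_hull _).measurableSet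
        fun x hx => hw F hF hFD x hx]
      simp)
  rw [bdryIntegral] at h
  rw [← h]
  refine Finset.sum_congr rfl fun K _ => Finset.sum_congr rfl fun a _ => ?_
  rw [integral_mul_const, meanFlux]
  ring

/-- What is needed of the solution `(Φ, φ)` of the dual problem. -/
theorem exists_dual (hd : 1 ≤ d) {Creg : ℝ} (hreg : P.DualRegularity Creg) {θ : Space d → ℝ}
    (hθ : MemLp θ 2 (volume.restrict P.Ω)) :
    ∃ (Φ : Space d → Space d) (φ : Space d → ℝ) (Gφ : Space d → Space d)
      (gΦ : Finset (Space d) → Fin d → Fin d → Space d → ℝ)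
      (tΦ : Finset (Space d) → Fin d → Space d → Space d → ℝ)
      (tφ : Finset (Space d) → Space d → ℝ),
      (∀ᵐ x ∂(volume.restrict P.Ω), (P.σ x)⁻¹ • Φ x + Gφ x = 0) ∧
      (∀ (v : Space d → ℝ) (Gv : Space d → Space d), P.MemH1D v Gv →
        ∫ x in P.Ω, inner ℝ (Φ x) (Gv x) = -∫ x in P.Ω, θ x * v x) ∧
      T.IsBrokenField Φ gΦ tΦ ∧
      (∀ K ∈ T.elements, IsElemTrace K φ (fun i x => Gφ x i) (fun a => tφ (facet K a))) ∧
      (∀ F, hull F ⊆ closure P.ΓD → tφ F = 0) ∧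
      ∑ K ∈ T.elements, ∑ i, ∑ j, ∫ x in hull K, gΦ K i j x ^ 2
        ≤ 2 * d * Creg ^ 2 * ∫ x in P.Ω, θ x ^ 2 ∧
      T.normSq (fun _ i x => Φ x i) ≤ 2 * d * Creg ^ 2 * ∫ x in P.Ω, θ x ^ 2 := by
  obtain ⟨Φ, φ, ⟨⟨Gφ, hφ, hσ⟩, hweak⟩, hp, hm, -, -, hbound⟩ := hreg θ hθ
  obtain ⟨tφ, htφ, htφ0⟩ := exists_single_valued_trace (T := T) hd hφ
  choose U hU0 hUg hUn using fun i => T.exists_derivs (hp i) (hm i)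
  have hw : ∀ K ∈ T.elements, ∀ i, WeakGrad (interior (hull K)) (fun x => Φ x i)
      (fun j => U i (Pi.single j 1)) := fun K hK i => by
    have := hUg i K hK 0 (by simp)
    simpa only [hU0, zero_add] using this
  have hex : ∀ (K : Finset (Space d)) (i : Fin d), ∃ t, K ∈ T.elements →
      IsElemTrace K (fun x => Φ x i) (fun j => U i (Pi.single j 1)) t := fun K i => by
    by_cases hK : K ∈ T.elements
    · obtain ⟨t, ht⟩ := (hw K hK i).exists_trace (isElement hK) hd
      exact ⟨t, fun _ => ht⟩
    · exact ⟨0, fun h => absurd h hK⟩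
  choose tΦ htΦ using hex
  have hd' : (1 : ℝ) ≤ d := by exact_mod_cast hd
  -- The sum of the norms on the two subdomains is squared componentwise, at the cost of a factor
  -- `2`.
  have hsq : ∑ i, (sobolevNorm P.Ωp 1 (fun x => Φ x i) + sobolevNorm P.Ωm 1 (fun x => Φ x i)) ^ 2
      ≤ 2 * (Creg ^ 2 * ∫ x in P.Ω, θ x ^ 2) := by
    have hv : ∀ D : Set (Space d), sobolevNormVec D 1 Φ ^ 2
        = ∑ i, sobolevNorm D 1 (fun x => Φ x i) ^ 2 := fun D =>
      Real.sq_sqrt (Finset.sum_nonneg fun i _ => sq_nonneg _)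
    have h0 : ∀ D : Set (Space d), 0 ≤ sobolevNormVec D 1 Φ := fun D => Real.sqrt_nonneg _
    have h1 : 0 ≤ sobolevNorm P.Ωp 2 φ := Real.sqrt_nonneg _
    have h2 : 0 ≤ sobolevNorm P.Ωm 2 φ := Real.sqrt_nonneg _
    have h3 : (sobolevNormVec P.Ωp 1 Φ + sobolevNormVec P.Ωm 1 Φ) ^ 2
        ≤ (Creg * Real.sqrt (∫ x in P.Ω, θ x ^ 2)) ^ 2 :=
      pow_le_pow_left₀ (add_nonneg (h0 _) (h0 _)) (by linarith) 2
    rw [mul_pow, Real.sq_sqrt (integral_nonneg fun x => sq_nonneg _)] at h3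
    have h4 : ∑ i, (sobolevNorm P.Ωp 1 (fun x => Φ x i)
        + sobolevNorm P.Ωm 1 (fun x => Φ x i)) ^ 2
        ≤ 2 * (sobolevNormVec P.Ωp 1 Φ ^ 2 + sobolevNormVec P.Ωm 1 Φ ^ 2) := by
      rw [hv, hv, ← Finset.sum_add_distrib, Finset.mul_sum]
      exact Finset.sum_le_sum fun i _ => add_sq_le
    nlinarith [mul_nonneg (h0 P.Ωp) (h0 P.Ωm)]
  have hone : ∀ i, ∀ α : Fin d → ℕ, ∑ j, α j ≤ 1 → ∑ K ∈ T.elements, ∫ x in hull K, U i α x ^ 2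
      ≤ (sobolevNorm P.Ωp 1 (fun x => Φ x i) + sobolevNorm P.Ωm 1 (fun x => Φ x i)) ^ 2 :=
    fun i α hα => by
      refine le_trans (Finset.sum_le_sum fun K _ => ?_) (hUn i (∑ j, α j) hα)
      refine Finset.single_le_sum (f := fun α => ∫ x in hull K, U i α x ^ 2)
        (fun α _ => integral_nonneg fun x => sq_nonneg _) ?_
      simp [Finset.mem_piAntidiag]
  refine ⟨Φ, φ, Gφ, fun _ i j => U i (Pi.single j 1), tΦ, tφ, hσ, hweak,
    fun K hK i => ⟨hw K hK i, htΦ K i hK⟩, htφ, htφ0, ?_, ?_⟩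
  · rw [Finset.sum_comm]
    simp_rw [fun i => Finset.sum_comm (s := T.elements) (t := (Finset.univ : Finset (Fin d)))
      (f := fun K j => ∫ x in hull K, U i (Pi.single j 1) x ^ 2)]
    -- Each of the `d` first derivatives is bounded by the full first-order norm, whence the factor
    -- `d`.
    calc ∑ i, ∑ j, ∑ K ∈ T.elements, ∫ x in hull K, U i (Pi.single j 1) x ^ 2
        ≤ ∑ i, ∑ _j : Fin d, (sobolevNorm P.Ωp 1 (fun x => Φ x i)
          + sobolevNorm P.Ωm 1 (fun x => Φ x i)) ^ 2 :=
          Finset.sum_le_sum fun i _ => Finset.sum_le_sum fun j _ => hone i _ (by simp)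
      _ = d * ∑ i, (sobolevNorm P.Ωp 1 (fun x => Φ x i)
          + sobolevNorm P.Ωm 1 (fun x => Φ x i)) ^ 2 := by
          simp [Finset.mul_sum]
      _ ≤ _ := by
          have := mul_le_mul_of_nonneg_left hsq d.cast_nonneg (α := ℝ)
          linarith
  · rw [normSq, Finset.sum_comm]
    have h5 : ∑ i, ∑ K ∈ T.elements, ∫ x in hull K, Φ x i ^ 2
        ≤ ∑ i, (sobolevNorm P.Ωp 1 (fun x => Φ x i)
          + sobolevNorm P.Ωm 1 (fun x => Φ x i)) ^ 2 :=
      Finset.sum_le_sum fun i _ => by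
        have := hone i 0 (by simp)
        simpa only [hU0] using this
    have h6 : 0 ≤ Creg ^ 2 * ∫ x in P.Ω, θ x ^ 2 :=
      mul_nonneg (sq_nonneg _) (integral_nonneg fun x => sq_nonneg _)
    nlinarith [h5.trans hsq]

end Triangulation

/-! ### The element means of the error -/

section

variable {P : Problem d} {T : Triangulation P} {k : ℕ} {τ : Finset (Space d) → ℝ}
  {f : Space d → ℝ} {q : Space d → Space d} {u : Space d → ℝ}
  {pq : Finset (Space d) → Space d → Space d} {pu : Finset (Space d) → Space d → ℝ}
  {s : Finset (Space d) → ℝ} {Gu : Space d → Space d} {tu : Finset (Space d) → Space d → ℝ}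
  {gq : Finset (Space d) → Fin d → Fin d → Space d → ℝ}
  {tq : Finset (Space d) → Fin d → Space d → Space d → ℝ}
  {qh : Finset (Space d) → Space d → Space d} {uh ubar : Finset (Space d) → Space d → ℝ}

theorem Triangulation.scaled_eq_neg_grad {K : Finset (Space d)} (hK : K ∈ T.elements) {c : ℝ}
    (hc : ∀ᵐ x ∂(volume.restrict (hull K)), P.σ x = c) {G : Space d → Space d}
    (h : ∀ᵐ x ∂(volume.restrict P.Ω), (P.σ x)⁻¹ • q x + G x = 0) (i : Fin d) :
    (fun x => c⁻¹ * q x i) =ᵐ[volume.restrict (hull K)] fun x => -G x i := by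
  filter_upwards [hc, ae_mono (restrict_hull_le hK) h] with x h1 h2
  have h3 := congrArg (fun v : Space d => v i) h2
  simp only [PiLp.add_apply, PiLp.smul_apply, PiLp.zero_apply, smul_eq_mul, h1] at h3
  linarith

/-- The interpolant preserves the mean of the divergence, and here the divergence is constant on the
element; so its value is reproduced exactly. -/
theorem Triangulation.IsBrokenField.div_raviartThomas (hd : 1 ≤ d)
    {c : Finset (Space d) → ℝ} {Φ : Space d → Space d}
    {gΦ : Finset (Space d) → Fin d → Fin d → Space d → ℝ}
    {tΦ : Finset (Space d) → Fin d → Space d → Space d → ℝ} (hb : T.IsBrokenField Φ gΦ tΦ)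
    (hΦ : ∀ (v : Space d → ℝ) (Gv : Space d → Space d), P.MemH1D v Gv →
      ∫ x in P.Ω, inner ℝ (Φ x) (Gv x) = -∫ x in P.Ω, T.piecewise c x * v x)
    {K : Finset (Space d)} (hK : K ∈ T.elements) :
    d * ∑ a ∈ K, meanFlux K (tΦ K) a / height K a = c K := by
  have hKe := Triangulation.isElement hK
  have h1 := hKe.volume_mul_div_raviartThomas_meanFlux hd fun i => (hb K hK i).2
  rw [← integral_finsetSum _ fun i _ => ?_] at h1
  · rw [integral_congr_ae ((Triangulation.div_eq (Triangulation.memLp_piecewise c) hΦ hb hK).trans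
      (Triangulation.piecewise_ae_eq c hK)), integral_const, measureReal_restrict_apply_univ,
      smul_eq_mul] at h1
    exact mul_left_cancel₀ hKe.volume_pos.ne' h1
  · have : IsFiniteMeasure (volume.restrict (hull K)) :=
      ⟨by simpa using (isCompact_hull K).measure_lt_top⟩
    exact ((hb K hK i).2.memg i).integrable (by norm_num)

/-- The element means of the error of the scalar variable, expressed by the flux error. -/
theorem sum_mean_error_sq (hd : 1 ≤ d) (hk : 1 ≤ k)
    (hE : IsExact T k τ f q u pq pu s Gu tu gq tq) (hH : IsHDGSolution T k τ f qh uh ubar)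
    {Φ : Space d → Space d} {gΦ : Finset (Space d) → Fin d → Fin d → Space d → ℝ}
    {tΦ : Finset (Space d) → Fin d → Space d → Space d → ℝ} (hb : T.IsBrokenField Φ gΦ tΦ)
    (hΦ : ∀ (v : Space d → ℝ) (Gv : Space d → Space d), P.MemH1D v Gv →
      ∫ x in P.Ω, inner ℝ (Φ x) (Gv x)
        = -∫ x in P.Ω, T.piecewise (fun K => mean (hull K) fun x => u x - uh K x) x * v x) :
    ∑ K ∈ T.elements, volume.real (hull K) * mean (hull K) (fun x => u x - uh K x) ^ 2
      = ∑ K ∈ T.elements, (s K)⁻¹ * ∑ i, ∫ x in hull K,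
          (q x i - qh K x i) * raviartThomas K (meanFlux K (tΦ K)) x i := by
  -- The interpolant has degree `1`, so it is an admissible test function because `k ≥ 1`.
  have hmem : MemV T k fun K => raviartThomas K (meanFlux K (tΦ K)) := fun K _ i =>
    (isPolyVec_raviartThomas K _ i).mono hk
  -- The facet terms drop out: `tu - ubar` is single valued and vanishes on Dirichlet facets, and
  -- the normal component of the interpolant is the mean flux of `Φ`.
  have h0 := Triangulation.sum_meanFlux_eq_zero hd (Triangulation.memLp_piecewise _) hΦ hb
    (w := fun F x => tu F x - ubar F x) fun F hF hFD x hx => by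
      simp [hE.trace_zero F hFD, (hH.memM F hF).2 hFD x hx]
  rw [error_flux hd hE hH hmem, Finset.sum_sub_distrib,
    Finset.sum_congr rfl fun K hK => Finset.sum_congr rfl fun a ha => ?_, h0, sub_zero]
  · refine Finset.sum_congr rfl fun K hK => ?_
    have hV := (Triangulation.isElement hK).volume_pos
    simp_rw [div_raviartThomas, hb.div_raviartThomas hd hΦ hK]
    rw [integral_mul_const, mean]
    field_simp
  · have hKe := Triangulation.isElement hK
    rw [← integral_const_mul]
    refine setIntegral_congr_fun (isCompact_hull _).measurableSet fun x hx => ?_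
    simp only [hKe.inner_raviartThomas_normal hd _ ha hx]
    ring

/-- The moment of degree `0`, available since `k ≥ 1`. It lets constants be subtracted from whatever
`q - Π_V q` is tested with. -/
theorem IsHDGProjection.integral_sub_eq_zero (hk : 1 ≤ k)
    (h : IsHDGProjection T k τ q u pq pu) {K : Finset (Space d)} (hK : K ∈ T.elements)
    (hq : ∀ i, MemLp (fun x => q x i) 2 (volume.restrict (hull K))) (i : Fin d) :
    ∫ x in hull K, (q x i - pq K x i) = 0 := by
  have h1 := h.moment_q K hK 0 hk (fun _ => EuclideanSpace.single i 1)
    fun j => IsPoly.const 0 _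
  simp only [EuclideanSpace.inner_single_right, conj_trivial, one_mul] at h1
  have hi : ∀ {g : Space d → ℝ}, MemLp g 2 (volume.restrict (hull K)) →
      Integrable g (volume.restrict (hull K)) := fun hg => by
    have : IsFiniteMeasure (volume.restrict (hull K)) :=
      ⟨by simpa using (isCompact_hull K).measure_lt_top⟩
    exact hg.integrable (by norm_num)
  rw [integral_sub (hi (hq i)) (hi ((h.memV K hK).memLp_hull K i)), h1, sub_self]

/-- The interpolant of `Φ` is split into its error and `Φ`, and the flux error into `q - Π_V q` and
`Π_V q - q_h`. The last part meets `σ⁻¹ Φ = -∇φ` and is rewritten by `duality_identity`. Each of the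
three resulting terms has a factor of order `h`. -/
theorem mean_error_identity (hd : 1 ≤ d) (hk : 1 ≤ k)
    (hE : IsExact T k τ f q u pq pu s Gu tu gq tq) (hH : IsHDGSolution T k τ f qh uh ubar)
    {Φ Gφ : Space d → Space d} {φ : Space d → ℝ}
    {gΦ : Finset (Space d) → Fin d → Fin d → Space d → ℝ}
    {tΦ : Finset (Space d) → Fin d → Space d → Space d → ℝ}
    {tφ : Finset (Space d) → Space d → ℝ}
    (hσ : ∀ K ∈ T.elements, ∀ i,
      (fun x => (s K)⁻¹ * Φ x i) =ᵐ[volume.restrict (hull K)] fun x => -Gφ x i)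
    (hb : T.IsBrokenField Φ gΦ tΦ)
    (hΦ : ∀ (v : Space d → ℝ) (Gv : Space d → Space d), P.MemH1D v Gv →
      ∫ x in P.Ω, inner ℝ (Φ x) (Gv x)
        = -∫ x in P.Ω, T.piecewise (fun K => mean (hull K) fun x => u x - uh K x) x * v x)
    (hφ : ∀ K ∈ T.elements, IsElemTrace K φ (fun i x => Gφ x i) (fun a => tφ (facet K a)))
    (hφ0 : ∀ F, hull F ⊆ closure P.ΓD → tφ F = 0)
    {v : Finset (Space d) → Space d → ℝ} {r : Finset (Space d) → Space d → Space d}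
    (hv : MemW T k v) (hr : MemV T k r)
    (h1 : ∀ K ∈ T.elements, ∀ l, IsPoly (k - 1) l →
      ∫ x in hull K, v K x * l x = ∫ x in hull K, φ x * l x)
    (h2 : ∀ K ∈ T.elements, ∀ i, ∀ l, IsPoly (k - 1) l → ∫ x in hull K, r K x i * l x = 0)
    (h3 : ∀ K ∈ T.elements, ∀ a ∈ K, ∀ μ, IsPoly k μ →
      ∫ x, inner ℝ (r K x) (normal K a) * μ x ∂(facetMeasure K a)
        = τ (facet K a) * ∫ x, (v K x - tφ (facet K a) x) * μ x ∂(facetMeasure K a)) :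
    ∑ K ∈ T.elements, volume.real (hull K) * mean (hull K) (fun x => u x - uh K x) ^ 2
      = (∑ K ∈ T.elements, (s K)⁻¹ * ∑ i, ∫ x in hull K, (q x i - qh K x i) *
          (raviartThomas K (meanFlux K (tΦ K)) x i - Φ x i))
        + (∑ K ∈ T.elements, (s K)⁻¹ * ∑ i, ∫ x in hull K, (q x i - pq K x i) *
          (Φ x i - mean (hull K) fun y => Φ y i))
        - ∑ K ∈ T.elements, (s K)⁻¹ * ∑ i, ∫ x in hull K, (q x i - qh K x i) * r K x i := by
  rw [sum_mean_error_sq hd hk hE hH hb hΦ, ← duality_identity hd hk hE hH hφ hφ0 hv hr h1 h2 h3,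
    ← Finset.sum_add_distrib, ← Finset.sum_sub_distrib]
  refine Finset.sum_congr rfl fun K hK => ?_
  rw [← mul_add, ← Finset.sum_add_distrib, Finset.mul_sum, Finset.mul_sum,
    ← Finset.sum_sub_distrib]
  refine Finset.sum_congr rfl fun i _ => ?_
  have mq := hE.memq hK i
  have mqh := (hH.memV K hK).memLp_hull K i
  have mpq := (hE.proj.memV K hK).memLp_hull K i
  have mΦ := (hb K hK i).2.memu
  have mc : MemLp (fun _ => mean (hull K) fun y => Φ y i) 2 (volume.restrict (hull K)) :=
    memLp_const_hull K _
  have mrt := (isPolyVec_raviartThomas K (meanFlux K (tΦ K))).memLp_hull K i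
  have hz := hE.proj.integral_sub_eq_zero hk hK (hE.memq hK) i
  have e1 : ∫ x in hull K, (pq K x i - qh K x i) * Gφ x i
      = -((s K)⁻¹ * ∫ x in hull K, (pq K x i - qh K x i) * Φ x i) := by
    rw [← integral_const_mul, ← integral_neg]
    refine integral_congr_ae ?_
    filter_upwards [hσ K hK i] with x hx
    linear_combination (pq K x i - qh K x i) * hx
  have comm : ∀ {a b c : Space d → ℝ}, MemLp a 2 (volume.restrict (hull K)) →
      MemLp b 2 (volume.restrict (hull K)) → MemLp c 2 (volume.restrict (hull K)) →
      ∫ x in hull K, a x * (b x - c x) = (∫ x in hull K, a x * b x) - ∫ x in hull K, a x * c x :=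
    fun ha hb hc => by
      simp_rw [mul_sub]
      exact integral_sub (integrable_mul_of_memLp ha hb) (integrable_mul_of_memLp ha hc)
  have m1 : MemLp (fun x => q x i - qh K x i) 2 (volume.restrict (hull K)) := mq.sub mqh
  have m2 : MemLp (fun x => q x i - pq K x i) 2 (volume.restrict (hull K)) := mq.sub mpq
  rw [e1, comm m1 mrt mΦ, comm m2 mΦ mc, integral_mul_const, hz,
    integral_sub_mul mq mqh mΦ, integral_sub_mul mq mpq mΦ, integral_sub_mul mpq mqh mΦ]
  ring

end

/-- On one element the non-interface facets carry the sign of its subdomain, and on interface facets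
`τ` is zero. -/
theorem TauCondition.sign {P : Problem d} {T : Triangulation P} {τ : Finset (Space d) → ℝ}
    (hd : 1 ≤ d) (h : TauCondition T τ) {K : Finset (Space d)} (hK : K ∈ T.elements) :
    (∀ a ∈ K, 0 ≤ τ (facet K a)) ∨ ∀ a ∈ K, τ (facet K a) ≤ 0 := by
  have hsub : ∀ a, facet K a ⊆ K := fun a => by
    classical exact fun b hb => (mem_facet.1 hb).2
  rcases Triangulation.sigma_cases P hK with ⟨hi, -⟩ | ⟨hi, -⟩
  · refine .inl fun a ha => ?_
    have hF := Triangulation.facet_mem hd hK ha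
    by_cases hI : hull (facet K a) ⊆ P.ΓI
    · exact (h.1 _ hF hI).ge
    · exact ((h.2 K hK _ hF (hsub a) hI).1 hi).le
  · refine .inr fun a ha => ?_
    have hF := Triangulation.facet_mem hd hK ha
    by_cases hI : hull (facet K a) ⊆ P.ΓI
    · exact (h.1 _ hF hI).le
    · exact ((h.2 K hK _ hF (hsub a) hI).2 hi).le

theorem Triangulation.normSq_le {P : Problem d} {T : Triangulation P}
    {a : Finset (Space d) → Fin d → Space d → ℝ} {N : Finset (Space d) → ℝ} {C D : ℝ}
    (hC : 0 ≤ C) (hN : ∀ K ∈ T.elements, 0 ≤ N K)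
    (h : ∀ K ∈ T.elements, ∑ i, ∫ x in hull K, a K i x ^ 2 ≤ C * Metric.diam (hull K) ^ 2 * N K)
    (hD : ∑ K ∈ T.elements, N K ≤ D) : T.normSq a ≤ C * T.h ^ 2 * D := by
  calc T.normSq a ≤ ∑ K ∈ T.elements, C * T.h ^ 2 * N K := Finset.sum_le_sum fun K hK =>
        (h K hK).trans <| mul_le_mul_of_nonneg_right (mul_le_mul_of_nonneg_left
          (pow_le_pow_left₀ Metric.diam_nonneg (diam_le_h hK) 2) hC) (hN K hK)
    _ ≤ _ := by
        rw [← Finset.mul_sum]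
        exact mul_le_mul_of_nonneg_left hD (mul_nonneg hC (sq_nonneg _))

/-- The element means of the error of the scalar variable are superconvergent. -/
theorem exists_mean_error_le (hd : 1 ≤ d) {k : ℕ} (hk : 1 ≤ k) (P : Problem d) {Creg : ℝ}
    (hreg : P.DualRegularity Creg) {ρ : ℝ} (hρ : 0 < ρ) (γ : ℝ) {S : ℝ} (hS : 0 ≤ S) :
    ∃ A : ℝ, 0 ≤ A ∧ ∀ T : Triangulation P, T.ShapeRegular ρ →
      ∀ τ : Finset (Space d) → ℝ, TauCondition T τ → (∀ F ∈ T.facets, |τ F| ≤ γ) →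
      ∀ (f : Space d → ℝ) (q : Space d → Space d) (u : Space d → ℝ)
        (pq : Finset (Space d) → Space d → Space d) (pu : Finset (Space d) → Space d → ℝ)
        (s : Finset (Space d) → ℝ) (Gu : Space d → Space d) (tu : Finset (Space d) → Space d → ℝ)
        (gq : Finset (Space d) → Fin d → Fin d → Space d → ℝ)
        (tq : Finset (Space d) → Fin d → Space d → Space d → ℝ)
        (qh : Finset (Space d) → Space d → Space d) (uh ubar : Finset (Space d) → Space d → ℝ),
        (∀ K ∈ T.elements, |(s K)⁻¹| ≤ S) → IsExact T k τ f q u pq pu s Gu tu gq tq →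
        IsHDGSolution T k τ f qh uh ubar →
        Real.sqrt (∑ K ∈ T.elements,
            volume.real (hull K) * mean (hull K) (fun x => u x - uh K x) ^ 2)
          ≤ A * T.h * (Real.sqrt (T.normSq fun K i x => q x i - qh K x i)
            + Real.sqrt (T.normSq fun K i x => q x i - pq K x i)) := by
  -- The constant `2 * ρ` is the bound for the ratio of height to diameter given by shape
  -- regularity.
  obtain ⟨C₂, hC₂, hlocal⟩ := exists_local_dual hd hk (c := 2 * ρ) (by positivity)
  set C₁ : ℝ := 2 * (d * (d + 1) ^ 2 / (2 * ρ) ^ 2 * ((d + 1) * 2 ^ d + 1)) + 2 * 2 ^ d with hC₁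
  have hC₁0 : 0 ≤ C₁ := by positivity
  -- A common bound for the three terms: interpolation error, deviation of `Φ` from its means, and
  -- the field `r`.
  set M : ℝ := C₁ + 2 ^ d + C₂ * γ ^ 2 * S ^ 2 with hM
  have hM0 : 0 ≤ M := by positivity
  set B : ℝ := Real.sqrt (M * (2 * d * Creg ^ 2)) with hB
  have hB0 : 0 ≤ B := Real.sqrt_nonneg _
  refine ⟨2 * S * B, by positivity, ?_⟩
  intro T hT τ hτ hγ f q u pq pu s Gu tu gq tq qh uh ubar hs hE hH
  -- The source of the dual problem is the piecewise constant function of element means, not the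
  -- full error; this makes the divergence of the interpolant exact.
  set c : Finset (Space d) → ℝ := fun K => mean (hull K) fun x => u x - uh K x with hc
  obtain ⟨Φ, φ, Gφ, gΦ, tΦ, tφ, hσ, hweak, hb, hφ, hφ0, hgΦ, hNΦ⟩ :=
    Triangulation.exists_dual (T := T) hd hreg (Triangulation.memLp_piecewise c)
  rw [Triangulation.integral_sq_piecewise] at hgΦ hNΦ
  set Q : ℝ := ∑ K ∈ T.elements, volume.real (hull K) * c K ^ 2 with hQ
  have hQ0 : 0 ≤ Q := Finset.sum_nonneg fun K _ => mul_nonneg measureReal_nonneg (sq_nonneg _)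
  have hσ' := fun K (hK : K ∈ T.elements) => Triangulation.scaled_eq_neg_grad hK (hE.sigma K hK) hσ
  have hex : ∀ K : Finset (Space d), ∃ (v : Space d → ℝ) (r : Space d → Space d),
      K ∈ T.elements → IsPoly k v ∧ IsPolyVec k r ∧
        (∀ s, IsPoly (k - 1) s → ∫ x in hull K, v x * s x = ∫ x in hull K, φ x * s x) ∧
        (∀ i, ∀ s, IsPoly (k - 1) s → ∫ x in hull K, r x i * s x = 0) ∧
        (∀ a ∈ K, ∀ μ, IsPoly k μ →
          ∫ x, inner ℝ (r x) (normal K a) * μ x ∂(facetMeasure K a)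
            = τ (facet K a) * ∫ x, (v x - tφ (facet K a) x) * μ x ∂(facetMeasure K a)) ∧
        ∑ i, ∫ x in hull K, r x i ^ 2 ≤
          C₂ * γ ^ 2 * Metric.diam (hull K) ^ 2 * ∑ i, ∫ x in hull K, Gφ x i ^ 2 := fun K => by
    by_cases hK : K ∈ T.elements
    · obtain ⟨v, r, h⟩ := hlocal K (Triangulation.isElement hK)
        (fun a ha => Triangulation.isElement_height_le hd hρ hT hK ha) (fun a => τ (facet K a)) γ
        (hτ.sign hd hK) (fun a ha => hγ _ (Triangulation.facet_mem hd hK ha)) φ _ _ (hφ K hK)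
      exact ⟨v, r, fun _ => h⟩
    · exact ⟨0, 0, fun h => absurd h hK⟩
  choose v r hvr using hex
  have hv : MemW T k v := fun K hK => (hvr K hK).1
  have hr : MemV T k r := fun K hK => (hvr K hK).2.1
  have hid := mean_error_identity hd hk hE hH hσ' hb hweak hφ hφ0 hv hr
    (fun K hK => (hvr K hK).2.2.1) (fun K hK => (hvr K hK).2.2.2.1)
    fun K hK => (hvr K hK).2.2.2.2.1
  have N₁ : T.normSq (fun K i x => raviartThomas K (meanFlux K (tΦ K)) x i - Φ x i)
      ≤ C₁ * T.h ^ 2 * (2 * d * Creg ^ 2 * Q) :=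
    Triangulation.normSq_le hC₁0
      (fun K _ => Finset.sum_nonneg fun i _ => sum_integral_sq_nonneg _ _)
      (fun K hK => (Triangulation.isElement hK).raviartThomas_error hd
        (fun i => (hb K hK i).2) (by positivity)
        fun a ha => Triangulation.isElement_height_le hd hρ hT hK ha) hgΦ
  have N₂ : T.normSq (fun K i x => Φ x i - mean (hull K) fun y => Φ y i)
      ≤ 2 ^ d * T.h ^ 2 * (2 * d * Creg ^ 2 * Q) :=
    Triangulation.normSq_le (by positivity)
      (fun K _ => Finset.sum_nonneg fun i _ => sum_integral_sq_nonneg _ _)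
      (fun K hK => by
        rw [Finset.mul_sum]
        exact Finset.sum_le_sum fun i _ => (hb K hK i).1.poincare (Triangulation.isElement hK)) hgΦ
  have N₃ : T.normSq (fun K i x => r K x i)
      ≤ C₂ * γ ^ 2 * S ^ 2 * T.h ^ 2 * (2 * d * Creg ^ 2 * Q) := by
    refine Triangulation.normSq_le (by positivity) (fun K _ => sum_integral_sq_nonneg _ _)
      (fun K hK => (hvr K hK).2.2.2.2.2.trans ?_) hNΦ
    -- By the dual equation `∇φ = -σ⁻¹ Φ`, so the bound on `Φ` also controls `r`.
    have h1 : ∑ i, ∫ x in hull K, Gφ x i ^ 2 ≤ S ^ 2 * ∑ i, ∫ x in hull K, Φ x i ^ 2 := by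
      rw [Finset.mul_sum]
      refine Finset.sum_le_sum fun i _ => ?_
      have h2 : ∫ x in hull K, Gφ x i ^ 2 = ((s K)⁻¹) ^ 2 * ∫ x in hull K, Φ x i ^ 2 := by
        rw [← integral_const_mul]
        refine integral_congr_ae ?_
        filter_upwards [hσ' K hK i] with x hx
        rw [← mul_pow, hx, neg_sq]
      rw [h2]
      refine mul_le_mul_of_nonneg_right ?_ (integral_nonneg fun x => sq_nonneg _)
      rw [← sq_abs]
      exact pow_le_pow_left₀ (abs_nonneg _) (hs K hK) 2
    calc _ ≤ C₂ * γ ^ 2 * Metric.diam (hull K) ^ 2 *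
          (S ^ 2 * ∑ i, ∫ x in hull K, Φ x i ^ 2) := by gcongr
      _ = _ := by ring
  have root : ∀ {X Y : ℝ}, Y ≤ M → X ≤ Y * T.h ^ 2 * (2 * d * Creg ^ 2 * Q) →
      Real.sqrt X ≤ B * (T.h * Real.sqrt Q) := fun {X Y} hY hX => by
    refine Real.sqrt_le_iff.2 ⟨mul_nonneg hB0 (mul_nonneg T.h_nonneg (Real.sqrt_nonneg _)), ?_⟩
    rw [mul_pow, mul_pow, hB, Real.sq_sqrt (by positivity), Real.sq_sqrt hQ0]
    refine hX.trans ?_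
    calc Y * T.h ^ 2 * (2 * d * Creg ^ 2 * Q) ≤ M * T.h ^ 2 * (2 * d * Creg ^ 2 * Q) := by gcongr
      _ = _ := by ring
  have p1 : (0 : ℝ) ≤ 2 ^ d := by positivity
  have p2 : 0 ≤ C₂ * γ ^ 2 * S ^ 2 := by positivity
  have R₁ := root (by rw [hM]; linarith) N₁
  have R₂ := root (by rw [hM]; linarith) N₂
  have R₃ := root (by rw [hM]; linarith) N₃
  have me : ∀ K ∈ T.elements, ∀ i, MemLp (fun x => q x i - qh K x i) 2
      (volume.restrict (hull K)) := fun K hK i =>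
    (hE.memq hK i).sub ((hH.memV K hK).memLp_hull K i)
  have mp : ∀ K ∈ T.elements, ∀ i, MemLp (fun x => q x i - pq K x i) 2
      (volume.restrict (hull K)) := fun K hK i =>
    (hE.memq hK i).sub ((hE.proj.memV K hK).memLp_hull K i)
  have mΦ := fun K (hK : K ∈ T.elements) i => (hb K hK i).2.memu
  have B₁ := Triangulation.abs_sum_weighted_le
    (b := fun K i x => raviartThomas K (meanFlux K (tΦ K)) x i - Φ x i) me (fun K hK i =>
    ((isPolyVec_raviartThomas K (meanFlux K (tΦ K))).memLp_hull K i).sub (mΦ K hK i)) hs hS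
  have B₂ := Triangulation.abs_sum_weighted_le
    (b := fun K i x => Φ x i - mean (hull K) fun y => Φ y i) mp (fun K hK i =>
    (mΦ K hK i).sub (memLp_const_hull K (mean (hull K) fun y => Φ y i))) hs hS
  have B₃ := Triangulation.abs_sum_weighted_le me
    (fun K hK i => (hr K hK).memLp_hull K i) hs hS
  set E := Real.sqrt (T.normSq fun K i x => q x i - qh K x i)
  set F := Real.sqrt (T.normSq fun K i x => q x i - pq K x i)
  have hE0 : 0 ≤ E := Real.sqrt_nonneg _
  have hF0 : 0 ≤ F := Real.sqrt_nonneg _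
  have b₁ := (abs_le.1 B₁).2.trans (mul_le_mul_of_nonneg_left (mul_le_mul_of_nonneg_left R₁ hE0) hS)
  have b₂ := (abs_le.1 B₂).2.trans (mul_le_mul_of_nonneg_left (mul_le_mul_of_nonneg_left R₂ hF0) hS)
  have b₃ := neg_le.1 (abs_le.1 B₃).1 |>.trans
    (mul_le_mul_of_nonneg_left (mul_le_mul_of_nonneg_left R₃ hE0) hS)
  have hh := T.h_nonneg
  have hQs : Real.sqrt Q * Real.sqrt Q = Q := Real.mul_self_sqrt hQ0
  have hfin : Real.sqrt Q * Real.sqrt Q ≤ 2 * S * B * T.h * (E + F) * Real.sqrt Q := by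
    rw [hQs]
    have : 0 ≤ S * (F * (B * (T.h * Real.sqrt Q))) := by positivity
    change Q = _ at hid
    calc Q ≤ S * (E * (B * (T.h * Real.sqrt Q))) + S * (F * (B * (T.h * Real.sqrt Q)))
          + S * (E * (B * (T.h * Real.sqrt Q))) := by linarith
      _ ≤ _ := by linarith
  -- The norm of the source, `√Q`, is cancelled on both sides; if it is zero, there is nothing to
  -- show.
  rcases (Real.sqrt_nonneg Q).eq_or_lt with h0 | h0
  · rw [← h0]; positivity
  · exact le_of_mul_le_mul_right hfin h0

/-! ### The post-processed solution -/

/-- The gradient of the post-processed solution on one element. -/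
theorem postProcessed_gradient_error {K : Finset (Space d)} {k : ℕ} {c : ℝ}
    {q : Space d → Space d} {G : Fin d → Space d → ℝ} {qh : Space d → Space d}
    {w p : Space d → ℝ} (hq : ∀ i, MemLp (fun x => q x i) 2 (volume.restrict (hull K)))
    (hG : ∀ i, MemLp (G i) 2 (volume.restrict (hull K)))
    (hqh : ∀ i, MemLp (fun x => qh x i) 2 (volume.restrict (hull K)))
    (hgrad : ∀ i, (fun x => c⁻¹ * q x i) =ᵐ[volume.restrict (hull K)] fun x => -G i x)
    (hw : IsPoly (k + 1) w) (hp : IsPoly (k + 1) p)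
    (hpost : ∀ v, IsPoly (k + 1) v →
      ∑ i, ∫ x in hull K, partialDeriv i w x * partialDeriv i v x
        = -(c⁻¹ * ∑ i, ∫ x in hull K, qh x i * partialDeriv i v x)) :
    ∑ i, ∫ x in hull K, (G i x - partialDeriv i w x) ^ 2
      ≤ 6 * (∑ i, ∫ x in hull K, (G i x - partialDeriv i p x) ^ 2)
        + 4 * (c⁻¹) ^ 2 * ∑ i, ∫ x in hull K, (q x i - qh x i) ^ 2 := by
  have mdw : ∀ i, MemLp (partialDeriv i w) 2 (volume.restrict (hull K)) := fun i =>
    memLp_hull K (hw.partialDeriv i).continuous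
  have mdp : ∀ i, MemLp (partialDeriv i p) 2 (volume.restrict (hull K)) := fun i =>
    memLp_hull K (hp.partialDeriv i).continuous
  have md : ∀ i, MemLp (fun x => partialDeriv i w x - partialDeriv i p x) 2
      (volume.restrict (hull K)) := fun i => (mdw i).sub (mdp i)
  have mGp : ∀ i, MemLp (fun x => G i x - partialDeriv i p x) 2 (volume.restrict (hull K)) :=
    fun i => (hG i).sub (mdp i)
  have me : ∀ i, MemLp (fun x => c⁻¹ * (q x i - qh x i)) 2 (volume.restrict (hull K)) :=
    fun i => ((hq i).sub (hqh i)).const_mul _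
  have mb : ∀ i, MemLp (fun x => c⁻¹ * (q x i - qh x i) + (G i x - partialDeriv i p x)) 2
      (volume.restrict (hull K)) := fun i => (me i).add (mGp i)
  have hdiff : ∀ i x, partialDeriv i (fun x => w x - p x) x
      = partialDeriv i w x - partialDeriv i p x :=
    partialDeriv_sub (hw.contDiff.differentiable (by simp)) (hp.contDiff.differentiable (by simp))
  have h1 := hpost _ (hw.sub hp)
  simp_rw [hdiff] at h1
  -- The post-processing equation is tested with `w - p`. Since `c⁻¹ q = -G`, the exact gradient can
  -- be inserted, and the right-hand side becomes flux error plus approximation error.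
  have h2 : ∑ i, ∫ x in hull K, (partialDeriv i w x - partialDeriv i p x) ^ 2
      = ∑ i, ∫ x in hull K, (c⁻¹ * (q x i - qh x i) + (G i x - partialDeriv i p x))
        * (partialDeriv i w x - partialDeriv i p x) := by
    have h3 : ∀ i, ∫ x in hull K, (partialDeriv i w x - partialDeriv i p x) ^ 2
        = (∫ x in hull K, partialDeriv i w x * (partialDeriv i w x - partialDeriv i p x))
          - ∫ x in hull K, partialDeriv i p x * (partialDeriv i w x - partialDeriv i p x) :=
      fun i => by
        rw [← integral_sub_mul (mdw i) (mdp i) (md i)]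
        exact integral_congr_ae (ae_of_all _ fun x => by ring)
    have h4 : ∀ i, ∫ x in hull K, (c⁻¹ * (q x i - qh x i) + (G i x - partialDeriv i p x))
          * (partialDeriv i w x - partialDeriv i p x)
        = -(c⁻¹ * ∫ x in hull K, qh x i * (partialDeriv i w x - partialDeriv i p x))
          - ∫ x in hull K, partialDeriv i p x * (partialDeriv i w x - partialDeriv i p x) :=
      fun i => by
        have hint : Integrable (fun x => -(c⁻¹ * (qh x i *
            (partialDeriv i w x - partialDeriv i p x)))) (volume.restrict (hull K)) :=
          ((integrable_mul_of_memLp (hqh i) (md i)).const_mul _).neg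
        rw [← integral_const_mul, ← integral_neg, ← integral_sub hint
          (integrable_mul_of_memLp (mdp i) (md i))]
        refine integral_congr_ae ?_
        filter_upwards [hgrad i] with x hx
        linear_combination (partialDeriv i w x - partialDeriv i p x) * hx
    simp_rw [h3, h4, Finset.sum_sub_distrib]
    rw [h1, Finset.sum_neg_distrib, Finset.mul_sum]
  have h5 := (abs_le.1 (sum_abs_integral_mul_le Finset.univ (fun i _ => mb i) fun i _ => md i)).2
  rw [← h2] at h5
  have h6 : ∑ i, ∫ x in hull K, (c⁻¹ * (q x i - qh x i) + (G i x - partialDeriv i p x)) ^ 2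
      ≤ 2 * ((c⁻¹) ^ 2 * ∑ i, ∫ x in hull K, (q x i - qh x i) ^ 2)
        + 2 * ∑ i, ∫ x in hull K, (G i x - partialDeriv i p x) ^ 2 := by
    rw [Finset.mul_sum, Finset.mul_sum, Finset.mul_sum, ← Finset.sum_add_distrib]
    refine Finset.sum_le_sum fun i _ => (integral_sq_add_le (me i) (mGp i)).trans_eq ?_
    simp_rw [mul_pow, integral_const_mul]
  have h7 : ∑ i, ∫ x in hull K, (G i x - partialDeriv i w x) ^ 2
      ≤ 2 * (∑ i, ∫ x in hull K, (G i x - partialDeriv i p x) ^ 2)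
        + 2 * ∑ i, ∫ x in hull K, (partialDeriv i w x - partialDeriv i p x) ^ 2 := by
    rw [Finset.mul_sum, Finset.mul_sum, ← Finset.sum_add_distrib]
    refine Finset.sum_le_sum fun i _ => le_trans (le_of_eq ?_) (integral_sq_sub_le (mGp i) (md i))
    exact integral_congr_ae (ae_of_all _ fun x => by ring)
  have hW := Real.sq_sqrt (sum_integral_sq_nonneg (ν := volume.restrict (hull K)) Finset.univ
    fun i x => partialDeriv i w x - partialDeriv i p x)
  have hB := Real.sq_sqrt (sum_integral_sq_nonneg (ν := volume.restrict (hull K)) Finset.univ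
    fun i x => c⁻¹ * (q x i - qh x i) + (G i x - partialDeriv i p x))
  -- With Cauchy-Schwarz this gives `‖∇(w - p)‖² ≤ ‖c⁻¹(q - q_h) + (G - ∇p)‖²`. The two splittings
  -- then produce `6 = 2 + 2·2` and `4 = 2·2`.
  have h8 := two_mul_le_add_sq
    (Real.sqrt (∑ i, ∫ x in hull K, (c⁻¹ * (q x i - qh x i) + (G i x - partialDeriv i p x)) ^ 2))
    (Real.sqrt (∑ i, ∫ x in hull K, (partialDeriv i w x - partialDeriv i p x) ^ 2))
  linarith

/-- A function on an element is controlled by its mean and its gradient. -/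
theorem WeakGrad.integral_sq_le {K : Finset (Space d)} (hK : IsElement K) {u : Space d → ℝ}
    {g : Fin d → Space d → ℝ} (h : WeakGrad (interior (hull K)) u g) :
    ∫ x in hull K, u x ^ 2 ≤ volume.real (hull K) * mean (hull K) u ^ 2
      + 2 ^ d * Metric.diam (hull K) ^ 2 * ∑ i, ∫ x in hull K, g i x ^ 2 := by
  have h1 := h.poincare hK
  have h2 := h.memu
  rw [restrict_interior_hull] at h2
  rw [integral_sub_mean_sq hK.volume_pos (isCompact_hull K).measure_lt_top h2] at h1
  have h3 : volume.real (hull K) * mean (hull K) u ^ 2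
      = (volume.real (hull K))⁻¹ * (∫ x in hull K, u x) ^ 2 := by
    have := hK.volume_pos
    rw [mean]
    field_simp
  linarith

section

variable {P : Problem d} {T : Triangulation P} {k : ℕ} {τ : Finset (Space d) → ℝ}
  {f : Space d → ℝ} {q : Space d → Space d} {u : Space d → ℝ}
  {pq : Finset (Space d) → Space d → Space d} {pu : Finset (Space d) → Space d → ℝ}
  {s : Finset (Space d) → ℝ} {Gu : Space d → Space d} {tu : Finset (Space d) → Space d → ℝ}
  {gq : Finset (Space d) → Fin d → Fin d → Space d → ℝ}
  {tq : Finset (Space d) → Fin d → Space d → Space d → ℝ}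
  {qh : Finset (Space d) → Space d → Space d} {uh us : Finset (Space d) → Space d → ℝ}

/-- The `H¹` regularity of `q` on the elements is contained in the existence of the traces in the
HDG projection. By uniqueness, those traces agree with the ones constructed here, for `u` with the
single-valued trace. -/
theorem exists_isExact (hd : 1 ≤ d) (T : Triangulation P)
    (hf : MemLp f 2 (volume.restrict P.Ω)) (hq : P.IsMixedSolution (fun x => -f x) q u)
    (hproj : IsHDGProjection T k τ q u pq pu) :
    ∃ s Gu tu gq tq, IsExact T k τ f q u pq pu s Gu tu gq tq ∧
      (∀ K ∈ T.elements, WeakGrad (interior (hull K)) u fun i x => Gu x i) ∧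
      ∀ K ∈ T.elements, s K = P.σp ∨ s K = P.σm := by
  obtain ⟨⟨Gu, hu, hσ⟩, hweak⟩ := hq
  obtain ⟨tu, htu, htu0⟩ := Triangulation.exists_single_valued_trace (T := T) hd hu
  have hs : ∀ K : Finset (Space d), ∃ s : ℝ, K ∈ T.elements → (s = P.σp ∨ s = P.σm) ∧
      ∀ᵐ x ∂(volume.restrict (hull K)), P.σ x = s := fun K => by
    by_cases hK : K ∈ T.elements
    · rcases Triangulation.sigma_cases P hK with ⟨-, h⟩ | ⟨-, h⟩
      exacts [⟨_, fun _ => ⟨.inl rfl, h⟩⟩, ⟨_, fun _ => ⟨.inr rfl, h⟩⟩]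
    · exact ⟨0, fun h => absurd h hK⟩
  choose s hs using hs
  have hex : ∀ (K : Finset (Space d)) (i : Fin d), ∃ g t, K ∈ T.elements →
      WeakGrad (interior (hull K)) (fun x => q x i) g ∧
        IsElemTrace K (fun x => q x i) g t := fun K i => by
    by_cases hK : K ∈ T.elements
    · have hKe := Triangulation.isElement hK
      obtain ⟨a, ha⟩ : K.Nonempty := Finset.card_pos.1 (by rw [hKe.card]; omega)
      obtain ⟨tq, -, htq, -⟩ := hproj.facet_moment K hK a ha
      obtain ⟨-, G, hG, -⟩ := htq i
      obtain ⟨t, ht⟩ := hG.weakGrad.exists_trace hKe hd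
      exact ⟨_, t, fun _ => ⟨hG.weakGrad, ht⟩⟩
    · exact ⟨0, 0, fun h => absurd h hK⟩
  choose gq tq hgt using hex
  have hw : ∀ K ∈ T.elements, WeakGrad (interior (hull K)) u fun i x => Gu x i := fun K hK =>
    hu.1.weakGrad.mono P.isOpen_Ω.measurableSet (Triangulation.interior_subset_Ω hK)
  refine ⟨s, Gu, tu, gq, tq, ⟨hf, fun K hK => (hs K hK).2,
    fun K hK => Triangulation.scaled_eq_neg_grad hK (hs K hK).2 hσ, htu, htu0,
    fun K hK i => hgt K i hK, hweak, hproj, fun K hK a ha l hl => ?_⟩, hw,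
    fun K hK => (hs K hK).1⟩
  have hKe := Triangulation.isElement hK
  obtain ⟨tq', tu', htq', htu', h⟩ := hproj.facet_moment K hK a ha
  rw [h l hl]
  have e1 := (htu K hK).ae_eq_of_hasTrace hKe hd ha (hw K hK) htu'
  have e2 := fun i => (hgt K i hK).2.ae_eq_of_hasTrace hKe hd ha (hgt K i hK).1 (htq' i)
  refine integral_congr_ae ?_
  filter_upwards [e1, ae_all_iff.2 e2] with x h1 h2
  simp only [h1, h2, inner_eq_sum]

theorem vectorError_eq_sqrt_normSq {r : Finset (Space d) → Space d → Space d}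
    (hq : ∀ K ∈ T.elements, ∀ i, MemLp (fun x => q x i) 2 (volume.restrict (hull K)))
    (hr : MemV T k r) :
    vectorError T q r = Real.sqrt (T.normSq fun K i x => q x i - r K x i) := by
  rw [vectorError, Triangulation.integral, Triangulation.normSq]
  congr 1
  refine Finset.sum_congr rfl fun K hK => ?_
  simpa using integral_norm_sq_eq_sum (v := fun x => q x - r K x)
    fun i => (hq K hK i).sub ((hr K hK).memLp_hull K i)

theorem sqrt_normSq_le_weightedError {r : Finset (Space d) → Space d → Space d} {S : ℝ}
    (hS : 0 < S)
    (hσ : ∀ K ∈ T.elements, ∀ᵐ x ∂(volume.restrict (hull K)), P.σ x = s K)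
    (hs : ∀ K ∈ T.elements, 1 ≤ S ^ 2 * |s K|⁻¹)
    (hq : ∀ K ∈ T.elements, ∀ i, MemLp (fun x => q x i) 2 (volume.restrict (hull K)))
    (hr : MemV T k r) :
    Real.sqrt (T.normSq fun K i x => q x i - r K x i) ≤ S * weightedError T q r := by
  refine Real.sqrt_le_iff.2 ⟨mul_nonneg hS.le (Real.sqrt_nonneg _), ?_⟩
  have h : ∀ K ∈ T.elements, ∫ x in hull K, |P.σ x|⁻¹ * ‖q x - r K x‖ ^ 2
      = |s K|⁻¹ * ∑ i, ∫ x in hull K, (q x i - r K x i) ^ 2 := fun K hK => by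
    have h1 := integral_norm_sq_eq_sum (v := fun x => q x - r K x)
      fun i => (hq K hK i).sub ((hr K hK).memLp_hull K i)
    simp only [PiLp.sub_apply] at h1
    rw [← h1, ← integral_const_mul]
    refine integral_congr_ae ?_
    filter_upwards [hσ K hK] with x hx
    rw [hx]
  have h0 : ∀ K ∈ T.elements, 0 ≤ ∫ x in hull K, |P.σ x|⁻¹ * ‖q x - r K x‖ ^ 2 := fun K _ =>
    integral_nonneg fun x => by positivity
  rw [weightedError, mul_pow, Triangulation.integral, Real.sq_sqrt (Finset.sum_nonneg h0),
    Finset.mul_sum, Triangulation.normSq]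
  refine Finset.sum_le_sum fun K hK => ?_
  rw [h K hK, ← mul_assoc]
  exact le_mul_of_one_le_left (sum_integral_sq_nonneg _ _) (hs K hK)

/-- The error of the post-processed solution on one element. -/
theorem IsExact.postProcessed_error (hE : IsExact T k τ f q u pq pu s Gu tu gq tq)
    (hG : ∀ K ∈ T.elements, WeakGrad (interior (hull K)) u fun i x => Gu x i)
    (hqh : MemV T k qh) (huh : MemW T k uh) (hpost : IsPostProcessed T k qh uh us)
    {K : Finset (Space d)} (hK : K ∈ T.elements) {p : Space d → ℝ} (hp : IsPoly (k + 1) p) :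
    ∫ x in hull K, (u x - us K x) ^ 2
      ≤ volume.real (hull K) * mean (hull K) (fun x => u x - uh K x) ^ 2
        + 2 ^ d * Metric.diam (hull K) ^ 2 *
          (6 * (∑ i, ∫ x in hull K, (Gu x i - partialDeriv i p x) ^ 2)
            + 4 * ((s K)⁻¹) ^ 2 * ∑ i, ∫ x in hull K, (q x i - qh K x i) ^ 2) := by
  obtain ⟨hus, hp1, hp2⟩ := hpost K hK
  have hKe := Triangulation.isElement hK
  have mqh := (hqh K hK).memLp_hull K
  have hfin : IsFiniteMeasure (volume.restrict (hull K)) :=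
    ⟨by simpa using (isCompact_hull K).measure_lt_top⟩
  have hi : ∀ {g : Space d → ℝ}, MemLp g 2 (volume.restrict (hull K)) →
      Integrable g (volume.restrict (hull K)) := fun hg => hg.integrable (by norm_num)
  -- The post-processing has the same element means as `u_h`, so its mean error is the
  -- superconvergent one.
  have hmean : mean (hull K) (fun x => u x - us K x) = mean (hull K) fun x => u x - uh K x := by
    have mu := hi (hE.trace K hK).memu
    rw [mean, mean, integral_sub mu (hi (memLp_hull K hus.continuous)),
      integral_sub mu (hi (memLp_hull K (huh K hK).continuous)), hp2]
  have h1 := ((hG K hK).sub (weakGrad_of_smooth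
    ((isCompact_hull K).isBounded.subset interior_subset) hus.contDiff)).integral_sq_le hKe
  rw [hmean] at h1
  have h2 := postProcessed_gradient_error (hE.memq hK) (hE.trace K hK).memg mqh (hE.grad K hK)
    hus hp fun v hv => by
      have h3 := hp1 v hv
      rw [hE.integral_sigma_inner hK mqh (hv.gradient.memLp_hull K),
        integral_inner_eq_sum (hus.gradient.memLp_hull K) (hv.gradient.memLp_hull K)] at h3
      simpa only [gradient_apply] using h3
  exact h1.trans (add_le_add_right (mul_le_mul_of_nonneg_left h2 (by positivity)) _)

/-- The error of the post-processed solution. -/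
theorem IsExact.scalarError_le (hE : IsExact T k τ f q u pq pu s Gu tu gq tq)
    (hG : ∀ K ∈ T.elements, WeakGrad (interior (hull K)) u fun i x => Gu x i)
    (hup : MemSobolev P.Ωp (k + 2) u) (hum : MemSobolev P.Ωm (k + 2) u)
    (hqh : MemV T k qh) (huh : MemW T k uh) (hpost : IsPostProcessed T k qh uh us)
    {S : ℝ} (hS : 0 ≤ S) (hs : ∀ K ∈ T.elements, |(s K)⁻¹| ≤ S) :
    scalarError T u us
      ≤ Real.sqrt (∑ K ∈ T.elements,
          volume.real (hull K) * mean (hull K) (fun x => u x - uh K x) ^ 2)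
        + 2 ^ (d + 1) * S * T.h * Real.sqrt (T.normSq fun K i x => q x i - qh K x i)
        + Real.sqrt (6 * 2 ^ d * (d * (2 ^ d * d) ^ (k + 1))) * T.h ^ (k + 2) *
          (sobolevNorm P.Ωp (k + 2) u + sobolevNorm P.Ωm (k + 2) u) := by
  obtain ⟨U, hU0, hUg, hUn⟩ := T.exists_derivs hup hum
  set N := sobolevNorm P.Ωp (k + 2) u + sobolevNorm P.Ωm (k + 2) u with hN
  have hN0 : 0 ≤ N := add_nonneg (Real.sqrt_nonneg _) (Real.sqrt_nonneg _)
  set R := ∑ K ∈ T.elements,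
    volume.real (hull K) * mean (hull K) (fun x => u x - uh K x) ^ 2 with hR
  have hR0 : 0 ≤ R := Finset.sum_nonneg fun K _ => mul_nonneg measureReal_nonneg (sq_nonneg _)
  set E := T.normSq fun K i x => q x i - qh K x i with hEdef
  have hE0 : 0 ≤ E := Triangulation.normSq_nonneg _
  set D : ℝ := d * (2 ^ d * d) ^ (k + 1) with hD
  have hD0 : 0 ≤ D := by positivity
  have hh := T.h_nonneg
  have hloc : ∀ K ∈ T.elements, ∫ x in hull K, (u x - us K x) ^ 2
      ≤ volume.real (hull K) * mean (hull K) (fun x => u x - uh K x) ^ 2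
        + 2 ^ d * T.h ^ 2 * (6 * (D * T.h ^ (2 * (k + 1)) *
            ∑ α ∈ Finset.piAntidiag (Finset.univ : Finset (Fin d)) (k + 2),
              ∫ x in hull K, U α x ^ 2)
          + 4 * S ^ 2 * ∑ i, ∫ x in hull K, (q x i - qh K x i) ^ 2) := fun K hK => by
    have hKe := Triangulation.isElement hK
    -- The order is `m = k + 2`, so `p` has degree `k + 1`, the degree of the post-processed
    -- solution.
    obtain ⟨p, hp, hpU⟩ := exists_poly_approx hKe (hUg K hK) (by omega)
    have hdiam := Triangulation.diam_le_h hK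
    have hGU : ∀ i, ∫ x in hull K, (Gu x i - partialDeriv i p x) ^ 2
        = ∫ x in hull K, (U (Pi.single i 1) x - partialDeriv i p x) ^ 2 := fun i => by
      have h1 := hUg K hK 0 (by simp)
      simp only [hU0, zero_add] at h1
      have h2 := (hG K hK).unique isOpen_interior h1 i
      rw [restrict_interior_hull] at h2
      refine integral_congr_ae ?_
      filter_upwards [h2] with x hx
      rw [hx]
    have h3 := hE.postProcessed_error hG hqh huh hpost hK (p := p) (by simpa using hp)
    simp_rw [hGU] at h3
    have hs2 : ((s K)⁻¹) ^ 2 ≤ S ^ 2 := by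
      rw [← sq_abs]
      exact pow_le_pow_left₀ (abs_nonneg _) (hs K hK) 2
    have h4 : 0 ≤ ∑ i, ∫ x in hull K, (q x i - qh K x i) ^ 2 := sum_integral_sq_nonneg _ _
    have h5 : 0 ≤ ∑ α ∈ Finset.piAntidiag (Finset.univ : Finset (Fin d)) (k + 2),
        ∫ x in hull K, U α x ^ 2 := sum_integral_sq_nonneg _ _
    have h6 : ∑ i, ∫ x in hull K, (U (Pi.single i 1) x - partialDeriv i p x) ^ 2
        ≤ D * T.h ^ (2 * (k + 1)) *
          ∑ α ∈ Finset.piAntidiag (Finset.univ : Finset (Fin d)) (k + 2),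
            ∫ x in hull K, U α x ^ 2 := by
      refine hpU.trans ?_
      rw [show k + 2 - 1 = k + 1 from rfl, ← hD]
      gcongr
    have h7 : 0 ≤ ∑ i, ∫ x in hull K, (U (Pi.single i 1) x - partialDeriv i p x) ^ 2 :=
      sum_integral_sq_nonneg _ _
    refine h3.trans (add_le_add_right ?_ _)
    gcongr
  have hsum : scalarError T u us ^ 2
      ≤ R + 2 ^ d * T.h ^ 2 * (6 * (D * T.h ^ (2 * (k + 1)) * N ^ 2) + 4 * S ^ 2 * E) := by
    rw [scalarError, Triangulation.integral, Real.sq_sqrt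
      (Finset.sum_nonneg fun K _ => integral_nonneg fun x => sq_nonneg _)]
    refine (Finset.sum_le_sum hloc).trans ?_
    rw [Finset.sum_add_distrib, ← Finset.mul_sum, Finset.sum_add_distrib, ← Finset.mul_sum,
      ← Finset.mul_sum, ← Finset.mul_sum, ← hR]
    change _ + _ * (_ + _ * E) ≤ _
    have := hUn (k + 2) le_rfl
    gcongr
  -- Enlarging `2 ^ d` to its square makes the flux term a perfect square, whose root has the factor
  -- `2 ^ (d + 1)`.
  have h2d : (2 : ℝ) ^ d * 2 ^ d ≥ 2 ^ d := by
    have : (1 : ℝ) ≤ 2 ^ d := one_le_pow₀ one_le_two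
    nlinarith
  set a := Real.sqrt R with ha
  set b := 2 ^ (d + 1) * S * T.h * Real.sqrt E with hb
  set e := Real.sqrt (6 * 2 ^ d * D) * T.h ^ (k + 2) * N with he
  have ha0 : 0 ≤ a := Real.sqrt_nonneg _
  have hb0 : 0 ≤ b := by positivity
  have he0 : 0 ≤ e := by positivity
  have ha2 : a ^ 2 = R := Real.sq_sqrt hR0
  have hb2 : 2 ^ d * T.h ^ 2 * (4 * S ^ 2 * E) ≤ b ^ 2 := by
    rw [hb, mul_pow, mul_pow, mul_pow, Real.sq_sqrt hE0]
    calc 2 ^ d * T.h ^ 2 * (4 * S ^ 2 * E) ≤ (2 ^ d * 2 ^ d) * T.h ^ 2 * (4 * S ^ 2 * E) := by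
          gcongr
      _ = _ := by ring
  have he2 : 2 ^ d * T.h ^ 2 * (6 * (D * T.h ^ (2 * (k + 1)) * N ^ 2)) = e ^ 2 := by
    rw [he, mul_pow, mul_pow, Real.sq_sqrt (by positivity)]
    ring
  -- A sum of squares of nonnegative numbers is at most the square of their sum.
  refine le_of_sq_le_sq ?_ (by positivity)
  nlinarith [mul_nonneg ha0 hb0, mul_nonneg ha0 he0, mul_nonneg hb0 he0]

end

end HDG

end

/-! ### The superconvergence estimate -/

theorem mainTheorem5 (d : ℕ) (hd : 2 ≤ d) (k : ℕ) (hk : 1 ≤ k) (P : HDG.Problem d)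
    (Creg : ℝ) (hreg : P.DualRegularity Creg) (ρ : ℝ) (hρ : 0 < ρ) (γ : ℝ) :
    ∃ C : ℝ, 0 < C ∧
      ∀ T : HDG.Triangulation P, T.ShapeRegular ρ →
      ∀ τ : Finset (HDG.Space d) → ℝ, HDG.TauCondition T τ → (∀ F ∈ T.facets, |τ F| ≤ γ) →
      ∀ f : HDG.Space d → ℝ, MeasureTheory.MemLp f 2 (MeasureTheory.volume.restrict P.Ω) →
      ∀ (q : HDG.Space d → HDG.Space d) (u : HDG.Space d → ℝ),
        P.IsMixedSolution (fun x => -f x) q u →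
        HDG.MemSobolev P.Ωp (k + 2) u → HDG.MemSobolev P.Ωm (k + 2) u →
      ∀ (qh : Finset (HDG.Space d) → HDG.Space d → HDG.Space d)
        (uh ubar us : Finset (HDG.Space d) → HDG.Space d → ℝ),
        HDG.IsHDGSolution T k τ f qh uh ubar →
        HDG.IsPostProcessed T k qh uh us →
      ∀ (pq : Finset (HDG.Space d) → HDG.Space d → HDG.Space d)
        (pu : Finset (HDG.Space d) → HDG.Space d → ℝ),
        HDG.IsHDGProjection T k τ q u pq pu →
        HDG.scalarError T u us ≤
          C * T.h * (HDG.weightedError T q qh + HDG.vectorError T q pq) +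
            C * T.h ^ (k + 2) *
              (HDG.sobolevNorm P.Ωp (k + 2) u + HDG.sobolevNorm P.Ωm (k + 2) u) := by
  have hd1 : 1 ≤ d := by omega
  -- A bound for `|σ|⁻¹` on both subdomains.
  set S : ℝ := P.σp⁻¹ + |P.σm|⁻¹ with hS
  have hσp := P.σp_pos
  have hσm : 0 < |P.σm| := abs_pos.2 P.σm_neg.ne
  have hSpos : 0 < S := by positivity
  -- The summand `1` gives `S' ≥ 1`, hence `|σ| ≤ S' ≤ S' ^ 2`, which compares the plain norm with
  -- the weighted one.
  set S' : ℝ := P.σp + |P.σm| + 1 with hS'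
  have hS'pos : 0 < S' := by positivity
  obtain ⟨A, hA, hmean⟩ := HDG.exists_mean_error_le hd1 hk P hreg hρ γ hSpos.le
  set D : ℝ := Real.sqrt (6 * 2 ^ d * (d * (2 ^ d * d) ^ (k + 1))) with hD
  -- The summands come from the element means, the flux part of the gradient error and the
  -- polynomial approximation; the final `1` makes the constant positive.
  refine ⟨A * (S' + 1) + 2 ^ (d + 1) * S * S' + D + 1, by positivity, ?_⟩
  intro T hT τ hτ hγ f hf q u hq hup hum qh uh ubar us hH hpost pq pu hproj
  obtain ⟨s, Gu, tu, gq, tq, hE, hG, hs⟩ := HDG.exists_isExact hd1 T hf hq hproj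
  have hs1 : ∀ K ∈ T.elements, |(s K)⁻¹| ≤ S := fun K hK => by
    rcases hs K hK with h | h <;> rw [h, abs_inv]
    · rw [abs_of_pos hσp, hS]
      exact le_add_of_nonneg_right (inv_pos.2 hσm).le
    · exact le_add_of_nonneg_left (inv_pos.2 hσp).le
  have hs2 : ∀ K ∈ T.elements, 1 ≤ S' ^ 2 * |s K|⁻¹ := fun K hK => by
    have h1 : 0 < |s K| ∧ |s K| ≤ S' := by
      rcases hs K hK with h | h <;> rw [h]
      · rw [abs_of_pos hσp]
        exact ⟨hσp, by linarith⟩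
      · exact ⟨hσm, by linarith⟩
    rw [← div_eq_mul_inv, one_le_div h1.1]
    nlinarith [h1.1]
  have h1 := hmean T hT τ hτ hγ f q u pq pu s Gu tu gq tq qh uh ubar hs1 hE hH
  have h2 := hE.scalarError_le hG hup hum hH.memV hH.memW hpost hSpos.le hs1
  have h3 := HDG.sqrt_normSq_le_weightedError hS'pos hE.sigma hs2 (fun K hK => hE.memq hK) hH.memV
  rw [← HDG.vectorError_eq_sqrt_normSq (fun K hK => hE.memq hK) hproj.memV] at h1
  rw [← hD] at h2
  set E := Real.sqrt (T.normSq fun K i x => q x i - qh K x i)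
  set w := HDG.weightedError T q qh
  set p := HDG.vectorError T q pq
  set N := HDG.sobolevNorm P.Ωp (k + 2) u + HDG.sobolevNorm P.Ωm (k + 2) u
  have hw : 0 ≤ w := Real.sqrt_nonneg _
  have hp : 0 ≤ p := Real.sqrt_nonneg _
  have hN : 0 ≤ N := add_nonneg (Real.sqrt_nonneg _) (Real.sqrt_nonneg _)
  have hD0 : 0 ≤ D := Real.sqrt_nonneg _
  have hh := T.h_nonneg
  have h4 : A * T.h * (E + p) ≤ A * (S' + 1) * T.h * (w + p) := by
    have : E + p ≤ (S' + 1) * (w + p) := by nlinarith [mul_nonneg hS'pos.le hp]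
    calc A * T.h * (E + p) ≤ A * T.h * ((S' + 1) * (w + p)) := by gcongr
      _ = _ := by ring
  have h5 : 2 ^ (d + 1) * S * T.h * E ≤ 2 ^ (d + 1) * S * S' * T.h * (w + p) := by
    have : E ≤ S' * (w + p) := by nlinarith [mul_nonneg hS'pos.le hp]
    calc 2 ^ (d + 1) * S * T.h * E ≤ 2 ^ (d + 1) * S * T.h * (S' * (w + p)) := by gcongr
      _ = _ := by ring
  have h6 : 0 ≤ (D + 1) * (T.h * (w + p)) := by positivity
  have h7 : 0 ≤ (A * (S' + 1) + 2 ^ (d + 1) * S * S' + 1) * (T.h ^ (k + 2) * N) := by positivity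
  linarith
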